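/- Fix $n$ and an alphabet $\mathcal A$ with $n+1$ letters. A marked permutation $\sigma$ is a pair of total orders (top and bottom) of $\mathcal A$. Glue the equally labelled sides of the $2(n+1)$-gon whose top and bottom sides are labelled by these orders; $\sigma$ has genus one if it is irreducible and the glued surface is a torus (equivalently, the polygon has $n$ classes of vertices, the marked points). The fundamental group of the surface punctured at the marked points is free on the loops $\gamma_\alpha$ ($\alpha\in\mathcal A$) crossing the side $\alpha$. The distinguished loop $\delta_\sigma$ is the loop that turns once around the marked point of the leftmost vertex of the polygon and first crosses the leftmost top side. Let $\mathbf P_\sigma$ be the set of piecewise Möbius interval exchange transformations with permutation $\sigma$: bijections $T$ of an interval $[a,b)$ which, for every letter $\alpha$, map the interval of $\alpha$ in a top partition of $[a,b)$ (ordered by the top order) onto its interval in a bottom partition (ordered by the bottom order) by the restriction of some $f_\alpha\in\mathrm{PSL}(2,\mathbb R)$ without pole on the closed interval. Let $\rho_T$ be the representation $\gamma_\alpha\mapsto f_\alpha$ in $\mathrm{PSL}(2,\mathbb R)$ (words being read as compositions of maps). Let $\mathcal E_\sigma\subset\mathbf P_\sigma$ be the set of those $T$ with domain $[0,1)$ for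 which $\rho_T(\delta_\sigma)$ belongs to the affine group, and let $\mathcal E=\bigcup_\sigma\mathcal E_\sigma$, the union being over all $\sigma$ of genus one. Let $u^t$ and $u^b$ be the rightmost singularities of $T$ on top and on bottom. If $u^t\ne u^b$, the Rauzy induction $E(T)$ is the first return map of $T$ to $[a,\max(u^t,u^b))$, affinely rescaled to $[0,1)$, with the usual labelling of its intervals. The winner of the step is the letter of the longer of the two last intervals, and the Rauzy path of $T$ is $\infty$-complete if $E^m(T)$ is defined for all $m$ and every letter wins infinitely often. Let $p$ be the left end of the top interval of the first bottom letter and $q$ the left end of the bottom interval of the first top letter (for a circular permutation these are the singularities of the exchange of two intervals obtained by grouping adjacent intervals mapped to adjacent intervals). A group step applies $E$ until the first return interval is $[a,\max(p,q))$; top wins if $p<q$, bottom wins if $q<p$. The accelerated renormalisation $\mathcal R$ applies group steps as long as the side that wins first keeps winning, and once more when the other side wins. The break size of $T$ at a marked point is the product of the right derivatives of $T$ at the singularities in that class divided by the product of the left derivatives. 1. $\mathcal E$ is invariant under Rauzy induction: if $T\in\mathcal E$ and $u^t\neq u^b$, then $E(T)$ is again a piecewise Möbius interval exchange transformation and it belongs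 to $\mathcal E$. 2. Renormalisation converges to $\mathcal E$ exponentially fast: for every $c\in\mathbb R^n$ there is $\rho\in(0,1)$ such that, for every $\sigma$ of genus one and every $T\in\mathbf P_\sigma$ whose breaks have sizes $c_1,\dots,c_n$ and whose Rauzy path is $\infty$-complete, $\mathcal R^kT$ is defined for all $k\ge0$ and there is a constant $C_T$ such that for every $k\ge 0$ some $T'_k\in\mathcal E$ with the same permutation as $\mathcal R^kT$ satisfies $d_{C^1}(\mathcal R^kT,T'_k)\le C_T\,\rho^k$. Here $d_{C^1}$ compares corresponding closed intervals, parametrised affinely by $[0,1]$: it is the supremum of the differences of the points, of their images and of the derivatives. -/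

import Mathlib

/-! ### Marked permutations and their polygons -/

/-- A marked permutation on the alphabet `𝒜` with `n + 1` letters: the top and bottom orders. -/
structure MarkedPerm (n : ℕ) (𝒜 : Type*) where
  top : Fin (n + 1) ≃ 𝒜
  bot : Fin (n + 1) ≃ 𝒜

namespace MarkedPerm

variable {n : ℕ} {𝒜 : Type*}

/-- No proper nonempty initial block of letters is the same on top and on bottom. -/
def Irreducible (σ : MarkedPerm n 𝒜) : Prop :=
  ∀ k : ℕ, 0 < k → k < n + 1 →
    σ.top '' {i | (i : ℕ) < k} ≠ σ.bot '' {i | (i : ℕ) < k}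

/-- Consider the `2 (n + 1)`-gon whose top sides are labelled, from left to right, by the top order
and whose bottom sides are labelled by the bottom order. `Sum.inl i` is the `i`-th vertex of the
top broken line and `Sum.inr i` the `i`-th vertex of the bottom broken line, so that the two leftmost
ones are the same vertex of the polygon, and likewise the two rightmost ones. Two sides with the
same label are glued by a translation, left end to left end and right end to right end. -/
inductive Glue (σ : MarkedPerm n 𝒜) : Fin (n + 2) ⊕ Fin (n + 2) → Fin (n + 2) ⊕ Fin (n + 2) → Prop
  | leftmost : Glue σ (Sum.inl 0) (Sum.inr 0)
  | rightmost : Glue σ (Sum.inl (Fin.last (n + 1))) (Sum.inr (Fin.last (n + 1)))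
  | leftEnd (α : 𝒜) :
      Glue σ (Sum.inl (σ.top.symm α).castSucc) (Sum.inr (σ.bot.symm α).castSucc)
  | rightEnd (α : 𝒜) :
      Glue σ (Sum.inl (σ.top.symm α).succ) (Sum.inr (σ.bot.symm α).succ)

/-- The marked points of the glued surface: classes of vertices of the polygon. -/
def MarkedPoint (σ : MarkedPerm n 𝒜) : Type := Quot σ.Glue

/-- The marked point at the left end of the top side labelled `α`. -/
def leftPoint (σ : MarkedPerm n 𝒜) (α : 𝒜) : σ.MarkedPoint :=
  Quot.mk _ (Sum.inl (σ.top.symm α).castSucc)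

/-- The marked point at the right end of the top side labelled `α`. -/
def rightPoint (σ : MarkedPerm n 𝒜) (α : 𝒜) : σ.MarkedPoint :=
  Quot.mk _ (Sum.inl (σ.top.symm α).succ)

/-- Irreducible and of genus one. The glued surface has one face, `n + 1` edges and
`V` vertices, so its Euler characteristic `V - (n + 1) + 1` vanishes exactly when `V = n`. -/
def GenusOne (σ : MarkedPerm n 𝒜) : Prop :=
  σ.Irreducible ∧ Nat.card σ.MarkedPoint = n

/-- Turning around the distinguished marked point (that of the leftmost vertex of the polygon),
from the moment when one is about to cross the top side `c` near its left end until one is back at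
the leftmost vertex. Crossing the top side `c` contributes the generator `c`; one re-enters through
the bottom side `c`, near its left end. If that end is the leftmost vertex, the turn is complete.
Otherwise one crosses the side `b` that precedes `c` on the bottom, which contributes `b⁻¹`, and
arrives at the right end of the top side `b`. If this is the rightmost vertex of the polygon, one
further crosses the last bottom side `e`, which contributes `e⁻¹`. Then one is about to cross the
next top side. Words are written as compositions: the side crossed first is the rightmost
letter. The first argument bounds the number of top sides crossed. -/
def turn (σ : MarkedPerm n 𝒜) : ℕ → 𝒜 → FreeGroup 𝒜
  | 0, _ => 1
  | k + 1, c =>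
    if σ.bot.symm c = 0 then FreeGroup.of c
    else
      let b := σ.bot (σ.bot.symm c - 1)
      if σ.top.symm b = Fin.last n then
        let e := σ.bot (Fin.last n)
        turn σ k (σ.top (σ.top.symm e + 1)) *
          (FreeGroup.of e)⁻¹ * (FreeGroup.of b)⁻¹ * FreeGroup.of c
      else
        turn σ k (σ.top (σ.top.symm b + 1)) * (FreeGroup.of b)⁻¹ * FreeGroup.of c

/-- The loop around the distinguished marked point which first crosses the leftmost top side, in
the fundamental group of the punctured surface, free on the loops `γ_α`. -/
def distinguishedLoop (σ : MarkedPerm n 𝒜) : FreeGroup 𝒜 :=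
  σ.turn (n + 1) (σ.top 0)

end MarkedPerm

/-- The order `p'` is obtained from `p` by moving the letter `l`, last in `p`, to the place right
after the letter `w`. -/
def MovedAfter {n : ℕ} {𝒜 : Type*} [DecidableEq 𝒜] (p p' : Fin (n + 1) ≃ 𝒜) (l w : 𝒜) : Prop :=
  ∀ γ : 𝒜, ((p'.symm γ : Fin (n + 1)) : ℕ) =
    if γ = l then (p.symm w : ℕ) + 1
    else if p.symm γ ≤ p.symm w then (p.symm γ : ℕ) else (p.symm γ : ℕ) + 1

/-! ### Möbius maps -/

/-- The Möbius map of a matrix, on the affine line. -/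
noncomputable def moebius (g : Matrix.SpecialLinearGroup (Fin 2) ℝ) (x : ℝ) : ℝ :=
  (g 0 0 * x + g 0 1) / (g 1 0 * x + g 1 1)

/-- Upper triangular matrices of determinant one. -/
def upperTriangular : Subgroup (Matrix.SpecialLinearGroup (Fin 2) ℝ) where
  carrier := {g | g 1 0 = 0}
  mul_mem' := by
    intro a b ha hb
    simp only [Set.mem_ofPred_eq] at ha hb ⊢
    simp [Matrix.mul_apply, Fin.sum_univ_two, ha, hb]
  one_mem' := by simp
  inv_mem' := by
    intro a ha
    simp only [Set.mem_ofPred_eq] at ha ⊢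
    simp [Matrix.SpecialLinearGroup.SL2_inv_expl, ha]

/-- The affine group, as a subgroup of `PSL(2, ℝ)`. -/
def affineGroup : Subgroup (Matrix.ProjectiveSpecialLinearGroup (Fin 2) ℝ) :=
  upperTriangular.map (QuotientGroup.mk' (Subgroup.center (Matrix.SpecialLinearGroup (Fin 2) ℝ)))

/-! ### Piecewise Möbius interval exchange transformations -/

/-- A piecewise Möbius interval exchange transformation of `[lo, hi)`. The interval of the letter
`α` has length `topLen α` in the top partition and `botLen α` in the bottom one; the matrix
`branch α` represents the element of `PSL(2, ℝ)` which maps the closed top interval of `α`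
onto the closed bottom interval of `α`, without a pole. (The determinant is one, so such a map
is an increasing diffeomorphism between the two.) -/
structure PIET (n : ℕ) (𝒜 : Type*) [Fintype 𝒜] where
  perm : MarkedPerm n 𝒜
  lo : ℝ
  hi : ℝ
  topLen : 𝒜 → ℝ
  botLen : 𝒜 → ℝ
  topLen_pos : ∀ α, 0 < topLen α
  botLen_pos : ∀ α, 0 < botLen α
  sum_topLen : ∑ α, topLen α = hi - lo
  sum_botLen : ∑ α, botLen α = hi - lo
  branch : 𝒜 → Matrix.SpecialLinearGroup (Fin 2) ℝ
  no_pole : ∀ α, ∀ x ∈ Set.Icc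
    (lo + ∑ β with perm.top.symm β < perm.top.symm α, topLen β)
    (lo + (∑ β with perm.top.symm β < perm.top.symm α, topLen β) + topLen α),
    branch α 1 0 * x + branch α 1 1 ≠ 0
  map_left : ∀ α,
    moebius (branch α) (lo + ∑ β with perm.top.symm β < perm.top.symm α, topLen β) =
      lo + ∑ β with perm.bot.symm β < perm.bot.symm α, botLen β
  map_right : ∀ α,
    moebius (branch α) (lo + (∑ β with perm.top.symm β < perm.top.symm α, topLen β) + topLen α) =
      lo + (∑ β with perm.bot.symm β < perm.bot.symm α, botLen β) + botLen α

namespace PIET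

variable {n : ℕ} {𝒜 : Type*} [Fintype 𝒜]

/-- Left end of the top interval of `α`. -/
noncomputable def topLeft (T : PIET n 𝒜) (α : 𝒜) : ℝ :=
  T.lo + ∑ β with T.perm.top.symm β < T.perm.top.symm α, T.topLen β

/-- Right end of the top interval of `α`. -/
noncomputable def topRight (T : PIET n 𝒜) (α : 𝒜) : ℝ :=
  T.topLeft α + T.topLen α

/-- Left end of the bottom interval of `α`. -/
noncomputable def botLeft (T : PIET n 𝒜) (α : 𝒜) : ℝ :=
  T.lo + ∑ β with T.perm.bot.symm β < T.perm.bot.symm α, T.botLen β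

/-- The interval exchange map itself: `branch α` on the top interval `[topLeft α, topRight α)`
of each letter `α`. (These intervals are disjoint; the value outside `[lo, hi)` is irrelevant.) -/
noncomputable def map (T : PIET n 𝒜) (x : ℝ) : ℝ :=
  ∑ α, (Set.Ico (T.topLeft α) (T.topRight α)).indicator (moebius (T.branch α)) x

/-- The associated representation of the free group on the loops `γ_α`: it sends `γ_α` to the
branch of `α`. -/
def rep (T : PIET n 𝒜) : FreeGroup 𝒜 →* Matrix.ProjectiveSpecialLinearGroup (Fin 2) ℝ :=
  FreeGroup.lift fun α => (QuotientGroup.mk (T.branch α))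

/-- The last singularity of the top partition. -/
noncomputable def cutTop (T : PIET n 𝒜) : ℝ := T.topLeft (T.perm.top (Fin.last n))

/-- The last singularity of the bottom partition. -/
noncomputable def cutBot (T : PIET n 𝒜) : ℝ := T.botLeft (T.perm.bot (Fin.last n))

/-- Rauzy induction considers the first return to `[lo, cut)`. -/
noncomputable def cut (T : PIET n 𝒜) : ℝ := max T.cutTop T.cutBot

open Classical in
/-- The letter of the longest of the two last intervals. -/
noncomputable def winner (T : PIET n 𝒜) : 𝒜 :=
  if T.cutTop < T.cutBot then T.perm.top (Fin.last n) else T.perm.bot (Fin.last n)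

end PIET

/-- `y` is the first return to `J` of the point `x` under iteration of `f`. -/
def IsFirstReturn (f : ℝ → ℝ) (J : Set ℝ) (x y : ℝ) : Prop :=
  ∃ m : ℕ, 0 < m ∧ f^[m] x = y ∧ y ∈ J ∧ ∀ k : ℕ, 0 < k → k < m → f^[k] x ∉ J

namespace PIET

variable {n : ℕ} {𝒜 : Type*} [Fintype 𝒜] [DecidableEq 𝒜]

/-- Elementary step of Rauzy induction: `T'` is the first return map of `T` to `[lo, cut)`, affinely
rescaled to `[0, 1)`, with the usual labelling of its intervals. Let `α` and `β` be the last
letters on top and on bottom. If the last top interval is the longest, the bottom order changes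
(`β` moves right after `α`) and the top interval of `α` is shortened. If the last bottom
interval is the longest, the top order changes (`α` moves right after `β`) and the bottom interval
of `β` is shortened. The other partition is then determined by the map. -/
structure RauzyStep (T T' : PIET n 𝒜) : Prop where
  cut_ne : T.cutTop ≠ T.cutBot
  lo_eq : T'.lo = 0
  hi_eq : T'.hi = 1
  first_return : ∀ y ∈ Set.Ico (0 : ℝ) 1,
    IsFirstReturn T.map (Set.Ico T.lo T.cut)
      (T.lo + (T.cut - T.lo) * y) (T.lo + (T.cut - T.lo) * T'.map y)
  top_wins : T.cutTop < T.cutBot →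
    T'.perm.top = T.perm.top ∧
    MovedAfter T.perm.bot T'.perm.bot (T.perm.bot (Fin.last n)) (T.perm.top (Fin.last n)) ∧
    ∀ γ, (T.cut - T.lo) * T'.topLen γ =
      if γ = T.perm.top (Fin.last n) then T.topLen γ - T.botLen (T.perm.bot (Fin.last n))
      else T.topLen γ
  bot_wins : T.cutBot < T.cutTop →
    T'.perm.bot = T.perm.bot ∧
    MovedAfter T.perm.top T'.perm.top (T.perm.top (Fin.last n)) (T.perm.bot (Fin.last n)) ∧
    ∀ γ, (T.cut - T.lo) * T'.botLen γ =
      if γ = T.perm.bot (Fin.last n) then T.botLen γ - T.topLen (T.perm.top (Fin.last n))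
      else T.botLen γ

/-- `T` is infinitely renormalisable and its Rauzy path is `∞`-complete: every letter wins
infinitely often. -/
def InfinitelyComplete (T : PIET n 𝒜) : Prop :=
  ∃ U : ℕ → PIET n 𝒜, U 0 = T ∧ (∀ m, RauzyStep (U m) (U (m + 1))) ∧
    ∀ α : 𝒜, ∀ N : ℕ, ∃ m, N ≤ m ∧ (U m).winner = α

/-- `RauzyChain T ℓ T'`: some number (at least one) of steps of Rauzy induction leads from `T` to
`T'`, and `T'` is the rescaling of the first return map of `T` to `[lo, lo + ℓ)`. -/
inductive RauzyChain : PIET n 𝒜 → ℝ → PIET n 𝒜 → Prop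
  | single {T T' : PIET n 𝒜} (h : RauzyStep T T') : RauzyChain T (T.cut - T.lo) T'
  | cons {T T₁ T' : PIET n 𝒜} {ℓ : ℝ} (h : RauzyStep T T₁) (h' : RauzyChain T₁ ℓ T') :
      RauzyChain T ((T.cut - T.lo) * ℓ) T'

/-! When the permutation of `T` is circular, that is, when the bottom order is a cyclic shift of the
top order, grouping adjacent intervals which are mapped to adjacent intervals turns `T` into a
continuous exchange of two intervals. Its top singularity is the left end `groupTop` of the
top interval of the first bottom letter, and its bottom singularity is the left end `groupBot` of the
bottom interval of the first top letter. -/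

/-- The singularity of the top partition into two groups of intervals. -/
noncomputable def groupTop (T : PIET n 𝒜) : ℝ := T.topLeft (T.perm.bot 0)

/-- The singularity of the bottom partition into two groups of intervals. -/
noncomputable def groupBot (T : PIET n 𝒜) : ℝ := T.botLeft (T.perm.top 0)

/-- The type of the exchange of two groups: `true` when the top wins (the last top group is longer
than the last bottom group), `false` when the bottom wins. -/
def GroupWins (T : PIET n 𝒜) : Bool → Prop
  | true => T.groupTop < T.groupBot
  | false => T.groupBot < T.groupTop

/-- One step of Rauzy induction for the exchange of two groups of intervals, that is, first
return to `[lo, max groupTop groupBot)`, realised by steps of Rauzy induction for `T`. -/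
def GroupStep (T T' : PIET n 𝒜) : Prop :=
  RauzyChain T (max T.groupTop T.groupBot - T.lo) T'

/-- Group steps are applied as long as the side `s` wins, and once more when the other side
eventually wins. -/
inductive GroupRun (s : Bool) : PIET n 𝒜 → PIET n 𝒜 → Prop
  | last {T T' : PIET n 𝒜} (hw : T.GroupWins (!s)) (h : GroupStep T T') : GroupRun s T T'
  | more {T T₁ T' : PIET n 𝒜} (hw : T.GroupWins s) (h : GroupStep T T₁)
      (h' : GroupRun s T₁ T') : GroupRun s T T'

/-- The renormalisation operator (the accelerated Rauzy induction): `T'` is the renormalisation of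
`T`. Group steps are applied as long as the side which wins for `T` keeps winning, and once more when
the other side eventually wins. -/
def Renormalises (T T' : PIET n 𝒜) : Prop :=
  ∃ s : Bool, T.GroupWins s ∧ GroupRun s T T'

end PIET

namespace PIET

variable {n : ℕ} {𝒜 : Type*} [Fintype 𝒜]

open Classical in
/-- Size of the break at a marked point: the product of the right derivatives at the singularities
of this class divided by the product of the left derivatives. -/
noncomputable def breakSize (T : PIET n 𝒜) (v : T.perm.MarkedPoint) : ℝ :=
  (∏ α with T.perm.leftPoint α = v, deriv (moebius (T.branch α)) (T.topLeft α)) /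
    ∏ α with T.perm.rightPoint α = v, deriv (moebius (T.branch α)) (T.topRight α)

/-- The sizes of the breaks of `T` are `c 0, …, c (n - 1)`, for some numbering of the
marked points. -/
def HasBreaks (T : PIET n 𝒜) (c : Fin n → ℝ) : Prop :=
  ∃ e : Fin n ≃ T.perm.MarkedPoint, ∀ i, T.breakSize (e i) = c i

/-- `T` and `S` have the same permutation and are at `C¹`-distance at most `ε`: on
corresponding intervals, parametrised affinely by `[0, 1]`, the points, their images and the
derivatives at these points differ by at most `ε`. -/
def C1DistLE (T S : PIET n 𝒜) (ε : ℝ) : Prop :=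
  T.perm = S.perm ∧ ∀ α, ∀ t ∈ Set.Icc (0 : ℝ) 1,
    |(T.topLeft α + t * T.topLen α) - (S.topLeft α + t * S.topLen α)| ≤ ε ∧
    |moebius (T.branch α) (T.topLeft α + t * T.topLen α) -
      moebius (S.branch α) (S.topLeft α + t * S.topLen α)| ≤ ε ∧
    |deriv (moebius (T.branch α)) (T.topLeft α + t * T.topLen α) -
      deriv (moebius (S.branch α)) (S.topLeft α + t * S.topLen α)| ≤ ε

/-- `P_σ`: piecewise Möbius interval exchange transformations with permutation `σ`. -/
def familyP (σ : MarkedPerm n 𝒜) : Set (PIET n 𝒜) := {T | T.perm = σ}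

/-- `E_σ`: those with domain `[0, 1)` for which the image of the loop around the distinguished
marked point belongs to the affine group. -/
def familyE (σ : MarkedPerm n 𝒜) : Set (PIET n 𝒜) :=
  {T | T ∈ familyP σ ∧ T.lo = 0 ∧ T.hi = 1 ∧ T.rep σ.distinguishedLoop ∈ affineGroup}

/-- The union of the families `E_σ` over all permutations `σ` of genus one. -/
def attractingFamily (n : ℕ) (𝒜 : Type*) [Fintype 𝒜] : Set (PIET n 𝒜) :=
  ⋃ σ ∈ {σ : MarkedPerm n 𝒜 | σ.GenusOne}, familyE σ

end PIET

/-! ### Möbius maps: elementary facts -/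

/-- The denominator of a Möbius map. -/
def moebiusDen (g : Matrix.SpecialLinearGroup (Fin 2) ℝ) (x : ℝ) : ℝ := g 1 0 * x + g 1 1

theorem sl2_det (g : Matrix.SpecialLinearGroup (Fin 2) ℝ) :
    g 0 0 * g 1 1 - g 0 1 * g 1 0 = 1 := by
  have := g.det_coe
  rwa [Matrix.det_fin_two] at this

theorem moebius_sub (g : Matrix.SpecialLinearGroup (Fin 2) ℝ) {x y : ℝ}
    (hx : moebiusDen g x ≠ 0) (hy : moebiusDen g y ≠ 0) :
    moebius g y - moebius g x = (y - x) / (moebiusDen g x * moebiusDen g y) := by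
  unfold moebius
  unfold moebiusDen at *
  rw [div_sub_div _ _ hy hx, div_eq_div_iff (mul_ne_zero hy hx) (mul_ne_zero hx hy)]
  linear_combination ((y - x) * (g 1 0 * x + g 1 1) * (g 1 0 * y + g 1 1)) * sl2_det g

theorem hasDerivAt_moebius (g : Matrix.SpecialLinearGroup (Fin 2) ℝ) {x : ℝ}
    (hx : moebiusDen g x ≠ 0) : HasDerivAt (moebius g) (1 / moebiusDen g x ^ 2) x := by
  have h1 : HasDerivAt (fun x : ℝ => g 0 0 * x + g 0 1) (g 0 0) x := by
    simpa using ((hasDerivAt_id x).const_mul (g 0 0)).add_const (g 0 1)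
  have h2 : HasDerivAt (fun x : ℝ => g 1 0 * x + g 1 1) (g 1 0) x := by
    simpa using ((hasDerivAt_id x).const_mul (g 1 0)).add_const (g 1 1)
  have h := h1.div h2 hx
  refine h.congr_deriv ?_
  unfold moebiusDen at *
  congr 1
  linear_combination sl2_det g

theorem deriv_moebius (g : Matrix.SpecialLinearGroup (Fin 2) ℝ) {x : ℝ}
    (hx : moebiusDen g x ≠ 0) : deriv (moebius g) x = 1 / moebiusDen g x ^ 2 :=
  (hasDerivAt_moebius g hx).deriv

theorem moebiusDen_mul (g h : Matrix.SpecialLinearGroup (Fin 2) ℝ) {x : ℝ}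
    (hx : moebiusDen h x ≠ 0) :
    moebiusDen (g * h) x = moebiusDen g (moebius h x) * moebiusDen h x := by
  unfold moebius
  unfold moebiusDen at *
  simp only [Matrix.SpecialLinearGroup.coe_mul, Matrix.mul_apply, Fin.sum_univ_two]
  field_simp
  ring

theorem moebius_mul (g h : Matrix.SpecialLinearGroup (Fin 2) ℝ) {x : ℝ}
    (hx : moebiusDen h x ≠ 0) : moebius (g * h) x = moebius g (moebius h x) := by
  unfold moebius
  unfold moebiusDen at *
  simp only [Matrix.SpecialLinearGroup.coe_mul, Matrix.mul_apply, Fin.sum_univ_two]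
  rw [← mul_div_mul_right _ (g 1 0 * _ + _) hx]
  have e : ∀ a b : ℝ, (a * ((h 0 0 * x + h 0 1) / (h 1 0 * x + h 1 1)) + b) *
      (h 1 0 * x + h 1 1) = a * (h 0 0 * x + h 0 1) + b * (h 1 0 * x + h 1 1) := by
    intro a b
    rw [add_mul, mul_assoc, div_mul_cancel₀ _ hx]
  rw [e, e]
  congr 1 <;> ring

theorem moebius_inv_apply (g : Matrix.SpecialLinearGroup (Fin 2) ℝ) {x : ℝ}
    (hx : moebiusDen g x ≠ 0) : moebius g⁻¹ (moebius g x) = x := by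
  rw [← moebius_mul _ _ hx]
  simp [moebius]

theorem moebiusDen_inv_apply (g : Matrix.SpecialLinearGroup (Fin 2) ℝ) {x : ℝ}
    (hx : moebiusDen g x ≠ 0) : moebiusDen g⁻¹ (moebius g x) = 1 / moebiusDen g x := by
  have := moebiusDen_mul g⁻¹ g hx
  rw [eq_div_iff hx, ← this]
  simp [moebiusDen]

theorem moebius_neg (g : Matrix.SpecialLinearGroup (Fin 2) ℝ) (x : ℝ) :
    moebius (-g) x = moebius g x := by
  unfold moebius
  simp only [Matrix.SpecialLinearGroup.coe_neg, Matrix.neg_apply]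
  rw [← neg_div_neg_eq]
  congr 1 <;> ring

theorem moebius_neg_fun (g : Matrix.SpecialLinearGroup (Fin 2) ℝ) :
    moebius (-g) = moebius g := funext (moebius_neg g)

theorem moebiusDen_neg (g : Matrix.SpecialLinearGroup (Fin 2) ℝ) (x : ℝ) :
    moebiusDen (-g) x = - moebiusDen g x := by
  unfold moebiusDen
  simp only [Matrix.SpecialLinearGroup.coe_neg, Matrix.neg_apply]
  ring

/-- Two matrices with the same Möbius map on an interval are equal up to sign. -/
theorem eq_or_eq_neg_of_moebius_eq (g h : Matrix.SpecialLinearGroup (Fin 2) ℝ) {l r : ℝ}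
    (hlr : l < r) (hg : ∀ x ∈ Set.Ico l r, moebiusDen g x ≠ 0)
    (hh : ∀ x ∈ Set.Ico l r, moebiusDen h x ≠ 0)
    (hgh : ∀ x ∈ Set.Ico l r, moebius g x = moebius h x) : h = g ∨ h = -g := by
  have key : ∀ x ∈ Set.Ico l r, (g 0 0 * h 1 0 - h 0 0 * g 1 0) * (x * x) +
      (g 0 0 * h 1 1 + g 0 1 * h 1 0 - h 0 0 * g 1 1 - h 0 1 * g 1 0) * x +
      (g 0 1 * h 1 1 - h 0 1 * g 1 1) = 0 := by
    intro x hx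
    have h1 : (g 0 0 * x + g 0 1) / moebiusDen g x = (h 0 0 * x + h 0 1) / moebiusDen h x :=
      hgh x hx
    rw [div_eq_div_iff (hg x hx) (hh x hx)] at h1
    unfold moebiusDen at h1
    linear_combination h1
  have k0 := key l ⟨le_rfl, hlr⟩
  have k1 := key ((2 * l + r) / 3) ⟨by linarith, by linarith⟩
  have k2 := key ((l + 2 * r) / 3) ⟨by linarith, by linarith⟩
  set A := g 0 0 * h 1 0 - h 0 0 * g 1 0
  set B := g 0 0 * h 1 1 + g 0 1 * h 1 0 - h 0 0 * g 1 1 - h 0 1 * g 1 0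
  set C := g 0 1 * h 1 1 - h 0 1 * g 1 1
  have hd : r - l ≠ 0 := by linarith
  have hA : A = 0 := by
    have : (r - l) ^ 2 * A = 0 := by linear_combination (9 / 2) * (k2 - 2 * k1 + k0)
    simpa [hd] using this
  have hB : B = 0 := by
    rw [hA] at k0 k1
    have : (r - l) * B = 0 := by linear_combination 3 * (k1 - k0)
    simpa [hd] using this
  have hC : C = 0 := by rw [hA, hB] at k0; linarith
  have dg := sl2_det g
  have dh := sl2_det h
  simp only [A, B, C] at hA hB hC
  set t := h 0 0 * g 1 1 - g 0 1 * h 1 0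
  have ht2 : t = g 0 0 * h 1 1 - h 0 1 * g 1 0 := by simp only [t]; linarith
  have e00 : h 0 0 = t * g 0 0 := by
    simp only [t]; linear_combination (-h 0 0) * dg + g 0 1 * hA
  have e10 : h 1 0 = t * g 1 0 := by
    simp only [t]; linear_combination (-h 1 0) * dg + g 1 1 * hA
  have e01 : h 0 1 = t * g 0 1 := by
    rw [ht2]; linear_combination (-h 0 1) * dg - g 0 0 * hC
  have e11 : h 1 1 = t * g 1 1 := by
    rw [ht2]; linear_combination (-h 1 1) * dg - g 1 0 * hC
  have htt : t ^ 2 = 1 := by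
    rw [e00, e01, e10, e11] at dh
    linear_combination dh - t ^ 2 * dg
  rcases (by simpa using htt : t = 1 ∨ t = -1) with h1 | h1
  · left
    ext i j
    fin_cases i <;> fin_cases j <;> simp [e00, e01, e10, e11, h1]
  · right
    ext i j
    fin_cases i <;> fin_cases j <;> simp [e00, e01, e10, e11, h1]

/-! ### Partitions of an interval indexed by an order of the letters -/

section Partition

variable {n : ℕ} {𝒜 : Type*} [Fintype 𝒜]

/-- Left end of the interval of `α` in the partition with order `p` and lengths `len`. -/
noncomputable def partLeft (p : Fin (n + 1) ≃ 𝒜) (len : 𝒜 → ℝ) (lo : ℝ) (α : 𝒜) : ℝ :=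
  lo + ∑ β with p.symm β < p.symm α, len β

variable {p : Fin (n + 1) ≃ 𝒜} {len : 𝒜 → ℝ} {lo : ℝ}

theorem partLeft_first {α : 𝒜} (h : (p.symm α : ℕ) = 0) : partLeft p len lo α = lo := by
  unfold partLeft
  rw [Finset.sum_eq_zero, add_zero]
  intro β hβ
  simp only [Finset.mem_filter, Finset.mem_univ, true_and, Fin.lt_def] at hβ
  omega

theorem partLeft_next {α β : 𝒜} (h : (p.symm β : ℕ) = p.symm α + 1) :
    partLeft p len lo β = partLeft p len lo α + len α := by
  classical
  unfold partLeft
  have : (Finset.univ.filter fun γ => p.symm γ < p.symm β) =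
      insert α (Finset.univ.filter fun γ => p.symm γ < p.symm α) := by
    ext γ
    simp only [Finset.mem_filter, Finset.mem_univ, true_and, Finset.mem_insert, Fin.lt_def]
    rw [← p.symm.injective.eq_iff, Fin.ext_iff]
    omega
  rw [this, Finset.sum_insert (by simp)]
  ring

theorem partLeft_last {α : 𝒜} (h : (p.symm α : ℕ) = n) :
    partLeft p len lo α + len α = lo + ∑ β, len β := by
  classical
  unfold partLeft
  have : Finset.univ = insert α (Finset.univ.filter fun γ => p.symm γ < p.symm α) := by
    ext γ
    have hh : p.symm γ = p.symm α ↔ γ = α := p.symm.injective.eq_iff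
    simp only [Finset.mem_filter, Finset.mem_univ, true_and, Finset.mem_insert, Fin.lt_def, ← hh,
      Fin.ext_iff, true_iff]
    have := (p.symm γ).isLt
    omega
  have h2 : ∑ γ, len γ = ∑ γ ∈ insert α (Finset.univ.filter fun γ => p.symm γ < p.symm α),
      len γ := by rw [← this]
  rw [h2, Finset.sum_insert (by simp)]
  ring

theorem partLeft_right_le (hlen : ∀ α, 0 ≤ len α) {α β : 𝒜} (h : p.symm α < p.symm β) :
    partLeft p len lo α + len α ≤ partLeft p len lo β := by
  classical
  unfold partLeft
  rw [add_assoc, add_comm _ (len α), ← Finset.sum_insert (by simp)]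
  refine add_le_add le_rfl (Finset.sum_le_sum_of_subset_of_nonneg ?_ (fun γ _ _ => hlen γ))
  intro γ
  simp only [Finset.mem_filter, Finset.mem_univ, true_and, Finset.mem_insert]
  rintro (rfl | h')
  · exact h
  · exact h'.trans h

theorem partLeft_mono (hlen : ∀ α, 0 ≤ len α) {α β : 𝒜} (h : p.symm α ≤ p.symm β) :
    partLeft p len lo α ≤ partLeft p len lo β := by
  rcases h.lt_or_eq with h | h
  · have := partLeft_right_le (lo := lo) hlen h
    linarith [hlen α]
  · rw [p.symm.injective h]

theorem le_partLeft (hlen : ∀ α, 0 ≤ len α) (α : 𝒜) : lo ≤ partLeft p len lo α := by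
  unfold partLeft
  linarith [Finset.sum_nonneg (s := Finset.univ.filter fun γ => p.symm γ < p.symm α)
    fun γ _ => hlen γ]

theorem partRight_le (hlen : ∀ α, 0 ≤ len α) (α : 𝒜) :
    partLeft p len lo α + len α ≤ lo + ∑ β, len β := by
  rcases Nat.lt_or_ge (p.symm α : ℕ) n with h | h
  · have h1 : p.symm α < p.symm (p (Fin.last n)) := by
      simp only [Equiv.symm_apply_apply, Fin.lt_def, Fin.val_last]; exact h
    have h2 := partLeft_right_le (lo := lo) hlen h1
    have h3 := partLeft_last (p := p) (len := len) (lo := lo) (α := p (Fin.last n)) (by simp)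
    linarith [hlen (p (Fin.last n))]
  · exact (partLeft_last (by have := (p.symm α).isLt; omega)).le

theorem exists_mem_part {x : ℝ} (hx : x ∈ Set.Ico lo (lo + ∑ β, len β)) :
    ∃ α, x ∈ Set.Ico (partLeft p len lo α) (partLeft p len lo α + len α) := by
  by_contra hcon
  push Not at hcon
  have key : ∀ k : ℕ, (hk : k < n + 1) → partLeft p len lo (p ⟨k, hk⟩) ≤ x := by
    intro k
    induction k with
    | zero => intro hk; rw [partLeft_first (by simp)]; exact hx.1
    | succ k ih =>
      intro hk
      rw [partLeft_next (α := p ⟨k, by omega⟩) (by simp)]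
      by_contra h
      exact hcon _ ⟨ih (by omega), not_le.mp h⟩
  have h1 := key n (by omega)
  have h2 := partLeft_last (p := p) (len := len) (lo := lo) (α := p ⟨n, by omega⟩) (by simp)
  exact hcon _ ⟨h1, by rw [h2]; exact hx.2⟩

theorem part_unique (hlen : ∀ α, 0 ≤ len α) {x : ℝ} {α β : 𝒜}
    (hα : x ∈ Set.Ico (partLeft p len lo α) (partLeft p len lo α + len α))
    (hβ : x ∈ Set.Ico (partLeft p len lo β) (partLeft p len lo β + len β)) : α = β := by
  rcases lt_trichotomy (p.symm α) (p.symm β) with h | h | h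
  · have := partLeft_right_le (lo := lo) hlen h
    linarith [hα.2, hβ.1]
  · exact p.symm.injective h
  · have := partLeft_right_le (lo := lo) hlen h
    linarith [hα.1, hβ.2]

end Partition

theorem moebiusDen_mul_pos (g : Matrix.SpecialLinearGroup (Fin 2) ℝ) {l r : ℝ}
    (h : ∀ x ∈ Set.Icc l r, moebiusDen g x ≠ 0) {x y : ℝ} (hx : x ∈ Set.Icc l r)
    (hy : y ∈ Set.Icc l r) : 0 < moebiusDen g x * moebiusDen g y := by
  by_contra hcon
  have hc : ContinuousOn (moebiusDen g) (Set.Icc l r) := by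
    unfold moebiusDen; fun_prop
  have hx' := h x hx
  have hy' := h y hy
  have hp : IsPreconnected (Set.Icc l r) := isPreconnected_Icc
  rcases lt_or_gt_of_ne hx' with h1 | h1 <;> rcases lt_or_gt_of_ne hy' with h2 | h2
  · exact hcon (mul_pos_of_neg_of_neg h1 h2)
  · obtain ⟨z, hz, hz0⟩ := hp.intermediate_value hx hy hc ⟨h1.le, h2.le⟩
    exact h z hz hz0
  · obtain ⟨z, hz, hz0⟩ := hp.intermediate_value hy hx hc ⟨h2.le, h1.le⟩
    exact h z hz hz0
  · exact hcon (mul_pos h1 h2)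

namespace MarkedPerm

variable {n : ℕ} {𝒜 : Type*}

/-- Exchange of the top and the bottom order. -/
def swap (σ : MarkedPerm n 𝒜) : MarkedPerm n 𝒜 := ⟨σ.bot, σ.top⟩

end MarkedPerm

namespace PIET

variable {n : ℕ} {𝒜 : Type*} [Fintype 𝒜]

/-- Right end of the bottom interval of `α`. -/
noncomputable def botRight (T : PIET n 𝒜) (α : 𝒜) : ℝ := T.botLeft α + T.botLen α

theorem topLeft_eq (T : PIET n 𝒜) (α : 𝒜) :
    T.topLeft α = partLeft T.perm.top T.topLen T.lo α := rfl

theorem botLeft_eq (T : PIET n 𝒜) (α : 𝒜) :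
    T.botLeft α = partLeft T.perm.bot T.botLen T.lo α := rfl

theorem topLen_nonneg (T : PIET n 𝒜) (α : 𝒜) : 0 ≤ T.topLen α := (T.topLen_pos α).le

theorem botLen_nonneg (T : PIET n 𝒜) (α : 𝒜) : 0 ≤ T.botLen α := (T.botLen_pos α).le

theorem topLeft_lt_topRight (T : PIET n 𝒜) (α : 𝒜) : T.topLeft α < T.topRight α := by
  unfold topRight; linarith [T.topLen_pos α]

theorem botLeft_lt_botRight (T : PIET n 𝒜) (α : 𝒜) : T.botLeft α < T.botRight α := by
  unfold botRight; linarith [T.botLen_pos α]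

theorem lo_le_topLeft (T : PIET n 𝒜) (α : 𝒜) : T.lo ≤ T.topLeft α :=
  le_partLeft T.topLen_nonneg α

theorem lo_le_botLeft (T : PIET n 𝒜) (α : 𝒜) : T.lo ≤ T.botLeft α :=
  le_partLeft T.botLen_nonneg α

theorem topRight_le_hi (T : PIET n 𝒜) (α : 𝒜) : T.topRight α ≤ T.hi := by
  have h := partRight_le (p := T.perm.top) (lo := T.lo) T.topLen_nonneg α
  rw [T.sum_topLen] at h
  unfold topRight
  rw [topLeft_eq]
  linarith

theorem botRight_le_hi (T : PIET n 𝒜) (α : 𝒜) : T.botRight α ≤ T.hi := by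
  have h := partRight_le (p := T.perm.bot) (lo := T.lo) T.botLen_nonneg α
  rw [T.sum_botLen] at h
  unfold botRight
  rw [botLeft_eq]
  linarith

theorem exists_mem_top (T : PIET n 𝒜) {x : ℝ} (hx : x ∈ Set.Ico T.lo T.hi) :
    ∃ α, x ∈ Set.Ico (T.topLeft α) (T.topRight α) := by
  apply exists_mem_part
  rw [T.sum_topLen]
  convert hx using 1
  ring_nf

theorem mem_top_unique (T : PIET n 𝒜) {x : ℝ} {α β : 𝒜}
    (hα : x ∈ Set.Ico (T.topLeft α) (T.topRight α))
    (hβ : x ∈ Set.Ico (T.topLeft β) (T.topRight β)) : α = β :=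
  part_unique T.topLen_nonneg hα hβ

theorem mem_of_mem_top (T : PIET n 𝒜) {x : ℝ} {α : 𝒜}
    (hα : x ∈ Set.Ico (T.topLeft α) (T.topRight α)) : x ∈ Set.Ico T.lo T.hi :=
  ⟨(T.lo_le_topLeft α).trans hα.1, hα.2.trans_le (T.topRight_le_hi α)⟩

theorem mem_of_mem_bot (T : PIET n 𝒜) {x : ℝ} {α : 𝒜}
    (hα : x ∈ Set.Ico (T.botLeft α) (T.botRight α)) : x ∈ Set.Ico T.lo T.hi :=
  ⟨(T.lo_le_botLeft α).trans hα.1, hα.2.trans_le (T.botRight_le_hi α)⟩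

theorem den_ne (T : PIET n 𝒜) {α : 𝒜} {x : ℝ} (hx : x ∈ Set.Icc (T.topLeft α) (T.topRight α)) :
    moebiusDen (T.branch α) x ≠ 0 := T.no_pole α x hx

theorem den_mul_pos (T : PIET n 𝒜) {α : 𝒜} {x y : ℝ}
    (hx : x ∈ Set.Icc (T.topLeft α) (T.topRight α))
    (hy : y ∈ Set.Icc (T.topLeft α) (T.topRight α)) :
    0 < moebiusDen (T.branch α) x * moebiusDen (T.branch α) y :=
  moebiusDen_mul_pos _ (fun _ h => T.den_ne h) hx hy

theorem left_mem (T : PIET n 𝒜) (α : 𝒜) : T.topLeft α ∈ Set.Icc (T.topLeft α) (T.topRight α) :=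
  Set.left_mem_Icc.mpr (T.topLeft_lt_topRight α).le

theorem right_mem (T : PIET n 𝒜) (α : 𝒜) : T.topRight α ∈ Set.Icc (T.topLeft α) (T.topRight α) :=
  Set.right_mem_Icc.mpr (T.topLeft_lt_topRight α).le

theorem branch_left (T : PIET n 𝒜) (α : 𝒜) : moebius (T.branch α) (T.topLeft α) = T.botLeft α :=
  T.map_left α

theorem branch_right (T : PIET n 𝒜) (α : 𝒜) :
    moebius (T.branch α) (T.topRight α) = T.botRight α := T.map_right α

theorem branch_sub (T : PIET n 𝒜) {α : 𝒜} {x y : ℝ}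
    (hx : x ∈ Set.Icc (T.topLeft α) (T.topRight α))
    (hy : y ∈ Set.Icc (T.topLeft α) (T.topRight α)) :
    moebius (T.branch α) y - moebius (T.branch α) x =
      (y - x) / (moebiusDen (T.branch α) x * moebiusDen (T.branch α) y) :=
  moebius_sub _ (T.den_ne hx) (T.den_ne hy)

theorem branch_strictMonoOn (T : PIET n 𝒜) (α : 𝒜) :
    StrictMonoOn (moebius (T.branch α)) (Set.Icc (T.topLeft α) (T.topRight α)) := by
  intro x hx y hy hxy
  have h := T.branch_sub hx hy
  have := div_pos (sub_pos.mpr hxy) (T.den_mul_pos hx hy)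
  linarith

theorem branch_mem_Icc (T : PIET n 𝒜) {α : 𝒜} {x : ℝ}
    (hx : x ∈ Set.Icc (T.topLeft α) (T.topRight α)) :
    moebius (T.branch α) x ∈ Set.Icc (T.botLeft α) (T.botRight α) := by
  rw [← branch_left, ← branch_right]
  exact ⟨(T.branch_strictMonoOn α).monotoneOn (T.left_mem α) hx hx.1,
    (T.branch_strictMonoOn α).monotoneOn hx (T.right_mem α) hx.2⟩

theorem branch_mem_Ico (T : PIET n 𝒜) {α : 𝒜} {x : ℝ}
    (hx : x ∈ Set.Ico (T.topLeft α) (T.topRight α)) :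
    moebius (T.branch α) x ∈ Set.Ico (T.botLeft α) (T.botRight α) := by
  refine ⟨(T.branch_mem_Icc (Set.Ico_subset_Icc_self hx)).1, ?_⟩
  rw [← branch_right]
  exact (T.branch_strictMonoOn α) (Set.Ico_subset_Icc_self hx) (T.right_mem α) hx.2

theorem exists_branch_eq (T : PIET n 𝒜) {α : 𝒜} {y : ℝ}
    (hy : y ∈ Set.Icc (T.botLeft α) (T.botRight α)) :
    ∃ x ∈ Set.Icc (T.topLeft α) (T.topRight α), moebius (T.branch α) x = y := by
  have hc : ContinuousOn (moebius (T.branch α)) (Set.Icc (T.topLeft α) (T.topRight α)) :=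
    fun x hx => (hasDerivAt_moebius _ (T.den_ne hx)).continuousAt.continuousWithinAt
  have := intermediate_value_Icc (T.topLeft_lt_topRight α).le hc
  rw [branch_left, branch_right] at this
  exact this hy

theorem map_eq (T : PIET n 𝒜) {α : 𝒜} {x : ℝ} (hx : x ∈ Set.Ico (T.topLeft α) (T.topRight α)) :
    T.map x = moebius (T.branch α) x := by
  classical
  unfold map
  rw [Finset.sum_eq_single α]
  · exact Set.indicator_of_mem hx _
  · intro β _ hβ
    exact Set.indicator_of_notMem (fun h => hβ (T.mem_top_unique h hx)) _
  · simp

theorem map_topLeft (T : PIET n 𝒜) (α : 𝒜) : T.map (T.topLeft α) = T.botLeft α := by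
  rw [T.map_eq (α := α) ⟨le_rfl, T.topLeft_lt_topRight α⟩, branch_left]

theorem map_mem_bot (T : PIET n 𝒜) {α : 𝒜} {x : ℝ}
    (hx : x ∈ Set.Ico (T.topLeft α) (T.topRight α)) :
    T.map x ∈ Set.Ico (T.botLeft α) (T.botRight α) := by
  rw [T.map_eq hx]; exact T.branch_mem_Ico hx

theorem map_mem (T : PIET n 𝒜) {x : ℝ} (hx : x ∈ Set.Ico T.lo T.hi) :
    T.map x ∈ Set.Ico T.lo T.hi := by
  obtain ⟨α, hα⟩ := T.exists_mem_top hx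
  exact T.mem_of_mem_bot (T.map_mem_bot hα)

/-- The inverse map: top and bottom are exchanged. -/
noncomputable def inv (T : PIET n 𝒜) : PIET n 𝒜 where
  perm := T.perm.swap
  lo := T.lo
  hi := T.hi
  topLen := T.botLen
  botLen := T.topLen
  topLen_pos := T.botLen_pos
  botLen_pos := T.topLen_pos
  sum_topLen := T.sum_botLen
  sum_botLen := T.sum_topLen
  branch α := (T.branch α)⁻¹
  no_pole := by
    intro α x hx
    obtain ⟨y, hy, rfl⟩ := T.exists_branch_eq hx
    have := moebiusDen_inv_apply (T.branch α) (T.den_ne hy)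
    unfold moebiusDen at this
    rw [this]
    exact one_div_ne_zero (T.den_ne hy)
  map_left α := by
    have := moebius_inv_apply (T.branch α) (T.den_ne (T.left_mem α))
    rwa [branch_left] at this
  map_right α := by
    have := moebius_inv_apply (T.branch α) (T.den_ne (T.right_mem α))
    rwa [branch_right] at this

theorem inv_inv (T : PIET n 𝒜) : T.inv.inv = T := by
  cases T
  simp [inv, MarkedPerm.swap]

@[simp] theorem inv_topLeft (T : PIET n 𝒜) (α : 𝒜) : T.inv.topLeft α = T.botLeft α := rfl
@[simp] theorem inv_botLeft (T : PIET n 𝒜) (α : 𝒜) : T.inv.botLeft α = T.topLeft α := rfl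
@[simp] theorem inv_topRight (T : PIET n 𝒜) (α : 𝒜) : T.inv.topRight α = T.botRight α := rfl
@[simp] theorem inv_botRight (T : PIET n 𝒜) (α : 𝒜) : T.inv.botRight α = T.topRight α := rfl
@[simp] theorem inv_lo (T : PIET n 𝒜) : T.inv.lo = T.lo := rfl
@[simp] theorem inv_hi (T : PIET n 𝒜) : T.inv.hi = T.hi := rfl
@[simp] theorem inv_cutTop (T : PIET n 𝒜) : T.inv.cutTop = T.cutBot := rfl
@[simp] theorem inv_cutBot (T : PIET n 𝒜) : T.inv.cutBot = T.cutTop := rfl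
@[simp] theorem inv_cut (T : PIET n 𝒜) : T.inv.cut = T.cut := max_comm _ _
@[simp] theorem inv_groupTop (T : PIET n 𝒜) : T.inv.groupTop = T.groupBot := rfl
@[simp] theorem inv_groupBot (T : PIET n 𝒜) : T.inv.groupBot = T.groupTop := rfl
@[simp] theorem inv_perm (T : PIET n 𝒜) : T.inv.perm = T.perm.swap := rfl

theorem inv_map_map (T : PIET n 𝒜) {x : ℝ} (hx : x ∈ Set.Ico T.lo T.hi) :
    T.inv.map (T.map x) = x := by
  obtain ⟨α, hα⟩ := T.exists_mem_top hx
  rw [T.inv.map_eq (α := α) (by simpa using T.map_mem_bot hα), T.map_eq hα]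
  exact moebius_inv_apply _ (T.den_ne (Set.Ico_subset_Icc_self hα))

theorem map_inv_map (T : PIET n 𝒜) {x : ℝ} (hx : x ∈ Set.Ico T.lo T.hi) :
    T.map (T.inv.map x) = x := by
  have := T.inv.inv_map_map (x := x) (by simpa using hx)
  rwa [inv_inv] at this

theorem map_injOn (T : PIET n 𝒜) : Set.InjOn T.map (Set.Ico T.lo T.hi) := by
  intro x hx y hy h
  rw [← T.inv_map_map hx, h, T.inv_map_map hy]

/-- The same map with the same labelled partitions: the branches agree in `PSL(2, ℝ)`. -/
structure Same (T S : PIET n 𝒜) : Prop where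
  perm : S.perm = T.perm
  lo : S.lo = T.lo
  hi : S.hi = T.hi
  topLen : S.topLen = T.topLen
  botLen : S.botLen = T.botLen
  branch : ∀ α, S.branch α = T.branch α ∨ S.branch α = -T.branch α

namespace Same

variable {T S R : PIET n 𝒜}

theorem refl (T : PIET n 𝒜) : Same T T := ⟨rfl, rfl, rfl, rfl, rfl, fun _ => Or.inl rfl⟩

theorem symm (h : Same T S) : Same S T :=
  ⟨h.perm.symm, h.lo.symm, h.hi.symm, h.topLen.symm, h.botLen.symm, fun α => by
    rcases h.branch α with h | h
    · exact Or.inl h.symm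
    · right; rw [h, neg_neg]⟩

theorem moebius (h : Same T S) (α : 𝒜) : moebius (S.branch α) = moebius (T.branch α) := by
  rcases h.branch α with h | h
  · rw [h]
  · rw [h, moebius_neg_fun]

theorem topLeft (h : Same T S) (α : 𝒜) : S.topLeft α = T.topLeft α := by
  rw [topLeft_eq, topLeft_eq, h.perm, h.lo, h.topLen]

theorem botLeft (h : Same T S) (α : 𝒜) : S.botLeft α = T.botLeft α := by
  rw [botLeft_eq, botLeft_eq, h.perm, h.lo, h.botLen]

theorem topRight (h : Same T S) (α : 𝒜) : S.topRight α = T.topRight α := by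
  unfold PIET.topRight; rw [h.topLeft, h.topLen]

theorem map (h : Same T S) : S.map = T.map := by
  unfold PIET.map
  simp only [h.topLeft, h.topRight, h.moebius]

theorem cutTop (h : Same T S) : S.cutTop = T.cutTop := by
  unfold PIET.cutTop; rw [h.topLeft, h.perm]

theorem cutBot (h : Same T S) : S.cutBot = T.cutBot := by
  unfold PIET.cutBot; rw [h.botLeft, h.perm]

theorem cut (h : Same T S) : S.cut = T.cut := by
  unfold PIET.cut; rw [h.cutTop, h.cutBot]

theorem groupTop (h : Same T S) : S.groupTop = T.groupTop := by
  unfold PIET.groupTop; rw [h.topLeft, h.perm]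

theorem groupBot (h : Same T S) : S.groupBot = T.groupBot := by
  unfold PIET.groupBot; rw [h.botLeft, h.perm]

theorem groupWins (h : Same T S) (s : Bool) : S.GroupWins s ↔ T.GroupWins s := by
  cases s <;> simp only [GroupWins, h.groupTop, h.groupBot]

theorem inv (h : Same T S) : Same T.inv S.inv :=
  ⟨by simp [h.perm], h.lo, h.hi, h.botLen, h.topLen, fun α => by
    rcases h.branch α with h | h
    · left; simp [PIET.inv, h]
    · right; simp only [PIET.inv, h]
      rw [inv_eq_iff_mul_eq_one, neg_mul_neg, mul_inv_cancel]⟩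

end Same

theorem Same.of_inv {T S : PIET n 𝒜} (h : Same T.inv S.inv) : Same T S := by
  have := h.inv
  rwa [inv_inv, inv_inv] at this

theorem same_of_map_eq_of_topLen {T S : PIET n 𝒜} (hp : S.perm = T.perm) (hlo : S.lo = T.lo)
    (hhi : S.hi = T.hi) (hm : ∀ x ∈ Set.Ico T.lo T.hi, S.map x = T.map x)
    (hlen : S.topLen = T.topLen) : Same T S := by
  have hl : ∀ α, S.topLeft α = T.topLeft α := by
    intro α; rw [topLeft_eq, topLeft_eq, hp, hlo, hlen]
  have hr : ∀ α, S.topRight α = T.topRight α := by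
    intro α; unfold topRight; rw [hl, hlen]
  have hb : ∀ α, S.branch α = T.branch α ∨ S.branch α = -T.branch α := by
    intro α
    refine eq_or_eq_neg_of_moebius_eq _ _ (T.topLeft_lt_topRight α)
      (fun x hx => T.den_ne (Set.Ico_subset_Icc_self hx))
      (fun x hx => S.den_ne (by rw [hl, hr]; exact Set.Ico_subset_Icc_self hx)) ?_
    intro x hx
    rw [← T.map_eq hx, ← S.map_eq (by rw [hl, hr]; exact hx), hm x (T.mem_of_mem_top hx)]
  refine ⟨hp, hlo, hhi, hlen, ?_, hb⟩
  ext α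
  have h1 : moebius (S.branch α) = moebius (T.branch α) := by
    rcases hb α with h | h
    · rw [h]
    · rw [h, moebius_neg_fun]
  have h2 : S.botLeft α = T.botLeft α := by rw [← branch_left, ← branch_left, h1, hl]
  have h3 : S.botRight α = T.botRight α := by rw [← branch_right, ← branch_right, h1, hr]
  unfold botRight at h3
  linarith

end PIET

set_option linter.unusedSectionVars false

/-! ### Affine rescaling -/

/-- The matrix of the affine map `x ↦ a + ℓ x`. -/
noncomputable def affineSL (a ℓ : ℝ) (hℓ : 0 < ℓ) : Matrix.SpecialLinearGroup (Fin 2) ℝ :=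
  ⟨!![Real.sqrt ℓ, a / Real.sqrt ℓ; 0, 1 / Real.sqrt ℓ], by
    have := (Real.sqrt_pos.mpr hℓ).ne'
    rw [Matrix.det_fin_two_of]; field_simp; ring⟩

section affineSL

variable {a ℓ : ℝ} (hℓ : 0 < ℓ)

theorem moebius_affineSL (x : ℝ) : moebius (affineSL a ℓ hℓ) x = a + ℓ * x := by
  have h := (Real.sqrt_pos.mpr hℓ).ne'
  have h2 := Real.mul_self_sqrt hℓ.le
  simp only [moebius, affineSL, Matrix.of_apply, Matrix.cons_val', Matrix.cons_val_zero,
    Matrix.cons_val_one, Matrix.cons_val_fin_one, zero_mul, zero_add]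
  rw [div_div_eq_mul_div, div_one, add_mul, div_mul_cancel₀ _ h]
  linear_combination x * h2

theorem moebiusDen_affineSL (x : ℝ) :
    moebiusDen (affineSL a ℓ hℓ) x = 1 / Real.sqrt ℓ := by
  simp [moebiusDen, affineSL]

theorem moebiusDen_affineSL_inv (x : ℝ) :
    moebiusDen (affineSL a ℓ hℓ)⁻¹ x = Real.sqrt ℓ := by
  rw [moebiusDen, Matrix.SpecialLinearGroup.SL2_inv_expl]
  simp [affineSL]

theorem moebius_affineSL_inv (x : ℝ) : moebius (affineSL a ℓ hℓ)⁻¹ x = (x - a) / ℓ := by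
  have h0 : moebiusDen (affineSL a ℓ hℓ) ((x - a) / ℓ) ≠ 0 := by
    rw [moebiusDen_affineSL]; exact one_div_ne_zero (Real.sqrt_pos.mpr hℓ).ne'
  have := moebius_inv_apply _ h0
  rwa [moebius_affineSL, mul_div_cancel₀ _ hℓ.ne', add_sub_cancel] at this

/-- Conjugation of a Möbius map by an affine map. -/
noncomputable def rescale (a ℓ : ℝ) (hℓ : 0 < ℓ) (g : Matrix.SpecialLinearGroup (Fin 2) ℝ) :
    Matrix.SpecialLinearGroup (Fin 2) ℝ :=
  (affineSL a ℓ hℓ)⁻¹ * (g * affineSL a ℓ hℓ)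

theorem moebiusDen_mul_affineSL (g : Matrix.SpecialLinearGroup (Fin 2) ℝ) (y : ℝ) :
    moebiusDen (g * affineSL a ℓ hℓ) y = moebiusDen g (a + ℓ * y) * (1 / Real.sqrt ℓ) := by
  rw [moebiusDen_mul, moebius_affineSL, moebiusDen_affineSL]
  rw [moebiusDen_affineSL]; exact one_div_ne_zero (Real.sqrt_pos.mpr hℓ).ne'

theorem moebiusDen_rescale (g : Matrix.SpecialLinearGroup (Fin 2) ℝ) {y : ℝ}
    (hy : moebiusDen g (a + ℓ * y) ≠ 0) :
    moebiusDen (rescale a ℓ hℓ g) y = moebiusDen g (a + ℓ * y) := by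
  have h := (Real.sqrt_pos.mpr hℓ).ne'
  have h1 : moebiusDen (g * affineSL a ℓ hℓ) y ≠ 0 := by
    rw [moebiusDen_mul_affineSL]; exact mul_ne_zero hy (one_div_ne_zero h)
  rw [rescale, moebiusDen_mul _ _ h1, moebiusDen_affineSL_inv, moebiusDen_mul_affineSL]
  field_simp

theorem moebius_rescale (g : Matrix.SpecialLinearGroup (Fin 2) ℝ) {y : ℝ}
    (hy : moebiusDen g (a + ℓ * y) ≠ 0) :
    moebius (rescale a ℓ hℓ g) y = (moebius g (a + ℓ * y) - a) / ℓ := by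
  have h := (Real.sqrt_pos.mpr hℓ).ne'
  have h1 : moebiusDen (g * affineSL a ℓ hℓ) y ≠ 0 := by
    rw [moebiusDen_mul_affineSL]; exact mul_ne_zero hy (one_div_ne_zero h)
  rw [rescale, moebius_mul _ _ h1, moebius_affineSL_inv, moebius_mul, moebius_affineSL]
  rw [moebiusDen_affineSL]; exact one_div_ne_zero h

end affineSL

/-! ### Moving the last letter of an order -/

section Moved

variable {n : ℕ} {𝒜 : Type*} [Fintype 𝒜] [DecidableEq 𝒜]

theorem movedAfter_unique {p p' p'' : Fin (n + 1) ≃ 𝒜} {l w : 𝒜} (h' : MovedAfter p p' l w)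
    (h'' : MovedAfter p p'' l w) : p' = p'' := by
  have : p'.symm = p''.symm := by
    ext γ
    rw [h' γ, h'' γ]
  rw [← p'.symm_symm, this, p''.symm_symm]

theorem exists_movedAfter (p : Fin (n + 1) ≃ 𝒜) {l w : 𝒜} (hl : (p.symm l : ℕ) = n)
    (hw : w ≠ l) : ∃ p', MovedAfter p p' l w := by
  have hlt : ∀ γ, γ ≠ l → (p.symm γ : ℕ) < n := by
    intro γ hγ
    have h1 := (p.symm γ).isLt
    have h2 : (p.symm γ : ℕ) ≠ n := fun h => hγ (p.symm.injective (Fin.ext (h.trans hl.symm)))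
    omega
  have hwn := hlt w hw
  let f : 𝒜 → Fin (n + 1) := fun γ =>
    ⟨if γ = l then (p.symm w : ℕ) + 1
      else if p.symm γ ≤ p.symm w then (p.symm γ : ℕ) else (p.symm γ : ℕ) + 1, by
      split_ifs with h1 h2
      · omega
      · exact (p.symm γ).isLt
      · have := hlt γ h1; omega⟩
  have hf : Function.Injective f := by
    intro γ δ h
    simp only [f, Fin.mk.injEq, Fin.le_def] at h
    by_contra hne
    have h3 : (p.symm γ : ℕ) ≠ p.symm δ := fun h => hne (p.symm.injective (Fin.ext h))
    split_ifs at h <;> first | omega | (subst_vars; exact hne rfl)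
  have hb : Function.Bijective f := by
    rw [Fintype.bijective_iff_injective_and_card]
    refine ⟨hf, ?_⟩
    rw [Fintype.card_fin, ← Fintype.card_congr p, Fintype.card_fin]
  refine ⟨(Equiv.ofBijective f hb).symm, fun γ => ?_⟩
  simp [f]

theorem sum_moved {len len' : 𝒜 → ℝ} {l w : 𝒜} (hw : w ≠ l) (hlw : len' l + len' w = len w)
    (hlen : ∀ γ, γ ≠ l → γ ≠ w → len' γ = len γ) : ∑ γ, len' γ = ∑ γ, len γ - len l := by
  have h := Fintype.sum_eq_add (f := fun γ => len γ - len' γ) l w hw.symm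
    (fun x hx => by rw [hlen x hx.1 hx.2, sub_self])
  rw [Finset.sum_sub_distrib] at h
  linarith

theorem partLeft_moved {p p' : Fin (n + 1) ≃ 𝒜} {l w : 𝒜} (hl : (p.symm l : ℕ) = n)
    (h : MovedAfter p p' l w) (hw : w ≠ l) {len len' : 𝒜 → ℝ} (hlw : len' l + len' w = len w)
    (hlen : ∀ γ, γ ≠ l → γ ≠ w → len' γ = len γ) (lo : ℝ) {γ : 𝒜} (hγ : γ ≠ l) :
    partLeft p' len' lo γ = partLeft p len lo γ := by
  have hlt : ∀ γ, γ ≠ l → (p.symm γ : ℕ) < n := by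
    intro γ hγ
    have h1 := (p.symm γ).isLt
    have h2 : (p.symm γ : ℕ) ≠ n := fun h => hγ (p.symm.injective (Fin.ext (h.trans hl.symm)))
    omega
  have hwn := hlt w hw
  have hγn := hlt γ hγ
  have hpos := h
  unfold MovedAfter at hpos
  simp only [Fin.le_def] at hpos
  unfold partLeft
  congr 1
  have hγ' := hpos γ
  rw [if_neg hγ] at hγ'
  have hl' := hpos l
  rw [if_pos rfl] at hl'
  by_cases hc : (p.symm γ : ℕ) ≤ p.symm w
  · rw [if_pos hc] at hγ'
    have hset : (Finset.univ.filter fun δ => p'.symm δ < p'.symm γ) =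
        Finset.univ.filter fun δ => p.symm δ < p.symm γ := by
      ext δ
      simp only [Finset.mem_filter, Finset.mem_univ, true_and, Fin.lt_def]
      by_cases hδ : δ = l
      · subst hδ; omega
      · have := hpos δ
        rw [if_neg hδ] at this
        split_ifs at this <;> omega
    rw [hset]
    refine Finset.sum_congr rfl fun δ hδ => ?_
    simp only [Finset.mem_filter, Finset.mem_univ, true_and, Fin.lt_def] at hδ
    refine hlen δ ?_ ?_
    · rintro rfl; omega
    · rintro rfl; omega
  · rw [if_neg hc] at hγ'
    have hset : (Finset.univ.filter fun δ => p'.symm δ < p'.symm γ) =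
        insert l (Finset.univ.filter fun δ => p.symm δ < p.symm γ) := by
      ext δ
      simp only [Finset.mem_filter, Finset.mem_univ, true_and, Fin.lt_def, Finset.mem_insert]
      by_cases hδ : δ = l
      · subst hδ; simp only [true_or, iff_true]; omega
      · have := hpos δ
        rw [if_neg hδ] at this
        simp only [hδ, false_or]
        split_ifs at this <;> omega
    have hlm : l ∉ Finset.univ.filter fun δ => p.symm δ < p.symm γ := by
      simp only [Finset.mem_filter, Finset.mem_univ, true_and, Fin.lt_def]; omega
    have hwm : w ∈ Finset.univ.filter fun δ => p.symm δ < p.symm γ := by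
      simp only [Finset.mem_filter, Finset.mem_univ, true_and, Fin.lt_def]; omega
    rw [hset, Finset.sum_insert hlm, ← Finset.add_sum_erase _ _ hwm, ← Finset.add_sum_erase _ len hwm,
      ← add_assoc, hlw]
    congr 1
    refine Finset.sum_congr rfl fun δ hδ => ?_
    rw [Finset.mem_erase] at hδ
    refine hlen δ ?_ hδ.1
    rintro rfl
    exact hlm hδ.2

theorem partLeft_moved_self {p p' : Fin (n + 1) ≃ 𝒜} {l w : 𝒜} (hl : (p.symm l : ℕ) = n)
    (h : MovedAfter p p' l w) (hw : w ≠ l) {len len' : 𝒜 → ℝ} (hlw : len' l + len' w = len w)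
    (hlen : ∀ γ, γ ≠ l → γ ≠ w → len' γ = len γ) (lo : ℝ) :
    partLeft p' len' lo l = partLeft p len lo w + len' w := by
  rw [← partLeft_moved hl h hw hlw hlen lo hw]
  apply partLeft_next
  rw [h l, h w, if_pos rfl, if_neg hw, if_pos le_rfl]

theorem partLeft_scaled (p : Fin (n + 1) ≃ 𝒜) (len : 𝒜 → ℝ) (lo ℓ : ℝ) (γ : 𝒜) :
    partLeft p (fun δ => len δ / ℓ) 0 γ = (partLeft p len lo γ - lo) / ℓ := by
  unfold partLeft
  rw [← Finset.sum_div]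
  ring

theorem partLeft_congr {p : Fin (n + 1) ≃ 𝒜} {len len' : 𝒜 → ℝ} {lo : ℝ} {γ : 𝒜}
    (h : ∀ δ, p.symm δ < p.symm γ → len' δ = len δ) :
    partLeft p len' lo γ = partLeft p len lo γ := by
  unfold partLeft
  congr 1
  refine Finset.sum_congr rfl fun δ hδ => ?_
  simp only [Finset.mem_filter, Finset.mem_univ, true_and] at hδ
  exact h δ hδ

end Moved

theorem IsFirstReturn.unique {f : ℝ → ℝ} {J : Set ℝ} {x y z : ℝ} (hy : IsFirstReturn f J x y)
    (hz : IsFirstReturn f J x z) : y = z := by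
  obtain ⟨m, hm, hmy, hyJ, hm'⟩ := hy
  obtain ⟨k, hk, hkz, hzJ, hk'⟩ := hz
  rcases lt_trichotomy m k with h | h | h
  · exact absurd (hmy ▸ hyJ) (hk' m hm h)
  · rw [← hmy, ← hkz, h]
  · exact absurd (hkz ▸ hzJ) (hm' k hk h)

namespace PIET

variable {n : ℕ} {𝒜 : Type*} [Fintype 𝒜]

theorem topRight_last (T : PIET n 𝒜) : T.topRight (T.perm.top (Fin.last n)) = T.hi := by
  have := partLeft_last (p := T.perm.top) (len := T.topLen) (lo := T.lo)
    (α := T.perm.top (Fin.last n)) (by simp)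
  rw [T.sum_topLen] at this
  unfold topRight
  rw [topLeft_eq]
  linarith

theorem botRight_last (T : PIET n 𝒜) : T.botRight (T.perm.bot (Fin.last n)) = T.hi :=
  T.inv.topRight_last

theorem cutTop_add (T : PIET n 𝒜) : T.cutTop + T.topLen (T.perm.top (Fin.last n)) = T.hi :=
  T.topRight_last

theorem cutBot_add (T : PIET n 𝒜) : T.cutBot + T.botLen (T.perm.bot (Fin.last n)) = T.hi :=
  T.botRight_last

theorem topLeft_le_cutTop (T : PIET n 𝒜) (α : 𝒜) : T.topLeft α ≤ T.cutTop := by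
  refine partLeft_mono T.topLen_nonneg ?_
  rw [Equiv.symm_apply_apply]; exact Fin.le_last _

theorem botLeft_le_cutBot (T : PIET n 𝒜) (α : 𝒜) : T.botLeft α ≤ T.cutBot :=
  T.inv.topLeft_le_cutTop α

theorem topRight_le_cutTop (T : PIET n 𝒜) {α : 𝒜} (h : α ≠ T.perm.top (Fin.last n)) :
    T.topRight α ≤ T.cutTop := by
  refine partLeft_right_le T.topLen_nonneg ?_
  rw [Equiv.symm_apply_apply]
  refine lt_of_le_of_ne (Fin.le_last _) fun h' => h ?_
  rw [← h', Equiv.apply_symm_apply]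

theorem botRight_le_cutBot (T : PIET n 𝒜) {α : 𝒜} (h : α ≠ T.perm.bot (Fin.last n)) :
    T.botRight α ≤ T.cutBot := T.inv.topRight_le_cutTop h

theorem lo_le_cutTop (T : PIET n 𝒜) : T.lo ≤ T.cutTop := T.lo_le_topLeft _

theorem lo_le_cutBot (T : PIET n 𝒜) : T.lo ≤ T.cutBot := T.lo_le_botLeft _

theorem cutTop_lt_hi (T : PIET n 𝒜) : T.cutTop < T.hi := by
  have := T.cutTop_add
  linarith [T.topLen_pos (T.perm.top (Fin.last n))]

theorem cutBot_lt_hi (T : PIET n 𝒜) : T.cutBot < T.hi := T.inv.cutTop_lt_hi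

variable [DecidableEq 𝒜]

/-- The hypotheses of a step of Rauzy induction in which the top wins. -/
structure TopWins (T : PIET n 𝒜) : Prop where
  lt : T.cutTop < T.cutBot
  ne : T.perm.top (Fin.last n) ≠ T.perm.bot (Fin.last n)

namespace TopWins

variable {T : PIET n 𝒜}

theorem pos (h : T.TopWins) : 0 < T.cutBot - T.lo := by linarith [h.lt, T.lo_le_cutTop]

theorem cutBot_mem (h : T.TopWins) : T.cutBot ∈ Set.Ioo (T.topLeft (T.perm.top (Fin.last n)))
    (T.topRight (T.perm.top (Fin.last n))) :=
  ⟨h.lt, by rw [T.topRight_last]; exact T.cutBot_lt_hi⟩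

theorem cutBot_mem_Icc (h : T.TopWins) : T.cutBot ∈ Set.Icc (T.topLeft (T.perm.top (Fin.last n)))
    (T.topRight (T.perm.top (Fin.last n))) := Set.Ioo_subset_Icc_self h.cutBot_mem

theorem bot_sub_top (h : T.TopWins) {x : ℝ} (hx : x ∈ Set.Icc (T.botLeft (T.perm.bot (Fin.last n)))
    (T.botRight (T.perm.bot (Fin.last n)))) :
    x ∈ Set.Icc (T.topLeft (T.perm.top (Fin.last n))) (T.topRight (T.perm.top (Fin.last n))) := by
  refine ⟨h.lt.le.trans hx.1, ?_⟩
  rw [T.topRight_last, ← T.botRight_last]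
  exact hx.2

end TopWins

/-- The image of the cut by the branch of the winner. -/
noncomputable def topSplit (T : PIET n 𝒜) : ℝ :=
  moebius (T.branch (T.perm.top (Fin.last n))) T.cutBot

theorem TopWins.split_mem {T : PIET n 𝒜} (h : T.TopWins) :
    T.topSplit ∈ Set.Ioo (T.botLeft (T.perm.top (Fin.last n)))
      (T.botRight (T.perm.top (Fin.last n))) := by
  rw [← branch_left, ← branch_right]
  exact ⟨T.branch_strictMonoOn _ (T.left_mem _) h.cutBot_mem_Icc h.cutBot_mem.1,
    T.branch_strictMonoOn _ h.cutBot_mem_Icc (T.right_mem _) h.cutBot_mem.2⟩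

/-- Top lengths after a step in which the top wins, before rescaling. -/
noncomputable def topStepTopLen (T : PIET n 𝒜) (γ : 𝒜) : ℝ :=
  if γ = T.perm.top (Fin.last n) then T.topLen γ - T.botLen (T.perm.bot (Fin.last n))
  else T.topLen γ

/-- Bottom lengths after a step in which the top wins, before rescaling. -/
noncomputable def topStepBotLen (T : PIET n 𝒜) (γ : 𝒜) : ℝ :=
  if γ = T.perm.bot (Fin.last n) then T.botRight (T.perm.top (Fin.last n)) - T.topSplit
  else if γ = T.perm.top (Fin.last n) then T.topSplit - T.botLeft (T.perm.top (Fin.last n))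
  else T.botLen γ

/-- Branches after a step in which the top wins, before rescaling. -/
noncomputable def topStepBranch (T : PIET n 𝒜) (γ : 𝒜) :
    Matrix.SpecialLinearGroup (Fin 2) ℝ :=
  if γ = T.perm.bot (Fin.last n) then T.branch (T.perm.top (Fin.last n)) * T.branch γ
  else T.branch γ

/-- Right ends of the top intervals after a step in which the top wins, before rescaling. -/
noncomputable def topStepRight (T : PIET n 𝒜) (γ : 𝒜) : ℝ :=
  if γ = T.perm.top (Fin.last n) then T.cutBot else T.topRight γ

section topStep

variable {T : PIET n 𝒜}

theorem topStepTopLen_eq (T : PIET n 𝒜) (γ : 𝒜) :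
    T.topStepTopLen γ = T.topStepRight γ - T.topLeft γ := by
  unfold topStepTopLen topStepRight
  split_ifs with h1
  · subst h1
    have := T.cutBot_add
    have := T.cutTop_add
    unfold cutTop at this
    linarith
  · unfold topRight; ring

theorem topStepRight_mem (h : T.TopWins) (γ : 𝒜) :
    T.topLeft γ < T.topStepRight γ ∧ T.topStepRight γ ≤ T.topRight γ := by
  unfold topStepRight
  split_ifs with h1
  · subst h1; exact ⟨h.cutBot_mem.1, h.cutBot_mem.2.le⟩
  · exact ⟨T.topLeft_lt_topRight γ, le_rfl⟩

theorem topStepBranch_spec (h : T.TopWins) {γ : 𝒜} {x : ℝ} (hx : x ∈ Set.Icc (T.topLeft γ) (T.topStepRight γ)) :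
    moebiusDen (T.topStepBranch γ) x ≠ 0 ∧
    moebius (T.topStepBranch γ) x = if γ = T.perm.bot (Fin.last n) then
      moebius (T.branch (T.perm.top (Fin.last n))) (moebius (T.branch γ) x)
      else moebius (T.branch γ) x := by
  have hx' : x ∈ Set.Icc (T.topLeft γ) (T.topRight γ) :=
    ⟨hx.1, hx.2.trans (topStepRight_mem h γ).2⟩
  unfold topStepBranch
  split_ifs with h1
  · have h2 := T.branch_mem_Icc hx'
    refine ⟨?_, moebius_mul _ _ (T.den_ne hx')⟩
    rw [moebiusDen_mul _ _ (T.den_ne hx')]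
    refine mul_ne_zero ?_ (T.den_ne hx')
    exact T.den_ne (h.bot_sub_top (h1 ▸ h2))
  · exact ⟨T.den_ne hx', rfl⟩

end topStep

/-- The step of Rauzy induction when the top wins. -/
noncomputable def topStep (T : PIET n 𝒜) (h : T.TopWins) : PIET n 𝒜 :=
  have hmv := (exists_movedAfter T.perm.bot (l := T.perm.bot (Fin.last n)) (by simp) h.ne)
  have htl : ∀ γ, T.lo + (T.cutBot - T.lo) *
      (0 + ∑ δ with T.perm.top.symm δ < T.perm.top.symm γ,
        T.topStepTopLen δ / (T.cutBot - T.lo)) = T.topLeft γ := by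
    intro γ
    have h1 := partLeft_scaled T.perm.top T.topStepTopLen T.lo (T.cutBot - T.lo) γ
    have h2 : partLeft T.perm.top T.topStepTopLen T.lo γ = T.topLeft γ := by
      apply partLeft_congr
      intro δ hδ
      unfold topStepTopLen
      rw [if_neg]
      rintro rfl
      rw [Equiv.symm_apply_apply] at hδ
      exact absurd hδ (not_lt.mpr (Fin.le_last _))
    unfold partLeft at h1
    rw [h1]
    unfold partLeft at h2
    rw [h2, mul_div_cancel₀ _ h.pos.ne']
    ring
  have htr : ∀ γ, T.lo + (T.cutBot - T.lo) *
      (0 + ∑ δ with T.perm.top.symm δ < T.perm.top.symm γ,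
        T.topStepTopLen δ / (T.cutBot - T.lo) + T.topStepTopLen γ / (T.cutBot - T.lo)) =
        T.topStepRight γ := by
    intro γ
    rw [mul_add, ← add_assoc, htl, mul_div_cancel₀ _ h.pos.ne', topStepTopLen_eq]
    ring
  have hlw : T.topStepBotLen (T.perm.bot (Fin.last n)) +
      T.topStepBotLen (T.perm.top (Fin.last n)) = T.botLen (T.perm.top (Fin.last n)) := by
    unfold topStepBotLen
    rw [if_pos rfl, if_neg h.ne, if_pos rfl]
    unfold botRight; ring
  have hoth : ∀ γ, γ ≠ T.perm.bot (Fin.last n) → γ ≠ T.perm.top (Fin.last n) →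
      T.topStepBotLen γ = T.botLen γ := by
    intro γ h1 h2
    unfold topStepBotLen
    rw [if_neg h1, if_neg h2]
  have hbl : ∀ γ, (0 + ∑ δ with hmv.choose.symm δ < hmv.choose.symm γ,
        T.topStepBotLen δ / (T.cutBot - T.lo)) =
        ((if γ = T.perm.bot (Fin.last n) then T.topSplit else T.botLeft γ) - T.lo) /
          (T.cutBot - T.lo) := by
    intro γ
    have h1 := partLeft_scaled hmv.choose T.topStepBotLen T.lo (T.cutBot - T.lo) γ
    unfold partLeft at h1
    rw [h1]
    congr 2
    change partLeft _ _ _ _ = _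
    split_ifs with h2
    · subst h2
      rw [partLeft_moved_self (by simp) hmv.choose_spec h.ne hlw hoth]
      unfold topStepBotLen
      rw [if_neg h.ne, if_pos rfl, botLeft_eq]
      ring
    · exact partLeft_moved (by simp) hmv.choose_spec h.ne hlw hoth _ h2
  { perm := ⟨T.perm.top, hmv.choose⟩
    lo := 0
    hi := 1
    topLen := fun γ => T.topStepTopLen γ / (T.cutBot - T.lo)
    botLen := fun γ => T.topStepBotLen γ / (T.cutBot - T.lo)
    topLen_pos := by
      intro γ
      refine div_pos ?_ h.pos
      rw [topStepTopLen_eq]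
      linarith [(topStepRight_mem h γ).1]
    botLen_pos := by
      intro γ
      refine div_pos ?_ h.pos
      unfold topStepBotLen
      split_ifs
      · linarith [h.split_mem.2]
      · linarith [h.split_mem.1]
      · exact T.botLen_pos γ
    sum_topLen := by
      rw [← Finset.sum_div, sub_zero, div_eq_one_iff_eq h.pos.ne']
      have h1 := T.sum_topLen
      have h2 : ∑ γ, (T.topLen γ - T.topStepTopLen γ) = T.botLen (T.perm.bot (Fin.last n)) := by
        rw [Finset.sum_eq_single (T.perm.top (Fin.last n))]
        · unfold topStepTopLen; rw [if_pos rfl]; ring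
        · intro δ _ hδ; unfold topStepTopLen; rw [if_neg hδ]; ring
        · simp
      rw [Finset.sum_sub_distrib] at h2
      linarith [T.cutBot_add]
    sum_botLen := by
      rw [← Finset.sum_div, sub_zero, div_eq_one_iff_eq h.pos.ne', sum_moved h.ne hlw hoth,
        T.sum_botLen]
      linarith [T.cutBot_add]
    branch := fun γ => rescale T.lo (T.cutBot - T.lo) h.pos (T.topStepBranch γ)
    no_pole := by
      intro γ x hx
      have hx' : T.lo + (T.cutBot - T.lo) * x ∈ Set.Icc (T.topLeft γ) (T.topStepRight γ) := by
        rw [← htl γ, ← htr γ]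
        exact ⟨by have := h.pos; gcongr; exact hx.1, by have := h.pos; gcongr; exact hx.2⟩
      have := (topStepBranch_spec h hx').1
      rw [← moebiusDen_rescale h.pos _ this] at this
      exact this
    map_left := by
      intro γ
      have hx' : T.topLeft γ ∈ Set.Icc (T.topLeft γ) (T.topStepRight γ) :=
        ⟨le_rfl, (topStepRight_mem h γ).1.le⟩
      have hs := topStepBranch_spec h hx'
      rw [moebius_rescale, htl, hs.2, hbl]
      · congr 2
        split_ifs with h1
        · rw [branch_left, topSplit, h1]; rfl
        · exact T.branch_left γ
      · rw [htl]; exact hs.1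
    map_right := by
      intro γ
      have hx' : T.topStepRight γ ∈ Set.Icc (T.topLeft γ) (T.topStepRight γ) :=
        ⟨(topStepRight_mem h γ).1.le, le_rfl⟩
      have hs := topStepBranch_spec h hx'
      rw [moebius_rescale, htr, hs.2, hbl, ← add_div]
      · congr 1
        unfold topStepBotLen topStepRight
        split_ifs with h1 h2 h3
        · exact absurd (h2.symm.trans h1) h.ne
        · rw [branch_right]
          have : T.botRight γ = T.topRight (T.perm.top (Fin.last n)) := by
            rw [h1, T.topRight_last, T.botRight_last]
          rw [this, branch_right]; ring
        · subst h3; unfold topSplit; ring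
        · rw [branch_right]; unfold botRight; ring
      · rw [htr]; exact hs.1 }

end PIET

namespace PIET

variable {n : ℕ} {𝒜 : Type*} [Fintype 𝒜] [DecidableEq 𝒜]

section topStep

variable {T : PIET n 𝒜} (h : T.TopWins)

theorem topStep_movedAfter : MovedAfter T.perm.bot (T.topStep h).perm.bot
    (T.perm.bot (Fin.last n)) (T.perm.top (Fin.last n)) :=
  (exists_movedAfter T.perm.bot (l := T.perm.bot (Fin.last n)) (by simp) h.ne).choose_spec

@[simp] theorem topStep_lo : (T.topStep h).lo = 0 := rfl
@[simp] theorem topStep_hi : (T.topStep h).hi = 1 := rfl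
@[simp] theorem topStep_top : (T.topStep h).perm.top = T.perm.top := rfl

theorem topStep_topLen (γ : 𝒜) :
    (T.topStep h).topLen γ = T.topStepTopLen γ / (T.cutBot - T.lo) := rfl

theorem topStep_branch (γ : 𝒜) : (T.topStep h).branch γ =
    rescale T.lo (T.cutBot - T.lo) h.pos (T.topStepBranch γ) := rfl

theorem topStep_topLeft (γ : 𝒜) :
    (T.topStep h).topLeft γ = (T.topLeft γ - T.lo) / (T.cutBot - T.lo) := by
  have h1 := partLeft_scaled T.perm.top T.topStepTopLen T.lo (T.cutBot - T.lo) γ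
  have h2 : partLeft T.perm.top T.topStepTopLen T.lo γ = T.topLeft γ := by
    apply partLeft_congr
    intro δ hδ
    unfold topStepTopLen
    rw [if_neg]
    rintro rfl
    rw [Equiv.symm_apply_apply] at hδ
    exact absurd hδ (not_lt.mpr (Fin.le_last _))
  rw [h2] at h1
  exact h1

theorem topStep_topRight (γ : 𝒜) :
    (T.topStep h).topRight γ = (T.topStepRight γ - T.lo) / (T.cutBot - T.lo) := by
  unfold topRight
  rw [topStep_topLeft, topStep_topLen, topStepTopLen_eq]
  ring

theorem topStep_lo_add_left (γ : 𝒜) :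
    T.lo + (T.cutBot - T.lo) * (T.topStep h).topLeft γ = T.topLeft γ := by
  rw [topStep_topLeft, mul_div_cancel₀ _ h.pos.ne']; ring

theorem topStep_lo_add_right (γ : 𝒜) :
    T.lo + (T.cutBot - T.lo) * (T.topStep h).topRight γ = T.topStepRight γ := by
  rw [topStep_topRight, mul_div_cancel₀ _ h.pos.ne']; ring

theorem topStep_mem_Icc {γ : 𝒜} {y : ℝ}
    (hy : y ∈ Set.Icc ((T.topStep h).topLeft γ) ((T.topStep h).topRight γ)) :
    T.lo + (T.cutBot - T.lo) * y ∈ Set.Icc (T.topLeft γ) (T.topStepRight γ) := by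
  have := h.pos
  rw [← topStep_lo_add_left h, ← topStep_lo_add_right h]
  exact ⟨by gcongr; exact hy.1, by gcongr; exact hy.2⟩

theorem topStep_moebius {γ : 𝒜} {y : ℝ}
    (hy : y ∈ Set.Icc ((T.topStep h).topLeft γ) ((T.topStep h).topRight γ)) :
    T.lo + (T.cutBot - T.lo) * moebius ((T.topStep h).branch γ) y =
      moebius (T.topStepBranch γ) (T.lo + (T.cutBot - T.lo) * y) := by
  rw [topStep_branch, moebius_rescale h.pos _ (topStepBranch_spec h (topStep_mem_Icc h hy)).1,
    mul_div_cancel₀ _ h.pos.ne']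
  ring

theorem cut_of_topWins (h : T.TopWins) : T.cut = T.cutBot := max_eq_right h.lt.le

theorem rauzyStep_topStep : RauzyStep T (T.topStep h) where
  cut_ne := h.lt.ne
  lo_eq := rfl
  hi_eq := rfl
  first_return := by
    intro y hy
    rw [cut_of_topWins h]
    obtain ⟨γ, hγ⟩ := (T.topStep h).exists_mem_top hy
    rw [(T.topStep h).map_eq hγ, topStep_moebius h (Set.Ico_subset_Icc_self hγ)]
    have hx : T.lo + (T.cutBot - T.lo) * y ∈ Set.Ico (T.topLeft γ) (T.topStepRight γ) := by
      have := h.pos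
      rw [← topStep_lo_add_left h, ← topStep_lo_add_right h]
      exact ⟨by gcongr; exact hγ.1, by gcongr; exact hγ.2⟩
    have hx' : T.lo + (T.cutBot - T.lo) * y ∈ Set.Ico (T.topLeft γ) (T.topRight γ) :=
      ⟨hx.1, hx.2.trans_le (topStepRight_mem h γ).2⟩
    have hm := T.map_mem_bot hx'
    rw [(topStepBranch_spec h (Set.Ico_subset_Icc_self hx)).2, ← T.map_eq hx']
    generalize T.lo + (T.cutBot - T.lo) * y = x at *
    split_ifs with h1
    · have h2 : T.map x ∈ Set.Ico (T.topLeft (T.perm.top (Fin.last n)))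
          (T.topRight (T.perm.top (Fin.last n))) := by
        rw [h1] at hm
        refine ⟨h.lt.le.trans hm.1, ?_⟩
        rw [T.topRight_last, ← T.botRight_last]
        exact hm.2
      have h3 := T.map_mem_bot h2
      refine ⟨2, two_pos, ?_, ?_, ?_⟩
      · rw [← T.map_eq h2]; rfl
      · rw [← T.map_eq h2]
        exact ⟨(T.lo_le_botLeft _).trans h3.1, h3.2.trans_le (T.botRight_le_cutBot h.ne)⟩
      · intro k hk hk'
        have : k = 1 := by omega
        subst this
        rw [h1] at hm
        exact fun hc => absurd hc.2 (not_lt.mpr hm.1)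
    · refine ⟨1, one_pos, rfl, ⟨(T.lo_le_botLeft _).trans hm.1,
        hm.2.trans_le (T.botRight_le_cutBot h1)⟩, ?_⟩
      intro k hk hk'
      omega
  top_wins _ := by
    refine ⟨rfl, topStep_movedAfter h, fun γ => ?_⟩
    rw [cut_of_topWins h, topStep_topLen, mul_div_cancel₀ _ h.pos.ne']
    rfl
  bot_wins h' := absurd h' h.lt.not_gt

end topStep

theorem cut_sub_lo_pos {T : PIET n 𝒜} (h : T.cutTop ≠ T.cutBot) : 0 < T.cut - T.lo := by
  have h1 := T.lo_le_cutTop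
  have h2 := T.lo_le_cutBot
  unfold cut
  rcases lt_or_gt_of_ne h with h | h
  · rw [max_eq_right h.le]; linarith
  · rw [max_eq_left h.le]; linarith

theorem cut_lt_hi (T : PIET n 𝒜) : T.cut < T.hi := max_lt T.cutTop_lt_hi T.cutBot_lt_hi

theorem lo_add_mem_cut {T : PIET n 𝒜} (h : T.cutTop ≠ T.cutBot) {y : ℝ}
    (hy : y ∈ Set.Ico (0 : ℝ) 1) :
    T.lo + (T.cut - T.lo) * y ∈ Set.Ico T.lo T.cut := by
  have := cut_sub_lo_pos h
  constructor
  · nlinarith [hy.1]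
  · nlinarith [hy.2]

theorem iterate_map_mem (T : PIET n 𝒜) {x : ℝ} (hx : x ∈ Set.Ico T.lo T.hi) (k : ℕ) :
    T.map^[k] x ∈ Set.Ico T.lo T.hi := by
  induction k with
  | zero => exact hx
  | succ k ih => rw [Function.iterate_succ_apply']; exact T.map_mem ih

theorem inv_iterate_iterate (T : PIET n 𝒜) {x : ℝ} (hx : x ∈ Set.Ico T.lo T.hi) {k m : ℕ}
    (hk : k ≤ m) : T.inv.map^[k] (T.map^[m] x) = T.map^[m - k] x := by
  induction k with
  | zero => rfl
  | succ k ih =>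
    rw [Function.iterate_succ_apply', ih (by omega)]
    obtain ⟨j, hj⟩ : ∃ j, m - k = j + 1 := ⟨m - k - 1, by omega⟩
    rw [hj, Function.iterate_succ_apply', T.inv_map_map (T.iterate_map_mem hx j)]
    congr 1
    omega

theorem isFirstReturn_inv (T : PIET n 𝒜) {J : Set ℝ} (hJ : J ⊆ Set.Ico T.lo T.hi) {x y : ℝ}
    (hx : x ∈ J) (h : IsFirstReturn T.map J x y) : IsFirstReturn T.inv.map J y x := by
  obtain ⟨m, hm, hmy, hyJ, hm'⟩ := h
  refine ⟨m, hm, ?_, hx, ?_⟩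
  · rw [← hmy, T.inv_iterate_iterate (hJ hx) le_rfl, Nat.sub_self]; rfl
  · intro k hk hk'
    rw [← hmy, T.inv_iterate_iterate (hJ hx) hk'.le]
    exact hm' _ (by omega) (by omega)

theorem RauzyStep.inv {T T' : PIET n 𝒜} (h : RauzyStep T T') : RauzyStep T.inv T'.inv where
  cut_ne := h.cut_ne.symm
  lo_eq := h.lo_eq
  hi_eq := h.hi_eq
  first_return := by
    intro y hy
    have hy' : y ∈ Set.Ico T'.lo T'.hi := by rwa [h.lo_eq, h.hi_eq]
    have hz := T'.inv.map_mem hy'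
    simp only [inv_lo, inv_hi, h.lo_eq, h.hi_eq] at hz
    have h1 := h.first_return _ hz
    rw [T'.map_inv_map hy'] at h1
    rw [inv_cut, inv_lo]
    refine T.isFirstReturn_inv ?_ (lo_add_mem_cut h.cut_ne hz) h1
    exact Set.Ico_subset_Ico_right T.cut_lt_hi.le
  top_wins h' := by
    obtain ⟨h1, h2, h3⟩ := h.bot_wins h'
    refine ⟨h1, h2, fun γ => ?_⟩
    rw [inv_cut]
    exact h3 γ
  bot_wins h' := by
    obtain ⟨h1, h2, h3⟩ := h.top_wins h'
    refine ⟨h1, h2, fun γ => ?_⟩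
    rw [inv_cut]
    exact h3 γ

theorem RauzyStep.congr_left {T S T' : PIET n 𝒜} (h : RauzyStep T T') (hs : Same T S) :
    RauzyStep S T' where
  cut_ne := by rw [hs.cutTop, hs.cutBot]; exact h.cut_ne
  lo_eq := h.lo_eq
  hi_eq := h.hi_eq
  first_return := by rw [hs.map, hs.lo, hs.cut]; exact h.first_return
  top_wins := by
    rw [hs.cutTop, hs.cutBot, hs.perm, hs.lo, hs.cut, hs.topLen, hs.botLen]
    exact h.top_wins
  bot_wins := by
    rw [hs.cutTop, hs.cutBot, hs.perm, hs.lo, hs.cut, hs.topLen, hs.botLen]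
    exact h.bot_wins

theorem RauzyStep.same_of_top {T T₁ T₂ : PIET n 𝒜} (h₁ : RauzyStep T T₁) (h₂ : RauzyStep T T₂)
    (h : T.cutTop < T.cutBot) : Same T₁ T₂ := by
  obtain ⟨a1, b1, c1⟩ := h₁.top_wins h
  obtain ⟨a2, b2, c2⟩ := h₂.top_wins h
  have hpos := cut_sub_lo_pos h₁.cut_ne
  refine same_of_map_eq_of_topLen ?_ (h₂.lo_eq.trans h₁.lo_eq.symm)
    (h₂.hi_eq.trans h₁.hi_eq.symm) ?_ ?_
  · have e1 : T₂.perm.top = T₁.perm.top := a2.trans a1.symm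
    have e2 : T₂.perm.bot = T₁.perm.bot := movedAfter_unique b2 b1
    calc T₂.perm = ⟨T₂.perm.top, T₂.perm.bot⟩ := rfl
      _ = T₁.perm := by rw [e1, e2]
  · intro x hx
    rw [h₁.lo_eq, h₁.hi_eq] at hx
    have := (h₂.first_return x hx).unique (h₁.first_return x hx)
    exact mul_left_cancel₀ hpos.ne' (add_left_cancel this)
  · ext γ
    exact mul_left_cancel₀ hpos.ne' ((c2 γ).trans (c1 γ).symm)

/-- A step of Rauzy induction is determined up to the signs of the branches. -/
theorem RauzyStep.same {T S T₁ S₁ : PIET n 𝒜} (hs : Same T S) (h₁ : RauzyStep T T₁)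
    (h₂ : RauzyStep S S₁) : Same T₁ S₁ := by
  replace h₂ := h₂.congr_left hs.symm
  rcases lt_or_gt_of_ne h₁.cut_ne with h | h
  · exact h₁.same_of_top h₂ h
  · exact Same.of_inv (h₁.inv.same_of_top h₂.inv h)

theorem RauzyStep.topWins {T T' : PIET n 𝒜} (h : RauzyStep T T') (h' : T.cutTop < T.cutBot) :
    T.TopWins := by
  refine ⟨h', fun hc => ?_⟩
  have := (h.top_wins h').2.1 (T.perm.bot (Fin.last n))
  rw [if_pos rfl, hc, Equiv.symm_apply_apply] at this
  have h2 := (T'.perm.bot.symm (T.perm.bot (Fin.last n))).isLt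
  simp only [Fin.val_last] at this
  omega

theorem RauzyStep.same_topStep {T T' : PIET n 𝒜} (h : RauzyStep T T') (h' : T.TopWins) :
    Same (T.topStep h') T' := (rauzyStep_topStep h').same_of_top h h'.lt

/-- A step of Rauzy induction exists when the last singularities and the last letters differ. -/
theorem exists_rauzyStep {T : PIET n 𝒜} (h : T.cutTop ≠ T.cutBot)
    (hne : T.perm.top (Fin.last n) ≠ T.perm.bot (Fin.last n)) : ∃ T', RauzyStep T T' := by
  rcases lt_or_gt_of_ne h with h | h
  · exact ⟨_, rauzyStep_topStep ⟨h, hne⟩⟩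
  · have := (rauzyStep_topStep (T := T.inv) ⟨h, hne.symm⟩).inv
    rw [inv_inv] at this
    exact ⟨_, this⟩

end PIET

namespace MarkedPerm

variable {n : ℕ} {𝒜 : Type*}

/-- The bottom order is obtained from the top order `A B C`, where the blocks `A`, `B`, `C` occupy the
positions `[0, r)`, `[r, s)` and `[s, n + 1)`, by exchanging the outer blocks: it is `C B A`. -/
structure Blocks (σ : MarkedPerm n 𝒜) (r s : ℕ) : Prop where
  pos : 0 < r
  le : r ≤ s
  le_n : s ≤ n
  bot_eq : ∀ γ, (σ.bot.symm γ : ℕ) =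
    if (σ.top.symm γ : ℕ) < r then (σ.top.symm γ : ℕ) + (n + 1) - r
    else if (σ.top.symm γ : ℕ) < s then (σ.top.symm γ : ℕ) + (n + 1) - (r + s)
    else (σ.top.symm γ : ℕ) - s

theorem glue_top_bot (σ : MarkedPerm n 𝒜) (γ : 𝒜) :
    (Quot.mk _ (Sum.inl (σ.top.symm γ).castSucc) : σ.MarkedPoint) =
      Quot.mk _ (Sum.inr (σ.bot.symm γ).castSucc) := Quot.sound (Glue.leftEnd γ)

theorem glue_top_bot_succ (σ : MarkedPerm n 𝒜) (γ : 𝒜) :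
    (Quot.mk _ (Sum.inl (σ.top.symm γ).succ) : σ.MarkedPoint) =
      Quot.mk _ (Sum.inr (σ.bot.symm γ).succ) := Quot.sound (Glue.rightEnd γ)

theorem Irreducible.first_ne {σ : MarkedPerm n 𝒜} (h : σ.Irreducible) (hn : 0 < n) :
    σ.top 0 ≠ σ.bot 0 := by
  intro hc
  apply h 1 one_pos (by omega)
  have : {i : Fin (n + 1) | (i : ℕ) < 1} = {0} := by
    ext i
    simp only [Set.mem_ofPred_eq, Set.mem_singleton_iff, Fin.ext_iff, Fin.val_zero]
    omega
  rw [this, Set.image_singleton, Set.image_singleton, hc]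

theorem Irreducible.last_ne {σ : MarkedPerm n 𝒜} (h : σ.Irreducible) (hn : 0 < n) :
    σ.top (Fin.last n) ≠ σ.bot (Fin.last n) := by
  intro hc
  apply h n hn (by omega)
  have : {i : Fin (n + 1) | (i : ℕ) < n} = {Fin.last n}ᶜ := by
    ext i
    simp only [Set.mem_ofPred_eq, Set.mem_compl_iff, Set.mem_singleton_iff, Fin.ext_iff,
      Fin.val_last]
    omega
  rw [this, Set.image_compl_eq σ.top.bijective, Set.image_compl_eq σ.bot.bijective,
    Set.image_singleton, Set.image_singleton, hc]

/-- The vertices strictly inside the top broken line. -/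
def innerTop (σ : MarkedPerm n 𝒜) (i : Fin n) : σ.MarkedPoint :=
  Quot.mk _ (Sum.inl i.castSucc.succ)

theorem innerTop_surjective {σ : MarkedPerm n 𝒜} (h0 : σ.top 0 ≠ σ.bot 0)
    (h1 : σ.top (Fin.last n) ≠ σ.bot (Fin.last n)) : Function.Surjective σ.innerTop := by
  have htop : ∀ i : ℕ, (hi : i < n + 2) →
      ∃ j, σ.innerTop j = Quot.mk _ (Sum.inl ⟨i, hi⟩) := by
    have inner : ∀ i : ℕ, (hi : i < n + 2) → 0 < i → i ≤ n →
        ∃ j, σ.innerTop j = Quot.mk _ (Sum.inl ⟨i, hi⟩) := by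
      intro i hi h0 hn
      refine ⟨⟨i - 1, by omega⟩, ?_⟩
      unfold innerTop
      congr 2
      ext
      simp only [Fin.val_succ, Fin.val_castSucc]
      omega
    intro i hi
    rcases Nat.eq_zero_or_pos i with h | h
    · subst h
      have hp : σ.top.symm (σ.bot 0) ≠ 0 := fun hc => h0 ((Equiv.symm_apply_eq _).mp hc).symm
      obtain ⟨j, hj⟩ := inner (σ.top.symm (σ.bot 0)) (by omega)
        (by rw [Nat.pos_iff_ne_zero]; exact fun hc => hp (Fin.ext hc)) (by omega)
      refine ⟨j, hj.trans ?_⟩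
      have e1 := σ.glue_top_bot (σ.bot 0)
      have e2 : (Quot.mk _ (Sum.inl 0) : σ.MarkedPoint) = Quot.mk _ (Sum.inr 0) :=
        Quot.sound Glue.leftmost
      rw [Equiv.symm_apply_apply] at e1
      exact e1.trans e2.symm
    · rcases Nat.lt_or_ge n i with h' | h'
      · have : i = n + 1 := by omega
        subst this
        have hp : σ.top.symm (σ.bot (Fin.last n)) ≠ Fin.last n :=
          fun hc => h1 ((Equiv.symm_apply_eq _).mp hc).symm
        have hp' : (σ.top.symm (σ.bot (Fin.last n)) : ℕ) ≠ n := fun hc => hp (Fin.ext hc)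
        obtain ⟨j, hj⟩ := inner (σ.top.symm (σ.bot (Fin.last n)) + 1) (by omega) (by omega)
          (by omega)
        refine ⟨j, hj.trans ?_⟩
        have e1 := σ.glue_top_bot_succ (σ.bot (Fin.last n))
        have e2 : (Quot.mk _ (Sum.inl (Fin.last (n + 1))) : σ.MarkedPoint) =
            Quot.mk _ (Sum.inr (Fin.last (n + 1))) := Quot.sound Glue.rightmost
        rw [Equiv.symm_apply_apply] at e1
        exact e1.trans e2.symm
      · exact inner i hi h h'
  intro v
  induction v using Quot.ind with
  | mk v =>
    rcases v with v | v
    · exact htop v v.isLt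
    · refine Fin.lastCases ?_ (fun i => ?_) v
      · obtain ⟨j, hj⟩ := htop (n + 1) (by omega)
        exact ⟨j, hj.trans (Quot.sound Glue.rightmost)⟩
      · obtain ⟨j, hj⟩ := htop (σ.top.symm (σ.bot i)) (by omega)
        refine ⟨j, hj.trans ?_⟩
        have := σ.glue_top_bot (σ.bot i)
        rw [Equiv.symm_apply_apply] at this
        exact this

instance (σ : MarkedPerm n 𝒜) : Finite σ.MarkedPoint :=
  Finite.of_surjective (Quot.mk σ.Glue) Quot.mk_surjective

/-- Exchanging top and bottom does not change the marked points. -/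
def swapPointFun (σ : MarkedPerm n 𝒜) : σ.MarkedPoint → σ.swap.MarkedPoint :=
  Quot.lift (fun v => Quot.mk _ v.swap) (by
    intro a b hab
    cases hab with
    | leftmost => exact (Quot.sound Glue.leftmost).symm
    | rightmost => exact (Quot.sound Glue.rightmost).symm
    | leftEnd α => exact (Quot.sound (Glue.leftEnd (σ := σ.swap) α)).symm
    | rightEnd α => exact (Quot.sound (Glue.rightEnd (σ := σ.swap) α)).symm)

/-- Exchanging top and bottom does not change the marked points. -/
def swapPoint (σ : MarkedPerm n 𝒜) : σ.MarkedPoint ≃ σ.swap.MarkedPoint where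
  toFun := σ.swapPointFun
  invFun := σ.swap.swapPointFun
  left_inv v := by
    induction v using Quot.ind with
    | mk v => rcases v with v | v <;> rfl
  right_inv v := by
    induction v using Quot.ind with
    | mk v => rcases v with v | v <;> rfl

theorem swapPoint_leftPoint (σ : MarkedPerm n 𝒜) (α : 𝒜) :
    σ.swapPoint (σ.leftPoint α) = σ.swap.leftPoint α :=
  (σ.swap.glue_top_bot α).symm

theorem swapPoint_rightPoint (σ : MarkedPerm n 𝒜) (α : 𝒜) :
    σ.swapPoint (σ.rightPoint α) = σ.swap.rightPoint α :=
  (σ.swap.glue_top_bot_succ α).symm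

theorem Irreducible.swap {σ : MarkedPerm n 𝒜} (h : σ.Irreducible) : σ.swap.Irreducible :=
  fun k hk hk' => (h k hk hk').symm

theorem GenusOne.swap {σ : MarkedPerm n 𝒜} (h : σ.GenusOne) : σ.swap.GenusOne :=
  ⟨h.1.swap, by rw [← Nat.card_congr σ.swapPoint]; exact h.2⟩

theorem GenusOne.pos {σ : MarkedPerm n 𝒜} (h : σ.GenusOne) : 0 < n := by
  rw [Nat.pos_iff_ne_zero]
  rintro rfl
  have h2 := h.2
  rw [Nat.card_eq_zero] at h2
  rcases h2 with h2 | h2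
  · exact h2.elim (Quot.mk _ (Sum.inl 0))
  · exact h2.not_finite inferInstance

theorem GenusOne.innerTop_injective {σ : MarkedPerm n 𝒜} (h : σ.GenusOne) :
    Function.Injective σ.innerTop := by
  have hs := innerTop_surjective (h.1.first_ne h.pos) (h.1.last_ne h.pos)
  have hc : Nat.card (Fin n) = Nat.card σ.MarkedPoint := by rw [h.2]; simp
  exact (Nat.bijective_iff_surjective_and_card _).mpr ⟨hs, hc⟩ |>.1

/-- Across an inner vertex of the top line other than two exceptional ones, adjacent letters are
adjacent on the bottom. -/
theorem GenusOne.bot_next {σ : MarkedPerm n 𝒜} (h : σ.GenusOne) {γ δ : 𝒜}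
    (hγδ : (σ.top.symm δ : ℕ) = σ.top.symm γ + 1) (hδ : (σ.bot.symm δ : ℕ) ≠ 0)
    (hγ : (σ.bot.symm γ : ℕ) ≠ n) : (σ.bot.symm δ : ℕ) = σ.bot.symm γ + 1 := by
  have e1 := σ.glue_top_bot δ
  have e2 := σ.glue_top_bot_succ γ
  have e3 : (σ.top.symm δ).castSucc = (σ.top.symm γ).succ := by ext; simpa using hγδ
  rw [e3, e2] at e1
  have e4 := congrArg σ.swapPoint e1
  have e5 : σ.swap.innerTop ⟨σ.bot.symm γ, by omega⟩ =
      σ.swap.innerTop ⟨σ.bot.symm δ - 1, by omega⟩ := by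
    refine e4.trans ?_
    change Quot.mk _ (Sum.inl _) = Quot.mk _ (Sum.inl _)
    congr 2
    ext
    simp only [Fin.val_castSucc, Fin.val_succ]
    omega
  have := h.swap.innerTop_injective e5
  rw [Fin.mk.injEq] at this
  omega

theorem GenusOne.exists_blocks {σ : MarkedPerm n 𝒜} (h : σ.GenusOne) : ∃ r s, σ.Blocks r s := by
  have hn := h.pos
  have h0 := h.1.first_ne hn
  have h1 := h.1.last_ne hn
  set r := (σ.top.symm (σ.bot (Fin.last n)) : ℕ) + 1 with hr
  set s := (σ.top.symm (σ.bot 0) : ℕ) with hs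
  have hs0 : s ≠ 0 := fun hc => h0 (by
    have : σ.top.symm (σ.bot 0) = 0 := Fin.ext hc
    exact ((Equiv.symm_apply_eq _).mp this).symm)
  have hrn : r ≠ n + 1 := fun hc => h1 (by
    have : σ.top.symm (σ.bot (Fin.last n)) = Fin.last n := Fin.ext (by simp; omega)
    exact ((Equiv.symm_apply_eq _).mp this).symm)
  have hsn : s ≤ n := by omega
  -- bottom position as a function of the top position
  let q : ℕ → ℕ := fun i => if hi : i < n + 1 then (σ.bot.symm (σ.top ⟨i, hi⟩) : ℕ) else 0
  have hq : ∀ γ, (σ.bot.symm γ : ℕ) = q (σ.top.symm γ) := by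
    intro γ
    simp only [q, dif_pos (σ.top.symm γ).isLt, Fin.eta, Equiv.apply_symm_apply]
  have hqi : ∀ i j, i < n + 1 → j < n + 1 → q i = q j → i = j := by
    intro i j hi hj hij
    simp only [q, dif_pos hi, dif_pos hj] at hij
    simpa using σ.top.injective (σ.bot.symm.injective (Fin.ext hij))
  have hqn : ∀ i, i < n + 1 → q i < n + 1 := by
    intro i hi
    simp only [q, dif_pos hi]
    exact Fin.isLt _
  have hqs : q s = 0 := by rw [hs, ← hq]; simp
  have hqr : q (r - 1) = n := by rw [hr, Nat.add_sub_cancel, ← hq]; simp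
  have hstep : ∀ i, i < n → i + 1 ≠ s → i + 1 ≠ r → q (i + 1) = q i + 1 := by
    intro i hi his hir
    have e1 : q (i + 1) ≠ 0 := fun hc => his (hqi _ _ (by omega) (by omega) (hc.trans hqs.symm))
    have e2 : q i ≠ n := fun hc => hir (by
      have := hqi _ _ (by omega) (by omega) (hc.trans hqr.symm); omega)
    simp only [q, dif_pos (show i < n + 1 by omega), dif_pos (show i + 1 < n + 1 by omega)]
      at e1 e2 ⊢
    exact h.bot_next (by simp) e1 e2
  have hrun : ∀ a k, a + k < n + 1 → (∀ j, a < j → j ≤ a + k → j ≠ s ∧ j ≠ r) →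
      q (a + k) = q a + k := by
    intro a k
    induction k with
    | zero => intros; rfl
    | succ k ih =>
      intro h1 h2
      have h3 := h2 (a + k + 1) (by omega) (by omega)
      have := ih (by omega) (fun j hj hj' => h2 j hj (by omega))
      have h4 := hstep (a + k) (by omega) h3.1 h3.2
      rw [← add_assoc, h4, this]; omega
  have hrs : r ≤ s := by
    by_contra hlt
    have := hrun s (r - 1 - s) (by omega) (fun j hj hj' => ⟨by omega, by omega⟩)
    have e : s + (r - 1 - s) = r - 1 := by omega
    rw [e, hqr, hqs] at this
    omega
  have hA : ∀ i, i < r → q i = i + (n + 1) - r := by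
    intro i hi
    have := hrun i (r - 1 - i) (by omega) (fun j hj hj' => ⟨by omega, by omega⟩)
    have e : i + (r - 1 - i) = r - 1 := by omega
    rw [e, hqr] at this
    omega
  have hC : ∀ i, s ≤ i → i < n + 1 → q i = i - s := by
    intro i hi hi'
    have := hrun s (i - s) (by omega) (fun j hj hj' => ⟨by omega, by omega⟩)
    have e : s + (i - s) = i := by omega
    rw [e, hqs] at this
    omega
  have hB : r < s → q r = n + 1 - s := by
    intro hlt
    have h1 := hrun r (s - 1 - r) (by omega) (fun j hj hj' => ⟨by omega, by omega⟩)
    have e : r + (s - 1 - r) = s - 1 := by omega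
    rw [e] at h1
    have h2 := hqn (s - 1) (by omega)
    have h3 : n + 1 - s ≤ q r := by
      by_contra hc
      have h4 := hC (s + q r) (by omega) (by omega)
      have := hqi (s + q r) r (by omega) (by omega) (by omega)
      omega
    have h5 : q (s - 1) < n + 1 - r := by
      by_contra hc
      have h4 := hA (q (s - 1) + r - (n + 1)) (by omega)
      have := hqi (q (s - 1) + r - (n + 1)) (s - 1) (by omega) (by omega) (by omega)
      omega
    omega
  refine ⟨r, s, by omega, hrs, hsn, fun γ => ?_⟩
  have hγ := (σ.top.symm γ).isLt
  rw [hq]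
  split_ifs with c1 c2
  · exact hA _ c1
  · have h1 := hrun r ((σ.top.symm γ : ℕ) - r) (by omega) (fun j hj hj' => ⟨by omega, by omega⟩)
    have e : r + ((σ.top.symm γ : ℕ) - r) = σ.top.symm γ := by omega
    rw [e, hB (by omega)] at h1
    omega
  · exact hC _ (by omega) hγ

/-- The inner vertex of the top line which represents the same marked point as a vertex of
the top line, for block sizes `r`, `s`. -/
def pointIndex (n r s i : ℕ) : ℕ := if i = 0 then s else if i = n + 1 then r else i

namespace Blocks

variable {σ : MarkedPerm n 𝒜} {r s : ℕ}

theorem eq_of_pos {γ δ : 𝒜} (h : (σ.top.symm γ : ℕ) = σ.top.symm δ) : γ = δ :=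
  σ.top.symm.injective (Fin.ext h)

theorem swap (h : σ.Blocks r s) : σ.swap.Blocks (n + 1 - s) (n + 1 - r) := by
  obtain ⟨h1, h2, h3, h4⟩ := h
  refine ⟨by omega, by omega, by omega, fun γ => ?_⟩
  have := h4 γ
  have := (σ.top.symm γ).isLt
  change (σ.top.symm γ : ℕ) = if (σ.bot.symm γ : ℕ) < n + 1 - s then
    (σ.bot.symm γ : ℕ) + (n + 1) - (n + 1 - s) else if (σ.bot.symm γ : ℕ) < n + 1 - r then
    (σ.bot.symm γ : ℕ) + (n + 1) - (n + 1 - s + (n + 1 - r)) else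
    (σ.bot.symm γ : ℕ) - (n + 1 - r)
  split_ifs at * <;> omega

theorem bot_top_last (h : σ.Blocks r s) : (σ.bot.symm (σ.top (Fin.last n)) : ℕ) = n - s := by
  have := h.bot_eq (σ.top (Fin.last n))
  have := h.le
  have := h.le_n
  simp only [Equiv.symm_apply_apply, Fin.val_last] at *
  split_ifs at * <;> omega

theorem bot_top_first (h : σ.Blocks r s) : (σ.bot.symm (σ.top 0) : ℕ) = n + 1 - r := by
  have := h.bot_eq (σ.top 0)
  rw [Equiv.symm_apply_apply, Fin.val_zero, if_pos h.pos] at this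
  omega

theorem top_bot_last (h : σ.Blocks r s) : (σ.top.symm (σ.bot (Fin.last n)) : ℕ) = r - 1 := by
  have := h.swap.bot_top_last
  have h2 := h.le
  have h3 := h.le_n
  change (σ.top.symm (σ.bot (Fin.last n)) : ℕ) = _ at this
  omega

theorem top_bot_first (h : σ.Blocks r s) : (σ.top.symm (σ.bot 0) : ℕ) = s := by
  have := h.swap.bot_top_first
  have h2 := h.le
  have h3 := h.le_n
  change (σ.top.symm (σ.bot 0) : ℕ) = _ at this
  omega

theorem last_ne (h : σ.Blocks r s) : σ.top (Fin.last n) ≠ σ.bot (Fin.last n) := by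
  intro hc
  have h1 := h.top_bot_last
  rw [← hc, Equiv.symm_apply_apply, Fin.val_last] at h1
  have := h.le
  have := h.le_n
  have := h.pos
  omega

theorem first_ne (h : σ.Blocks r s) : σ.top 0 ≠ σ.bot 0 := by
  intro hc
  have h1 := h.top_bot_first
  rw [← hc, Equiv.symm_apply_apply, Fin.val_zero] at h1
  have := h.le
  have := h.pos
  omega

theorem n_pos (h : σ.Blocks r s) : 0 < n := by
  have := h.le
  have := h.le_n
  have := h.pos
  omega

theorem pointIndex_self {i : ℕ} (h0 : 0 < i) (hi : i ≤ n) : pointIndex n r s i = i := by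
  unfold pointIndex
  split_ifs <;> omega

theorem irreducible (h : σ.Blocks r s) : σ.Irreducible := by
  intro k hk hk' hc
  have key : ∀ γ, (σ.top.symm γ : ℕ) < k ↔ (σ.bot.symm γ : ℕ) < k := by
    intro γ
    have := Set.ext_iff.mp hc γ
    simpa [Equiv.image_eq_preimage_symm] using this
  have h1 := key (σ.bot 0)
  have h2 := key (σ.bot (Fin.last n))
  rw [h.top_bot_first, Equiv.symm_apply_apply, Fin.val_zero] at h1
  rw [h.top_bot_last, Equiv.symm_apply_apply, Fin.val_last] at h2
  have := h.le
  omega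

/-- Index of the marked point of a vertex. -/
def vertexIndex (σ : MarkedPerm n 𝒜) (r s : ℕ) : Fin (n + 2) ⊕ Fin (n + 2) → ℕ
  | Sum.inl i => pointIndex n r s i
  | Sum.inr i => if hi : (i : ℕ) < n + 1 then pointIndex n r s (σ.top.symm (σ.bot ⟨i, hi⟩)) else r

theorem vertexIndex_glue (h : σ.Blocks r s) {v w : Fin (n + 2) ⊕ Fin (n + 2)} (hvw : σ.Glue v w) :
    vertexIndex σ r s v = vertexIndex σ r s w := by
  have hle := h.le
  have hn := h.le_n
  have hp := h.pos
  cases hvw with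
  | leftmost =>
    have := h.top_bot_first
    simp only [vertexIndex, Fin.val_zero, Nat.zero_lt_succ]
    change _ = pointIndex n r s (σ.top.symm (σ.bot 0))
    rw [this, pointIndex_self (by omega) hn]
    rfl
  | rightmost =>
    simp [vertexIndex, pointIndex]
  | leftEnd α =>
    simp only [vertexIndex, Fin.val_castSucc, dif_pos (σ.bot.symm α).isLt, Fin.eta,
      Equiv.apply_symm_apply]
  | rightEnd α =>
    have hPα := (σ.top.symm α).isLt
    have hQα := (σ.bot.symm α).isLt
    have hα := h.bot_eq α
    simp only [vertexIndex, Fin.val_succ]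
    split_ifs with hi
    · obtain ⟨β, hβ⟩ : ∃ β, β = σ.bot ⟨(σ.bot.symm α : ℕ) + 1, hi⟩ := ⟨_, rfl⟩
      have hb : (σ.bot.symm β : ℕ) = σ.bot.symm α + 1 := by rw [hβ]; simp
      rw [← hβ]
      have hβ' := h.bot_eq β
      have hPβ := (σ.top.symm β).isLt
      unfold pointIndex
      split_ifs at * <;> omega
    · unfold pointIndex
      split_ifs at * <;> omega

/-- Index of a marked point. -/
def index (h : σ.Blocks r s) : σ.MarkedPoint → ℕ :=
  Quot.lift (vertexIndex σ r s) fun _ _ => h.vertexIndex_glue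

theorem index_leftPoint (h : σ.Blocks r s) (α : 𝒜) :
    h.index (σ.leftPoint α) = pointIndex n r s (σ.top.symm α) := rfl

theorem index_rightPoint (h : σ.Blocks r s) (α : 𝒜) :
    h.index (σ.rightPoint α) = pointIndex n r s (σ.top.symm α + 1) := rfl

theorem index_innerTop (h : σ.Blocks r s) (i : Fin n) : h.index (σ.innerTop i) = i + 1 := by
  change pointIndex n r s (i.castSucc.succ : Fin (n + 2)) = _
  rw [pointIndex_self] <;> simp

theorem innerTop_bijective (h : σ.Blocks r s) : Function.Bijective σ.innerTop := by
  refine ⟨fun i j hij => ?_, innerTop_surjective h.first_ne h.last_ne⟩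
  have := congrArg h.index hij
  rw [index_innerTop, index_innerTop] at this
  exact Fin.ext (by omega)

/-- The marked points, numbered by the inner vertices of the top line. -/
noncomputable def pointEquiv (h : σ.Blocks r s) : Fin n ≃ σ.MarkedPoint :=
  Equiv.ofBijective σ.innerTop h.innerTop_bijective

theorem pointEquiv_eq_iff (h : σ.Blocks r s) (i : Fin n) (v : σ.MarkedPoint) :
    v = h.pointEquiv i ↔ h.index v = i + 1 := by
  obtain ⟨j, rfl⟩ := h.pointEquiv.surjective v
  rw [h.pointEquiv.injective.eq_iff]
  change _ ↔ h.index (σ.innerTop j) = _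
  rw [index_innerTop, Fin.ext_iff]
  omega

theorem genusOne (h : σ.Blocks r s) : σ.GenusOne :=
  ⟨h.irreducible, by rw [← Nat.card_congr h.pointEquiv]; simp⟩

end Blocks

section Step

variable [DecidableEq 𝒜] {σ σ' : MarkedPerm n 𝒜} {r s : ℕ}

theorem Blocks.top_step (h : σ.Blocks r s) (ht : σ'.top = σ.top)
    (hb : MovedAfter σ.bot σ'.bot (σ.bot (Fin.last n)) (σ.top (Fin.last n))) :
    σ'.Blocks (if r = 1 then s else r - 1) s := by
  have hle := h.le
  have hn := h.le_n
  have hp := h.pos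
  refine ⟨by split_ifs <;> omega, by split_ifs <;> omega, hn, fun γ => ?_⟩
  rw [ht, hb γ]
  simp only [Fin.le_def, h.bot_top_last]
  have h1 := h.bot_eq γ
  have h2 := h.top_bot_last
  have h3 := (σ.top.symm γ).isLt
  by_cases hγ : γ = σ.bot (Fin.last n)
  · subst hγ
    rw [if_pos rfl, h2]
    split_ifs <;> omega
  · have h4 : (σ.top.symm γ : ℕ) ≠ r - 1 := fun hc => hγ (Blocks.eq_of_pos (hc.trans h2.symm))
    rw [if_neg hγ]
    split_ifs at h1 <;> split_ifs <;> omega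

end Step

end MarkedPerm

namespace MarkedPerm

variable {n : ℕ} {𝒜 : Type*} {σ : MarkedPerm n 𝒜} {r s : ℕ}

theorem turn_first {k : ℕ} (hk : 0 < k) {c : 𝒜} (hc : σ.bot.symm c = 0) :
    σ.turn k c = FreeGroup.of c := by
  obtain ⟨j, rfl⟩ := Nat.exists_eq_succ_of_ne_zero hk.ne'
  simp [turn, hc]

theorem Blocks.eq_top_bot_first (h : σ.Blocks r s) {i : Fin (n + 1)} (hi : (i : ℕ) = s) :
    σ.top i = σ.bot 0 := by
  rw [← Equiv.eq_symm_apply]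
  exact Fin.ext (hi.trans h.top_bot_first.symm)

theorem Blocks.bot_first_ne_zero (h : σ.Blocks r s) : σ.bot.symm (σ.top 0) ≠ 0 := by
  intro hc
  have := h.bot_top_first
  rw [hc, Fin.val_zero] at this
  have := h.le
  have := h.le_n
  omega

theorem Blocks.loop_circular (h : σ.Blocks s s) : σ.distinguishedLoop =
    FreeGroup.of (σ.bot 0) * (FreeGroup.of (σ.bot (Fin.last n)))⁻¹ *
      (FreeGroup.of (σ.top (Fin.last n)))⁻¹ * FreeGroup.of (σ.top 0) := by
  have hp := h.pos
  have hn := h.le_n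
  have h0 := h.bot_first_ne_zero
  have hb : σ.bot (σ.bot.symm (σ.top 0) - 1) = σ.top (Fin.last n) := by
    rw [← Equiv.eq_symm_apply]
    apply Fin.ext
    rw [Fin.val_sub_one_of_ne_zero h0, h.bot_top_first, h.bot_top_last]
    omega
  have he : σ.top (σ.top.symm (σ.bot (Fin.last n)) + 1) = σ.bot 0 := by
    apply h.eq_top_bot_first
    have := h.top_bot_last
    rw [Fin.val_add_one_of_lt, this]
    · omega
    · rw [Fin.lt_def, this, Fin.val_last]; omega
  unfold distinguishedLoop turn
  simp only [h0, if_false, hb, Equiv.symm_apply_apply, if_true, he]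
  rw [turn_first h.n_pos (by simp)]

theorem Blocks.loop_of_lt (h : σ.Blocks r s) (hrs : r < s) {γ : 𝒜}
    (hγ : (σ.top.symm γ : ℕ) = s - 1) : σ.distinguishedLoop =
    FreeGroup.of (σ.bot 0) * (FreeGroup.of γ)⁻¹ * FreeGroup.of (σ.top 0) := by
  have hp := h.pos
  have hn := h.le_n
  have h0 := h.bot_first_ne_zero
  have hb : σ.bot (σ.bot.symm (σ.top 0) - 1) = γ := by
    rw [← Equiv.eq_symm_apply]
    apply Fin.ext
    rw [Fin.val_sub_one_of_ne_zero h0, h.bot_top_first, h.bot_eq γ, hγ]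
    split_ifs <;> omega
  have hl : σ.top.symm γ ≠ Fin.last n := by
    intro hc
    rw [hc, Fin.val_last] at hγ
    omega
  have he : σ.top (σ.top.symm γ + 1) = σ.bot 0 := by
    apply h.eq_top_bot_first
    rw [Fin.val_add_one_of_lt, hγ]
    · omega
    · rw [Fin.lt_def, hγ, Fin.val_last]; omega
  unfold distinguishedLoop turn
  simp only [h0, if_false, hb, hl, he]
  rw [turn_first h.n_pos (by simp)]

end MarkedPerm

namespace PIET

variable {n : ℕ} {𝒜 : Type*} [Fintype 𝒜]

/-- The product of the matrices of the branches along the distinguished loop. -/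
def loopMatrix (T : PIET n 𝒜) : Matrix.SpecialLinearGroup (Fin 2) ℝ :=
  FreeGroup.lift T.branch T.perm.distinguishedLoop

theorem rep_apply (T : PIET n 𝒜) (w : FreeGroup 𝒜) :
    T.rep w = QuotientGroup.mk (FreeGroup.lift T.branch w) := by
  have : T.rep = (QuotientGroup.mk' _).comp (FreeGroup.lift T.branch) := by
    ext α
    simp [rep]
  rw [this]
  rfl

theorem center_le_upperTriangular :
    Subgroup.center (Matrix.SpecialLinearGroup (Fin 2) ℝ) ≤ upperTriangular := by
  intro z hz
  rw [Matrix.SpecialLinearGroup.mem_center_iff] at hz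
  obtain ⟨c, -, hc⟩ := hz
  change z 1 0 = 0
  rw [← hc]
  simp

theorem mk_mem_affineGroup (g : Matrix.SpecialLinearGroup (Fin 2) ℝ) :
    (QuotientGroup.mk g : Matrix.ProjectiveSpecialLinearGroup (Fin 2) ℝ) ∈ affineGroup ↔
      g 1 0 = 0 := by
  have h := Subgroup.comap_map_eq_self (f := QuotientGroup.mk'
    (Subgroup.center (Matrix.SpecialLinearGroup (Fin 2) ℝ))) (H := upperTriangular)
    (by rw [QuotientGroup.ker_mk']; exact center_le_upperTriangular)
  exact Subgroup.ext_iff.mp h g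

theorem mem_attractingFamily {T : PIET n 𝒜} : T ∈ attractingFamily n 𝒜 ↔
    T.perm.GenusOne ∧ T.lo = 0 ∧ T.hi = 1 ∧ T.loopMatrix 1 0 = 0 := by
  simp only [attractingFamily, Set.mem_iUnion, familyE, familyP, Set.mem_ofPred_eq, exists_prop]
  constructor
  · rintro ⟨σ, h1, h2, h3, h4, h5⟩
    subst h2
    rw [rep_apply, mk_mem_affineGroup] at h5
    exact ⟨h1, h3, h4, h5⟩
  · rintro ⟨h1, h2, h3, h4⟩
    refine ⟨_, h1, rfl, h2, h3, ?_⟩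
    rw [rep_apply, mk_mem_affineGroup]
    exact h4

theorem Same.loopMatrix {T S : PIET n 𝒜} (h : Same T S) :
    S.loopMatrix = T.loopMatrix ∨ S.loopMatrix = -T.loopMatrix := by
  unfold PIET.loopMatrix
  rw [h.perm]
  induction T.perm.distinguishedLoop using FreeGroup.induction_on with
  | C1 => simp
  | of α => simpa using h.branch α
  | inv_of α _ =>
    simp only [map_inv, FreeGroup.lift_apply_of]
    rcases h.branch α with h | h
    · left; rw [h]
    · right; rw [h, inv_eq_iff_mul_eq_one, neg_mul_neg, mul_inv_cancel]
  | mul x y hx hy =>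
    simp only [map_mul]
    rcases hx with hx | hx <;> rcases hy with hy | hy <;> simp [hx, hy]

theorem inv_loopMatrix {T : PIET n 𝒜} (h : T.perm.GenusOne) :
    T.inv.loopMatrix = T.loopMatrix⁻¹ := by
  obtain ⟨r, s, hb⟩ := h.exists_blocks
  unfold loopMatrix
  have hle := hb.le
  have hn := hb.le_n
  rcases hle.eq_or_lt with hrs | hrs
  · subst hrs
    rw [hb.loop_circular, inv_perm, hb.swap.loop_circular]
    simp [inv, MarkedPerm.swap, mul_assoc]
  · obtain ⟨γ, hγ⟩ : ∃ γ, (T.perm.top.symm γ : ℕ) = s - 1 :=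
      ⟨T.perm.top ⟨s - 1, by omega⟩, by simp⟩
    have hγ' : (T.perm.swap.top.symm γ : ℕ) = n + 1 - r - 1 := by
      have := hb.bot_eq γ
      change (T.perm.bot.symm γ : ℕ) = _
      rw [this, hγ]
      split_ifs <;> omega
    rw [hb.loop_of_lt hrs hγ, inv_perm, hb.swap.loop_of_lt (by omega) hγ']
    simp [inv, MarkedPerm.swap, mul_assoc]

variable [DecidableEq 𝒜]

/-- Conjugation by an affine map as a homomorphism. -/
noncomputable def rescaleHom (a ℓ : ℝ) (hℓ : 0 < ℓ) :
    Matrix.SpecialLinearGroup (Fin 2) ℝ →* Matrix.SpecialLinearGroup (Fin 2) ℝ :=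
  (MulAut.conj (affineSL a ℓ hℓ)⁻¹).toMonoidHom

theorem rescaleHom_apply (a ℓ : ℝ) (hℓ : 0 < ℓ) (g : Matrix.SpecialLinearGroup (Fin 2) ℝ) :
    rescaleHom a ℓ hℓ g = rescale a ℓ hℓ g := by
  simp [rescaleHom, rescale, mul_assoc]

theorem topStep_lift {T : PIET n 𝒜} (h : T.TopWins) (w : FreeGroup 𝒜) :
    FreeGroup.lift (T.topStep h).branch w =
      rescale T.lo (T.cutBot - T.lo) h.pos (FreeGroup.lift T.topStepBranch w) := by
  have : FreeGroup.lift (T.topStep h).branch =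
      (rescaleHom T.lo (T.cutBot - T.lo) h.pos).comp (FreeGroup.lift T.topStepBranch) := by
    ext1 α
    simp [rescaleHom_apply, topStep_branch]
  rw [this, MonoidHom.comp_apply, rescaleHom_apply]

theorem topStep_blocks {T : PIET n 𝒜} (h : T.TopWins) {r s : ℕ} (hb : T.perm.Blocks r s) :
    (T.topStep h).perm.Blocks (if r = 1 then s else r - 1) s :=
  hb.top_step rfl (topStep_movedAfter h)

theorem topStep_loopMatrix {T : PIET n 𝒜} (h : T.TopWins) (hg : T.perm.GenusOne) :
    (T.topStep h).loopMatrix = rescale T.lo (T.cutBot - T.lo) h.pos T.loopMatrix := by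
  obtain ⟨r, s, hb⟩ := hg.exists_blocks
  have hle := hb.le
  have hn := hb.le_n
  have hp := hb.pos
  unfold loopMatrix
  rw [topStep_lift]
  congr 1
  have hb' := topStep_blocks h hb
  have htop : (T.topStep h).perm.top = T.perm.top := rfl
  have hfirst : (T.topStep h).perm.bot 0 = T.perm.bot 0 := by
    have h1 := hb'.top_bot_first
    rw [htop, ← hb.top_bot_first] at h1
    exact MarkedPerm.Blocks.eq_of_pos h1
  have hbr : ∀ γ, γ ≠ T.perm.bot (Fin.last n) → T.topStepBranch γ = T.branch γ := by
    intro γ hγ; unfold topStepBranch; rw [if_neg hγ]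
  have hbl : T.topStepBranch (T.perm.bot (Fin.last n)) =
      T.branch (T.perm.top (Fin.last n)) * T.branch (T.perm.bot (Fin.last n)) := by
    unfold topStepBranch; rw [if_pos rfl]
  have hposl := hb.top_bot_last
  have hb0 := hbr (T.perm.bot 0) (by
    intro hc
    have := hb.top_bot_first
    rw [hc, hposl] at this
    omega)
  have htl := hbr _ h.ne
  obtain ⟨γ, hγ⟩ : ∃ γ, (T.perm.top.symm γ : ℕ) = s - 1 :=
    ⟨T.perm.top ⟨s - 1, by omega⟩, by simp⟩
  by_cases hr : r = 1
  · subst hr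
    rw [if_pos rfl] at hb'
    have h0 : T.perm.top 0 = T.perm.bot (Fin.last n) :=
      MarkedPerm.Blocks.eq_of_pos (by rw [hposl]; simp)
    rw [hb'.loop_circular, hfirst, htop]
    have hl' : (T.topStep h).perm.bot (Fin.last n) = γ :=
      MarkedPerm.Blocks.eq_of_pos (σ := T.perm) (hb'.top_bot_last.trans hγ.symm)
    rw [hl']
    rcases hle.eq_or_lt with hrs | hrs
    · subst hrs
      have hγb : γ = T.perm.bot (Fin.last n) :=
        MarkedPerm.Blocks.eq_of_pos (hγ.trans hposl.symm)
      rw [hb.loop_circular, hγb, h0]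
      simp [hbl, htl, hb0, mul_assoc]
    · have hγb := hbr γ (by rintro rfl; omega)
      rw [hb.loop_of_lt hrs hγ, h0]
      simp [hbl, htl, hb0, hγb, mul_assoc]
  · rw [if_neg hr] at hb'
    have ht0 := hbr (T.perm.top 0) (by
      intro hc
      rw [← hc, Equiv.symm_apply_apply, Fin.val_zero] at hposl
      omega)
    rw [hb'.loop_of_lt (by omega) (γ := γ) hγ, hfirst, htop]
    rcases hle.eq_or_lt with hrs | hrs
    · subst hrs
      have hγb : γ = T.perm.bot (Fin.last n) :=
        MarkedPerm.Blocks.eq_of_pos (hγ.trans hposl.symm)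
      rw [hb.loop_circular, hγb]
      simp [hbl, ht0, hb0, mul_assoc]
    · have hγb := hbr γ (by rintro rfl; omega)
      rw [hb.loop_of_lt hrs hγ]
      simp [ht0, hb0, hγb]

theorem sl2_mul_apply (g h : Matrix.SpecialLinearGroup (Fin 2) ℝ) (i j : Fin 2) :
    (g * h) i j = g i 0 * h 0 j + g i 1 * h 1 j := by
  rw [Matrix.SpecialLinearGroup.coe_mul, Matrix.mul_apply, Fin.sum_univ_two]

theorem rescale_apply_one_zero (a ℓ : ℝ) (hℓ : 0 < ℓ) (g : Matrix.SpecialLinearGroup (Fin 2) ℝ) :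
    rescale a ℓ hℓ g 1 0 = ℓ * g 1 0 := by
  have h2 := Real.mul_self_sqrt hℓ.le
  rw [rescale, sl2_mul_apply, sl2_mul_apply, sl2_mul_apply,
    Matrix.SpecialLinearGroup.SL2_inv_expl]
  simp [affineSL]
  linear_combination (g 1 0) * h2

theorem rescale_zero_apply_zero_zero (ℓ : ℝ) (hℓ : 0 < ℓ)
    (g : Matrix.SpecialLinearGroup (Fin 2) ℝ) : rescale 0 ℓ hℓ g 0 0 = g 0 0 := by
  have h2 := (Real.sqrt_pos.mpr hℓ).ne'
  rw [rescale, sl2_mul_apply, sl2_mul_apply, sl2_mul_apply,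
    Matrix.SpecialLinearGroup.SL2_inv_expl]
  simp [affineSL]
  field_simp

theorem rescale_inv (a ℓ : ℝ) (hℓ : 0 < ℓ) (g : Matrix.SpecialLinearGroup (Fin 2) ℝ) :
    rescale a ℓ hℓ g⁻¹ = (rescale a ℓ hℓ g)⁻¹ := by
  rw [← rescaleHom_apply, map_inv, rescaleHom_apply]

theorem RauzyStep.topStep_or {T T' : PIET n 𝒜} (h : RauzyStep T T') :
    (∃ h' : T.TopWins, Same (T.topStep h') T') ∨
      ∃ h' : T.inv.TopWins, Same (T.inv.topStep h') T'.inv := by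
  rcases lt_or_gt_of_ne h.cut_ne with h1 | h1
  · exact Or.inl ⟨h.topWins h1, h.same_topStep _⟩
  · exact Or.inr ⟨h.inv.topWins h1, h.inv.same_topStep _⟩

theorem RauzyStep.genusOne {T T' : PIET n 𝒜} (h : RauzyStep T T') (hg : T.perm.GenusOne) :
    T'.perm.GenusOne := by
  rcases h.topStep_or with ⟨h1, h2⟩ | ⟨h1, h2⟩
  · obtain ⟨r, s, hb⟩ := hg.exists_blocks
    rw [h2.perm]
    exact (topStep_blocks h1 hb).genusOne
  · obtain ⟨r, s, hb⟩ := hg.swap.exists_blocks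
    have := (topStep_blocks (T := T.inv) h1 hb).genusOne.swap
    rw [← h2.perm] at this
    exact this

/-- The matrix of the distinguished loop is only conjugated by the rescaling. -/
theorem RauzyStep.loopMatrix {T T' : PIET n 𝒜} (h : RauzyStep T T') (hg : T.perm.GenusOne) :
    T'.loopMatrix = rescale T.lo (T.cut - T.lo) (cut_sub_lo_pos h.cut_ne) T.loopMatrix ∨
    T'.loopMatrix = -rescale T.lo (T.cut - T.lo) (cut_sub_lo_pos h.cut_ne) T.loopMatrix := by
  have hcut := cut_sub_lo_pos h.cut_ne
  rcases h.topStep_or with ⟨h1, h2⟩ | ⟨h1, h2⟩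
  · have := h2.loopMatrix
    rw [topStep_loopMatrix h1 hg] at this
    convert this using 3
    all_goals first | rw [cut_of_topWins h1] | skip
    all_goals congr 1; rw [cut_of_topWins h1]
  · have := h2.inv.loopMatrix
    rw [inv_inv, inv_loopMatrix, topStep_loopMatrix h1 hg.swap, inv_loopMatrix hg, rescale_inv,
      _root_.inv_inv] at this
    · have e : T.inv.cutBot = T.cut := by rw [← cut_of_topWins h1, inv_cut]
      simp only [e] at this
      exact this
    · obtain ⟨r, s, hb⟩ := hg.swap.exists_blocks
      exact (topStep_blocks (T := T.inv) h1 hb).genusOne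

/-- The attracting family is invariant under Rauzy induction. -/
theorem RauzyStep.mem_attractingFamily {T T' : PIET n 𝒜} (h : RauzyStep T T')
    (hT : T ∈ attractingFamily n 𝒜) : T' ∈ attractingFamily n 𝒜 := by
  rw [PIET.mem_attractingFamily] at hT ⊢
  obtain ⟨h1, h2, h3, h4⟩ := hT
  refine ⟨h.genusOne h1, h.lo_eq, h.hi_eq, ?_⟩
  rcases h.loopMatrix h1 with h5 | h5
  · rw [h5, rescale_apply_one_zero, h4, mul_zero]
  · rw [h5]
    simp only [Matrix.SpecialLinearGroup.coe_neg, Matrix.neg_apply]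
    rw [rescale_apply_one_zero, h4, mul_zero, neg_zero]

theorem attractingFamily_invariant (T : PIET n 𝒜) (hT : T ∈ attractingFamily n 𝒜)
    (h : T.cutTop ≠ T.cutBot) : (∃ T' : PIET n 𝒜, RauzyStep T T') ∧
      ∀ T' : PIET n 𝒜, RauzyStep T T' → T' ∈ attractingFamily n 𝒜 := by
  refine ⟨?_, fun T' h' => h'.mem_attractingFamily hT⟩
  obtain ⟨r, s, hb⟩ := (PIET.mem_attractingFamily.mp hT).1.exists_blocks
  exact exists_rauzyStep h hb.last_ne

end PIET

/-! ### Logarithms of derivatives -/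

/-- The logarithm of the derivative of a Möbius map. -/
noncomputable def lderiv (g : Matrix.SpecialLinearGroup (Fin 2) ℝ) (x : ℝ) : ℝ :=
  -2 * Real.log (moebiusDen g x)

theorem deriv_eq_exp_lderiv (g : Matrix.SpecialLinearGroup (Fin 2) ℝ) {x : ℝ}
    (hx : moebiusDen g x ≠ 0) : deriv (moebius g) x = Real.exp (lderiv g x) := by
  rw [deriv_moebius g hx, lderiv, show -2 * Real.log (moebiusDen g x) =
    -(Real.log (moebiusDen g x ^ 2)) by rw [Real.log_pow]; push_cast; ring, Real.exp_neg,
    Real.exp_log (by positivity), one_div]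

theorem lderiv_mul (g h : Matrix.SpecialLinearGroup (Fin 2) ℝ) {x : ℝ}
    (hx : moebiusDen h x ≠ 0) (hx' : moebiusDen g (moebius h x) ≠ 0) :
    lderiv (g * h) x = lderiv g (moebius h x) + lderiv h x := by
  unfold lderiv
  rw [moebiusDen_mul _ _ hx, Real.log_mul hx' hx]
  ring

theorem lderiv_neg (g : Matrix.SpecialLinearGroup (Fin 2) ℝ) (x : ℝ) :
    lderiv (-g) x = lderiv g x := by
  unfold lderiv
  rw [moebiusDen_neg, Real.log_neg_eq_log]

theorem lderiv_inv_apply (g : Matrix.SpecialLinearGroup (Fin 2) ℝ) {x : ℝ}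
    (hx : moebiusDen g x ≠ 0) : lderiv g⁻¹ (moebius g x) = -lderiv g x := by
  unfold lderiv
  rw [moebiusDen_inv_apply _ hx, one_div, Real.log_inv]
  ring

theorem lderiv_rescale {a ℓ : ℝ} (hℓ : 0 < ℓ) (g : Matrix.SpecialLinearGroup (Fin 2) ℝ) {y : ℝ}
    (hy : moebiusDen g (a + ℓ * y) ≠ 0) :
    lderiv (rescale a ℓ hℓ g) y = lderiv g (a + ℓ * y) := by
  unfold lderiv
  rw [moebiusDen_rescale _ _ hy]

/-- Without pole on an interval, the logarithm of the derivative is monotone or antitone. -/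
theorem lderiv_monotone_or_antitone (g : Matrix.SpecialLinearGroup (Fin 2) ℝ) {l r : ℝ}
    (h : ∀ x ∈ Set.Icc l r, moebiusDen g x ≠ 0) :
    MonotoneOn (lderiv g) (Set.Icc l r) ∨ AntitoneOn (lderiv g) (Set.Icc l r) := by
  rcases Set.eq_empty_or_nonempty (Set.Icc l r) with he | ⟨z, hz⟩
  · rw [he]; left; intro x hx; simp at hx
  have key : ∀ x ∈ Set.Icc l r, lderiv g x = -2 * Real.log (moebiusDen g z * moebiusDen g x) +
      2 * Real.log (moebiusDen g z) := by
    intro x hx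
    rw [lderiv, Real.log_mul (h z hz) (h x hx)]; ring
  have hp : ∀ x ∈ Set.Icc l r, 0 < moebiusDen g z * moebiusDen g x :=
    fun x hx => moebiusDen_mul_pos g h hz hx
  have hd : ∀ x y, moebiusDen g z * moebiusDen g y = moebiusDen g z * moebiusDen g x +
      moebiusDen g z * g 1 0 * (y - x) := by
    intro x y; unfold moebiusDen; ring
  rcases le_total 0 (moebiusDen g z * g 1 0) with hc | hc
  · right
    intro x hx y hy hxy
    rw [key x hx, key y hy]
    have := Real.log_le_log (hp x hx) (by
      rw [hd x y]; nlinarith [mul_nonneg hc (sub_nonneg.mpr hxy)] :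
      moebiusDen g z * moebiusDen g x ≤ moebiusDen g z * moebiusDen g y)
    linarith
  · left
    intro x hx y hy hxy
    rw [key x hx, key y hy]
    have := Real.log_le_log (hp y hy) (by
      rw [hd x y]; nlinarith [mul_nonneg (neg_nonneg.mpr hc) (sub_nonneg.mpr hxy)] :
      moebiusDen g z * moebiusDen g y ≤ moebiusDen g z * moebiusDen g x)
    linarith

theorem abs_lderiv_add {g : Matrix.SpecialLinearGroup (Fin 2) ℝ} {l r : ℝ}
    (h : ∀ x ∈ Set.Icc l r, moebiusDen g x ≠ 0) {x y : ℝ} (hx : l ≤ x) (hxy : x ≤ y) (hy : y ≤ r) :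
    |lderiv g x - lderiv g l| + |lderiv g y - lderiv g x| = |lderiv g y - lderiv g l| := by
  have hl : l ∈ Set.Icc l r := ⟨le_rfl, by linarith⟩
  have hx' : x ∈ Set.Icc l r := ⟨hx, by linarith⟩
  have hy' : y ∈ Set.Icc l r := ⟨by linarith, hy⟩
  rcases lderiv_monotone_or_antitone g h with hm | hm
  · have h1 := hm hl hx' hx
    have h2 := hm hx' hy' hxy
    rw [abs_of_nonneg (by linarith), abs_of_nonneg (by linarith), abs_of_nonneg (by linarith)]
    ring
  · have h1 := hm hl hx' hx
    have h2 := hm hx' hy' hxy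
    rw [abs_of_nonpos (by linarith), abs_of_nonpos (by linarith), abs_of_nonpos (by linarith)]
    ring

namespace PIET

variable {n : ℕ} {𝒜 : Type*} [Fintype 𝒜]

/-- Logarithm of the derivative at the left end of a top interval. -/
noncomputable def dL (T : PIET n 𝒜) (γ : 𝒜) : ℝ := lderiv (T.branch γ) (T.topLeft γ)

/-- Logarithm of the derivative at the right end of a top interval. -/
noncomputable def dR (T : PIET n 𝒜) (γ : 𝒜) : ℝ := lderiv (T.branch γ) (T.topRight γ)

/-- The mean non-linearity of a branch. -/
noncomputable def nonlin (T : PIET n 𝒜) (γ : 𝒜) : ℝ := T.dR γ - T.dL γ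

/-- The total non-linearity. -/
noncomputable def totalNonlin (T : PIET n 𝒜) : ℝ := ∑ γ, |T.nonlin γ|

theorem inv_dL (T : PIET n 𝒜) (γ : 𝒜) : T.inv.dL γ = -T.dL γ := by
  unfold dL
  rw [inv_topLeft, ← branch_left]
  exact lderiv_inv_apply _ (T.den_ne (T.left_mem γ))

theorem inv_dR (T : PIET n 𝒜) (γ : 𝒜) : T.inv.dR γ = -T.dR γ := by
  unfold dR
  rw [inv_topRight, ← branch_right]
  exact lderiv_inv_apply _ (T.den_ne (T.right_mem γ))

theorem inv_nonlin (T : PIET n 𝒜) (γ : 𝒜) : T.inv.nonlin γ = -T.nonlin γ := by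
  unfold nonlin; rw [inv_dL, inv_dR]; ring

theorem inv_totalNonlin (T : PIET n 𝒜) : T.inv.totalNonlin = T.totalNonlin := by
  unfold totalNonlin; simp only [inv_nonlin, abs_neg]

theorem Same.dL {T S : PIET n 𝒜} (h : Same T S) (γ : 𝒜) : S.dL γ = T.dL γ := by
  unfold PIET.dL
  rw [h.topLeft]
  rcases h.branch γ with h | h <;> rw [h]
  rw [lderiv_neg]

theorem Same.dR {T S : PIET n 𝒜} (h : Same T S) (γ : 𝒜) : S.dR γ = T.dR γ := by
  unfold PIET.dR
  rw [h.topRight]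
  rcases h.branch γ with h | h <;> rw [h]
  rw [lderiv_neg]

theorem Same.nonlin {T S : PIET n 𝒜} (h : Same T S) (γ : 𝒜) : S.nonlin γ = T.nonlin γ := by
  unfold PIET.nonlin; rw [h.dL, h.dR]

theorem Same.totalNonlin {T S : PIET n 𝒜} (h : Same T S) : S.totalNonlin = T.totalNonlin := by
  unfold PIET.totalNonlin; simp only [h.nonlin]

/-- Logarithm of the size of the break at the marked point of index `i`. -/
noncomputable def logBreak (T : PIET n 𝒜) (r s i : ℕ) : ℝ :=
  ∑ γ, ((if MarkedPerm.pointIndex n r s (T.perm.top.symm γ) = i then T.dL γ else 0) -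
    if MarkedPerm.pointIndex n r s (T.perm.top.symm γ + 1) = i then T.dR γ else 0)

theorem Same.logBreak {T S : PIET n 𝒜} (h : Same T S) (r s i : ℕ) :
    S.logBreak r s i = T.logBreak r s i := by
  unfold PIET.logBreak; simp only [h.dL, h.dR, h.perm]

theorem deriv_left (T : PIET n 𝒜) (γ : 𝒜) :
    deriv (moebius (T.branch γ)) (T.topLeft γ) = Real.exp (T.dL γ) :=
  deriv_eq_exp_lderiv _ (T.den_ne (T.left_mem γ))

theorem deriv_right (T : PIET n 𝒜) (γ : 𝒜) :
    deriv (moebius (T.branch γ)) (T.topRight γ) = Real.exp (T.dR γ) :=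
  deriv_eq_exp_lderiv _ (T.den_ne (T.right_mem γ))

open Classical in
theorem breakSize_eq_exp (T : PIET n 𝒜) (v : T.perm.MarkedPoint) :
    T.breakSize v = Real.exp (∑ γ, ((if T.perm.leftPoint γ = v then T.dL γ else 0) -
      if T.perm.rightPoint γ = v then T.dR γ else 0)) := by
  unfold breakSize
  simp only [deriv_left, deriv_right]
  rw [Finset.sum_sub_distrib, Real.exp_sub, ← Finset.sum_filter, ← Finset.sum_filter,
    Real.exp_sum, Real.exp_sum]

theorem breakSize_pointEquiv (T : PIET n 𝒜) {r s : ℕ} (hb : T.perm.Blocks r s) (i : Fin n) :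
    T.breakSize (hb.pointEquiv i) = Real.exp (T.logBreak r s (i + 1)) := by
  rw [breakSize_eq_exp]
  unfold logBreak
  simp only [hb.pointEquiv_eq_iff, hb.index_leftPoint, hb.index_rightPoint]

/-- The marked points of the inverse map. -/
def invPoint (T : PIET n 𝒜) : T.perm.MarkedPoint ≃ T.inv.perm.MarkedPoint := T.perm.swapPoint

open Classical in
theorem inv_breakSize (T : PIET n 𝒜) (v : T.perm.MarkedPoint) :
    T.inv.breakSize (T.invPoint v) = (T.breakSize v)⁻¹ := by
  rw [breakSize_eq_exp, breakSize_eq_exp, ← Real.exp_neg, ← Finset.sum_neg_distrib]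
  congr 1
  refine Finset.sum_congr rfl fun γ _ => ?_
  have e1 : T.invPoint (T.perm.leftPoint γ) = T.inv.perm.leftPoint γ :=
    T.perm.swapPoint_leftPoint γ
  have e2 : T.invPoint (T.perm.rightPoint γ) = T.inv.perm.rightPoint γ :=
    T.perm.swapPoint_rightPoint γ
  have e3 : ∀ w, T.invPoint w = T.invPoint v ↔ w = v := fun w => T.invPoint.injective.eq_iff
  rw [← e1, ← e2]
  have e4 : ∀ w x, (if T.invPoint w = T.invPoint v then -x else (0 : ℝ)) =
      -(if w = v then x else 0) := by
    intro w x
    by_cases hw : w = v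
    · rw [if_pos hw, if_pos (congrArg _ hw)]
    · rw [if_neg hw, if_neg fun hc => hw ((e3 w).mp hc), neg_zero]
  rw [inv_dL, inv_dR, e4, e4]
  ring

theorem HasBreaks.inv {T : PIET n 𝒜} {c : Fin n → ℝ} (h : T.HasBreaks c) :
    T.inv.HasBreaks fun i => (c i)⁻¹ := by
  obtain ⟨e, he⟩ := h
  refine ⟨e.trans T.invPoint, fun i => ?_⟩
  rw [Equiv.trans_apply, inv_breakSize, he]

theorem HasBreaks.congr {T S : PIET n 𝒜} {c : Fin n → ℝ} {r s r' s' : ℕ} (h : T.HasBreaks c)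
    (hT : T.perm.Blocks r s) (hS : S.perm.Blocks r' s')
    (hTS : ∀ i, 0 < i → i ≤ n → S.logBreak r' s' i = T.logBreak r s i) : S.HasBreaks c := by
  obtain ⟨e, he⟩ := h
  refine ⟨(e.trans hT.pointEquiv.symm).trans hS.pointEquiv, fun i => ?_⟩
  obtain ⟨j, hj⟩ := hT.pointEquiv.surjective (e i)
  simp only [Equiv.trans_apply, ← hj, Equiv.symm_apply_apply]
  rw [breakSize_pointEquiv, hTS _ (by omega) (by omega), ← breakSize_pointEquiv T hT, hj, he]

theorem HasBreaks.sum_abs {T : PIET n 𝒜} {c : Fin n → ℝ} {r s : ℕ} (h : T.HasBreaks c)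
    (hT : T.perm.Blocks r s) :
    ∑ i : Fin n, |T.logBreak r s (i + 1)| = ∑ i, |Real.log (c i)| := by
  obtain ⟨e, he⟩ := h
  rw [← Equiv.sum_comp (e.trans hT.pointEquiv.symm)]
  refine Finset.sum_congr rfl fun i _ => ?_
  obtain ⟨j, hj⟩ := hT.pointEquiv.surjective (e i)
  simp only [Equiv.trans_apply, ← hj, Equiv.symm_apply_apply]
  rw [← he, ← hj, breakSize_pointEquiv, Real.log_exp]

variable [DecidableEq 𝒜]

section topStep

variable {T : PIET n 𝒜} (h : T.TopWins)

theorem topStep_lderiv {γ : 𝒜} {y : ℝ}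
    (hy : y ∈ Set.Icc ((T.topStep h).topLeft γ) ((T.topStep h).topRight γ)) :
    lderiv ((T.topStep h).branch γ) y =
      lderiv (T.topStepBranch γ) (T.lo + (T.cutBot - T.lo) * y) := by
  rw [topStep_branch, lderiv_rescale h.pos _ (topStepBranch_spec h (topStep_mem_Icc h hy)).1]

theorem topStepBranch_lderiv (h : T.TopWins) {γ : 𝒜} {x : ℝ}
    (hx : x ∈ Set.Icc (T.topLeft γ) (T.topStepRight γ)) :
    lderiv (T.topStepBranch γ) x = lderiv (T.branch γ) x +
      if γ = T.perm.bot (Fin.last n) then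
        lderiv (T.branch (T.perm.top (Fin.last n))) (moebius (T.branch γ) x) else 0 := by
  have hx' : x ∈ Set.Icc (T.topLeft γ) (T.topRight γ) :=
    ⟨hx.1, hx.2.trans (topStepRight_mem h γ).2⟩
  unfold topStepBranch
  split_ifs with h1
  · have h2 := T.branch_mem_Icc hx'
    rw [lderiv_mul _ _ (T.den_ne hx') (T.den_ne (h.bot_sub_top (h1 ▸ h2))), add_comm]
  · rw [add_zero]

theorem topStep_dL (γ : 𝒜) : (T.topStep h).dL γ = T.dL γ +
    if γ = T.perm.bot (Fin.last n) then
      lderiv (T.branch (T.perm.top (Fin.last n))) T.cutBot else 0 := by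
  unfold dL
  rw [topStep_lderiv h ((T.topStep h).left_mem γ), topStep_lo_add_left,
    topStepBranch_lderiv h ⟨le_rfl, (topStepRight_mem h γ).1.le⟩]
  congr 1
  split_ifs with h1
  · rw [branch_left, h1]; rfl
  · rfl

theorem topStep_dR (γ : 𝒜) : (T.topStep h).dR γ =
    if γ = T.perm.top (Fin.last n) then
      lderiv (T.branch (T.perm.top (Fin.last n))) T.cutBot
    else T.dR γ + if γ = T.perm.bot (Fin.last n) then T.dR (T.perm.top (Fin.last n)) else 0 := by
  unfold dR
  rw [topStep_lderiv h ((T.topStep h).right_mem γ), topStep_lo_add_right,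
    topStepBranch_lderiv h ⟨(topStepRight_mem h γ).1.le, le_rfl⟩]
  unfold topStepRight
  split_ifs with h1 h2 h3
  · exact absurd (h1.symm.trans h2) h.ne
  · rw [h1, add_zero]
  · rw [branch_right, h3, T.botRight_last, T.topRight_last]
  · rfl

theorem topStep_nonlin_winner (h : T.TopWins) :
    (T.topStep h).nonlin (T.perm.top (Fin.last n)) =
      lderiv (T.branch (T.perm.top (Fin.last n))) T.cutBot - T.dL (T.perm.top (Fin.last n)) := by
  unfold nonlin
  rw [topStep_dL, topStep_dR, if_pos rfl, if_neg h.ne, add_zero]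

theorem topStep_nonlin_loser (h : T.TopWins) :
    (T.topStep h).nonlin (T.perm.bot (Fin.last n)) = T.nonlin (T.perm.bot (Fin.last n)) +
      (T.dR (T.perm.top (Fin.last n)) -
        lderiv (T.branch (T.perm.top (Fin.last n))) T.cutBot) := by
  unfold nonlin
  rw [topStep_dL, topStep_dR, if_pos rfl, if_pos rfl, if_neg h.ne.symm]
  ring

theorem topStep_nonlin_other (h : T.TopWins) {γ : 𝒜} (h1 : γ ≠ T.perm.top (Fin.last n))
    (h2 : γ ≠ T.perm.bot (Fin.last n)) : (T.topStep h).nonlin γ = T.nonlin γ := by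
  unfold nonlin
  rw [topStep_dL, topStep_dR, if_neg h1, if_neg h2, if_neg h2, add_zero, add_zero]

theorem topStep_sum_nonlin (h : T.TopWins) : ∑ γ, (T.topStep h).nonlin γ = ∑ γ, T.nonlin γ := by
  rw [← sub_eq_zero, ← Finset.sum_sub_distrib,
    Fintype.sum_eq_add (T.perm.top (Fin.last n)) (T.perm.bot (Fin.last n)) h.ne
      (fun γ hγ => by rw [topStep_nonlin_other h hγ.1 hγ.2, sub_self]),
    topStep_nonlin_winner, topStep_nonlin_loser]
  unfold nonlin
  ring

theorem topStep_totalNonlin_le (h : T.TopWins) : (T.topStep h).totalNonlin ≤ T.totalNonlin := by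
  unfold totalNonlin
  rw [← sub_nonpos, ← Finset.sum_sub_distrib,
    Fintype.sum_eq_add (T.perm.top (Fin.last n)) (T.perm.bot (Fin.last n)) h.ne
      (fun γ hγ => by rw [topStep_nonlin_other h hγ.1 hγ.2, sub_self]),
    topStep_nonlin_winner, topStep_nonlin_loser]
  have h1 := abs_lderiv_add (fun x hx => T.den_ne hx) h.cutBot_mem.1.le h.cutBot_mem.2.le le_rfl
  have h2 := abs_add_le (T.nonlin (T.perm.bot (Fin.last n)))
    (T.dR (T.perm.top (Fin.last n)) - lderiv (T.branch (T.perm.top (Fin.last n))) T.cutBot)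
  have h3 : |T.nonlin (T.perm.top (Fin.last n))| =
    |lderiv (T.branch (T.perm.top (Fin.last n))) (T.topRight (T.perm.top (Fin.last n))) -
      lderiv (T.branch (T.perm.top (Fin.last n))) (T.topLeft (T.perm.top (Fin.last n)))| := rfl
  rw [h3, ← h1]
  unfold dL dR at *
  linarith

theorem topStep_logBreak {r s : ℕ} (hb : T.perm.Blocks r s) {i : ℕ} :
    (T.topStep h).logBreak (if r = 1 then s else r - 1) s i = T.logBreak r s i := by
  have hle := hb.le
  have hn := hb.le_n
  have hp := hb.pos
  unfold logBreak
  rw [topStep_top]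
  have hlast : ∀ γ, γ ≠ T.perm.top (Fin.last n) → (T.perm.top.symm γ : ℕ) < n := by
    intro γ hγ
    have h1 := (T.perm.top.symm γ).isLt
    have h2 : (T.perm.top.symm γ : ℕ) ≠ n := fun hc => hγ (by
      have : T.perm.top.symm γ = Fin.last n := Fin.ext hc
      exact (Equiv.symm_apply_eq _).mp this)
    omega
  have hpl : ∀ r' k, k ≤ n → MarkedPerm.pointIndex n r' s k = MarkedPerm.pointIndex n r s k := by
    intro r' k hk
    unfold MarkedPerm.pointIndex
    split_ifs <;> omega
  rw [← sub_eq_zero, ← Finset.sum_sub_distrib,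
    Fintype.sum_eq_add (T.perm.top (Fin.last n)) (T.perm.bot (Fin.last n)) h.ne]
  · have e1 : (T.perm.top.symm (T.perm.top (Fin.last n)) : ℕ) = n := by simp
    rw [topStep_dL, topStep_dR, topStep_dL, topStep_dR, if_neg h.ne, if_pos rfl, if_pos rfl,
      if_neg h.ne.symm, if_pos rfl, e1, hb.top_bot_last, hpl _ n le_rfl, hpl _ (r - 1) (by omega),
      hpl _ (r - 1 + 1) (by omega)]
    have e2 : MarkedPerm.pointIndex n (if r = 1 then s else r - 1) s (n + 1) =
        MarkedPerm.pointIndex n r s (r - 1) := by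
      have h1 : r - 1 ≠ n + 1 := by omega
      simp only [MarkedPerm.pointIndex, Nat.succ_ne_zero, if_false, if_true, if_neg h1]
      by_cases hr : r = 1
      · simp [hr]
      · rw [if_neg hr, if_neg (by omega)]
    have e3 : MarkedPerm.pointIndex n r s (n + 1) = r := by simp [MarkedPerm.pointIndex]
    have e4 : MarkedPerm.pointIndex n r s (r - 1 + 1) = r := by
      rw [Nat.sub_add_cancel hp, MarkedPerm.Blocks.pointIndex_self hp (by omega)]
    rw [e2, e3, e4]
    split_ifs <;> ring_nf
  · intro γ hγ
    have h1 := hlast γ hγ.1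
    rw [topStep_dL, topStep_dR, if_neg hγ.2, if_neg hγ.1, if_neg hγ.2, hpl _ _ h1.le,
      hpl _ (_ + 1) (Nat.succ_le_of_lt h1)]
    ring

end topStep

theorem RauzyStep.sum_nonlin {T T' : PIET n 𝒜} (h : RauzyStep T T') :
    ∑ γ, T'.nonlin γ = ∑ γ, T.nonlin γ := by
  rcases h.topStep_or with ⟨h1, h2⟩ | ⟨h1, h2⟩
  · rw [← topStep_sum_nonlin h1]
    simp only [h2.nonlin]
  · have := topStep_sum_nonlin h1
    have h3 := fun γ => h2.nonlin γ
    simp only [inv_nonlin] at this h3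
    rw [← neg_inj, ← Finset.sum_neg_distrib, ← Finset.sum_neg_distrib, ← this]
    exact Finset.sum_congr rfl fun γ _ => h3 γ

theorem RauzyStep.totalNonlin_le {T T' : PIET n 𝒜} (h : RauzyStep T T') :
    T'.totalNonlin ≤ T.totalNonlin := by
  rcases h.topStep_or with ⟨h1, h2⟩ | ⟨h1, h2⟩
  · rw [h2.totalNonlin]; exact topStep_totalNonlin_le h1
  · rw [← inv_totalNonlin, ← inv_totalNonlin T, h2.totalNonlin]
    exact topStep_totalNonlin_le h1

theorem HasBreaks.topStep {T : PIET n 𝒜} {c : Fin n → ℝ} (hc : T.HasBreaks c) (h : T.TopWins)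
    {T' : PIET n 𝒜} (hs : Same (T.topStep h) T') (hg : T.perm.GenusOne) : T'.HasBreaks c := by
  obtain ⟨r, s, hb⟩ := hg.exists_blocks
  have hb' := topStep_blocks h hb
  rw [← hs.perm] at hb'
  exact hc.congr hb hb' fun i _ _ => by rw [hs.logBreak, topStep_logBreak h hb]

theorem HasBreaks.rauzyStep {T T' : PIET n 𝒜} {c : Fin n → ℝ} (hc : T.HasBreaks c)
    (h : RauzyStep T T') (hg : T.perm.GenusOne) : T'.HasBreaks c := by
  rcases h.topStep_or with ⟨h1, h2⟩ | ⟨h1, h2⟩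
  · exact hc.topStep h1 h2 hg
  · have := (hc.inv.topStep h1 h2 hg.swap).inv
    rw [inv_inv] at this
    simpa using this

end PIET

namespace PIET

variable {n : ℕ} {𝒜 : Type*} [Fintype 𝒜]

theorem map_lo (T : PIET n 𝒜) : T.map T.lo = T.groupBot := by
  have h : T.topLeft (T.perm.top 0) = T.lo := partLeft_first (by simp)
  have := T.map_topLeft (T.perm.top 0)
  rwa [h] at this

theorem map_groupTop (T : PIET n 𝒜) : T.map T.groupTop = T.lo := by
  unfold groupTop
  rw [T.map_topLeft]
  exact partLeft_first (by simp)

theorem groupTop_mem (T : PIET n 𝒜) : T.groupTop ∈ Set.Ico T.lo T.hi :=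
  T.mem_of_mem_top ⟨le_rfl, T.topLeft_lt_topRight _⟩

theorem groupBot_mem (T : PIET n 𝒜) : T.groupBot ∈ Set.Ico T.lo T.hi := T.inv.groupTop_mem

theorem groupTop_le_cutTop (T : PIET n 𝒜) : T.groupTop ≤ T.cutTop := T.topLeft_le_cutTop _

theorem groupBot_le_cutBot (T : PIET n 𝒜) : T.groupBot ≤ T.cutBot := T.botLeft_le_cutBot _

variable [DecidableEq 𝒜]

theorem RauzyStep.group {T T' : PIET n 𝒜} (h : RauzyStep T T')
    (hlt : max T.groupTop T.groupBot < T.cut) :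
    T.lo + (T.cut - T.lo) * T'.groupTop = T.groupTop ∧
      T.lo + (T.cut - T.lo) * T'.groupBot = T.groupBot := by
  have hpos := cut_sub_lo_pos h.cut_ne
  obtain ⟨h1, h2⟩ := max_lt_iff.mp hlt
  constructor
  · set y := (T.groupTop - T.lo) / (T.cut - T.lo) with hy
    have hmul : T.lo + (T.cut - T.lo) * y = T.groupTop := by
      rw [hy, mul_div_cancel₀ _ hpos.ne']; ring
    have hmem : y ∈ Set.Ico (0 : ℝ) 1 :=
      ⟨div_nonneg (by linarith [T.groupTop_mem.1]) hpos.le, by rw [hy, div_lt_one hpos]; linarith⟩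
    have hr := h.first_return y hmem
    have hr' : IsFirstReturn T.map (Set.Ico T.lo T.cut) (T.lo + (T.cut - T.lo) * y) T.lo := by
      rw [hmul]
      exact ⟨1, one_pos, T.map_groupTop, ⟨le_rfl, by linarith⟩, fun k hk hk' => by omega⟩
    have h0 := hr.unique hr'
    have h3 : T'.map y = 0 := by
      have : (T.cut - T.lo) * T'.map y = 0 := by linarith
      rcases mul_eq_zero.mp this with h | h
      · linarith
      · exact h
    have h4 := T'.map_groupTop
    rw [h.lo_eq] at h4
    have h5 := T'.groupTop_mem
    rw [h.lo_eq, h.hi_eq] at h5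
    have h6 : T'.groupTop = y := by
      apply T'.map_injOn
      · rwa [h.lo_eq, h.hi_eq]
      · rwa [h.lo_eq, h.hi_eq]
      · rw [h4, h3]
    rw [h6, hmul]
  · have hr := h.first_return 0 ⟨le_rfl, one_pos⟩
    have h4 := T'.map_lo
    rw [h.lo_eq] at h4
    rw [mul_zero, add_zero, h4] at hr
    have hr' : IsFirstReturn T.map (Set.Ico T.lo T.cut) T.lo T.groupBot :=
      ⟨1, one_pos, T.map_lo, ⟨T.groupBot_mem.1, h2⟩, fun k hk hk' => by omega⟩
    exact hr.unique hr'

/-- A step of Rauzy induction either completes a step for the two groups of intervals, or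
reduces the number of letters to be moved before that. -/
theorem RauzyStep.group_cases_of_top {T T' : PIET n 𝒜} (h : RauzyStep T T') (h' : T.TopWins)
    {r s : ℕ} (hb : T.perm.Blocks r s) :
    (T'.perm.Blocks s s ∧ T.cut = max T.groupTop T.groupBot ∧ T.groupTop < T.groupBot) ∨
      (∃ r', T'.perm.Blocks r' s ∧ r' < r ∧ max T.groupTop T.groupBot < T.cut) := by
  have hb' := topStep_blocks h' hb
  rw [← (h.same_topStep h').perm] at hb'
  have h1 := T.groupTop_le_cutTop
  have h2 := T.groupBot_le_cutBot
  have h3 := h'.lt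
  have hp := hb.pos
  have hl := hb.top_bot_last
  rw [cut_of_topWins h']
  by_cases hr : r = 1
  · left
    rw [if_pos hr] at hb'
    have h0 : T.perm.top 0 = T.perm.bot (Fin.last n) :=
      MarkedPerm.Blocks.eq_of_pos (by rw [hl, hr]; simp)
    have h4 : T.groupBot = T.cutBot := by unfold groupBot cutBot; rw [h0]
    refine ⟨hb', ?_, by linarith⟩
    rw [max_eq_right (by linarith), h4]
  · right
    rw [if_neg hr] at hb'
    refine ⟨r - 1, hb', by omega, max_lt (by linarith) ?_⟩
    have h0 : T.perm.top 0 ≠ T.perm.bot (Fin.last n) := by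
      intro hc
      rw [← hc, Equiv.symm_apply_apply, Fin.val_zero] at hl
      omega
    have := T.botRight_le_cutBot h0
    unfold groupBot
    linarith [T.botLeft_lt_botRight (T.perm.top 0)]

theorem RauzyStep.group_cases {T T' : PIET n 𝒜} (h : RauzyStep T T') {r s : ℕ}
    (hb : T.perm.Blocks r s) :
    ((∃ t, T'.perm.Blocks t t) ∧ T.cut = max T.groupTop T.groupBot ∧
        T.groupTop ≠ T.groupBot) ∨
      (∃ r' s', T'.perm.Blocks r' s' ∧ r' + (n - s') < r + (n - s) ∧
        max T.groupTop T.groupBot < T.cut) := by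
  have hn := hb.le_n
  have hle := hb.le
  rcases h.topStep_or with ⟨h1, -⟩ | ⟨h1, -⟩
  · rcases h.group_cases_of_top h1 hb with ⟨h2, h3, h4⟩ | ⟨r', h2, h3, h4⟩
    · exact Or.inl ⟨⟨s, h2⟩, h3, h4.ne⟩
    · exact Or.inr ⟨r', s, h2, by omega, h4⟩
  · rcases h.inv.group_cases_of_top h1 hb.swap with ⟨h2, h3, h4⟩ | ⟨r', h2, h3, h4⟩
    · left
      rw [inv_cut, inv_groupTop, inv_groupBot, max_comm] at h3
      exact ⟨⟨_, h2.swap⟩, h3, h4.ne'⟩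
    · right
      rw [inv_cut, inv_groupTop, inv_groupBot, max_comm] at h4
      have h5 := h2.le
      have h6 := h2.pos
      refine ⟨_, _, h2.swap, ?_, h4⟩
      omega

theorem exists_groupStep_aux (N : ℕ) : ∀ U : ℕ → PIET n 𝒜, (∀ m, RauzyStep (U m) (U (m + 1))) →
    ∀ r s, (U 0).perm.Blocks r s → r + (n - s) ≤ N →
    ∃ m, 0 < m ∧ GroupStep (U 0) (U m) ∧ (∃ t, (U m).perm.Blocks t t) ∧
      (U 0).groupTop ≠ (U 0).groupBot ∧
      ∀ k < m, ((U k).groupTop < (U k).groupBot ↔ (U 0).groupTop < (U 0).groupBot) := by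
  induction N with
  | zero =>
    intro U hU r s hb hN
    have := hb.pos
    omega
  | succ N ih =>
    intro U hU r s hb hN
    have hpos := cut_sub_lo_pos (hU 0).cut_ne
    rcases (hU 0).group_cases hb with ⟨h1, h2, h3⟩ | ⟨r', s', h1, h2, h3⟩
    · refine ⟨1, one_pos, ?_, h1, h3, fun k hk => ?_⟩
      · unfold GroupStep
        rw [← h2]
        exact RauzyChain.single (hU 0)
      · obtain rfl : k = 0 := by omega
        rfl
    · obtain ⟨m, hm, hg, hc, hne, hk⟩ := ih (fun m => U (m + 1)) (fun m => hU (m + 1)) r' s' h1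
        (by omega)
      obtain ⟨g1, g2⟩ := (hU 0).group h3
      simp only [zero_add] at g1 g2 hg hne hk
      have key : (U 1).groupTop < (U 1).groupBot ↔ (U 0).groupTop < (U 0).groupBot := by
        rw [← g1, ← g2, add_lt_add_iff_left, mul_lt_mul_iff_right₀ hpos]
      refine ⟨m + 1, by omega, ?_, hc, ?_, ?_⟩
      · have h4 := RauzyChain.cons (hU 0) hg
        unfold GroupStep
        convert h4 using 1
        rw [(hU 0).lo_eq, sub_zero, mul_max_of_nonneg _ _ hpos.le, ← g1, ← g2, max_add_add_left]
        ring
      · intro hc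
        rw [← g1, ← g2] at hc
        exact hne (mul_left_cancel₀ hpos.ne' (add_left_cancel hc))
      · intro k hk'
        rcases Nat.eq_zero_or_pos k with rfl | hk0
        · rfl
        · obtain ⟨j, rfl⟩ := Nat.exists_eq_succ_of_ne_zero hk0.ne'
          rw [← key]
          exact hk j (by omega)

theorem rauzySeq_genusOne {U : ℕ → PIET n 𝒜} (hU : ∀ m, RauzyStep (U m) (U (m + 1)))
    (h0 : (U 0).perm.GenusOne) (m : ℕ) : (U m).perm.GenusOne := by
  induction m with
  | zero => exact h0
  | succ m ih => exact (hU m).genusOne ih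

theorem exists_groupStep {U : ℕ → PIET n 𝒜} (hU : ∀ m, RauzyStep (U m) (U (m + 1)))
    (h0 : (U 0).perm.GenusOne) (m : ℕ) :
    ∃ m', m < m' ∧ GroupStep (U m) (U m') ∧ (∃ t, (U m').perm.Blocks t t) ∧
      (U m).groupTop ≠ (U m).groupBot ∧
      ∀ k, m ≤ k → k < m' →
        ((U k).groupTop < (U k).groupBot ↔ (U m).groupTop < (U m).groupBot) := by
  obtain ⟨r, s, hb⟩ := (rauzySeq_genusOne hU h0 m).exists_blocks
  obtain ⟨d, hd, h1, h2, h3, h4⟩ := exists_groupStep_aux _ (fun k => U (m + k))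
    (fun k => hU (m + k)) r s hb le_rfl
  refine ⟨m + d, by omega, h1, h2, h3, fun k hk hk' => ?_⟩
  have := h4 (k - m) (by omega)
  rwa [show m + (k - m) = k by omega] at this

theorem RauzyStep.first_letters {T T' : PIET n 𝒜} (h : RauzyStep T T') (hg : T.perm.GenusOne) :
    T'.perm.top 0 = T.perm.top 0 ∧ T'.perm.bot 0 = T.perm.bot 0 := by
  have key : ∀ {T T' : PIET n 𝒜}, RauzyStep T T' → T.perm.GenusOne → T.TopWins →
      T'.perm.top 0 = T.perm.top 0 ∧ T'.perm.bot 0 = T.perm.bot 0 := by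
    intro T T' h hg h'
    obtain ⟨r, s, hb⟩ := hg.exists_blocks
    have hb' := topStep_blocks h' hb
    rw [← (h.same_topStep h').perm] at hb'
    have ht := (h.top_wins h'.lt).1
    refine ⟨by rw [ht], MarkedPerm.Blocks.eq_of_pos (σ := T.perm) ?_⟩
    rw [hb.top_bot_first, ← ht, hb'.top_bot_first]
  rcases h.topStep_or with ⟨h1, -⟩ | ⟨h1, -⟩
  · exact key h hg h1
  · exact (key h.inv hg.swap h1).symm

/-- If every letter wins infinitely often then the top group does not win for ever. -/
theorem exists_groupBot_le {U : ℕ → PIET n 𝒜} (hU : ∀ m, RauzyStep (U m) (U (m + 1)))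
    (h0 : (U 0).perm.GenusOne) (hw : ∀ α : 𝒜, ∀ N : ℕ, ∃ m, N ≤ m ∧ (U m).winner = α) (M : ℕ) :
    ∃ m, M ≤ m ∧ (U m).groupBot ≤ (U m).groupTop := by
  by_contra hcon
  push Not at hcon
  have hg := rauzySeq_genusOne hU h0
  have hfirst : ∀ m, (U m).perm.top 0 = (U 0).perm.top 0 ∧ (U m).perm.bot 0 = (U 0).perm.bot 0 := by
    intro m
    induction m with
    | zero => exact ⟨rfl, rfl⟩
    | succ m ih =>
      obtain ⟨h1, h2⟩ := (hU m).first_letters (hg m)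
      exact ⟨h1.trans ih.1, h2.trans ih.2⟩
  set b := (U 0).perm.bot 0
  have htop : ∀ m, M ≤ m → (U m).perm.top (Fin.last n) = b → (U m).cutTop < (U m).cutBot := by
    intro m hm hl
    rcases lt_or_gt_of_ne (hU m).cut_ne with h | h
    · exact h
    · exfalso
      have h1 := hcon m hm
      have h2 := (U m).groupBot_le_cutBot
      have h3 : (U m).groupTop = (U m).cutTop := by
        unfold groupTop cutTop; rw [hl, (hfirst m).2]
      linarith
  obtain ⟨m₀, hm₀, hwin⟩ := hw b M
  have hl₀ : (U m₀).perm.top (Fin.last n) = b := by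
    unfold winner at hwin
    split_ifs at hwin with h
    · exact hwin
    · exfalso
      rw [← (hfirst m₀).2, EmbeddingLike.apply_eq_iff_eq, Fin.ext_iff, Fin.val_last,
        Fin.val_zero] at hwin
      have := (hg m₀).pos
      omega
  have hl : ∀ m, m₀ ≤ m → (U m).perm.top (Fin.last n) = b := by
    intro m hm
    induction m, hm using Nat.le_induction with
    | base => exact hl₀
    | succ m hm ih =>
      rw [((hU m).top_wins (htop m (by omega) ih)).1, ih]
  obtain ⟨m₁, hm₁, hwin₁⟩ := hw ((U 0).perm.top 0) m₀
  have h1 := htop m₁ (by omega) (hl m₁ hm₁)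
  unfold winner at hwin₁
  rw [if_pos h1, hl m₁ hm₁] at hwin₁
  exact h0.1.first_ne h0.pos hwin₁.symm

theorem inv_winner {T : PIET n 𝒜} (h : T.cutTop ≠ T.cutBot) : T.inv.winner = T.winner := by
  unfold winner
  rcases lt_or_gt_of_ne h with h | h
  · rw [if_pos h, inv_cutTop, inv_cutBot, if_neg h.not_gt]; rfl
  · rw [if_neg h.not_gt, inv_cutTop, inv_cutBot, if_pos h]; rfl

theorem exists_groupTop_le {U : ℕ → PIET n 𝒜} (hU : ∀ m, RauzyStep (U m) (U (m + 1)))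
    (h0 : (U 0).perm.GenusOne) (hw : ∀ α : 𝒜, ∀ N : ℕ, ∃ m, N ≤ m ∧ (U m).winner = α) (M : ℕ) :
    ∃ m, M ≤ m ∧ (U m).groupTop ≤ (U m).groupBot := by
  refine exists_groupBot_le (U := fun m => (U m).inv) (fun m => (hU m).inv) h0.swap ?_ M
  intro α N
  obtain ⟨m, h1, h2⟩ := hw α N
  exact ⟨m, h1, by rw [inv_winner (hU m).cut_ne]; exact h2⟩

/-! ### Uniqueness of the renormalisations -/

theorem RauzyStep.cut_mem {T T' : PIET n 𝒜} (h : RauzyStep T T') (hlo : T.lo = 0)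
    (hhi : T.hi = 1) : 0 < T.cut - T.lo ∧ T.cut - T.lo < 1 := by
  have h1 := cut_sub_lo_pos h.cut_ne
  have h2 := T.cut_lt_hi
  rw [hhi] at h2
  exact ⟨h1, by rw [hlo]; linarith⟩

theorem RauzyChain.lt_one {T T' : PIET n 𝒜} {ℓ : ℝ} (h : RauzyChain T ℓ T') (hlo : T.lo = 0)
    (hhi : T.hi = 1) : 0 < ℓ ∧ ℓ < 1 := by
  induction h with
  | single h => exact h.cut_mem hlo hhi
  | cons h h' ih =>
    have h1 := h.cut_mem hlo hhi
    have h2 := ih h.lo_eq h.hi_eq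
    exact ⟨mul_pos h1.1 h2.1, mul_lt_one_of_nonneg_of_lt_one_left h1.1.le h1.2 h2.2.le⟩

theorem RauzyChain.lo_hi {T T' : PIET n 𝒜} {ℓ : ℝ} (h : RauzyChain T ℓ T') :
    T'.lo = 0 ∧ T'.hi = 1 := by
  induction h with
  | single h => exact ⟨h.lo_eq, h.hi_eq⟩
  | cons h h' ih => exact ih

theorem RauzyChain.same {T S T' S' : PIET n 𝒜} {ℓ : ℝ} (h : RauzyChain T ℓ T')
    (h' : RauzyChain S ℓ S') (hs : Same T S) : Same T' S' := by
  induction h generalizing S S' with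
  | @single T T' h =>
    have hcut : S.cut - S.lo = T.cut - T.lo := by rw [hs.cut, hs.lo]
    have hpos := cut_sub_lo_pos h.cut_ne
    generalize hk : T.cut - T.lo = k at h'
    cases h' with
    | single h1 => exact h.same hs h1
    | cons h1 h2 =>
      have := (h2.lt_one h1.lo_eq h1.hi_eq).2
      rw [← hcut] at hk hpos
      nlinarith
  | @cons T T₁ T' ℓ h h2 ih =>
    have hcut : S.cut - S.lo = T.cut - T.lo := by rw [hs.cut, hs.lo]
    have hpos := cut_sub_lo_pos h.cut_ne
    generalize hk : (T.cut - T.lo) * ℓ = k at h'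
    cases h' with
    | single h1 =>
      have := (h2.lt_one h.lo_eq h.hi_eq).2
      rw [hcut] at hk
      nlinarith
    | cons h1 h3 =>
      rw [hcut] at hk
      have := mul_left_cancel₀ hpos.ne' hk
      subst this
      exact ih h3 (h.same hs h1)

theorem GroupStep.same {T S T' S' : PIET n 𝒜} (h : GroupStep T T') (h' : GroupStep S S')
    (hs : Same T S) : Same T' S' := by
  unfold GroupStep at h h'
  rw [hs.groupTop, hs.groupBot, hs.lo] at h'
  exact RauzyChain.same h h' hs

theorem GroupWins.not {T : PIET n 𝒜} {s : Bool} (h : T.GroupWins s) : ¬T.GroupWins (!s) := by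
  cases s <;> exact not_lt.mpr (le_of_lt h)

theorem GroupRun.same {T S T' S' : PIET n 𝒜} {s : Bool} (h : GroupRun s T T')
    (h' : GroupRun s S S') (hs : Same T S) : Same T' S' := by
  induction h generalizing S S' with
  | last hw h =>
    cases h' with
    | last hw' h1 => exact h.same h1 hs
    | more hw' h1 h2 => exact absurd hw ((hs.groupWins s).mp hw').not
  | more hw h h2 ih =>
    cases h' with
    | last hw' h1 => exact absurd ((hs.groupWins _).mp hw') hw.not
    | more hw' h1 h3 => exact ih h3 (h.same h1 hs)

/-- The renormalisation is determined up to the signs of the branches. -/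
theorem Renormalises.same {T S T' S' : PIET n 𝒜} (h : Renormalises T T')
    (h' : Renormalises S S') (hs : Same T S) : Same T' S' := by
  obtain ⟨s, hw, hr⟩ := h
  obtain ⟨t, hw', hr'⟩ := h'
  rw [hs.groupWins] at hw'
  obtain rfl : s = t := by
    by_contra hne
    have : t = !s := by cases s <;> cases t <;> simp_all
    exact hw.not (this ▸ hw')
  exact hr.same hr' hs

theorem renormalises_same {S S' : ℕ → PIET n 𝒜} (h0 : Same (S 0) (S' 0))
    (hS : ∀ k, Renormalises (S k) (S (k + 1))) (hS' : ∀ k, Renormalises (S' k) (S' (k + 1)))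
    (k : ℕ) : Same (S k) (S' k) := by
  induction k with
  | zero => exact h0
  | succ k ih => exact (hS k).same (hS' k) ih

theorem Same.c1DistLE {T S R : PIET n 𝒜} (h : Same T S) {ε : ℝ} (h' : C1DistLE T R ε) :
    C1DistLE S R ε := by
  refine ⟨h.perm.trans h'.1, fun α t ht => ?_⟩
  rw [h.topLeft, h.topLen, h.moebius]
  exact h'.2 α t ht

/-! ### Sequences of steps for two groups -/

/-- A sequence of steps for the exchange of two groups of intervals, in which
both sides win infinitely often. -/
structure GroupSeq (T : ℕ → PIET n 𝒜) : Prop where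
  step : ∀ j, GroupStep (T j) (T (j + 1))
  genusOne : ∀ j, (T j).perm.GenusOne
  circular : ∀ j, ∃ t, (T (j + 1)).perm.Blocks t t
  ne : ∀ j, (T j).groupTop ≠ (T j).groupBot
  bot_wins : ∀ J, ∃ j, J ≤ j ∧ (T j).groupBot < (T j).groupTop
  top_wins : ∀ J, ∃ j, J ≤ j ∧ (T j).groupTop < (T j).groupBot

theorem RauzyChain.induct {P : PIET n 𝒜 → Prop}
    (hP : ∀ T T', RauzyStep T T' → T.perm.GenusOne → P T → P T') {T T' : PIET n 𝒜} {ℓ : ℝ}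
    (h : RauzyChain T ℓ T') (hg : T.perm.GenusOne) (hT : P T) : P T' := by
  induction h with
  | single h => exact hP _ _ h hg hT
  | cons h h' ih => exact ih (h.genusOne hg) (hP _ _ h hg hT)

theorem exists_groupSeq {T : PIET n 𝒜} (hg : T.perm.GenusOne) (h : T.InfinitelyComplete) :
    ∃ S : ℕ → PIET n 𝒜, S 0 = T ∧ GroupSeq S := by
  obtain ⟨U, rfl, hU, hw⟩ := h
  choose f hf1 hf2 hf3 hf4 hf5 using exists_groupStep hU hg
  let m : ℕ → ℕ := fun j => f^[j] 0
  have hm : ∀ j, m (j + 1) = f (m j) := fun j => Function.iterate_succ_apply' f j 0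
  have hmono : StrictMono m := strictMono_nat_of_lt_succ fun j => by rw [hm]; exact hf1 _
  have hblock : ∀ J M, m J ≤ M → ∃ j, J ≤ j ∧ m j ≤ M ∧ M < m (j + 1) := by
    intro J M hM
    have hex : ∃ k, M < m k := ⟨M + 1, (Nat.lt_succ_self M).trans_le (hmono.id_le _)⟩
    have h1 := Nat.find_spec hex
    have h2 : Nat.find hex ≠ 0 := by
      intro h0
      rw [h0] at h1
      have := hmono.monotone (Nat.zero_le J)
      omega
    obtain ⟨j, hj⟩ := Nat.exists_eq_succ_of_ne_zero h2
    have h3 : ¬ M < m j := Nat.find_min hex (by omega)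
    rw [hj] at h1
    refine ⟨j, ?_, not_lt.mp h3, h1⟩
    by_contra hc
    have := hmono.monotone (show j + 1 ≤ J by omega)
    simp only [Nat.succ_eq_add_one] at h1
    omega
  refine ⟨fun j => U (m j), rfl, ?_, fun j => rauzySeq_genusOne hU hg _, ?_, fun j => hf4 _, ?_, ?_⟩
  · intro j
    simp only [hm]
    exact hf2 _
  · intro j
    simp only [hm]
    exact hf3 _
  · intro J
    obtain ⟨M, hM, hM'⟩ := exists_groupBot_le hU hg hw (m J)
    obtain ⟨j, hj, hj1, hj2⟩ := hblock J M hM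
    refine ⟨j, hj, lt_of_le_of_ne ?_ (hf4 _).symm⟩
    have := hf5 (m j) M hj1 (by rw [← hm]; exact hj2)
    by_contra hc
    exact absurd (this.mpr (not_le.mp hc)) (not_lt.mpr hM')
  · intro J
    obtain ⟨M, hM, hM'⟩ := exists_groupTop_le hU hg hw (m J)
    obtain ⟨j, hj, hj1, hj2⟩ := hblock J M hM
    refine ⟨j, hj, ?_⟩
    have := hf5 (m j) M hj1 (by rw [← hm]; exact hj2)
    rw [← this]
    exact lt_of_le_of_ne hM' (hf4 M)

end PIET

namespace PIET

variable {n : ℕ} {𝒜 : Type*} [Fintype 𝒜]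

/-! ### Circular maps -/

/-- A map of `[0, 1)` with circular permutation. -/
structure Circ (T : PIET n 𝒜) : Prop where
  lo : T.lo = 0
  hi : T.hi = 1
  blocks : ∃ t, T.perm.Blocks t t

theorem Circ.inv {T : PIET n 𝒜} (h : T.Circ) : T.inv.Circ :=
  ⟨h.lo, h.hi, h.blocks.imp' (fun t => n + 1 - t) fun _ h => h.swap⟩

theorem topRight_le_topLeft (T : PIET n 𝒜) {γ δ : 𝒜}
    (h : (T.perm.top.symm γ : ℕ) < T.perm.top.symm δ) : T.topRight γ ≤ T.topLeft δ :=
  partLeft_right_le T.topLen_nonneg h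

theorem botRight_le_botLeft (T : PIET n 𝒜) {γ δ : 𝒜}
    (h : (T.perm.bot.symm γ : ℕ) < T.perm.bot.symm δ) : T.botRight γ ≤ T.botLeft δ :=
  T.inv.topRight_le_topLeft h

theorem topLeft_le_topLeft (T : PIET n 𝒜) {γ δ : 𝒜}
    (h : (T.perm.top.symm γ : ℕ) ≤ T.perm.top.symm δ) : T.topLeft γ ≤ T.topLeft δ :=
  partLeft_mono T.topLen_nonneg h

theorem lt_groupTop_iff {T : PIET n 𝒜} {r s : ℕ} (hb : T.perm.Blocks r s) {γ : 𝒜} {x : ℝ}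
    (hx : x ∈ Set.Ico (T.topLeft γ) (T.topRight γ)) :
    x < T.groupTop ↔ (T.perm.top.symm γ : ℕ) < s := by
  have h0 := hb.top_bot_first
  constructor
  · intro h
    by_contra hc
    have := T.topLeft_le_topLeft (γ := T.perm.bot 0) (δ := γ) (by omega)
    unfold groupTop at h
    linarith [hx.1]
  · intro h
    have := T.topRight_le_topLeft (γ := γ) (δ := T.perm.bot 0) (by omega)
    exact hx.2.trans_le this

namespace Circ

variable {T : PIET n 𝒜} (h : T.Circ)

theorem mem_iff (h : T.Circ) {x : ℝ} : x ∈ Set.Ico T.lo T.hi ↔ x ∈ Set.Ico (0 : ℝ) 1 := by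
  rw [h.lo, h.hi]

theorem map_mem (h : T.Circ) {x : ℝ} (hx : x ∈ Set.Ico (0 : ℝ) 1) :
    T.map x ∈ Set.Ico (0 : ℝ) 1 := by
  rw [← h.mem_iff] at hx ⊢; exact T.map_mem hx

theorem lt_groupTop_iff_le_map (h : T.Circ) {x : ℝ} (hx : x ∈ Set.Ico (0 : ℝ) 1) :
    x < T.groupTop ↔ T.groupBot ≤ T.map x := by
  obtain ⟨t, hb⟩ := h.blocks
  obtain ⟨γ, hγ⟩ := T.exists_mem_top (h.mem_iff.mpr hx)
  rw [lt_groupTop_iff hb hγ]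
  have h1 := T.map_mem_bot hγ
  have h2 := lt_groupTop_iff (T := T.inv) hb.swap (γ := γ) h1
  rw [inv_groupTop] at h2
  rw [← not_lt, h2]
  have e := hb.bot_eq γ
  have := hb.le_n
  have := (T.perm.top.symm γ).isLt
  change _ ↔ ¬ (T.perm.bot.symm γ : ℕ) < n + 1 - t
  split_ifs at e <;> omega

theorem strictMonoOn_aux (h : T.Circ) {x y : ℝ} (hx : x ∈ Set.Ico (0 : ℝ) 1)
    (hy : y ∈ Set.Ico (0 : ℝ) 1) (hxy : x < y) (hs : x < T.groupTop ↔ y < T.groupTop) :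
    T.map x < T.map y := by
  obtain ⟨t, hb⟩ := h.blocks
  obtain ⟨γ, hγ⟩ := T.exists_mem_top (h.mem_iff.mpr hx)
  obtain ⟨δ, hδ⟩ := T.exists_mem_top (h.mem_iff.mpr hy)
  rw [lt_groupTop_iff hb hγ, lt_groupTop_iff hb hδ] at hs
  have h1 := T.map_mem_bot hγ
  have h2 := T.map_mem_bot hδ
  rcases lt_trichotomy (T.perm.top.symm γ : ℕ) (T.perm.top.symm δ) with hlt | heq | hlt
  · have : (T.perm.bot.symm γ : ℕ) < T.perm.bot.symm δ := by
      have e1 := hb.bot_eq γ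
      have e2 := hb.bot_eq δ
      have e3 := hb.le_n
      split_ifs at e1 e2 <;> omega
    have := T.botRight_le_botLeft this
    linarith [h1.2, h2.1]
  · obtain rfl := MarkedPerm.Blocks.eq_of_pos heq
    rw [T.map_eq hγ, T.map_eq hδ]
    exact T.branch_strictMonoOn γ (Set.Ico_subset_Icc_self hγ) (Set.Ico_subset_Icc_self hδ) hxy
  · have := T.topRight_le_topLeft hlt
    linarith [hγ.1, hδ.2]

theorem groupTop_pos (h : T.Circ) : 0 < T.groupTop := by
  obtain ⟨t, hb⟩ := h.blocks
  have h0 := hb.top_bot_first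
  have h1 := hb.pos
  have := T.topRight_le_topLeft (γ := T.perm.top 0) (δ := T.perm.bot 0) (by
    rw [Equiv.symm_apply_apply, h0]; exact h1)
  have h2 := T.topLeft_lt_topRight (T.perm.top 0)
  have h3 := T.lo_le_topLeft (T.perm.top 0)
  rw [h.lo] at h3
  unfold groupTop
  linarith

theorem groupBot_pos (h : T.Circ) : 0 < T.groupBot := h.inv.groupTop_pos

theorem groupTop_lt_one (h : T.Circ) : T.groupTop < 1 := by
  have := T.groupTop_mem.2; rwa [h.hi] at this

theorem groupBot_lt_one (h : T.Circ) : T.groupBot < 1 := h.inv.groupTop_lt_one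

theorem map_zero (h : T.Circ) : T.map 0 = T.groupBot := by
  have := T.map_lo; rwa [h.lo] at this

theorem map_groupTop (h : T.Circ) : T.map T.groupTop = 0 := by
  rw [PIET.map_groupTop, h.lo]

theorem map_inj (h : T.Circ) {x y : ℝ} (hx : x ∈ Set.Ico (0 : ℝ) 1) (hy : y ∈ Set.Ico (0 : ℝ) 1)
    (hxy : T.map x = T.map y) : x = y :=
  T.map_injOn (h.mem_iff.mpr hx) (h.mem_iff.mpr hy) hxy

end Circ

/-- The lift to the line of a circular map, seen as a map of the circle. -/
noncomputable def lift (T : PIET n 𝒜) (x : ℝ) : ℝ :=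
  T.map (Int.fract x) + (if T.groupTop ≤ Int.fract x then 1 else 0) + ⌊x⌋

theorem fract_mem (x : ℝ) : Int.fract x ∈ Set.Ico (0 : ℝ) 1 :=
  ⟨Int.fract_nonneg x, Int.fract_lt_one x⟩

namespace Circ

variable {T : PIET n 𝒜}

theorem lift_eq_of_lt (h : T.Circ) {x : ℝ} (h0 : 0 ≤ x) (hx : x < T.groupTop) :
    T.lift x = T.map x := by
  have h1 : Int.fract x = x := Int.fract_eq_self.mpr ⟨h0, hx.trans h.groupTop_lt_one⟩
  have h2 : ⌊x⌋ = 0 := Int.floor_eq_zero_iff.mpr ⟨h0, hx.trans h.groupTop_lt_one⟩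
  rw [lift, h1, h2, if_neg (not_le.mpr hx)]
  simp

theorem lift_eq_of_ge (h : T.Circ) {x : ℝ} (hx : T.groupTop ≤ x) (h1 : x < 1) :
    T.lift x = T.map x + 1 := by
  have h0 := h.groupTop_pos.le.trans hx
  have h3 : Int.fract x = x := Int.fract_eq_self.mpr ⟨h0, h1⟩
  have h2 : ⌊x⌋ = 0 := Int.floor_eq_zero_iff.mpr ⟨h0, h1⟩
  rw [lift, h3, h2, if_pos hx]
  simp

theorem lift_add_int (x : ℝ) (k : ℤ) : T.lift (x + k) = T.lift x + k := by
  rw [lift, Int.fract_add_intCast, Int.floor_add_intCast, lift]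
  push_cast
  ring

theorem lift_base (h : T.Circ) {x : ℝ} (hx : x ∈ Set.Ico (0 : ℝ) 1) :
    T.lift x ∈ Set.Ico T.groupBot (1 + T.groupBot) := by
  have h1 := h.map_mem hx
  have h2 := h.lt_groupTop_iff_le_map hx
  rcases lt_or_ge x T.groupTop with hlt | hge
  · rw [h.lift_eq_of_lt hx.1 hlt]
    exact ⟨h2.mp hlt, by linarith [h1.2, h.groupBot_pos]⟩
  · rw [h.lift_eq_of_ge hge hx.2]
    have h3 := not_le.mp fun hc => absurd (h2.mpr hc) (not_lt.mpr hge)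
    exact ⟨by linarith [h1.1, h.groupBot_lt_one], by linarith⟩

theorem lift_strictMono (h : T.Circ) : StrictMono T.lift := by
  have key : ∀ x y : ℝ, x ∈ Set.Ico (0 : ℝ) 1 → y ∈ Set.Ico (0 : ℝ) 1 → x < y →
      T.lift x < T.lift y := by
    intro x y hx hy hxy
    rcases lt_or_ge y T.groupTop with hy1 | hy1
    · rw [h.lift_eq_of_lt hx.1 (hxy.trans hy1), h.lift_eq_of_lt hy.1 hy1]
      exact h.strictMonoOn_aux hx hy hxy (iff_of_true (hxy.trans hy1) hy1)
    · rcases lt_or_ge x T.groupTop with hx1 | hx1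
      · rw [h.lift_eq_of_lt hx.1 hx1, h.lift_eq_of_ge hy1 hy.2]
        linarith [(h.map_mem hx).2, (h.map_mem hy).1]
      · rw [h.lift_eq_of_ge hx1 hx.2, h.lift_eq_of_ge hy1 hy.2]
        have := h.strictMonoOn_aux hx hy hxy (iff_of_false (not_lt.mpr hx1) (not_lt.mpr hy1))
        linarith
  intro x y hxy
  have ex : x = Int.fract x + ⌊x⌋ := (Int.fract_add_floor x).symm
  have ey : y = Int.fract y + ⌊y⌋ := (Int.fract_add_floor y).symm
  rw [ex, ey, lift_add_int, lift_add_int]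
  have hx := h.lift_base (fract_mem x)
  have hy := h.lift_base (fract_mem y)
  rcases (Int.floor_le_floor hxy.le).lt_or_eq with hlt | heq
  · have : (⌊x⌋ : ℝ) + 1 ≤ ⌊y⌋ := by exact_mod_cast hlt
    linarith [hx.2, hy.1]
  · rw [heq]
    have : Int.fract x < Int.fract y := by
      have : (⌊x⌋ : ℝ) = ⌊y⌋ := by rw [heq]
      linarith
    linarith [key _ _ (fract_mem x) (fract_mem y) this]

theorem lift_surjective (h : T.Circ) : Function.Surjective T.lift := by
  intro z
  set w := Int.fract (z - T.groupBot) + T.groupBot with hw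
  have hz : z = w + ⌊z - T.groupBot⌋ := by
    have := Int.fract_add_floor (z - T.groupBot)
    linarith
  have h0 := h.groupBot_pos
  have h1 := h.groupBot_lt_one
  have hf := fract_mem (z - T.groupBot)
  have key : ∀ v ∈ Set.Ico (0 : ℝ) 1, ∃ x ∈ Set.Ico (0 : ℝ) 1, T.map x = v := by
    intro v hv
    exact ⟨T.inv.map v, h.inv.map_mem hv, T.map_inv_map (h.mem_iff.mpr hv)⟩
  suffices ∃ x, T.lift x = w by
    obtain ⟨x, hx⟩ := this
    refine ⟨x + ⌊z - T.groupBot⌋, ?_⟩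
    rw [lift_add_int, hx, ← hz]
  rcases lt_or_ge w 1 with hlt | hge
  · obtain ⟨x, hx, hxv⟩ := key w ⟨by linarith [hf.1], hlt⟩
    refine ⟨x, ?_⟩
    rw [h.lift_eq_of_lt hx.1, hxv]
    rw [h.lt_groupTop_iff_le_map hx, hxv]
    linarith [hf.1]
  · obtain ⟨x, hx, hxv⟩ := key (w - 1) ⟨by linarith, by linarith [hf.2]⟩
    refine ⟨x, ?_⟩
    rw [h.lift_eq_of_ge _ hx.2, hxv]
    · ring
    · rw [← not_lt, h.lt_groupTop_iff_le_map hx, hxv]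
      linarith [hf.2]

/-- The lift to the line of a circular map. -/
noncomputable def liftIso (h : T.Circ) : ℝ ≃o ℝ :=
  StrictMono.orderIsoOfSurjective T.lift h.lift_strictMono h.lift_surjective

theorem liftIso_apply (h : T.Circ) (x : ℝ) : h.liftIso x = T.lift x := rfl

end Circ

/-- The logarithm of the right derivative. -/
noncomputable def logD (T : PIET n 𝒜) (x : ℝ) : ℝ :=
  ∑ α, (Set.Ico (T.topLeft α) (T.topRight α)).indicator (lderiv (T.branch α)) x

theorem logD_eq (T : PIET n 𝒜) {α : 𝒜} {x : ℝ}
    (hx : x ∈ Set.Ico (T.topLeft α) (T.topRight α)) : T.logD x = lderiv (T.branch α) x := by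
  classical
  unfold logD
  rw [Finset.sum_eq_single α]
  · exact Set.indicator_of_mem hx _
  · intro β _ hβ
    exact Set.indicator_of_notMem (fun h => hβ (T.mem_top_unique h hx)) _
  · simp

theorem map_hasDerivWithinAt (T : PIET n 𝒜) {x : ℝ} (hx : x ∈ Set.Ico T.lo T.hi) :
    HasDerivWithinAt T.map (Real.exp (T.logD x)) (Set.Ici x) x := by
  obtain ⟨α, hα⟩ := T.exists_mem_top hx
  have h1 := T.den_ne (Set.Ico_subset_Icc_self hα)
  have h2 := (hasDerivAt_moebius (T.branch α) h1).hasDerivWithinAt (s := Set.Ici x)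
  rw [← deriv_moebius _ h1, deriv_eq_exp_lderiv _ h1, ← T.logD_eq hα] at h2
  refine h2.congr_of_eventuallyEq ?_ (T.map_eq hα)
  filter_upwards [Ico_mem_nhdsGE hα.2] with z hz
  exact T.map_eq ⟨hα.1.trans hz.1, hz.2⟩

theorem Circ.lift_hasDerivWithinAt {T : PIET n 𝒜} (h : T.Circ) (x : ℝ) :
    HasDerivWithinAt T.lift (Real.exp (T.logD (Int.fract x))) (Set.Ici x) x := by
  have key : ∀ y ∈ Set.Ico (0 : ℝ) 1,
      HasDerivWithinAt T.lift (Real.exp (T.logD y)) (Set.Ici y) y := by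
    intro y hy
    have h2 := T.map_hasDerivWithinAt (h.mem_iff.mpr hy)
    rcases lt_or_ge y T.groupTop with hlt | hge
    · refine h2.congr_of_eventuallyEq ?_ (h.lift_eq_of_lt hy.1 hlt)
      filter_upwards [Ico_mem_nhdsGE hlt] with z hz
      exact h.lift_eq_of_lt (hy.1.trans hz.1) hz.2
    · refine (h2.add_const 1).congr_of_eventuallyEq ?_ (h.lift_eq_of_ge hge hy.2)
      filter_upwards [Ico_mem_nhdsGE hy.2] with z hz
      exact h.lift_eq_of_ge (hge.trans hz.1) hz.2
  have h1 := key _ (fract_mem x)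
  have h3 : T.lift = fun z => T.lift (z - ⌊x⌋) + ⌊x⌋ := by
    ext z
    have := lift_add_int (T := T) (z - ⌊x⌋) ⌊x⌋
    rw [sub_add_cancel] at this
    exact this
  rw [h3]
  refine HasDerivWithinAt.add_const _ ?_
  have h4 : HasDerivWithinAt (fun z : ℝ => z - ⌊x⌋) 1 (Set.Ici x) x :=
    (hasDerivWithinAt_id x _).sub_const _
  have h5 := HasDerivWithinAt.comp x (s' := Set.Ici (Int.fract x)) (h₂ := T.lift)
    (h := fun z : ℝ => z - ⌊x⌋) h1 h4 (fun z hz => by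
      change Int.fract x ≤ z - ⌊x⌋
      rw [← Int.self_sub_floor]
      exact sub_le_sub_right hz _)
  rw [mul_one] at h5
  exact h5

/-! ### First returns of first returns -/

theorem IsFirstReturn.trans {f f₁ : ℝ → ℝ} {φ : ℝ → ℝ} {I J : Set ℝ}
    (hJ : J ⊆ I) (hφ : Function.Injective φ)
    (h : ∀ y ∈ I, IsFirstReturn f (φ '' I) (φ y) (φ (f₁ y))) {y z : ℝ} (hy : y ∈ I)
    (hz : IsFirstReturn f₁ J y z) : IsFirstReturn f (φ '' J) (φ y) (φ z) := by
  obtain ⟨m, hm, hmz, hzJ, hm'⟩ := hz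
  induction m generalizing y with
  | zero => omega
  | succ m ih =>
    obtain ⟨k, hk, hkz, hkI, hk'⟩ := h y hy
    have hyI : f₁ y ∈ I := by
      obtain ⟨w, hw, hw'⟩ := hkI
      rwa [← hφ hw']
    rcases Nat.eq_zero_or_pos m with rfl | hm0
    · refine ⟨k, hk, by rw [hkz]; exact congrArg φ hmz, ⟨z, hzJ, rfl⟩, fun i hi hi' hc => ?_⟩
      exact hk' i hi hi' (Set.image_mono hJ hc)
    · obtain ⟨k₁, hk₁, hkz₁, hkJ₁, hk₁'⟩ := ih hyI hm0 (by
        rw [← hmz, Function.iterate_succ_apply]) (fun i hi hi' => by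
        have := hm' (i + 1) (by omega) (by omega)
        rwa [Function.iterate_succ_apply] at this)
      refine ⟨k₁ + k, by omega, ?_, hkJ₁, fun i hi hi' => ?_⟩
      · rw [Function.iterate_add_apply, hkz, hkz₁]
      · rcases lt_trichotomy i k with hlt | rfl | hgt
        · exact fun hc => hk' i hi hlt (Set.image_mono hJ hc)
        · rw [hkz]
          rintro ⟨w, hw, hw'⟩
          have := hm' 1 one_pos (by omega)
          rw [Function.iterate_one, ← hφ hw'] at this
          exact this hw
        · have := hk₁' (i - k) (by omega) (by omega)
          rwa [← hkz, ← Function.iterate_add_apply, Nat.sub_add_cancel hgt.le] at this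

variable [DecidableEq 𝒜]

theorem affine_image_Ico (a ℓ : ℝ) (hℓ : 0 < ℓ) (c : ℝ) :
    (fun y : ℝ => a + ℓ * y) '' Set.Ico 0 c = Set.Ico a (a + ℓ * c) := by
  ext x
  constructor
  · rintro ⟨y, hy, rfl⟩
    exact ⟨by nlinarith [hy.1], by nlinarith [hy.2]⟩
  · intro hx
    refine ⟨(x - a) / ℓ, ⟨div_nonneg (by linarith [hx.1]) hℓ.le, ?_⟩, ?_⟩
    · rw [div_lt_iff₀ hℓ]; linarith [hx.2]
    · simp only []
      rw [mul_div_cancel₀ _ hℓ.ne']; ring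

theorem RauzyChain.first_return {T T' : PIET n 𝒜} {ℓ : ℝ} (h : RauzyChain T ℓ T') :
    ∀ y ∈ Set.Ico (0 : ℝ) 1, IsFirstReturn T.map (Set.Ico T.lo (T.lo + ℓ)) (T.lo + ℓ * y)
      (T.lo + ℓ * T'.map y) := by
  induction h with
  | single h =>
    intro y hy
    have := h.first_return y hy
    rwa [add_sub_cancel]
  | @cons T T₁ T' ℓ h h' ih =>
    intro y hy
    have hpos := cut_sub_lo_pos h.cut_ne
    obtain ⟨h0, h1⟩ := h'.lt_one h.lo_eq h.hi_eq
    have h2 := ih y hy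
    rw [h.lo_eq, zero_add, zero_add, zero_add] at h2
    have h3 := IsFirstReturn.trans (f := T.map) (φ := fun y : ℝ => T.lo + (T.cut - T.lo) * y)
      (I := Set.Ico 0 1) (J := Set.Ico 0 ℓ) (Set.Ico_subset_Ico_right h1.le)
      (fun x y hxy => mul_left_cancel₀ hpos.ne' (add_left_cancel hxy))
      (fun y hy => by
        rw [affine_image_Ico _ _ hpos, mul_one, add_sub_cancel]
        exact h.first_return y hy)
      ⟨by nlinarith [hy.1], by nlinarith [hy.2]⟩ h2
    rw [affine_image_Ico _ _ hpos] at h3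
    simpa only [mul_assoc] using h3

/-! ### A step for two groups -/

section GroupStep

variable {T T' : PIET n 𝒜}

theorem Circ.groupStep_top (h : T.Circ) (h' : T'.Circ) (hs : GroupStep T T')
    (hw : T.groupTop < T.groupBot) :
    T.groupBot * T'.groupTop = T.groupTop ∧
    (∀ y ∈ Set.Ico 0 T'.groupTop, T.groupBot * T'.map y = T.map (T.map (T.groupBot * y))) ∧
    ∀ y ∈ Set.Ico T'.groupTop 1, T.groupBot * T'.map y = T.map (T.groupBot * y) := by
  have hq := h.groupBot_pos
  have hq1 := h.groupBot_lt_one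
  unfold GroupStep at hs
  rw [max_eq_right hw.le, h.lo, sub_zero] at hs
  have hfr := hs.first_return
  simp only [h.lo, zero_add] at hfr
  have hm : ∀ y ∈ Set.Ico (0 : ℝ) 1, T.groupBot * y ∈ Set.Ico 0 T.groupBot := fun y hy =>
    ⟨mul_nonneg hq.le hy.1, by nlinarith [hy.2]⟩
  have hm1 : ∀ y ∈ Set.Ico (0 : ℝ) 1, T.groupBot * y ∈ Set.Ico (0 : ℝ) 1 := fun y hy =>
    ⟨(hm y hy).1, (hm y hy).2.trans hq1⟩
  have hA : ∀ y ∈ Set.Ico (0 : ℝ) 1, T.groupBot * y < T.groupTop →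
      T.groupBot * T'.map y = T.map (T.map (T.groupBot * y)) := by
    intro y hy hlt
    refine (hfr y hy).unique ?_
    have h1 := (h.lt_groupTop_iff_le_map (hm1 y hy)).mp hlt
    have h2 := h.map_mem (hm1 y hy)
    have h3 := h.map_mem h2
    have h4 : T.map (T.map (T.groupBot * y)) < T.groupBot := by
      rw [← not_le, ← h.lt_groupTop_iff_le_map h2]
      linarith
    refine ⟨2, two_pos, rfl, ⟨h3.1, h4⟩, fun k hk hk' => ?_⟩
    obtain rfl : k = 1 := by omega
    exact fun hc => absurd hc.2 (not_lt.mpr h1)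
  have hC : ∀ y ∈ Set.Ico (0 : ℝ) 1, T.groupTop ≤ T.groupBot * y →
      T.groupBot * T'.map y = T.map (T.groupBot * y) := by
    intro y hy hge
    refine (hfr y hy).unique ?_
    have h2 := h.map_mem (hm1 y hy)
    have h4 : T.map (T.groupBot * y) < T.groupBot := by
      rw [← not_le, ← h.lt_groupTop_iff_le_map (hm1 y hy)]
      linarith
    exact ⟨1, one_pos, rfl, ⟨h2.1, h4⟩, fun k hk hk' => by omega⟩
  have hp : T.groupBot * T'.groupTop = T.groupTop := by
    have hy : T.groupTop / T.groupBot ∈ Set.Ico (0 : ℝ) 1 :=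
      ⟨div_nonneg h.groupTop_pos.le hq.le, by rwa [div_lt_one hq]⟩
    have hmul : T.groupBot * (T.groupTop / T.groupBot) = T.groupTop := mul_div_cancel₀ _ hq.ne'
    have h1 := hC _ hy hmul.ge
    rw [hmul, h.map_groupTop] at h1
    have h2 : T'.map (T.groupTop / T.groupBot) = 0 := by
      rcases mul_eq_zero.mp h1 with h3 | h3
      · exact absurd h3 hq.ne'
      · exact h3
    have h3 : T'.groupTop = T.groupTop / T.groupBot :=
      h'.map_inj ⟨h'.groupTop_pos.le, h'.groupTop_lt_one⟩ hy (by rw [h'.map_groupTop, h2])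
    rw [h3, hmul]
  refine ⟨hp, fun y hy => ?_, fun y hy => ?_⟩
  · refine hA y ⟨hy.1, hy.2.trans h'.groupTop_lt_one⟩ ?_
    rw [← hp]
    exact mul_lt_mul_of_pos_left hy.2 hq
  · refine hC y ⟨h'.groupTop_pos.le.trans hy.1, hy.2⟩ ?_
    rw [← hp]
    exact mul_le_mul_of_nonneg_left hy.1 hq.le

theorem Circ.groupStep_bot (h : T.Circ) (h' : T'.Circ) (hs : GroupStep T T')
    (hw : T.groupBot < T.groupTop) :
    T.map (T.groupTop * T'.groupTop) = T.groupTop ∧ T.groupTop * T'.groupBot = T.groupBot ∧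
    (∀ y ∈ Set.Ico 0 T'.groupTop, T.groupTop * T'.map y = T.map (T.groupTop * y)) ∧
    ∀ y ∈ Set.Ico T'.groupTop 1, T.groupTop * T'.map y = T.map (T.map (T.groupTop * y)) := by
  have hp := h.groupTop_pos
  have hp1 := h.groupTop_lt_one
  unfold GroupStep at hs
  rw [max_eq_left hw.le, h.lo, sub_zero] at hs
  have hfr := hs.first_return
  simp only [h.lo, zero_add] at hfr
  have hm : ∀ y ∈ Set.Ico (0 : ℝ) 1, T.groupTop * y ∈ Set.Ico 0 T.groupTop := fun y hy =>
    ⟨mul_nonneg hp.le hy.1, by nlinarith [hy.2]⟩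
  have hm1 : ∀ y ∈ Set.Ico (0 : ℝ) 1, T.groupTop * y ∈ Set.Ico (0 : ℝ) 1 := fun y hy =>
    ⟨(hm y hy).1, (hm y hy).2.trans hp1⟩
  have hA : ∀ y ∈ Set.Ico (0 : ℝ) 1, T.map (T.groupTop * y) < T.groupTop →
      T.groupTop * T'.map y = T.map (T.groupTop * y) := by
    intro y hy hlt
    refine (hfr y hy).unique ?_
    exact ⟨1, one_pos, rfl, ⟨(h.map_mem (hm1 y hy)).1, hlt⟩, fun k hk hk' => by omega⟩
  have hC : ∀ y ∈ Set.Ico (0 : ℝ) 1, T.groupTop ≤ T.map (T.groupTop * y) →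
      T.groupTop * T'.map y = T.map (T.map (T.groupTop * y)) := by
    intro y hy hge
    refine (hfr y hy).unique ?_
    have h2 := h.map_mem (hm1 y hy)
    have h3 := h.map_mem h2
    have h4 : T.map (T.map (T.groupTop * y)) < T.groupBot := by
      rw [← not_le, ← h.lt_groupTop_iff_le_map h2]
      linarith
    refine ⟨2, two_pos, rfl, ⟨h3.1, h4.trans hw⟩, fun k hk hk' => ?_⟩
    obtain rfl : k = 1 := by omega
    exact fun hc => absurd hc.2 (not_lt.mpr hge)
  have hy0 : T'.groupTop ∈ Set.Ico (0 : ℝ) 1 := ⟨h'.groupTop_pos.le, h'.groupTop_lt_one⟩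
  have hsplit : T.map (T.groupTop * T'.groupTop) = T.groupTop := by
    rcases lt_or_ge (T.map (T.groupTop * T'.groupTop)) T.groupTop with hlt | hge
    · exfalso
      have h1 := hA _ hy0 hlt
      rw [h'.map_groupTop, mul_zero] at h1
      have h2 := (h.lt_groupTop_iff_le_map (hm1 _ hy0)).mp (hm _ hy0).2
      linarith [h.groupBot_pos]
    · have h1 := hC _ hy0 hge
      rw [h'.map_groupTop, mul_zero] at h1
      exact h.map_inj (h.map_mem (hm1 _ hy0)) ⟨hp.le, hp1⟩ (by rw [h.map_groupTop, ← h1])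
  have hA' : ∀ y ∈ Set.Ico 0 T'.groupTop, T.groupTop * T'.map y = T.map (T.groupTop * y) := by
    intro y hy
    have hy1 : y ∈ Set.Ico (0 : ℝ) 1 := ⟨hy.1, hy.2.trans h'.groupTop_lt_one⟩
    refine hA y hy1 ?_
    exact (h.strictMonoOn_aux (hm1 _ hy1) (hm1 _ hy0) (mul_lt_mul_of_pos_left hy.2 hp)
      (iff_of_true (hm _ hy1).2 (hm _ hy0).2)).trans_eq hsplit
  refine ⟨hsplit, ?_, hA', fun y hy => ?_⟩
  · have := hA' 0 ⟨le_rfl, h'.groupTop_pos⟩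
    rwa [h'.map_zero, mul_zero, h.map_zero] at this
  · have hy1 : y ∈ Set.Ico (0 : ℝ) 1 := ⟨h'.groupTop_pos.le.trans hy.1, hy.2⟩
    refine hC y hy1 ?_
    rcases hy.1.eq_or_lt with he | hlt
    · rw [← he, hsplit]
    · exact (hsplit.symm.trans_lt (h.strictMonoOn_aux (hm1 _ hy0) (hm1 _ hy1)
        (mul_lt_mul_of_pos_left hlt hp) (iff_of_true (hm _ hy0).2 (hm _ hy1).2))).le

end GroupStep

end PIET

namespace PIET

variable {n : ℕ} {𝒜 : Type*} [Fintype 𝒜]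

/-! ### Quasi-periodic functions adapted to a partition -/

/-- The function of the line whose increment over a period is `∑ α, w α`, which increases by `w α`
across the top interval of `α`, and whose value there is given by `u α` up to a constant. -/
noncomputable def accum (T : PIET n 𝒜) (w : 𝒜 → ℝ) (u : 𝒜 → ℝ → ℝ) (x : ℝ) : ℝ :=
  ∑ α, (Set.Ico (T.topLeft α) (T.topRight α)).indicator
    (fun z => partLeft T.perm.top w 0 α + u α z) (Int.fract x) + (∑ α, w α) * ⌊x⌋

section accum

variable {T : PIET n 𝒜} {w w' : 𝒜 → ℝ} {u u' : 𝒜 → ℝ → ℝ}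

theorem accum_eq {α : 𝒜} {x : ℝ}
    (hx : Int.fract x ∈ Set.Ico (T.topLeft α) (T.topRight α)) :
    T.accum w u x = partLeft T.perm.top w 0 α + u α (Int.fract x) + (∑ α, w α) * ⌊x⌋ := by
  classical
  unfold accum
  rw [Finset.sum_eq_single α]
  · rw [Set.indicator_of_mem hx]
  · intro β _ hβ
    exact Set.indicator_of_notMem (fun h => hβ (T.mem_top_unique h hx)) _
  · simp

theorem accum_add_int (x : ℝ) (k : ℤ) : T.accum w u (x + k) = T.accum w u x + (∑ α, w α) * k := by
  unfold accum
  rw [Int.fract_add_intCast, Int.floor_add_intCast]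
  push_cast
  ring

theorem Circ.exists_letter (h : T.Circ) (x : ℝ) :
    ∃ α, Int.fract x ∈ Set.Ico (T.topLeft α) (T.topRight α) :=
  T.exists_mem_top (h.mem_iff.mpr (fract_mem x))

theorem partLeft_add (p : Fin (n + 1) ≃ 𝒜) (w w' : 𝒜 → ℝ) (α : 𝒜) :
    partLeft p (fun γ => w γ + w' γ) 0 α = partLeft p w 0 α + partLeft p w' 0 α := by
  unfold partLeft
  rw [Finset.sum_add_distrib]
  ring

theorem partLeft_sub (p : Fin (n + 1) ≃ 𝒜) (w w' : 𝒜 → ℝ) (α : 𝒜) :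
    partLeft p (fun γ => w γ - w' γ) 0 α = partLeft p w 0 α - partLeft p w' 0 α := by
  unfold partLeft
  rw [Finset.sum_sub_distrib]
  ring

theorem Circ.accum_add (h : T.Circ) (x : ℝ) :
    T.accum (fun α => w α + w' α) (fun α z => u α z + u' α z) x =
      T.accum w u x + T.accum w' u' x := by
  obtain ⟨α, hα⟩ := h.exists_letter x
  rw [accum_eq hα, accum_eq hα, accum_eq hα, partLeft_add, Finset.sum_add_distrib]
  ring

theorem Circ.accum_sub (h : T.Circ) (x : ℝ) :
    T.accum (fun α => w α - w' α) (fun α z => u α z - u' α z) x =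
      T.accum w u x - T.accum w' u' x := by
  obtain ⟨α, hα⟩ := h.exists_letter x
  rw [accum_eq hα, accum_eq hα, accum_eq hα, partLeft_sub, Finset.sum_sub_distrib]
  ring

theorem Circ.accum_monotone (h : T.Circ)
    (hu : ∀ α, MonotoneOn (u α) (Set.Icc (T.topLeft α) (T.topRight α)))
    (h0 : ∀ α, 0 ≤ u α (T.topLeft α)) (h1 : ∀ α, u α (T.topRight α) ≤ w α) :
    Monotone (T.accum w u) := by
  have hb : ∀ α, ∀ z ∈ Set.Ico (T.topLeft α) (T.topRight α), 0 ≤ u α z ∧ u α z ≤ w α :=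
    fun α z hz =>
      ⟨(h0 α).trans (hu α (T.left_mem α) (Set.Ico_subset_Icc_self hz) hz.1),
        (hu α (Set.Ico_subset_Icc_self hz) (T.right_mem α) hz.2.le).trans (h1 α)⟩
  have hw : ∀ α, 0 ≤ w α := fun α =>
    (hb α _ ⟨le_rfl, T.topLeft_lt_topRight α⟩).1.trans (hb α _ ⟨le_rfl, T.topLeft_lt_topRight α⟩).2
  intro x y hxy
  obtain ⟨α, hα⟩ := h.exists_letter x
  obtain ⟨β, hβ⟩ := h.exists_letter y
  rw [accum_eq hα, accum_eq hβ]
  rcases (Int.floor_le_floor hxy).lt_or_eq with hlt | heq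
  · have e1 := partRight_le (p := T.perm.top) (lo := 0) hw α
    have e2 := le_partLeft (p := T.perm.top) (lo := 0) hw β
    have e3 : (⌊x⌋ : ℝ) + 1 ≤ ⌊y⌋ := by exact_mod_cast hlt
    have e4 : 0 ≤ ∑ α, w α := Finset.sum_nonneg fun α _ => hw α
    have e5 := (hb α _ hα).2
    have e6 := (hb β _ hβ).1
    nlinarith
  · have hf : Int.fract x ≤ Int.fract y := by
      have : (⌊x⌋ : ℝ) = ⌊y⌋ := by rw [heq]
      have := Int.fract_add_floor x
      have := Int.fract_add_floor y
      linarith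
    rw [heq]
    gcongr ?_ + _
    rcases lt_trichotomy (T.perm.top.symm α : ℕ) (T.perm.top.symm β) with hlt | he | hlt
    · have e1 := partLeft_right_le (p := T.perm.top) (lo := 0) hw hlt
      linarith [(hb α _ hα).2, (hb β _ hβ).1]
    · obtain rfl := MarkedPerm.Blocks.eq_of_pos he
      gcongr
      exact hu α (Set.Ico_subset_Icc_self hα) (Set.Ico_subset_Icc_self hβ) hf
    · exfalso
      have := T.topRight_le_topLeft hlt
      linarith [hα.1, hβ.2]

theorem Circ.accum_continuous (h : T.Circ)
    (hu : ∀ α, ContinuousOn (u α) (Set.Icc (T.topLeft α) (T.topRight α)))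
    (h0 : ∀ α, u α (T.topLeft α) = 0) (h1 : ∀ α, u α (T.topRight α) = w α) :
    Continuous (T.accum w u) := by
  classical
  set F : ℝ → ℝ := fun x => ∑ α, (u α (max (T.topLeft α) (min x (T.topRight α)))) with hF
  have hFc : Continuous F := by
    refine continuous_finsetSum _ fun α _ => ?_
    refine (hu α).comp_continuous (by fun_prop) fun x => ⟨le_max_left _ _, ?_⟩
    exact max_le (T.topLeft_lt_topRight α).le (min_le_right _ _)
  have hle : ∀ α (z : ℝ), z ≤ T.topLeft α →
      u α (max (T.topLeft α) (min z (T.topRight α))) = 0 := by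
    intro α z hz
    rw [min_eq_left (hz.trans (T.topLeft_lt_topRight α).le), max_eq_left hz, h0]
  have hge : ∀ α (z : ℝ), T.topRight α ≤ z →
      u α (max (T.topLeft α) (min z (T.topRight α))) = w α := by
    intro α z hz
    rw [min_eq_right hz, max_eq_right (T.topLeft_lt_topRight α).le, h1]
  have hFe : ∀ α, ∀ z ∈ Set.Ico (T.topLeft α) (T.topRight α),
      F z = partLeft T.perm.top w 0 α + u α z := by
    intro α z hz
    have : ∀ β, u β (max (T.topLeft β) (min z (T.topRight β))) =
        (if T.perm.top.symm β < T.perm.top.symm α then w β else 0) +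
          if β = α then u α z else 0 := by
      intro β
      rcases lt_trichotomy (T.perm.top.symm β : ℕ) (T.perm.top.symm α) with hlt | he | hlt
      · rw [hge β z ((T.topRight_le_topLeft hlt).trans hz.1), if_pos (Fin.lt_def.mpr hlt), if_neg, add_zero]
        rintro rfl; exact lt_irrefl _ hlt
      · obtain rfl := MarkedPerm.Blocks.eq_of_pos he
        rw [min_eq_left hz.2.le, max_eq_right hz.1, if_neg (lt_irrefl _), if_pos rfl, zero_add]
      · rw [hle β z (hz.2.le.trans (T.topRight_le_topLeft hlt)), if_neg, if_neg, add_zero]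
        · rintro rfl; exact lt_irrefl _ hlt
        · exact not_lt.mpr (Fin.le_def.mpr hlt.le)
    simp only [hF, this, Finset.sum_add_distrib, Finset.sum_ite_eq', Finset.mem_univ, if_true]
    unfold partLeft
    rw [Finset.sum_filter, zero_add]
  have hF0 : F 0 = 0 := Finset.sum_eq_zero fun α _ => hle α 0 (by
    have := T.lo_le_topLeft α; rwa [h.lo] at this)
  have hF1 : F 1 = ∑ α, w α := Finset.sum_congr rfl fun α _ => hge α 1 (by
    have := T.topRight_le_hi α; rwa [h.hi] at this)
  have hc : Continuous ((fun x => F x - (∑ α, w α) * x) ∘ Int.fract) :=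
    ContinuousOn.comp_fract'' (by fun_prop) (by rw [hF0, hF1]; ring)
  have he : T.accum w u = fun x =>
      ((fun x => F x - (∑ α, w α) * x) ∘ Int.fract) x + (∑ α, w α) * x := by
    ext x
    obtain ⟨α, hα⟩ := h.exists_letter x
    rw [accum_eq hα]
    simp only [Function.comp_apply]
    rw [hFe α _ hα]
    have := Int.fract_add_floor x
    linear_combination (∑ α, w α) * this
  rw [he]
  fun_prop

theorem Circ.abs_accum_sub_le (h : T.Circ)
    (hu : ∀ α, ∀ x ∈ Set.Icc (T.topLeft α) (T.topRight α),
      ∀ y ∈ Set.Icc (T.topLeft α) (T.topRight α), x ≤ y → |u α y - u α x| ≤ u' α y - u' α x)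
    (h0 : ∀ α, |u α (T.topLeft α)| ≤ u' α (T.topLeft α))
    (h1 : ∀ α, |w α - u α (T.topRight α)| ≤ w' α - u' α (T.topRight α)) {x y : ℝ} (hxy : x ≤ y) :
    |T.accum w u y - T.accum w u x| ≤ T.accum w' u' y - T.accum w' u' x := by
  have m1 := h.accum_monotone (w := fun α => w' α + w α) (u := fun α z => u' α z + u α z)
    (fun α x hx y hy hxy => by
      have := abs_le.mp (hu α x hx y hy hxy); simp only []; linarith)
    (fun α => by have := abs_le.mp (h0 α); linarith)
    (fun α => by have := abs_le.mp (h1 α); linarith) hxy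
  have m2 := h.accum_monotone (w := fun α => w' α - w α) (u := fun α z => u' α z - u α z)
    (fun α x hx y hy hxy => by
      have := abs_le.mp (hu α x hx y hy hxy); simp only []; linarith)
    (fun α => by have := abs_le.mp (h0 α); linarith)
    (fun α => by have := abs_le.mp (h1 α); linarith) hxy
  rw [h.accum_add, h.accum_add] at m1
  rw [h.accum_sub, h.accum_sub] at m2
  rw [abs_le]
  constructor <;> linarith

end accum

/-! ### The derivative -/

/-- The jump of the logarithm of the derivative at the right end of an interval, cyclically. -/
noncomputable def jump (T : PIET n 𝒜) (γ : 𝒜) : ℝ :=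
  T.dL (T.perm.top (T.perm.top.symm γ + 1)) - T.dR γ

theorem partLeft_nonlin_add_jump (T : PIET n 𝒜) (γ : 𝒜) :
    partLeft T.perm.top (fun γ => T.nonlin γ + T.jump γ) 0 γ = T.dL γ - T.dL (T.perm.top 0) := by
  have key : ∀ k : ℕ, ∀ γ, (T.perm.top.symm γ : ℕ) = k →
      partLeft T.perm.top (fun γ => T.nonlin γ + T.jump γ) 0 γ =
        T.dL γ - T.dL (T.perm.top 0) := by
    intro k
    induction k with
    | zero =>
      intro γ hγ
      rw [partLeft_first hγ]
      have : γ = T.perm.top 0 := by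
        rw [← Equiv.symm_apply_eq]; exact Fin.ext hγ
      rw [this, sub_self]
    | succ k ih =>
      intro γ hγ
      have hk : k < n + 1 := by have := (T.perm.top.symm γ).isLt; omega
      have h1 := ih (T.perm.top ⟨k, hk⟩) (by simp)
      rw [partLeft_next (α := T.perm.top ⟨k, hk⟩) (by simp [hγ]), h1]
      have h2 : T.perm.top (T.perm.top.symm (T.perm.top ⟨k, hk⟩) + 1) = γ := by
        rw [Equiv.symm_apply_apply, ← Equiv.eq_symm_apply]
        ext
        rw [Fin.val_add_one_of_lt (by rw [Fin.lt_def, Fin.val_last]; simp only []; omega), hγ]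
      simp only [jump, h2, nonlin]
      ring
  exact key _ γ rfl

theorem sum_nonlin_add_jump (T : PIET n 𝒜) : ∑ γ, (T.nonlin γ + T.jump γ) = 0 := by
  have h1 := partLeft_last (p := T.perm.top) (len := fun γ => T.nonlin γ + T.jump γ) (lo := 0)
    (α := T.perm.top (Fin.last n)) (by simp)
  rw [partLeft_nonlin_add_jump] at h1
  have h2 : T.perm.top (T.perm.top.symm (T.perm.top (Fin.last n)) + 1) = T.perm.top 0 := by
    rw [Equiv.symm_apply_apply, Fin.last_add_one]
  simp only [jump, h2, nonlin, zero_add] at h1 ⊢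
  rw [← h1]
  ring

theorem Circ.logD_fract {T : PIET n 𝒜} (h : T.Circ) (x : ℝ) :
    T.logD (Int.fract x) = T.dL (T.perm.top 0) +
      T.accum (fun γ => T.nonlin γ + T.jump γ) (fun γ z => lderiv (T.branch γ) z - T.dL γ) x := by
  obtain ⟨α, hα⟩ := h.exists_letter x
  rw [accum_eq hα, partLeft_nonlin_add_jump, sum_nonlin_add_jump, T.logD_eq hα]
  ring

theorem abs_lderiv_sub_le (T : PIET n 𝒜) {γ : 𝒜} {x y : ℝ}
    (hx : x ∈ Set.Icc (T.topLeft γ) (T.topRight γ)) (hy : y ∈ Set.Icc (T.topLeft γ) (T.topRight γ))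
    (hxy : x ≤ y) :
    |lderiv (T.branch γ) y - lderiv (T.branch γ) x| =
      |lderiv (T.branch γ) y - T.dL γ| - |lderiv (T.branch γ) x - T.dL γ| := by
  rw [eq_sub_iff_add_eq', dL]
  exact abs_lderiv_add (fun z hz => T.den_ne hz) hx.1 hxy hy.2

/-- The total variation of the logarithm of the derivative along the line. -/
noncomputable def variation (T : PIET n 𝒜) (κ : 𝒜 → ℝ) : ℝ → ℝ :=
  T.accum (fun γ => |T.nonlin γ| + |T.jump γ - κ γ|) fun γ z => |lderiv (T.branch γ) z - T.dL γ|

theorem Circ.abs_accum_le_variation {T : PIET n 𝒜} (h : T.Circ) (κ : 𝒜 → ℝ) {x y : ℝ}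
    (hxy : x ≤ y) :
    |T.accum (fun γ => T.nonlin γ + T.jump γ - κ γ) (fun γ z => lderiv (T.branch γ) z - T.dL γ) y -
      T.accum (fun γ => T.nonlin γ + T.jump γ - κ γ) (fun γ z => lderiv (T.branch γ) z - T.dL γ) x|
      ≤ T.variation κ y - T.variation κ x := by
  refine h.abs_accum_sub_le (fun α x hx y hy hxy => ?_) (fun α => ?_) (fun α => ?_) hxy
  · rw [sub_sub_sub_cancel_right, T.abs_lderiv_sub_le hx hy hxy]
  · simp
  · change |T.nonlin α + T.jump α - κ α - T.nonlin α| ≤ |T.nonlin α| + |T.jump α - κ α| - |T.nonlin α|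
    rw [add_sub_assoc, add_sub_cancel_left, add_sub_cancel_left]

theorem Circ.variation_monotone {T : PIET n 𝒜} (h : T.Circ) (κ : 𝒜 → ℝ) :
    Monotone (T.variation κ) := by
  refine h.accum_monotone (fun α x hx y hy hxy => ?_) (fun α => abs_nonneg _) fun α => ?_
  · have := T.abs_lderiv_sub_le hx hy hxy
    have := abs_nonneg (lderiv (T.branch α) y - lderiv (T.branch α) x)
    linarith
  · exact le_add_of_nonneg_right (abs_nonneg _)

theorem Circ.abs_logD_le_variation {T : PIET n 𝒜} (h : T.Circ) {x y : ℝ} (hxy : x ≤ y) :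
    |T.logD (Int.fract y) - T.logD (Int.fract x)| ≤ T.variation 0 y - T.variation 0 x := by
  have := h.abs_accum_le_variation 0 hxy
  simp only [Pi.zero_apply, sub_zero] at this
  rw [h.logD_fract, h.logD_fract, add_sub_add_left_eq_sub]
  exact this

theorem logBreak_eq {T : PIET n 𝒜} {t : ℕ} (hb : T.perm.Blocks t t) {γ : 𝒜}
    (h1 : (T.perm.top.symm γ : ℕ) ≠ n) (h2 : (T.perm.top.symm γ : ℕ) + 1 ≠ t) :
    T.logBreak t t (T.perm.top.symm γ + 1) = T.jump γ := by
  classical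
  have hP := (T.perm.top.symm γ).isLt
  set δ := T.perm.top (T.perm.top.symm γ + 1) with hδ
  have hδP : (T.perm.top.symm δ : ℕ) = T.perm.top.symm γ + 1 := by
    rw [hδ, Equiv.symm_apply_apply, Fin.val_add_one_of_lt]
    rw [Fin.lt_def, Fin.val_last]; omega
  unfold logBreak
  rw [Finset.sum_sub_distrib, Finset.sum_eq_single δ, Finset.sum_eq_single γ]
  · have e1 : MarkedPerm.pointIndex n t t (T.perm.top.symm γ + 1) = T.perm.top.symm γ + 1 :=
      MarkedPerm.Blocks.pointIndex_self (Nat.succ_pos _) (by omega)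
    rw [if_pos (by rw [hδP, e1]), if_pos e1]
    rfl
  · intro β _ hβ
    rw [if_neg]
    intro hc
    have hP' := (T.perm.top.symm β).isLt
    apply hβ
    apply MarkedPerm.Blocks.eq_of_pos (σ := T.perm)
    unfold MarkedPerm.pointIndex at hc
    split_ifs at hc <;> omega
  · simp
  · intro β _ hβ
    rw [if_neg]
    intro hc
    have hP' := (T.perm.top.symm β).isLt
    apply hβ
    apply MarkedPerm.Blocks.eq_of_pos (σ := T.perm)
    unfold MarkedPerm.pointIndex at hc
    split_ifs at hc <;> omega
  · simp

/-- The variation of the logarithm of the derivative, apart from the singularities of the exchange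
of two groups. -/
noncomputable def groupVar (T : PIET n 𝒜) (c : Fin n → ℝ) : ℝ :=
  T.totalNonlin + ∑ i, |Real.log (c i)|

/-- The jumps at the singularities of the exchange of two groups. -/
noncomputable def groupJump (T : PIET n 𝒜) (t : ℕ) (γ : 𝒜) : ℝ :=
  if (T.perm.top.symm γ : ℕ) + 1 = t ∨ (T.perm.top.symm γ : ℕ) = n then T.jump γ else 0

theorem sum_abs_jump_sub_le {T : PIET n 𝒜} {t : ℕ} (hb : T.perm.Blocks t t) {c : Fin n → ℝ}
    (hc : T.HasBreaks c) :
    ∑ γ, |T.jump γ - T.groupJump t γ| ≤ ∑ i, |Real.log (c i)| := by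
  rw [← hc.sum_abs hb, ← Equiv.sum_comp T.perm.top, Fin.sum_univ_castSucc]
  have e1 : |T.jump (T.perm.top (Fin.last n)) - T.groupJump t (T.perm.top (Fin.last n))| = 0 := by
    unfold groupJump
    rw [if_pos (Or.inr (by simp)), sub_self, abs_zero]
  rw [e1, add_zero]
  refine Finset.sum_le_sum fun i _ => ?_
  have hi : ((T.perm.top.symm (T.perm.top i.castSucc) : Fin (n + 1)) : ℕ) = i := by simp
  unfold groupJump
  rw [hi]
  split_ifs with h1
  · rw [sub_self, abs_zero]; exact abs_nonneg _
  · push Not at h1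
    have := logBreak_eq hb (γ := T.perm.top i.castSucc) (by rw [hi]; exact h1.2)
      (by rw [hi]; exact h1.1)
    rw [hi] at this
    rw [sub_zero, this]

theorem variation_groupJump_total {T : PIET n 𝒜} {t : ℕ} (hb : T.perm.Blocks t t) {c : Fin n → ℝ}
    (hc : T.HasBreaks c) :
    ∑ γ, (|T.nonlin γ| + |T.jump γ - T.groupJump t γ|) ≤ T.groupVar c := by
  rw [Finset.sum_add_distrib]
  exact add_le_add le_rfl (sum_abs_jump_sub_le hb hc)

/-- The oscillation of the logarithm of the derivative on a group of intervals. -/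
theorem Circ.abs_logD_sub_le {T : PIET n 𝒜} (h : T.Circ) {c : Fin n → ℝ} (hc : T.HasBreaks c)
    {x y : ℝ} (hx : x ∈ Set.Ico (0 : ℝ) 1) (hy : y ∈ Set.Ico (0 : ℝ) 1)
    (hs : x < T.groupTop ↔ y < T.groupTop) : |T.logD y - T.logD x| ≤ T.groupVar c := by
  wlog hxy : x ≤ y generalizing x y
  · rw [abs_sub_comm]
    exact this hy hx hs.symm (not_le.mp hxy).le
  obtain ⟨t, hb⟩ := h.blocks
  have h1 := h.abs_accum_le_variation (T.groupJump t) hxy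
  have fx := Int.fract_eq_self.mpr hx
  have fy := Int.fract_eq_self.mpr hy
  have flx : ⌊x⌋ = 0 := Int.floor_eq_zero_iff.mpr hx
  have fly : ⌊y⌋ = 0 := Int.floor_eq_zero_iff.mpr hy
  obtain ⟨α, hα⟩ := T.exists_mem_top (h.mem_iff.mpr hx)
  obtain ⟨β, hβ⟩ := T.exists_mem_top (h.mem_iff.mpr hy)
  have e0 : partLeft T.perm.top (T.groupJump t) 0 α = partLeft T.perm.top (T.groupJump t) 0 β := by
    rw [lt_groupTop_iff hb hα, lt_groupTop_iff hb hβ] at hs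
    have key : ∀ γ, ∀ δ, (T.perm.top.symm γ : ℕ) ≤ T.perm.top.symm δ →
        ((T.perm.top.symm γ : ℕ) < t ↔ (T.perm.top.symm δ : ℕ) < t) →
        partLeft T.perm.top (T.groupJump t) 0 γ = partLeft T.perm.top (T.groupJump t) 0 δ := by
      intro γ δ hγδ ht
      unfold partLeft
      congr 1
      refine Finset.sum_subset (fun ε hε => ?_) (fun ε hε hε' => ?_)
      · rw [Finset.mem_filter] at hε ⊢
        exact ⟨hε.1, lt_of_lt_of_le hε.2 hγδ⟩
      · have h2 := (Finset.mem_filter.mp hε).2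
        have h3 : ¬ T.perm.top.symm ε < T.perm.top.symm γ := fun hc =>
          hε' (Finset.mem_filter.mpr ⟨Finset.mem_univ _, hc⟩)
        rw [Fin.lt_def] at h2 h3
        have := (T.perm.top.symm δ).isLt
        unfold groupJump
        rw [if_neg]
        omega
    rcases le_total (T.perm.top.symm α : ℕ) (T.perm.top.symm β) with hle | hle
    · exact key _ _ hle hs
    · exact (key _ _ hle hs.symm).symm
  have e1 := accum_eq (w := fun γ => T.nonlin γ + T.jump γ - T.groupJump t γ)
    (u := fun γ z => lderiv (T.branch γ) z - T.dL γ) (fx.symm ▸ hα)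
  have e2 := accum_eq (w := fun γ => T.nonlin γ + T.jump γ - T.groupJump t γ)
    (u := fun γ z => lderiv (T.branch γ) z - T.dL γ) (fy.symm ▸ hβ)
  rw [partLeft_sub _ (fun γ => T.nonlin γ + T.jump γ), partLeft_nonlin_add_jump, flx, fx] at e1
  rw [partLeft_sub _ (fun γ => T.nonlin γ + T.jump γ), partLeft_nonlin_add_jump, fly, fy,
    ← e0] at e2
  rw [e1, e2] at h1
  rw [T.logD_eq hα, T.logD_eq hβ]
  refine le_trans (le_of_eq ?_) (h1.trans ?_)
  · congr 1
    push_cast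
    ring
  · have m := h.variation_monotone (T.groupJump t)
    have h2 : T.variation (T.groupJump t) y ≤ T.variation (T.groupJump t) 1 := m hy.2.le
    have h3 : T.variation (T.groupJump t) 0 ≤ T.variation (T.groupJump t) x := m hx.1
    have h4 : T.variation (T.groupJump t) 1 = T.variation (T.groupJump t) 0 +
        ∑ γ, (|T.nonlin γ| + |T.jump γ - T.groupJump t γ|) := by
      have := accum_add_int (T := T) (w := fun γ => |T.nonlin γ| + |T.jump γ - T.groupJump t γ|)
        (u := fun γ z => |lderiv (T.branch γ) z - T.dL γ|) 0 1
      unfold variation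
      rw [Int.cast_one, zero_add, mul_one] at this
      exact this
    have h5 := variation_groupJump_total hb hc
    linarith

end PIET

/-! ### Mean slopes -/

/-- Logarithm of the mean slope. -/
noncomputable def logSlope (G : ℝ → ℝ) (x y : ℝ) : ℝ := Real.log ((G y - G x) / (y - x))

/-- `D` is the logarithm of the right derivative of the increasing map `G`. -/
structure HasLogDeriv (G D : ℝ → ℝ) : Prop where
  mono : StrictMono G
  cont : Continuous G
  deriv : ∀ x, HasDerivWithinAt G (Real.exp (D x)) (Set.Ici x) x

namespace HasLogDeriv

variable {G D : ℝ → ℝ}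

theorem slope_pos (h : HasLogDeriv G D) {x y : ℝ} (hxy : x < y) : 0 < (G y - G x) / (y - x) :=
  div_pos (sub_pos.mpr (h.mono hxy)) (sub_pos.mpr hxy)

theorem exp_logSlope (h : HasLogDeriv G D) {x y : ℝ} (hxy : x < y) :
    Real.exp (logSlope G x y) * (y - x) = G y - G x := by
  rw [logSlope, Real.exp_log (h.slope_pos hxy), div_mul_cancel₀ _ (sub_pos.mpr hxy).ne']

theorem logSlope_le (h : HasLogDeriv G D) {x y M : ℝ} (hxy : x < y)
    (hM : ∀ z ∈ Set.Ico x y, D z ≤ M) : logSlope G x y ≤ M := by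
  rw [logSlope, Real.log_le_iff_le_exp (h.slope_pos hxy), div_le_iff₀ (sub_pos.mpr hxy)]
  have := image_le_of_deriv_right_le_deriv_boundary (f := G) (f' := fun z => Real.exp (D z))
    (a := x) (b := y) (B := fun z => G x + Real.exp M * (z - x)) (B' := fun _ => Real.exp M)
    h.cont.continuousOn (fun z _ => h.deriv z) (by simp) (by fun_prop)
    (fun z _ => by
      have := (((hasDerivWithinAt_id z (Set.Ici z)).sub_const x).const_mul (Real.exp M)).const_add
        (G x)
      rwa [mul_one] at this)
    (fun z hz => Real.exp_le_exp.mpr (hM z hz)) (Set.right_mem_Icc.mpr hxy.le)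
  linarith

theorem le_logSlope (h : HasLogDeriv G D) {x y M : ℝ} (hxy : x < y)
    (hM : ∀ z ∈ Set.Ico x y, M ≤ D z) : M ≤ logSlope G x y := by
  rw [logSlope, Real.le_log_iff_exp_le (h.slope_pos hxy), le_div_iff₀ (sub_pos.mpr hxy)]
  have := image_le_of_deriv_right_le_deriv_boundary (B := G) (B' := fun z => Real.exp (D z))
    (a := x) (b := y) (f := fun z => G x + Real.exp M * (z - x)) (f' := fun _ => Real.exp M)
    (by fun_prop) (fun z _ => by
      have := (((hasDerivWithinAt_id z (Set.Ici z)).sub_const x).const_mul (Real.exp M)).const_add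
        (G x)
      rwa [mul_one] at this) (by simp) h.cont.continuousOn (fun z _ => h.deriv z)
    (fun z hz => Real.exp_le_exp.mpr (hM z hz)) (Set.right_mem_Icc.mpr hxy.le)
  linarith

theorem abs_logSlope_sub_le (h : HasLogDeriv G D) {x y x' y' V : ℝ} (hxy : x < y) (hxy' : x' < y')
    (hV : ∀ z ∈ Set.Ico x y, ∀ z' ∈ Set.Ico x' y', |D z - D z'| ≤ V) :
    |logSlope G x y - logSlope G x' y'| ≤ V := by
  rw [abs_le]
  constructor
  · have : logSlope G x' y' ≤ logSlope G x y + V := h.logSlope_le hxy' fun z' hz' => by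
      have : D z' - V ≤ logSlope G x y := h.le_logSlope hxy fun z hz => by
        linarith [abs_le.mp (hV z hz z' hz')]
      linarith
    linarith
  · have : logSlope G x y ≤ logSlope G x' y' + V := h.logSlope_le hxy fun z hz => by
      have : D z - V ≤ logSlope G x' y' := h.le_logSlope hxy' fun z' hz' => by
        linarith [abs_le.mp (hV z hz z' hz')]
      linarith
    linarith

end HasLogDeriv

namespace PIET

variable {n : ℕ} {𝒜 : Type*} [Fintype 𝒜]

namespace Circ

variable {T T' : PIET n 𝒜}

theorem hasLogDeriv (h : T.Circ) : HasLogDeriv T.lift fun x => T.logD (Int.fract x) :=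
  ⟨h.lift_strictMono, h.liftIso.continuous, h.lift_hasDerivWithinAt⟩

theorem lift_zero (h : T.Circ) : T.lift 0 = T.groupBot := by
  rw [h.lift_eq_of_lt le_rfl h.groupTop_pos, h.map_zero]

theorem lift_one (h : T.Circ) : T.lift 1 = 1 + T.groupBot := by
  have := lift_add_int (T := T) 0 1
  rw [Int.cast_one, zero_add, h.lift_zero] at this
  rw [this, add_comm]

theorem lift_groupTop (h : T.Circ) : T.lift T.groupTop = 1 := by
  rw [h.lift_eq_of_ge le_rfl h.groupTop_lt_one, h.map_groupTop, zero_add]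

theorem lift_mem_of_le (h : T.Circ) {x : ℝ} (hx : x ∈ Set.Icc 0 T.groupTop) :
    T.lift x ∈ Set.Icc T.groupBot 1 := by
  rw [← h.lift_zero, ← h.lift_groupTop]
  exact ⟨h.lift_strictMono.monotone hx.1, h.lift_strictMono.monotone hx.2⟩

variable [DecidableEq 𝒜]

theorem lift_step_top (h : T.Circ) (h' : T'.Circ) (hs : GroupStep T T')
    (hw : T.groupTop < T.groupBot) :
    T.groupBot * T'.groupTop = T.groupTop ∧
    (∀ y ∈ Set.Icc 0 T'.groupTop, T.groupBot * T'.lift y = T.lift (T.lift (T.groupBot * y)) - 1) ∧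
    ∀ y ∈ Set.Icc T'.groupTop 1, T.groupBot * (T'.lift y - 1) = T.lift (T.groupBot * y) - 1 := by
  obtain ⟨h1, h2, h3⟩ := h.groupStep_top h' hs hw
  have hq := h.groupBot_pos
  have hq1 := h.groupBot_lt_one
  have hA : ∀ y ∈ Set.Icc 0 T'.groupTop,
      T.groupBot * T'.lift y = T.lift (T.lift (T.groupBot * y)) - 1 := by
    intro y hy
    rcases hy.2.eq_or_lt with rfl | hlt
    · rw [h1, h.lift_groupTop, h.lift_one, h'.lift_groupTop]; ring
    · have e1 : T.groupBot * y < T.groupTop := by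
        rw [← h1]; exact mul_lt_mul_of_pos_left hlt hq
      have e2 : T.groupBot * y ∈ Set.Ico (0 : ℝ) 1 :=
        ⟨mul_nonneg hq.le hy.1, e1.trans h.groupTop_lt_one⟩
      have e3 := (h.lt_groupTop_iff_le_map e2).mp e1
      rw [h'.lift_eq_of_lt hy.1 hlt, h2 y ⟨hy.1, hlt⟩, h.lift_eq_of_lt e2.1 e1,
        h.lift_eq_of_ge (hw.le.trans e3) (h.map_mem e2).2]
      ring
  refine ⟨h1, hA, fun y hy => ?_⟩
  rcases hy.2.eq_or_lt with rfl | hlt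
  · have := hA 0 ⟨le_rfl, h'.groupTop_pos.le⟩
    rw [h'.lift_zero, mul_zero, h.lift_zero] at this
    rw [h'.lift_one, add_sub_cancel_left, mul_one, this]
  · have e1 : T.groupTop ≤ T.groupBot * y := by
      rw [← h1]; exact mul_le_mul_of_nonneg_left hy.1 hq.le
    rw [h'.lift_eq_of_ge hy.1 hlt, h.lift_eq_of_ge e1 (by nlinarith), add_sub_cancel_right,
      add_sub_cancel_right, h3 y ⟨hy.1, hlt⟩]

theorem lift_step_bot (h : T.Circ) (h' : T'.Circ) (hs : GroupStep T T')
    (hw : T.groupBot < T.groupTop) :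
    T.lift (T.groupTop * T'.groupTop) = T.groupTop ∧ T.groupTop * T'.groupBot = T.groupBot ∧
    (∀ y ∈ Set.Icc 0 T'.groupTop, T.groupTop * T'.lift y = T.lift (T.groupTop * y)) ∧
    ∀ y ∈ Set.Icc T'.groupTop 1,
      T.groupTop * (T'.lift y - 1) = T.lift (T.lift (T.groupTop * y)) - 1 := by
  obtain ⟨h1, h2, h3, h4⟩ := h.groupStep_bot h' hs hw
  have hp := h.groupTop_pos
  have hp1 := h.groupTop_lt_one
  have hm : ∀ y ∈ Set.Ico (0 : ℝ) 1, T.lift (T.groupTop * y) = T.map (T.groupTop * y) :=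
    fun y hy => h.lift_eq_of_lt (mul_nonneg hp.le hy.1) (by nlinarith [hy.2])
  have h0 : T.lift (T.groupTop * T'.groupTop) = T.groupTop := by
    rw [hm _ ⟨h'.groupTop_pos.le, h'.groupTop_lt_one⟩, h1]
  refine ⟨h0, h2, fun y hy => ?_, fun y hy => ?_⟩
  · rcases hy.2.eq_or_lt with rfl | hlt
    · rw [h0, h'.lift_groupTop, mul_one]
    · rw [h'.lift_eq_of_lt hy.1 hlt, h3 y ⟨hy.1, hlt⟩, hm y ⟨hy.1, hlt.trans h'.groupTop_lt_one⟩]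
  · rcases hy.2.eq_or_lt with rfl | hlt
    · rw [h'.lift_one, add_sub_cancel_left, h2, mul_one, h.lift_groupTop, h.lift_one,
        add_sub_cancel_left]
    · have hy1 : y ∈ Set.Ico (0 : ℝ) 1 := ⟨h'.groupTop_pos.le.trans hy.1, hlt⟩
      have e1 : T.groupTop ≤ T.map (T.groupTop * y) := by
        rw [← hm y hy1]
        nth_rw 1 [← h0]
        exact h.lift_strictMono.monotone (mul_le_mul_of_nonneg_left hy.1 hp.le)
      have e2 : T.groupTop * y ∈ Set.Ico (0 : ℝ) 1 :=
        ⟨mul_nonneg hp.le hy1.1, by nlinarith⟩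
      rw [h'.lift_eq_of_ge hy.1 hlt, add_sub_cancel_right, h4 y ⟨hy.1, hlt⟩, hm y hy1,
        h.lift_eq_of_ge e1 (h.map_mem e2).2, add_sub_cancel_right]

end Circ

/-- Logarithm of the mean slope on the first group. -/
noncomputable def slopeA (T : PIET n 𝒜) : ℝ := Real.log ((1 - T.groupBot) / T.groupTop)

/-- Logarithm of the mean slope on the second group. -/
noncomputable def slopeC (T : PIET n 𝒜) : ℝ := Real.log (T.groupBot / (1 - T.groupTop))

theorem Circ.slopeA_eq {T : PIET n 𝒜} (h : T.Circ) : T.slopeA = logSlope T.lift 0 T.groupTop := by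
  rw [logSlope, h.lift_groupTop, h.lift_zero, sub_zero, slopeA]

theorem Circ.slopeC_eq {T : PIET n 𝒜} (h : T.Circ) : T.slopeC = logSlope T.lift T.groupTop 1 := by
  rw [logSlope, h.lift_groupTop, h.lift_one, add_sub_cancel_left, slopeC]

theorem inv_slopeA (T : PIET n 𝒜) : T.inv.slopeA = -T.slopeC := by
  rw [slopeA, slopeC, ← Real.log_inv, inv_div]; rfl

theorem inv_slopeC (T : PIET n 𝒜) : T.inv.slopeC = -T.slopeA := by
  rw [slopeA, slopeC, ← Real.log_inv, inv_div]; rfl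

theorem Circ.slope_of_bot {T : PIET n 𝒜} (h : T.Circ) (hw : T.groupBot < T.groupTop) :
    T.slopeA ≤ max 0 (-T.slopeC) ∧ -T.slopeA ≤ max 0 T.slopeC := by
  have hp := h.groupTop_pos
  have hq := h.groupBot_pos
  have hp1 := h.groupTop_lt_one
  have hq1 := h.groupBot_lt_one
  have key : (T.groupTop - T.groupBot) * (1 - T.groupBot - T.groupTop) =
    T.groupTop * (1 - T.groupTop) - T.groupBot * (1 - T.groupBot) := by ring
  have e1 : -T.slopeC = Real.log ((1 - T.groupTop) / T.groupBot) := by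
    rw [slopeC, ← Real.log_inv, inv_div]
  have e2 : -T.slopeA = Real.log (T.groupTop / (1 - T.groupBot)) := by
    rw [slopeA, ← Real.log_inv, inv_div]
  rcases le_total (T.groupTop + T.groupBot) 1 with h1 | h1
  · constructor
    · refine le_max_of_le_right ?_
      rw [e1, slopeA]
      apply Real.log_le_log (div_pos (by linarith) hp)
      rw [div_le_div_iff₀ hp hq]
      nlinarith
    · refine le_max_of_le_left ?_
      rw [e2]
      apply Real.log_nonpos (div_nonneg hp.le (by linarith))
      rw [div_le_one (by linarith)]
      linarith
  · constructor
    · refine le_max_of_le_left ?_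
      apply Real.log_nonpos (div_nonneg (by linarith) hp.le)
      rw [div_le_one hp]
      linarith
    · refine le_max_of_le_right ?_
      rw [e2, slopeC]
      apply Real.log_le_log (div_pos hp (by linarith))
      rw [div_le_div_iff₀ (by linarith) (by linarith)]
      nlinarith

variable [DecidableEq 𝒜]

theorem Circ.slopeC_step_bot {T T' : PIET n 𝒜} (h : T.Circ) (h' : T'.Circ) (hs : GroupStep T T')
    (hw : T.groupBot < T.groupTop) :
    T'.slopeC = T.slopeC + logSlope T.lift (T.groupTop * T'.groupTop) T.groupTop := by
  obtain ⟨h1, h2, -, -⟩ := h.lift_step_bot h' hs hw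
  have hp := h.groupTop_pos
  have hp1 := h.groupTop_lt_one
  have hp1' := h'.groupTop_lt_one
  have hq := h.groupBot_pos
  have e : T.groupTop - T.groupTop * T'.groupTop = T.groupTop * (1 - T'.groupTop) := by ring
  rw [logSlope, h1, h.lift_groupTop, e, slopeC, slopeC, ← h2, ← Real.log_mul]
  · congr 1
    have : 1 - T.groupTop ≠ 0 := by linarith
    have : 1 - T'.groupTop ≠ 0 := by linarith
    field_simp
  · rw [h2]; exact (div_pos hq (by linarith)).ne'
  · exact (div_pos (by linarith) (mul_pos hp (by linarith))).ne'

theorem RauzyChain.inv {T T' : PIET n 𝒜} {ℓ : ℝ} (h : RauzyChain T ℓ T') :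
    RauzyChain T.inv ℓ T'.inv := by
  induction h with
  | single h =>
    have := RauzyChain.single h.inv
    rwa [inv_cut] at this
  | cons h _ ih =>
    have := RauzyChain.cons h.inv ih
    rwa [inv_cut] at this

theorem GroupStep.inv {T T' : PIET n 𝒜} (h : GroupStep T T') : GroupStep T.inv T'.inv := by
  have := RauzyChain.inv h
  rwa [max_comm] at this

/-- An infinite sequence of steps for two groups between circular maps, such that both sides win
infinitely often. -/
structure CircSeq (S : ℕ → PIET n 𝒜) (c : Fin n → ℝ) : Prop where
  circ : ∀ j, (S j).Circ
  step : ∀ j, GroupStep (S j) (S (j + 1))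
  ne : ∀ j, (S j).groupTop ≠ (S j).groupBot
  top_wins : ∀ N, ∃ j, N ≤ j ∧ (S j).groupTop < (S j).groupBot
  bot_wins : ∀ N, ∃ j, N ≤ j ∧ (S j).groupBot < (S j).groupTop
  breaks : ∀ j, (S j).HasBreaks c

namespace CircSeq

variable {S : ℕ → PIET n 𝒜} {c : Fin n → ℝ}

theorem inv (h : CircSeq S c) : CircSeq (fun j => (S j).inv) fun i => (c i)⁻¹ :=
  ⟨fun j => (h.circ j).inv, fun j => (h.step j).inv, fun j => (h.ne j).symm, h.bot_wins, h.top_wins,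
    fun j => (h.breaks j).inv⟩

theorem shift (h : CircSeq S c) (k : ℕ) : CircSeq (fun j => S (k + j)) c := by
  refine ⟨fun j => h.circ _, fun j => h.step _, fun j => h.ne _, fun N => ?_, fun N => ?_,
    fun j => h.breaks _⟩
  · obtain ⟨j, hj, hj'⟩ := h.top_wins (k + N)
    refine ⟨j - k, by omega, ?_⟩
    rwa [Nat.add_sub_cancel' (by omega)]
  · obtain ⟨j, hj, hj'⟩ := h.bot_wins (k + N)
    refine ⟨j - k, by omega, ?_⟩
    rwa [Nat.add_sub_cancel' (by omega)]

theorem bot_of_not (h : CircSeq S c) {j : ℕ} (hj : ¬ (S j).groupTop < (S j).groupBot) :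
    (S j).groupBot < (S j).groupTop := lt_of_le_of_ne (not_lt.mp hj) (h.ne j).symm

theorem inv_groupVar (T : PIET n 𝒜) (c : Fin n → ℝ) :
    T.inv.groupVar (fun i => (c i)⁻¹) = T.groupVar c := by
  unfold groupVar
  rw [inv_totalNonlin]
  simp only [Real.log_inv, abs_neg]

/-- While the bottom wins, the restriction of the map to the first group is only rescaled. -/
theorem exists_rescale (h : CircSeq S c) {e : ℕ} {j : ℕ} (hej : e ≤ j)
    (hb : ∀ i, e ≤ i → i < j → (S i).groupBot < (S i).groupTop) :
    ∃ ℓ : ℝ, 0 < ℓ ∧ ℓ * (S j).groupTop ≤ (S e).groupTop ∧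
      ∀ y ∈ Set.Icc 0 (S j).groupTop, (S e).lift (ℓ * y) = ℓ * (S j).lift y := by
  induction j, hej using Nat.le_induction with
  | base => exact ⟨1, one_pos, by rw [one_mul], fun y _ => by rw [one_mul, one_mul]⟩
  | succ j hj ih =>
    obtain ⟨ℓ, h0, h1, h2⟩ := ih fun i hi hi' => hb i hi (by omega)
    obtain ⟨-, -, h3, -⟩ := (h.circ j).lift_step_bot (h.circ (j + 1)) (h.step j)
      (hb j hj (by omega))
    have hp := (h.circ j).groupTop_pos
    refine ⟨ℓ * (S j).groupTop, mul_pos h0 hp, ?_, fun y hy => ?_⟩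
    · have := (h.circ (j + 1)).groupTop_lt_one
      nlinarith [mul_pos h0 hp]
    · rw [mul_assoc, h2 _ ⟨mul_nonneg hp.le hy.1, ?_⟩, ← h3 y hy, mul_assoc]
      have := hy.2.trans (h.circ (j + 1)).groupTop_lt_one.le
      nlinarith

theorem abs_logSlope_sub_le (h : CircSeq S c) {e i j : ℕ} (hei : e ≤ i) (hej : e ≤ j)
    (hbi : ∀ k, e ≤ k → k < i → (S k).groupBot < (S k).groupTop)
    (hbj : ∀ k, e ≤ k → k < j → (S k).groupBot < (S k).groupTop) {x y x' y' : ℝ}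
    (hx : 0 ≤ x) (hxy : x < y) (hy : y ≤ (S i).groupTop)
    (hx' : 0 ≤ x') (hxy' : x' < y') (hy' : y' ≤ (S j).groupTop) :
    |logSlope (S i).lift x y - logSlope (S j).lift x' y'| ≤ (S e).groupVar c := by
  obtain ⟨ℓ, h0, h1, h2⟩ := h.exists_rescale hei hbi
  obtain ⟨ℓ', h0', h1', h2'⟩ := h.exists_rescale hej hbj
  have key : ∀ (i : ℕ) (ℓ x y : ℝ), 0 < ℓ → 0 ≤ x → x < y → y ≤ (S i).groupTop →
      (∀ y ∈ Set.Icc 0 (S i).groupTop, (S e).lift (ℓ * y) = ℓ * (S i).lift y) →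
      logSlope (S i).lift x y = logSlope (S e).lift (ℓ * x) (ℓ * y) := by
    intro i ℓ x y h0 hx hxy hy h2
    rw [logSlope, logSlope, h2 x ⟨hx, by linarith⟩, h2 y ⟨by linarith, hy⟩, ← mul_sub, ← mul_sub,
      mul_div_mul_left _ _ h0.ne']
  rw [key i ℓ x y h0 hx hxy hy h2, key j ℓ' x' y' h0' hx' hxy' hy' h2']
  refine (h.circ e).hasLogDeriv.abs_logSlope_sub_le (by gcongr) (by gcongr) fun z hz z' hz' => ?_
  have ez : z < (S e).groupTop := hz.2.trans_le ((by gcongr : ℓ * y ≤ ℓ * _).trans h1)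
  have ez' : z' < (S e).groupTop := hz'.2.trans_le ((by gcongr : ℓ' * y' ≤ ℓ' * _).trans h1')
  have mz : z ∈ Set.Ico (0 : ℝ) 1 :=
    ⟨(mul_nonneg h0.le hx).trans hz.1, ez.trans (h.circ e).groupTop_lt_one⟩
  have mz' : z' ∈ Set.Ico (0 : ℝ) 1 :=
    ⟨(mul_nonneg h0'.le hx').trans hz'.1, ez'.trans (h.circ e).groupTop_lt_one⟩
  simp only [Int.fract_eq_self.mpr mz, Int.fract_eq_self.mpr mz']
  exact (h.circ e).abs_logD_sub_le (h.breaks e) mz' mz (iff_of_true ez' ez)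

theorem abs_slopeA_sub_le (h : CircSeq S c) {e i j : ℕ} (hei : e ≤ i) (hij : i ≤ j)
    (hb : ∀ k, e ≤ k → k < j → (S k).groupBot < (S k).groupTop) :
    |(S i).slopeA - (S j).slopeA| ≤ (S e).groupVar c := by
  rw [(h.circ i).slopeA_eq, (h.circ j).slopeA_eq]
  exact h.abs_logSlope_sub_le hei (hei.trans hij) (fun k h1 h2 => hb k h1 (by omega)) hb le_rfl
    (h.circ i).groupTop_pos le_rfl le_rfl (h.circ j).groupTop_pos le_rfl

theorem abs_slopeC_sub_slopeA_le (h : CircSeq S c) {e i j : ℕ} (hei : e ≤ i) (hij : i < j)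
    (hb : ∀ k, e ≤ k → k < j → (S k).groupBot < (S k).groupTop) :
    |(S (i + 1)).slopeC - (S i).slopeC - (S j).slopeA| ≤ (S e).groupVar c := by
  rw [(h.circ i).slopeC_step_bot (h.circ (i + 1)) (h.step i) (hb i hei hij),
    (h.circ j).slopeA_eq, add_sub_cancel_left]
  have hp := (h.circ i).groupTop_pos
  have hp1 := (h.circ (i + 1)).groupTop_lt_one
  have hp1' := (h.circ (i + 1)).groupTop_pos
  exact h.abs_logSlope_sub_le hei (hei.trans hij.le) (fun k h1 h2 => hb k h1 (by omega)) hb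
    (by positivity) (by nlinarith) le_rfl le_rfl (h.circ j).groupTop_pos le_rfl

end CircSeq

end PIET

/-! ### The recursion for the mean slopes -/

theorem exists_run_start {P : ℕ → Prop} {m j : ℕ} (hmj : m ≤ j) (hj : P j) :
    ∃ s, m ≤ s ∧ s ≤ j ∧ (∀ k, s ≤ k → k ≤ j → P k) ∧ (s = m ∨ ¬ P (s - 1)) := by
  induction j, hmj using Nat.le_induction with
  | base => exact ⟨m, le_rfl, le_rfl, fun k h1 h2 => (le_antisymm h2 h1) ▸ hj, Or.inl rfl⟩
  | succ j hmj ih =>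
    by_cases hP : P j
    · obtain ⟨s, h1, h2, h3, h4⟩ := ih hP
      refine ⟨s, h1, by omega, fun k h5 h6 => ?_, h4⟩
      rcases h6.eq_or_lt with rfl | h6
      · exact hj
      · exact h3 k h5 (by omega)
    · exact ⟨j + 1, by omega, le_rfl, fun k h1 h2 => (le_antisymm h2 h1) ▸ hj, Or.inr hP⟩

/-- Logarithms of the mean slopes on the two groups, along a sequence of steps; `w j` says that the
top wins at the step `j`. -/
structure SlopeSeq (a b : ℕ → ℝ) (w : ℕ → Prop) (V : ℝ) : Prop where
  top_le : ∀ j, w j → b j ≤ max 0 (-a j) ∧ -b j ≤ max 0 (a j)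
  bot_le : ∀ j, ¬ w j → a j ≤ max 0 (-b j) ∧ -a j ≤ max 0 (b j)
  bot_const : ∀ e i j, e ≤ i → i ≤ j → (∀ k, e ≤ k → k < j → ¬ w k) → |a i - a j| ≤ V
  bot_step : ∀ e i j, e ≤ i → i < j → (∀ k, e ≤ k → k < j → ¬ w k) →
    |b (i + 1) - b i - a j| ≤ V
  top_const : ∀ e i j, e ≤ i → i ≤ j → (∀ k, e ≤ k → k < j → w k) → |b i - b j| ≤ V
  top_step : ∀ e i j, e ≤ i → i < j → (∀ k, e ≤ k → k < j → w k) →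
    |a (i + 1) - a i - b j| ≤ V
  top_wins : ∀ N, ∃ j, N ≤ j ∧ w j
  bot_wins : ∀ N, ∃ j, N ≤ j ∧ ¬ w j

namespace SlopeSeq

variable {a b : ℕ → ℝ} {w : ℕ → Prop} {V : ℝ}

theorem dual (h : SlopeSeq a b w V) :
    SlopeSeq (fun j => -b j) (fun j => -a j) (fun j => ¬ w j) V where
  top_le j hj := by
    have := h.bot_le j hj
    rw [neg_neg, neg_neg]
    exact ⟨this.2, this.1⟩
  bot_le j hj := by
    have := h.top_le j (not_not.mp hj)
    rw [neg_neg, neg_neg]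
    exact ⟨this.2, this.1⟩
  bot_const e i j h1 h2 h3 := by
    have := h.top_const e i j h1 h2 fun k h4 h5 => not_not.mp (h3 k h4 h5)
    rwa [neg_sub_neg, abs_sub_comm]
  bot_step e i j h1 h2 h3 := by
    have := h.top_step e i j h1 h2 fun k h4 h5 => not_not.mp (h3 k h4 h5)
    rw [← abs_neg]
    convert this using 2
    ring
  top_const e i j h1 h2 h3 := by
    have := h.bot_const e i j h1 h2 h3
    rwa [neg_sub_neg, abs_sub_comm]
  top_step e i j h1 h2 h3 := by
    have := h.bot_step e i j h1 h2 h3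
    rw [← abs_neg]
    convert this using 2
    ring
  top_wins := h.bot_wins
  bot_wins N := by
    obtain ⟨j, h1, h2⟩ := h.top_wins N
    exact ⟨j, h1, not_not.mpr h2⟩

theorem V_nonneg (h : SlopeSeq a b w V) : 0 ≤ V :=
  (abs_nonneg _).trans (h.bot_const 0 0 0 le_rfl le_rfl fun _ _ hk => absurd hk (Nat.not_lt_zero _))

theorem abs_slopeA_le (h : SlopeSeq a b w V) {j : ℕ} (hj : ¬ w j) : |a j| ≤ |b j| := by
  obtain ⟨h1, h2⟩ := h.bot_le j hj
  rw [abs_le]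
  have h3 : max 0 (-b j) ≤ |b j| := max_le (abs_nonneg _) (neg_le_abs _)
  have h4 : max 0 (b j) ≤ |b j| := max_le (abs_nonneg _) (le_abs_self _)
  constructor <;> linarith

theorem abs_slopeC_le_of_bot_run (h : SlopeSeq a b w V) {e s : ℕ} (hes : e < s) (hs : w s)
    (hb : ∀ k, e ≤ k → k < s → ¬ w k) : |b s| ≤ max V ((|b e| + V) / 2) := by
  have hV := h.V_nonneg
  obtain ⟨h1, h2⟩ := h.top_le s hs
  have hd : ∀ i, e ≤ i → i < s → |b (i + 1) - b i - a s| ≤ V := fun i hi hi' =>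
    h.bot_step e i s hi hi' hb
  rcases le_total 0 (b s) with h0 | h0
  · rw [abs_of_nonneg h0]
    rcases le_total 0 (a s + V) with h3 | h3
    · exact le_max_of_le_left (h1.trans (max_le hV (by linarith)))
    · have key : ∀ i, e + 1 ≤ i → i ≤ s → b i ≤ b e + (a s + V) := by
        intro i hi
        induction i, hi using Nat.le_induction with
        | base => intro _; linarith [(abs_le.mp (hd e le_rfl hes)).2]
        | succ i hi ih =>
          intro hi'
          linarith [(abs_le.mp (hd i (by omega) (by omega))).2, ih (by omega)]
      have h4 := key s hes le_rfl
      have h5 : b s ≤ -a s := h1.trans_eq (max_eq_right (by linarith))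
      exact le_max_of_le_right (by linarith [le_abs_self (b e)])
  · rw [abs_of_nonpos h0]
    rcases le_total 0 (V - a s) with h3 | h3
    · exact le_max_of_le_left (h2.trans (max_le hV (by linarith)))
    · have key : ∀ i, e + 1 ≤ i → i ≤ s → b e + (a s - V) ≤ b i := by
        intro i hi
        induction i, hi using Nat.le_induction with
        | base => intro _; linarith [(abs_le.mp (hd e le_rfl hes)).1]
        | succ i hi ih =>
          intro hi'
          linarith [(abs_le.mp (hd i (by omega) (by omega))).1, ih (by omega)]
      have h4 := key s hes le_rfl
      have h5 : -b s ≤ a s := h2.trans_eq (max_eq_right (by linarith))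
      exact le_max_of_le_right (by linarith [neg_le_abs (b e)])

theorem exists_bot_start (h : SlopeSeq a b w V) (N : ℕ) : ∃ j, N ≤ j ∧ w j ∧ ¬ w (j + 1) := by
  obtain ⟨i, hi, hwi⟩ := h.top_wins N
  obtain ⟨k, hk, hwk⟩ := h.bot_wins i
  by_contra hcon
  push Not at hcon
  have : ∀ j, i ≤ j → w j := by
    intro j hj
    induction j, hj using Nat.le_induction with
    | base => exact hwi
    | succ j hj ih => exact hcon j (by omega) ih
  exact hwk (this k hk)

theorem abs_slopeC_recursion (h : SlopeSeq a b w V) {m j : ℕ} (hm : w m) (hm' : ¬ w (m + 1))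
    (hmj : m < j) (hj : w j) :
    ∃ i, m ≤ i ∧ i < j ∧ w i ∧ ¬ w (i + 1) ∧
      |b (j + 1)| ≤ max (2 * V) (|b (i + 1)| / 2 + 3 / 2 * V) := by
  have hj2 : m + 2 ≤ j := by
    have : j ≠ m + 1 := fun hc => hm' (hc ▸ hj)
    omega
  obtain ⟨s, h1, h2, h3, h4⟩ := exists_run_start hj2 hj
  have hs : ¬ w (s - 1) := by
    rcases h4 with rfl | h4
    · exact hm'
    · exact h4
  obtain ⟨e, g1, g2, g3, g4⟩ := exists_run_start (P := fun k => ¬ w k) (m := m + 1) (j := s - 1)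
    (by omega) hs
  have he : w (e - 1) := by
    rcases g4 with rfl | g4
    · exact hm
    · exact not_not.mp g4
  refine ⟨e - 1, by omega, by omega, he, ?_, ?_⟩
  · rw [Nat.sub_add_cancel (by omega)]; exact g3 e le_rfl g2
  · rw [Nat.sub_add_cancel (by omega)]
    have h5 := h.abs_slopeC_le_of_bot_run (e := e) (s := s) (by omega) (h3 s le_rfl h2)
      fun k hk hk' => g3 k hk (by omega)
    have h6 := h.top_const s s (j + 1) le_rfl (by omega) fun k hk hk' => h3 k hk (by omega)
    have h7 : |b (j + 1)| ≤ |b s| + V := by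
      have := abs_sub_abs_le_abs_sub (b (j + 1)) (b s)
      rw [abs_sub_comm] at this
      linarith
    rcases le_max_iff.mp h5 with h8 | h8
    · exact le_max_of_le_left (by linarith)
    · exact le_max_of_le_right (by linarith)

theorem exists_abs_slopeC_le (h : SlopeSeq a b w V) :
    ∃ J, ∀ j, J ≤ j → w j → ¬ w (j + 1) → |b (j + 1)| ≤ 3 * V + 1 := by
  have hV := h.V_nonneg
  obtain ⟨m₀, -, hm₀, hm₀'⟩ := h.exists_bot_start 0
  set M := |b (m₀ + 1)| with hM
  have hM0 : 0 ≤ M := abs_nonneg _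
  have key : ∀ k : ℕ, ∃ m, w m ∧ ¬ w (m + 1) ∧
      ∀ j, m ≤ j → w j → ¬ w (j + 1) → |b (j + 1)| ≤ 3 * V + M / 2 ^ k := by
    intro k
    induction k with
    | zero =>
      refine ⟨m₀, hm₀, hm₀', fun j => ?_⟩
      induction j using Nat.strong_induction_on with
      | _ j ih =>
        intro hj hwj hwj'
        rcases hj.eq_or_lt with rfl | hlt
        · rw [pow_zero, div_one]; linarith
        · obtain ⟨i, h1, h2, h3, h4, h5⟩ := h.abs_slopeC_recursion hm₀ hm₀' hlt hwj
          have h6 := ih i h2 h1 h3 h4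
          rw [pow_zero, div_one] at h6 ⊢
          exact h5.trans (max_le (by linarith) (by linarith))
    | succ k ih =>
      obtain ⟨m, hm, hm', hk⟩ := ih
      obtain ⟨m', h1, h2, h3⟩ := h.exists_bot_start (m + 1)
      refine ⟨m', h2, h3, fun j hj hwj hwj' => ?_⟩
      obtain ⟨i, g1, g2, g3, g4, g5⟩ := h.abs_slopeC_recursion hm hm' (by omega) hwj
      have h6 := hk i g1 g3 g4
      have h7 : 0 ≤ M / 2 ^ (k + 1) := by positivity
      have h8 : M / 2 ^ (k + 1) = M / 2 ^ k / 2 := by rw [pow_succ]; field_simp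
      exact g5.trans (max_le (by linarith) (by linarith))
  obtain ⟨k, hk⟩ := exists_pow_lt_of_lt_one (show (0 : ℝ) < 1 / (M + 1) by positivity)
    (show (1 / 2 : ℝ) < 1 by norm_num)
  obtain ⟨m, -, -, hm⟩ := key k
  refine ⟨m, fun j h1 h2 h3 => (hm j h1 h2 h3).trans ?_⟩
  have : M / 2 ^ k ≤ 1 := by
    have h4 : M * (1 / 2) ^ k ≤ M * (1 / (M + 1)) := by gcongr
    have h5 : M * (1 / (M + 1)) ≤ 1 := by
      rw [mul_one_div, div_le_one (by positivity)]; linarith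
    calc M / 2 ^ k = M * (1 / 2) ^ k := by rw [one_div, inv_pow]; rfl
      _ ≤ 1 := h4.trans h5
  linarith

theorem exists_abs_le (h : SlopeSeq a b w V) :
    ∃ J, ∀ j, J ≤ j → (w j ↔ ¬ w (j + 1)) →
      |a (j + 1)| ≤ 3 * V + 1 ∧ |b (j + 1)| ≤ 3 * V + 1 := by
  obtain ⟨J, hJ⟩ := h.exists_abs_slopeC_le
  obtain ⟨J', hJ'⟩ := h.dual.exists_abs_slopeC_le
  refine ⟨max J J', fun j hj hw => ?_⟩
  by_cases hwj : w j
  · have h1 := hw.mp hwj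
    have h2 := hJ j ((le_max_left _ _).trans hj) hwj h1
    exact ⟨(h.abs_slopeA_le h1).trans h2, h2⟩
  · have h1 : w (j + 1) := not_not.mp fun hc => hwj (hw.mpr hc)
    have h2 := hJ' j ((le_max_right _ _).trans hj) hwj (not_not.mpr h1)
    have h3 := h.dual.abs_slopeA_le (j := j + 1) (not_not.mpr h1)
    rw [abs_neg] at h2
    rw [abs_neg, abs_neg] at h3
    exact ⟨h2, h3.trans h2⟩

/-- The slopes right after a change of the winner, and one step later. -/
theorem exists_abs_le_step (h : SlopeSeq a b w V) :
    ∃ J, ∀ j, J ≤ j → (w j ↔ ¬ w (j + 1)) →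
      |a (j + 2)| ≤ 8 * V + 2 ∧ |b (j + 2)| ≤ 8 * V + 2 := by
  have hV := h.V_nonneg
  obtain ⟨J, hJ⟩ := h.exists_abs_le
  refine ⟨J, fun j hj hw => ?_⟩
  obtain ⟨h1, h2⟩ := hJ j hj hw
  rw [abs_le] at h1 h2 ⊢
  rw [abs_le]
  by_cases hwj : w (j + 1)
  · have hr : ∀ k, j + 1 ≤ k → k < j + 2 → w k := fun k hk hk' => by
      obtain rfl : k = j + 1 := by omega
      exact hwj
    have h3 := abs_le.mp (h.top_const (j + 1) (j + 1) (j + 2) le_rfl (by omega) hr)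
    have h4 := abs_le.mp (h.top_step (j + 1) (j + 1) (j + 2) le_rfl (by omega) hr)
    rw [show j + 1 + 1 = j + 2 from rfl] at h4
    refine ⟨⟨?_, ?_⟩, ?_, ?_⟩ <;> linarith
  · have hr : ∀ k, j + 1 ≤ k → k < j + 2 → ¬ w k := fun k hk hk' => by
      obtain rfl : k = j + 1 := by omega
      exact hwj
    have h3 := abs_le.mp (h.bot_const (j + 1) (j + 1) (j + 2) le_rfl (by omega) hr)
    have h4 := abs_le.mp (h.bot_step (j + 1) (j + 1) (j + 2) le_rfl (by omega) hr)
    rw [show j + 1 + 1 = j + 2 from rfl] at h4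
    refine ⟨⟨?_, ?_⟩, ?_, ?_⟩ <;> linarith

end SlopeSeq

namespace PIET

variable {n : ℕ} {𝒜 : Type*} [Fintype 𝒜] [DecidableEq 𝒜]

theorem RauzyChain.totalNonlin_le {T T' : PIET n 𝒜} {ℓ : ℝ} (h : RauzyChain T ℓ T') :
    T'.totalNonlin ≤ T.totalNonlin := by
  induction h with
  | single h => exact h.totalNonlin_le
  | cons h _ ih => exact ih.trans h.totalNonlin_le

theorem RauzyChain.sum_nonlin {T T' : PIET n 𝒜} {ℓ : ℝ} (h : RauzyChain T ℓ T') :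
    ∑ γ, T'.nonlin γ = ∑ γ, T.nonlin γ := by
  induction h with
  | single h => exact h.sum_nonlin
  | cons h _ ih => exact ih.trans h.sum_nonlin

namespace CircSeq

variable {S : ℕ → PIET n 𝒜} {c : Fin n → ℝ}

theorem groupVar_antitone (h : CircSeq S c) : Antitone fun j => (S j).groupVar c :=
  antitone_nat_of_succ_le fun j => by
    have := RauzyChain.totalNonlin_le (h.step j)
    unfold groupVar
    linarith

theorem slopeSeq (h : CircSeq S c) {V : ℝ} (hV : (S 0).groupVar c ≤ V) :
    SlopeSeq (fun j => (S j).slopeA) (fun j => (S j).slopeC)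
      (fun j => (S j).groupTop < (S j).groupBot) V := by
  have hV' : ∀ e, (S e).groupVar c ≤ V := fun e => (h.groupVar_antitone (Nat.zero_le e)).trans hV
  have hVi : ∀ e, (S e).inv.groupVar (fun i => (c i)⁻¹) ≤ V := fun e => by
    rw [inv_groupVar]; exact hV' e
  refine ⟨fun j hj => ?_, fun j hj => (h.circ j).slope_of_bot (h.bot_of_not hj),
    fun e i j h1 h2 h3 => ?_, fun e i j h1 h2 h3 => ?_, fun e i j h1 h2 h3 => ?_,
    fun e i j h1 h2 h3 => ?_, h.top_wins, fun N => ?_⟩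
  · have := (h.inv.circ j).slope_of_bot hj
    rw [inv_slopeA, inv_slopeC, neg_neg, neg_neg] at this
    exact ⟨this.2, this.1⟩
  · exact (h.abs_slopeA_sub_le h1 h2 fun k hk hk' => h.bot_of_not (h3 k hk hk')).trans (hV' e)
  · exact (h.abs_slopeC_sub_slopeA_le h1 h2 fun k hk hk' => h.bot_of_not (h3 k hk hk')).trans
      (hV' e)
  · have := (h.inv.abs_slopeA_sub_le h1 h2 h3).trans (hVi e)
    rwa [inv_slopeA, inv_slopeA, neg_sub_neg, abs_sub_comm] at this
  · have := (h.inv.abs_slopeC_sub_slopeA_le h1 h2 h3).trans (hVi e)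
    rw [inv_slopeC, inv_slopeC, inv_slopeA, abs_le] at this
    change |(S (i + 1)).slopeA - (S i).slopeA - (S j).slopeC| ≤ V
    rw [abs_le]
    constructor <;> linarith
  · obtain ⟨j, h1, h2⟩ := h.bot_wins N
    exact ⟨j, h1, not_lt.mpr h2.le⟩

end CircSeq

end PIET

/-! ### Towers over a first return map -/

/-- An increasing homeomorphism of the line which commutes with integer translations. -/
def CommutesInt (G : ℝ ≃o ℝ) : Prop := ∀ (x : ℝ) (k : ℤ), G (x + k) = G x + k

theorem CommutesInt.pow {G : ℝ ≃o ℝ} (h : CommutesInt G) (m : ℕ) : CommutesInt (G ^ m) := by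
  induction m with
  | zero => intro x k; simp
  | succ m ih => intro x k; rw [pow_succ', RelIso.mul_apply, RelIso.mul_apply, ih, h]

theorem CommutesInt.inv {G : ℝ ≃o ℝ} (h : CommutesInt G) : CommutesInt G⁻¹ := by
  intro x k
  apply G.injective
  rw [h, RelIso.apply_inv_self, RelIso.apply_inv_self]

theorem CommutesInt.zpow {G : ℝ ≃o ℝ} (h : CommutesInt G) (m : ℤ) : CommutesInt (G ^ m) := by
  cases m with
  | ofNat m => rw [Int.ofNat_eq_natCast, zpow_natCast]; exact h.pow m
  | negSucc m => rw [zpow_negSucc]; exact (h.pow _).inv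

/-- A nondecreasing function whose increment over a period is `tot`. -/
structure QuasiPeriodic (Ψ : ℝ → ℝ) (tot : ℝ) : Prop where
  mono : Monotone Ψ
  add_int : ∀ (x : ℝ) (k : ℤ), Ψ (x + k) = Ψ x + tot * k

theorem CommutesInt.quasiPeriodic {G : ℝ ≃o ℝ} (h : CommutesInt G) : QuasiPeriodic G 1 :=
  ⟨G.monotone, fun x k => by rw [h, one_mul]⟩

/-- Birkhoff sums. -/
noncomputable def birk (G : ℝ ≃o ℝ) (Ψ : ℝ → ℝ) (m : ℕ) (x : ℝ) : ℝ :=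
  ∑ i ∈ Finset.range m, Ψ ((G ^ i) x)

theorem birk_add (G : ℝ ≃o ℝ) (Ψ : ℝ → ℝ) (a c : ℕ) (x : ℝ) :
    birk G Ψ (c + a) x = birk G Ψ a x + birk G Ψ c ((G ^ a) x) := by
  unfold birk
  rw [add_comm, Finset.sum_range_add]
  simp only [← RelIso.mul_apply, ← pow_add, add_comm]

theorem birk_add_int {G : ℝ ≃o ℝ} (hG : CommutesInt G) {Ψ : ℝ → ℝ} {tot : ℝ}
    (hΨ : QuasiPeriodic Ψ tot) (m : ℕ) (x : ℝ) (k : ℤ) :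
    birk G Ψ m (x + k) = birk G Ψ m x + m * (tot * k) := by
  unfold birk
  simp only [(hG.pow _) x k, hΨ.add_int, Finset.sum_add_distrib, Finset.sum_const,
    Finset.card_range, nsmul_eq_mul]

theorem birk_mono (G : ℝ ≃o ℝ) {Ψ : ℝ → ℝ} (hΨ : Monotone Ψ) (m : ℕ) : Monotone (birk G Ψ m) :=
  fun _ _ hxy => Finset.sum_le_sum fun i _ => hΨ ((G ^ i).monotone hxy)

namespace PIET

variable {n : ℕ} {𝒜 : Type*} [Fintype 𝒜]

theorem Circ.commutesInt {T : PIET n 𝒜} (h : T.Circ) : CommutesInt h.liftIso :=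
  fun x k => lift_add_int x k

/-- `T` is the rescaling of the first return map to `[0, ℓ)`; the return times of the two groups of
intervals are `a` and `c`. -/
structure Realizes (G : ℝ ≃o ℝ) (T : PIET n 𝒜) (ℓ : ℝ) (a c : ℕ) (s t : ℤ) : Prop where
  pos : 0 < ℓ
  left : ∀ y ∈ Set.Icc 0 T.groupTop, (G ^ a) (ℓ * y) = ℓ * T.lift y + s
  right : ∀ y ∈ Set.Icc T.groupTop 1, (G ^ c) (ℓ * y) = ℓ * (T.lift y - 1) + t
  mass : ∀ Ψ tot, QuasiPeriodic Ψ tot →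
    birk G Ψ a (ℓ * T.groupTop) - birk G Ψ a 0 +
      (birk G Ψ c ℓ - birk G Ψ c (ℓ * T.groupTop)) = tot

theorem Circ.realizes {T : PIET n 𝒜} (h : T.Circ) : Realizes h.liftIso T 1 1 1 0 1 := by
  refine ⟨one_pos, fun y _ => ?_, fun y _ => ?_, fun Ψ tot hΨ => ?_⟩
  · rw [pow_one, one_mul, one_mul, Int.cast_zero, add_zero]; rfl
  · rw [pow_one, one_mul, one_mul, Int.cast_one, sub_add_cancel]; rfl
  · have := hΨ.add_int 0 1
    simp [birk] at this ⊢
    linarith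

variable [DecidableEq 𝒜] {G : ℝ ≃o ℝ} {T T' : PIET n 𝒜} {ℓ : ℝ} {a c : ℕ} {s t : ℤ}

theorem Realizes.step_top (hG : CommutesInt G) (h : T.Circ) (h' : T'.Circ) (hs : GroupStep T T')
    (hw : T.groupTop < T.groupBot) (hr : Realizes G T ℓ a c s t) :
    Realizes G T' (ℓ * T.groupBot) (c + a) c (s + t) t := by
  obtain ⟨h1, h2, h3⟩ := h.lift_step_top h' hs hw
  have hq := h.groupBot_pos
  have hq1 := h.groupBot_lt_one
  have hp := h.groupTop_pos
  have hr0 := hr.pos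
  refine ⟨mul_pos hr.pos hq, fun y hy => ?_, fun y hy => ?_, fun Ψ tot hΨ => ?_⟩
  · have e1 : T.groupBot * y ∈ Set.Icc 0 T.groupTop := by
      rw [← h1]
      exact ⟨mul_nonneg hq.le hy.1, mul_le_mul_of_nonneg_left hy.2 hq.le⟩
    have e2 := h.lift_mem_of_le e1
    rw [pow_add, RelIso.mul_apply, mul_assoc, hr.left _ e1, hG.pow c,
      hr.right _ ⟨hw.le.trans e2.1, e2.2⟩, mul_assoc, h2 y hy]
    push_cast
    ring
  · have e1 : T.groupBot * y ∈ Set.Icc T.groupTop 1 := by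
      refine ⟨?_, by nlinarith [hy.2, h'.groupTop_pos.trans_le hy.1]⟩
      rw [← h1]
      exact mul_le_mul_of_nonneg_left hy.1 hq.le
    rw [mul_assoc, hr.right _ e1, mul_assoc, h3 y hy]
  · have m := hr.mass Ψ tot hΨ
    have e1 := hr.left T.groupTop ⟨hp.le, le_rfl⟩
    have e2 := hr.left 0 ⟨le_rfl, hp.le⟩
    rw [h.lift_groupTop, mul_one] at e1
    rw [h.lift_zero, mul_zero] at e2
    rw [mul_assoc, h1, birk_add, birk_add, e1, e2, birk_add_int hG hΨ, birk_add_int hG hΨ]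
    linarith

theorem Realizes.step_bot (hG : CommutesInt G) (h : T.Circ) (h' : T'.Circ) (hs : GroupStep T T')
    (hw : T.groupBot < T.groupTop) (hr : Realizes G T ℓ a c s t) :
    Realizes G T' (ℓ * T.groupTop) a (c + a) s (s + t) := by
  obtain ⟨h1, h2, h3, h4⟩ := h.lift_step_bot h' hs hw
  have hp := h.groupTop_pos
  have hp1 := h.groupTop_lt_one
  have hp' := h'.groupTop_pos
  have hp1' := h'.groupTop_lt_one
  refine ⟨mul_pos hr.pos hp, fun y hy => ?_, fun y hy => ?_, fun Ψ tot hΨ => ?_⟩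
  · have e1 : T.groupTop * y ∈ Set.Icc 0 T.groupTop :=
      ⟨mul_nonneg hp.le hy.1, by nlinarith [hy.2]⟩
    rw [mul_assoc, hr.left _ e1, mul_assoc, h3 y hy]
  · have hy0 := hp'.le.trans hy.1
    have e1 : T.groupTop * y ∈ Set.Icc 0 T.groupTop :=
      ⟨mul_nonneg hp.le hy0, by nlinarith [hy.2]⟩
    have e2 := (h.lift_mem_of_le e1).2
    have e3 : T.groupTop ≤ T.lift (T.groupTop * y) := by
      nth_rw 1 [← h1]
      exact h.lift_strictMono.monotone (mul_le_mul_of_nonneg_left hy.1 hp.le)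
    rw [pow_add, RelIso.mul_apply, mul_assoc, hr.left _ e1, hG.pow c, hr.right _ ⟨e3, e2⟩,
      mul_assoc, h4 y hy]
    push_cast
    ring
  · have m := hr.mass Ψ tot hΨ
    have e1 := hr.left T.groupTop ⟨hp.le, le_rfl⟩
    have e2 := hr.left (T.groupTop * T'.groupTop) ⟨by positivity, by nlinarith⟩
    rw [h.lift_groupTop, mul_one] at e1
    rw [h1] at e2
    rw [mul_assoc, birk_add, birk_add, e1, e2, birk_add_int hG hΨ, birk_add_int hG hΨ]
    linarith

open Classical in
/-- Return times of the two groups along a sequence of steps. -/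
noncomputable def heights (S : ℕ → PIET n 𝒜) : ℕ → ℕ × ℕ
  | 0 => (1, 1)
  | j + 1 => if (S j).groupTop < (S j).groupBot then
      ((heights S j).2 + (heights S j).1, (heights S j).2)
    else ((heights S j).1, (heights S j).2 + (heights S j).1)

/-- Lengths of the intervals of the first returns along a sequence of steps. -/
noncomputable def scale (S : ℕ → PIET n 𝒜) : ℕ → ℝ
  | 0 => 1
  | j + 1 => scale S j * max (S j).groupTop (S j).groupBot

namespace CircSeq

variable {S : ℕ → PIET n 𝒜} {b : Fin n → ℝ}

theorem realizes (h : CircSeq S b) (j : ℕ) :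
    ∃ s t : ℤ, Realizes (h.circ 0).liftIso (S j) (scale S j) (heights S j).1 (heights S j).2 s t := by
  induction j with
  | zero => exact ⟨0, 1, (h.circ 0).realizes⟩
  | succ j ih =>
    obtain ⟨s, t, hr⟩ := ih
    by_cases hw : (S j).groupTop < (S j).groupBot
    · refine ⟨s + t, t, ?_⟩
      have := hr.step_top (h.circ 0).commutesInt (h.circ j) (h.circ (j + 1)) (h.step j) hw
      simp only [heights, scale, if_pos hw, max_eq_right hw.le]
      exact this
    · refine ⟨s, s + t, ?_⟩
      have hw' := h.bot_of_not hw
      have := hr.step_bot (h.circ 0).commutesInt (h.circ j) (h.circ (j + 1)) (h.step j) hw'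
      simp only [heights, scale, if_neg hw, max_eq_left hw'.le]
      exact this

theorem heights_pos (S : ℕ → PIET n 𝒜) (j : ℕ) : 0 < (heights S j).1 ∧ 0 < (heights S j).2 := by
  induction j with
  | zero => exact ⟨one_pos, one_pos⟩
  | succ j ih =>
    unfold heights
    split_ifs
    · exact ⟨by simp only []; omega, ih.2⟩
    · exact ⟨ih.1, by simp only []; omega⟩

theorem heights_le_succ (S : ℕ → PIET n 𝒜) (j : ℕ) :
    (heights S j).1 ≤ (heights S (j + 1)).1 ∧ (heights S j).2 ≤ (heights S (j + 1)).2 := by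
  have e : heights S (j + 1) = if (S j).groupTop < (S j).groupBot then
      ((heights S j).2 + (heights S j).1, (heights S j).2)
    else ((heights S j).1, (heights S j).2 + (heights S j).1) := rfl
  rw [e]
  split_ifs
  · exact ⟨Nat.le_add_left _ _, le_rfl⟩
  · exact ⟨le_rfl, Nat.le_add_right _ _⟩

theorem exists_lt_heights (h : CircSeq S b) (H : ℕ) :
    ∃ N, ∀ j, N ≤ j → H < (heights S j).1 ∧ H < (heights S j).2 := by
  have m1 : Monotone fun j => (heights S j).1 :=
    monotone_nat_of_le_succ fun j => (heights_le_succ S j).1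
  have m2 : Monotone fun j => (heights S j).2 :=
    monotone_nat_of_le_succ fun j => (heights_le_succ S j).2
  induction H with
  | zero => exact ⟨0, fun j _ => heights_pos S j⟩
  | succ H ih =>
    obtain ⟨N, hN⟩ := ih
    obtain ⟨i, hi, hwi⟩ := h.top_wins N
    obtain ⟨k, hk, hwk⟩ := h.bot_wins N
    refine ⟨max i k + 1, fun j hj => ?_⟩
    have e1 : (heights S (i + 1)).1 ≤ (heights S j).1 := m1 (by omega)
    have e2 : (heights S (k + 1)).2 ≤ (heights S j).2 := m2 (by omega)
    rw [heights, if_pos hwi] at e1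
    rw [heights, if_neg (not_lt.mpr hwk.le)] at e2
    have e3 := hN i hi
    have e4 := hN k hk
    simp only [] at e1 e2
    omega

/-- After a step won by the bottom, the second group has the largest return time. -/
theorem heights_le_of_bot {j : ℕ} (hw : (S j).groupBot < (S j).groupTop) :
    (heights S (j + 1)).1 ≤ (heights S (j + 1)).2 := by
  rw [heights, if_neg (not_lt.mpr hw.le)]
  exact Nat.le_add_left _ _

end CircSeq

end PIET

/-! ### Distortion -/

theorem birk_sub_le (G : ℝ ≃o ℝ) {Ψ : ℝ → ℝ} (hΨ : Monotone Ψ) {m m' : ℕ} (hm : m ≤ m') {x y : ℝ}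
    (hxy : x ≤ y) : birk G Ψ m y - birk G Ψ m x ≤ birk G Ψ m' y - birk G Ψ m' x := by
  unfold birk
  rw [← Finset.sum_sub_distrib, ← Finset.sum_sub_distrib]
  refine Finset.sum_le_sum_of_subset_of_nonneg (Finset.range_mono hm) fun i _ _ => ?_
  exact sub_nonneg.mpr (hΨ ((G ^ i).monotone hxy))

theorem HasLogDeriv.pow {G : ℝ ≃o ℝ} {D : ℝ → ℝ} (h : HasLogDeriv G D) (m : ℕ) :
    HasLogDeriv (G ^ m : ℝ ≃o ℝ) (birk G D m) := by
  refine ⟨(G ^ m).strictMono, (G ^ m).continuous, ?_⟩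
  induction m with
  | zero =>
    intro x
    simp only [birk, Finset.range_zero, Finset.sum_empty, Real.exp_zero, pow_zero, RelIso.coe_one]
    exact hasDerivWithinAt_id x _
  | succ m ih =>
    intro x
    have h1 := HasDerivWithinAt.comp x (h.deriv ((G ^ m) x)) (ih x)
      fun z hz => (G ^ m).monotone hz
    have h2 : ⇑G ∘ ⇑(G ^ m : ℝ ≃o ℝ) = (G ^ (m + 1) : ℝ ≃o ℝ) := by
      ext z
      rw [pow_succ', RelIso.mul_apply, Function.comp_apply]
    have h3 : birk G D (m + 1) x = D ((G ^ m) x) + birk G D m x := by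
      unfold birk
      rw [Finset.sum_range_succ, add_comm]
    rw [h2, ← Real.exp_add, ← h3] at h1
    exact h1

/-- The logarithm `D` of the right derivative of `G` has variation at most `Ω` over a period. -/
structure BoundedVar (G : ℝ ≃o ℝ) (D Φ : ℝ → ℝ) (Ω : ℝ) : Prop where
  comm : CommutesInt G
  logDeriv : HasLogDeriv G D
  var : QuasiPeriodic Φ Ω
  abs_sub_le : ∀ x y, x ≤ y → |D y - D x| ≤ Φ y - Φ x

namespace BoundedVar

variable {G : ℝ ≃o ℝ} {D Φ : ℝ → ℝ} {Ω : ℝ}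

theorem nonneg (h : BoundedVar G D Φ Ω) : 0 ≤ Ω := by
  have h1 := h.var.add_int 0 1
  have h2 := h.var.mono (show (0 : ℝ) ≤ 0 + (1 : ℤ) by norm_num)
  rw [h1] at h2
  simpa using h2

theorem abs_birk_sub_le (h : BoundedVar G D Φ Ω) (m : ℕ) {x y : ℝ} (hxy : x ≤ y) :
    |birk G D m y - birk G D m x| ≤ birk G Φ m y - birk G Φ m x := by
  unfold birk
  rw [← Finset.sum_sub_distrib, ← Finset.sum_sub_distrib]
  exact (Finset.abs_sum_le_sum_abs _ _).trans
    (Finset.sum_le_sum fun i _ => h.abs_sub_le _ _ ((G ^ i).monotone hxy))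

theorem abs_logSlope_sub_le (h : BoundedVar G D Φ Ω) {m : ℕ} {u v B : ℝ}
    (hB : birk G Φ m v - birk G Φ m u ≤ B) {x y x' y' : ℝ} (hx : u ≤ x) (hxy : x < y) (hy : y ≤ v)
    (hx' : u ≤ x') (hxy' : x' < y') (hy' : y' ≤ v) :
    |logSlope (G ^ m : ℝ ≃o ℝ) x y - logSlope (G ^ m : ℝ ≃o ℝ) x' y'| ≤ B := by
  refine (h.logDeriv.pow m).abs_logSlope_sub_le hxy hxy' fun z hz z' hz' => ?_
  have mono := birk_mono G h.var.mono m
  have key : ∀ z z', u ≤ z → z ≤ z' → z' ≤ v → |birk G D m z' - birk G D m z| ≤ B :=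
    fun z z' h1 h2 h3 => by
      have := h.abs_birk_sub_le m h2
      linarith [mono h1, mono h3]
  rcases le_total z z' with hzz | hzz
  · rw [abs_sub_comm]
    exact key z z' (hx.trans hz.1) hzz (hz'.2.le.trans hy')
  · exact key z' z (hx'.trans hz'.1) hzz (hz.2.le.trans hy)

/-- Comparison of the lengths of images. -/
theorem mul_le_of_distortion (h : BoundedVar G D Φ Ω) {m : ℕ} {u v B : ℝ}
    (hB : birk G Φ m v - birk G Φ m u ≤ B) {x y x' y' : ℝ} (hx : u ≤ x) (hxy : x < y) (hy : y ≤ v)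
    (hx' : u ≤ x') (hxy' : x' < y') (hy' : y' ≤ v) :
    Real.exp (-B) * (((G ^ m) y - (G ^ m) x) * (y' - x')) ≤
      ((G ^ m) y' - (G ^ m) x') * (y - x) := by
  have h1 := (abs_le.mp (h.abs_logSlope_sub_le hB hx hxy hy hx' hxy' hy')).2
  have h2 := (h.logDeriv.pow m).exp_logSlope hxy
  have h3 := (h.logDeriv.pow m).exp_logSlope hxy'
  rw [← h2, ← h3]
  have h4 : Real.exp (-B) * Real.exp (logSlope (G ^ m : ℝ ≃o ℝ) x y) ≤
      Real.exp (logSlope (G ^ m : ℝ ≃o ℝ) x' y') := by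
    rw [← Real.exp_add, Real.exp_le_exp]; linarith
  have h5 : 0 ≤ (y - x) * (y' - x') :=
    mul_nonneg (by linarith) (by linarith)
  nlinarith [mul_le_mul_of_nonneg_right h4 h5]

end BoundedVar

namespace PIET

variable {n : ℕ} {𝒜 : Type*} [Fintype 𝒜]

theorem variation_quasiPeriodic {T : PIET n 𝒜} (h : T.Circ) (κ : 𝒜 → ℝ) :
    QuasiPeriodic (T.variation κ) (∑ γ, (|T.nonlin γ| + |T.jump γ - κ γ|)) :=
  ⟨h.variation_monotone κ, fun x k => accum_add_int x k⟩

theorem Circ.boundedVar {T : PIET n 𝒜} (h : T.Circ) :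
    BoundedVar h.liftIso (fun x => T.logD (Int.fract x)) (T.variation 0)
      (∑ γ, (|T.nonlin γ| + |T.jump γ - (0 : 𝒜 → ℝ) γ|)) :=
  ⟨h.commutesInt, h.hasLogDeriv, variation_quasiPeriodic h 0,
    fun _ _ hxy => h.abs_logD_le_variation hxy⟩

/-- A first return with mean slopes bounded by `K`, whose second group has the largest return
time. -/
structure Tower (G : ℝ ≃o ℝ) (T : PIET n 𝒜) (ℓ : ℝ) (a c : ℕ) (s t : ℤ) (K : ℝ) : Prop
    extends Realizes G T ℓ a c s t where
  circ : T.Circ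
  ht_pos : 0 < a
  ht_le : a ≤ c
  slopeA_le : |T.slopeA| ≤ K
  slopeC_le : |T.slopeC| ≤ K

/-- The left end of the part of the base of the tower above which the floor `i` is. -/
noncomputable def floorLeft (T : PIET n 𝒜) (ℓ : ℝ) (a i : ℕ) : ℝ :=
  if i < a then 0 else ℓ * T.groupTop

namespace Tower

variable {G : ℝ ≃o ℝ} {T : PIET n 𝒜} {ℓ K : ℝ} {a c : ℕ} {s t : ℤ} {D Φ : ℝ → ℝ} {Ω : ℝ}

theorem cut_pos (h : Tower G T ℓ a c s t K) : 0 < ℓ * T.groupTop := mul_pos h.pos h.circ.groupTop_pos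

theorem cut_lt (h : Tower G T ℓ a c s t K) : ℓ * T.groupTop < ℓ := by
  nlinarith [h.pos, h.circ.groupTop_lt_one]

theorem floorLeft_nonneg (h : Tower G T ℓ a c s t K) (i : ℕ) : 0 ≤ T.floorLeft ℓ a i := by
  unfold floorLeft
  split_ifs
  · exact le_rfl
  · exact h.cut_pos.le

theorem floorLeft_le (h : Tower G T ℓ a c s t K) (i : ℕ) : T.floorLeft ℓ a i ≤ ℓ * T.groupTop := by
  unfold floorLeft
  split_ifs
  · exact h.cut_pos.le
  · exact le_rfl

theorem floorLeft_lt (h : Tower G T ℓ a c s t K) (i : ℕ) : T.floorLeft ℓ a i < ℓ :=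
  (h.floorLeft_le i).trans_lt h.cut_lt

/-- The floors fill a period. -/
theorem sum_floors (h : Tower G T ℓ a c s t K) {Ψ : ℝ → ℝ} {tot : ℝ} (hΨ : QuasiPeriodic Ψ tot) :
    ∑ i ∈ Finset.range c, (Ψ ((G ^ i) ℓ) - Ψ ((G ^ i) (T.floorLeft ℓ a i))) = tot := by
  rw [← h.mass Ψ tot hΨ]
  obtain ⟨d, rfl⟩ := Nat.exists_eq_add_of_le h.ht_le
  have e1 : ∀ i ∈ Finset.range a, Ψ ((G ^ i) ℓ) - Ψ ((G ^ i) (T.floorLeft ℓ a i)) =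
      Ψ ((G ^ i) ℓ) - Ψ ((G ^ i) 0) := fun i hi => by
    rw [floorLeft, if_pos (Finset.mem_range.mp hi)]
  have e2 : ∀ i ∈ Finset.range d,
      Ψ ((G ^ (a + i)) ℓ) - Ψ ((G ^ (a + i)) (T.floorLeft ℓ a (a + i))) =
      Ψ ((G ^ (a + i)) ℓ) - Ψ ((G ^ (a + i)) (ℓ * T.groupTop)) := fun i _ => by
    rw [floorLeft, if_neg (by omega)]
  unfold birk
  rw [Finset.sum_range_add, Finset.sum_congr rfl e1, Finset.sum_congr rfl e2,
    Finset.sum_range_add, Finset.sum_range_add, Finset.sum_sub_distrib, Finset.sum_sub_distrib]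
  ring

theorem birk_base_le (h : Tower G T ℓ a c s t K) {Ψ : ℝ → ℝ} {tot : ℝ}
    (hΨ : QuasiPeriodic Ψ tot) : birk G Ψ a ℓ - birk G Ψ a 0 ≤ tot := by
  have h1 := h.mass Ψ tot hΨ
  have h2 := birk_sub_le G hΨ.mono h.ht_le h.cut_lt.le
  linarith

theorem birk_first_le (h : Tower G T ℓ a c s t K) {Ψ : ℝ → ℝ} {tot : ℝ}
    (hΨ : QuasiPeriodic Ψ tot) : birk G Ψ a (ℓ * T.groupTop) - birk G Ψ a 0 ≤ tot := by
  have h1 := h.mass Ψ tot hΨ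
  have h2 := birk_mono G hΨ.mono c h.cut_lt.le
  linarith

theorem birk_second_le (h : Tower G T ℓ a c s t K) {Ψ : ℝ → ℝ} {tot : ℝ}
    (hΨ : QuasiPeriodic Ψ tot) : birk G Ψ c ℓ - birk G Ψ c (ℓ * T.groupTop) ≤ tot := by
  have h1 := h.mass Ψ tot hΨ
  have h2 := birk_mono G hΨ.mono a h.cut_pos.le
  linarith

theorem birk_floor_le (h : Tower G T ℓ a c s t K) {Ψ : ℝ → ℝ} {tot : ℝ}
    (hΨ : QuasiPeriodic Ψ tot) {i : ℕ} (hi : i ≤ c) :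
    birk G Ψ i ℓ - birk G Ψ i (T.floorLeft ℓ a i) ≤ tot := by
  by_cases hia : i < a
  · rw [floorLeft, if_pos hia]
    exact (birk_sub_le G hΨ.mono hia.le h.pos.le).trans (h.birk_base_le hΨ)
  · rw [floorLeft, if_neg hia]
    exact (birk_sub_le G hΨ.mono hi h.cut_lt.le).trans (h.birk_second_le hΨ)

theorem exp_slopeA_mul (h : Tower G T ℓ a c s t K) :
    (G ^ a) (ℓ * T.groupTop) - (G ^ a) 0 = Real.exp T.slopeA * (ℓ * T.groupTop) := by
  have e1 := h.left T.groupTop ⟨h.circ.groupTop_pos.le, le_rfl⟩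
  have e2 := h.left 0 ⟨le_rfl, h.circ.groupTop_pos.le⟩
  have hp := h.circ.groupTop_pos
  rw [h.circ.lift_groupTop] at e1
  rw [h.circ.lift_zero, mul_zero] at e2
  rw [e1, e2, slopeA, Real.exp_log (div_pos (by linarith [h.circ.groupBot_lt_one]) hp)]
  field_simp
  ring

theorem exp_slopeC_mul (h : Tower G T ℓ a c s t K) :
    (G ^ c) ℓ - (G ^ c) (ℓ * T.groupTop) = Real.exp T.slopeC * (ℓ - ℓ * T.groupTop) := by
  have e1 := h.right T.groupTop ⟨le_rfl, h.circ.groupTop_lt_one.le⟩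
  have e2 := h.right 1 ⟨h.circ.groupTop_lt_one.le, le_rfl⟩
  have hp : 0 < 1 - T.groupTop := by linarith [h.circ.groupTop_lt_one]
  rw [h.circ.lift_groupTop] at e1
  rw [h.circ.lift_one, mul_one] at e2
  rw [e1, e2, slopeC, Real.exp_log (div_pos h.circ.groupBot_pos hp)]
  field_simp
  ring

theorem pow_zero_eq (h : Tower G T ℓ a c s t K) : (G ^ a) 0 = ℓ * T.groupBot + s := by
  have e2 := h.left 0 ⟨le_rfl, h.circ.groupTop_pos.le⟩
  rwa [h.circ.lift_zero, mul_zero] at e2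

theorem pow_cut_eq (h : Tower G T ℓ a c s t K) : (G ^ a) (ℓ * T.groupTop) = ℓ + s := by
  have e1 := h.left T.groupTop ⟨h.circ.groupTop_pos.le, le_rfl⟩
  rwa [h.circ.lift_groupTop, mul_one] at e1

theorem pow_cut_eq' (h : Tower G T ℓ a c s t K) : (G ^ c) (ℓ * T.groupTop) = t := by
  have e1 := h.right T.groupTop ⟨le_rfl, h.circ.groupTop_lt_one.le⟩
  rwa [h.circ.lift_groupTop, sub_self, mul_zero, zero_add] at e1

theorem pow_one_eq (h : Tower G T ℓ a c s t K) : (G ^ c) ℓ = ℓ * T.groupBot + t := by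
  have e2 := h.right 1 ⟨h.circ.groupTop_lt_one.le, le_rfl⟩
  rwa [h.circ.lift_one, mul_one, add_sub_cancel_left] at e2

theorem return_le (h : Tower G T ℓ a c s t K) (hD : BoundedVar G D Φ Ω) {i m : ℕ} {k : ℤ}
    {X Y σ : ℝ} (hi : i < a) (hX : 0 ≤ X) (hXY : X < Y) (hY : Y ≤ ℓ)
    (hm : birk G Φ m Y - birk G Φ m X ≤ Ω)
    (hσ : (G ^ m) Y - (G ^ m) X = Real.exp σ * (Y - X)) (hσK : -K ≤ σ)
    (h0 : (k : ℝ) ≤ (G ^ m) X) (h1 : (G ^ m) Y ≤ ℓ + k) {x y : ℝ} (hx : X ≤ x) (hxy : x < y)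
    (hy : y ≤ Y) :
    Real.exp (-(3 * Ω + K)) * ((G ^ i) y - (G ^ i) x) ≤ (G ^ (m + i)) y - (G ^ (m + i)) x := by
  have hΩ := hD.nonneg
  have g1 := hD.mul_le_of_distortion hm le_rfl hXY le_rfl hx hxy hy
  rw [hσ] at g1
  have hlt : (G ^ m) x < (G ^ m) y := (G ^ m).strictMono hxy
  have g2 := hD.mul_le_of_distortion (h.birk_floor_le hD.var (hi.le.trans h.ht_le))
    (x := x) (y := y) (x' := (G ^ m) x - k) (y' := (G ^ m) y - k)
    (by rw [floorLeft, if_pos hi]; linarith) hxy (by linarith)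
    (by rw [floorLeft, if_pos hi]; linarith [(G ^ m).monotone hx]) (by linarith)
    (by linarith [(G ^ m).monotone hy])
  have e : ∀ z, (G ^ i) ((G ^ m) z - k) = (G ^ (m + i)) z - k := fun z => by
    have := (hD.comm.pow i) ((G ^ m) z - k) k
    rw [sub_add_cancel] at this
    rw [add_comm m i, pow_add, RelIso.mul_apply, this, add_sub_cancel_right]
  rw [e, e, sub_sub_sub_cancel_right, sub_sub_sub_cancel_right] at g2
  have g3 : Real.exp (-Ω) * Real.exp σ * (y - x) ≤ (G ^ m) y - (G ^ m) x := by
    have hYX : 0 < Y - X := sub_pos.mpr hXY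
    refine le_of_mul_le_mul_right ?_ hYX
    linarith
  have g4 : Real.exp (-(3 * Ω + K)) ≤ Real.exp (-Ω) * (Real.exp (-Ω) * Real.exp σ) := by
    rw [← Real.exp_add, ← Real.exp_add, Real.exp_le_exp]; linarith
  have g5 : 0 ≤ (G ^ i) y - (G ^ i) x := sub_nonneg.mpr ((G ^ i).monotone hxy.le)
  refine le_of_mul_le_mul_right ?_ (sub_pos.mpr hxy)
  refine le_trans ?_ g2
  calc _ ≤ Real.exp (-Ω) * (Real.exp (-Ω) * Real.exp σ) * ((G ^ i) y - (G ^ i) x) * (y - x) := by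
        gcongr
    _ = Real.exp (-Ω) * (((G ^ i) y - (G ^ i) x) * (Real.exp (-Ω) * Real.exp σ * (y - x))) := by
        ring
    _ ≤ _ := by gcongr

theorem return_back_le (h : Tower G T ℓ a c s t K) (hD : BoundedVar G D Φ Ω) {i : ℕ}
    (hi : i < c) (hia : a ≤ i) {x y : ℝ} (hx : ℓ * T.groupTop ≤ x) (hxy : x < y) (hy : y ≤ ℓ) :
    Real.exp (-(3 * Ω + K)) * ((G ^ i) y - (G ^ i) x) ≤ (G ^ (i - a)) y - (G ^ (i - a)) x := by
  have hΩ := hD.nonneg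
  obtain ⟨d, rfl⟩ := Nat.exists_eq_add_of_le hia
  rw [Nat.add_sub_cancel_left]
  have hmono := birk_mono G hD.var.mono
  have b1 := h.birk_second_le hD.var
  have b2 := birk_sub_le G hD.var.mono (show d ≤ c by omega) h.cut_lt.le
  have b3 := birk_sub_le G hD.var.mono (show d + a ≤ c by omega) h.cut_lt.le
  have b4 := birk_add_int hD.comm hD.var d ((G ^ a) ℓ - s) s
  have b5 := birk_add_int hD.comm hD.var d ℓ s
  rw [birk_add, birk_add, h.pow_cut_eq, b5] at b3
  rw [sub_add_cancel] at b4
  have b6 := hmono a h.cut_lt.le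
  have hB : birk G Φ d ((G ^ a) ℓ - s) - birk G Φ d (ℓ * T.groupTop) ≤ 2 * Ω := by linarith
  have hlt : (G ^ a) x < (G ^ a) y := (G ^ a).strictMono hxy
  have m1 := (G ^ a).monotone hx
  have m2 := (G ^ a).monotone hy
  rw [h.pow_cut_eq] at m1
  have g1 := hD.mul_le_of_distortion hB (x := (G ^ a) x - s) (y := (G ^ a) y - s) (x' := x)
    (y' := y) (by linarith [h.cut_lt]) (by linarith) (by linarith) hx hxy (by linarith)
  have e : ∀ z, (G ^ d) ((G ^ a) z - s) = (G ^ (a + d)) z - s := fun z => by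
    have := (hD.comm.pow d) ((G ^ a) z - s) s
    rw [sub_add_cancel] at this
    rw [add_comm a d, pow_add, RelIso.mul_apply, this, add_sub_cancel_right]
  rw [e, e, sub_sub_sub_cancel_right, sub_sub_sub_cancel_right] at g1
  have g2 := hD.mul_le_of_distortion (h.birk_base_le hD.var) (x := x) (y := y) (x' := 0)
    (y' := ℓ * T.groupTop) (h.cut_pos.le.trans hx) hxy hy le_rfl h.cut_pos h.cut_lt.le
  rw [h.exp_slopeA_mul, sub_zero] at g2
  have g3 : (G ^ a) y - (G ^ a) x ≤ Real.exp (Ω + K) * (y - x) := by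
    have h1 : Real.exp (-Ω) * ((G ^ a) y - (G ^ a) x) ≤ Real.exp T.slopeA * (y - x) := by
      refine le_of_mul_le_mul_right ?_ h.cut_pos
      linarith
    have h2 : Real.exp T.slopeA ≤ Real.exp K :=
      Real.exp_le_exp.mpr ((le_abs_self _).trans h.slopeA_le)
    have h3 : Real.exp (Ω + K) * (y - x) = Real.exp Ω * (Real.exp K * (y - x)) := by
      rw [Real.exp_add]; ring
    have h4 : (G ^ a) y - (G ^ a) x =
        Real.exp Ω * (Real.exp (-Ω) * ((G ^ a) y - (G ^ a) x)) := by
      rw [← mul_assoc, ← Real.exp_add, add_neg_cancel, Real.exp_zero, one_mul]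
    rw [h3, h4]
    exact mul_le_mul_of_nonneg_left
      (h1.trans (mul_le_mul_of_nonneg_right h2 (sub_nonneg.mpr hxy.le))) (Real.exp_pos _).le
  have g5 : 0 ≤ (G ^ d) y - (G ^ d) x := sub_nonneg.mpr ((G ^ d).monotone hxy.le)
  have g6 : Real.exp (-(3 * Ω + K)) * Real.exp (Ω + K) = Real.exp (-(2 * Ω)) := by
    rw [← Real.exp_add]; ring_nf
  have g7 : Real.exp (-(2 * Ω)) * ((G ^ (a + d)) y - (G ^ (a + d)) x) ≤
      ((G ^ d) y - (G ^ d) x) * Real.exp (Ω + K) := by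
    refine le_of_mul_le_mul_right ?_ (sub_pos.mpr hxy)
    have := mul_le_mul_of_nonneg_left g3 g5
    linarith
  refine le_of_mul_le_mul_right ?_ (Real.exp_pos (Ω + K))
  calc _ = Real.exp (-(2 * Ω)) * ((G ^ (a + d)) y - (G ^ (a + d)) x) := by rw [← g6]; ring
    _ ≤ _ := g7

/-- A long floor has a long part with a long image after a long time. -/
theorem exists_return (h : Tower G T ℓ a c s t K) (hD : BoundedVar G D Φ Ω) {i : ℕ} (hi : i < c)
    {μ : ℝ} (hμ : μ ≤ (G ^ i) ℓ - (G ^ i) (T.floorLeft ℓ a i)) (hμ0 : 0 ≤ μ) :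
    ∃ X Y, 0 ≤ X ∧ X < Y ∧ Y ≤ ℓ ∧ μ / 2 ≤ (G ^ i) Y - (G ^ i) X ∧
      ∃ m : ℤ, a ≤ m.natAbs ∧ ∀ x y, X ≤ x → x < y → y ≤ Y →
        Real.exp (-(3 * Ω + K)) * ((G ^ i) y - (G ^ i) x) ≤
          (G ^ (m + i)) y - (G ^ (m + i)) x := by
  have hpos := h.cut_pos
  have hlt := h.cut_lt
  by_cases hia : i < a
  · rw [floorLeft, if_pos hia] at hμ
    rcases le_total (μ / 2) ((G ^ i) (ℓ * T.groupTop) - (G ^ i) 0) with h1 | h1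
    · refine ⟨0, ℓ * T.groupTop, le_rfl, hpos, hlt.le, h1, a, by simp, fun x y hx hxy hy => ?_⟩
      have := h.return_le hD (m := a) (k := s) hia le_rfl hpos hlt.le (h.birk_first_le hD.var)
        (by rw [h.exp_slopeA_mul, sub_zero]) (abs_le.mp h.slopeA_le).1
        (by rw [h.pow_zero_eq]; linarith [mul_pos h.pos h.circ.groupBot_pos])
        (by rw [h.pow_cut_eq]) hx hxy hy
      rw [← Nat.cast_add, zpow_natCast]
      exact this
    · refine ⟨ℓ * T.groupTop, ℓ, hpos.le, hlt, le_rfl, by linarith, c, by simp [h.ht_le],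
        fun x y hx hxy hy => ?_⟩
      have := h.return_le hD (m := c) (k := t) hia hpos.le hlt le_rfl (h.birk_second_le hD.var)
        h.exp_slopeC_mul (abs_le.mp h.slopeC_le).1
        (by rw [h.pow_cut_eq'])
        (by rw [h.pow_one_eq]; nlinarith [h.pos, h.circ.groupBot_lt_one]) hx hxy hy
      rw [← Nat.cast_add, zpow_natCast]
      exact this
  · rw [floorLeft, if_neg hia] at hμ
    refine ⟨ℓ * T.groupTop, ℓ, hpos.le, hlt, le_rfl, by linarith, -a, by simp,
      fun x y hx hxy hy => ?_⟩
    have := h.return_back_le hD hi (not_lt.mp hia) hx hxy hy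
    rw [show -(a : ℤ) + i = ((i - a : ℕ) : ℤ) by omega, zpow_natCast]
    exact this

end Tower

end PIET

/-! ### The floors of the towers are small -/

theorem exists_grid_cell {M : ℕ} (hM : 0 < M) {x y : ℝ} (hxy : x + 2 / M ≤ y) :
    ∃ (r : Fin M) (q : ℤ), x ≤ (r : ℝ) / M + q ∧ ((r : ℝ) + 1) / M + q ≤ y := by
  have hM' : (0 : ℝ) < M := by exact_mod_cast hM
  have hMz : (0 : ℤ) < M := by exact_mod_cast hM
  set k : ℤ := ⌈x * M⌉ with hk
  have h1 : x * M ≤ k := Int.le_ceil _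
  have h2 : (k : ℝ) < x * M + 1 := Int.ceil_lt_add_one _
  have h3 : k = (k % M).toNat + M * (k / M) := by
    rw [Int.toNat_of_nonneg (Int.emod_nonneg _ hMz.ne'), Int.emod_add_mul_ediv]
  have h4 : (k % M).toNat < M := by
    have := Int.emod_lt_of_pos k hMz
    omega
  have h5 : (k : ℝ) = ((k % M).toNat : ℝ) + M * ((k / M : ℤ) : ℝ) := by
    have := congrArg (fun z : ℤ => (z : ℝ)) h3
    push_cast at this
    exact_mod_cast this
  have h6 : ((k % M).toNat : ℝ) / M + ((k / M : ℤ) : ℝ) = k / M := by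
    rw [h5]; field_simp
  refine ⟨⟨_, h4⟩, k / M, ?_, ?_⟩
  · change x ≤ ((k % M).toNat : ℝ) / M + ((k / M : ℤ) : ℝ)
    rw [h6, le_div_iff₀ hM']
    exact h1
  · change (((k % M).toNat : ℝ) + 1) / M + ((k / M : ℤ) : ℝ) ≤ y
    have h7 : (((k % M).toNat : ℝ) + 1) / M + ((k / M : ℤ) : ℝ) = (k + 1) / M := by
      rw [h5]; field_simp; ring
    rw [h7]
    refine le_trans ?_ hxy
    rw [div_le_iff₀ hM', add_mul, div_mul_cancel₀ _ hM'.ne']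
    linarith

namespace PIET

variable {n : ℕ} {𝒜 : Type*} [Fintype 𝒜]

/-- The images of an interval contained in floors of arbitrarily high towers have a summable
length. -/
theorem summable_images {G : ℝ ≃o ℝ} (hG : CommutesInt G) {x y : ℝ} (hxy : x ≤ y)
    (hU : ∀ H : ℕ, ∃ (T : PIET n 𝒜) (ℓ : ℝ) (a c : ℕ) (s t : ℤ) (K : ℝ) (i : ℕ) (q : ℤ),
      Tower G T ℓ a c s t K ∧ H ≤ a ∧ (G ^ i) 0 ≤ x + q ∧ y + q ≤ (G ^ i) ℓ) :
    Summable fun k : ℤ => (G ^ k) y - (G ^ k) x := by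
  have hf : ∀ k : ℤ, 0 ≤ (G ^ k) y - (G ^ k) x := fun k => sub_nonneg.mpr ((G ^ k).monotone hxy)
  refine summable_of_sum_le (c := 1) hf fun u => ?_
  set H := u.sup Int.natAbs + 1 with hH
  have hu : ∀ k ∈ u, k.natAbs < H := fun k hk => Nat.lt_succ_of_le (Finset.le_sup hk)
  obtain ⟨T, ℓ, a, c, s, t, K, i, q, hT, ha, hx, hy⟩ := hU (2 * H)
  have h1 := hT.birk_base_le (hG.zpow ((i : ℤ) - H)).quasiPeriodic
  unfold birk at h1
  rw [← Finset.sum_sub_distrib] at h1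
  have h2 : u ⊆ (Finset.range a).image fun l : ℕ => (l : ℤ) - H := by
    intro k hk
    have := hu k hk
    refine Finset.mem_image.mpr ⟨(k + H).toNat, Finset.mem_range.mpr (by omega), by omega⟩
  calc ∑ k ∈ u, ((G ^ k) y - (G ^ k) x)
      ≤ ∑ k ∈ (Finset.range a).image fun l : ℕ => (l : ℤ) - H, ((G ^ k) y - (G ^ k) x) :=
        Finset.sum_le_sum_of_subset_of_nonneg h2 fun k _ _ => hf k
    _ = ∑ l ∈ Finset.range a, ((G ^ ((l : ℤ) - H)) y - (G ^ ((l : ℤ) - H)) x) :=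
        Finset.sum_image fun l _ l' _ hl => by simpa using hl
    _ ≤ _ := Finset.sum_le_sum fun l _ => ?_
    _ ≤ 1 := h1
  have e : ∀ z, (G ^ ((i : ℤ) - H)) ((G ^ l) z) = (G ^ ((l : ℤ) - H)) ((G ^ i) z) := fun z => by
    rw [← zpow_natCast, ← zpow_natCast, ← RelIso.mul_apply, ← RelIso.mul_apply, ← zpow_add,
      ← zpow_add]
    congr 2
    ring
  have e1 := (G ^ ((l : ℤ) - H)).monotone hx
  have e2 := (G ^ ((l : ℤ) - H)).monotone hy
  rw [(hG.zpow _) x q] at e1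
  rw [(hG.zpow _) y q] at e2
  rw [e, e]
  linarith

variable [DecidableEq 𝒜]

/-- The times when the mean slopes are bounded, the second group has the largest return time and
the top wins. -/
def GoodTime (S : ℕ → PIET n 𝒜) (K : ℝ) (j : ℕ) : Prop :=
  (heights S j).1 ≤ (heights S j).2 ∧ |(S j).slopeA| ≤ K ∧ |(S j).slopeC| ≤ K ∧
    (S j).groupTop < (S j).groupBot

theorem GoodTime.exists_tower {S : ℕ → PIET n 𝒜} {b : Fin n → ℝ} (h : CircSeq S b) {K : ℝ} {j : ℕ}
    (hj : GoodTime S K j) : ∃ s t, Tower (h.circ 0).liftIso (S j) (scale S j) (heights S j).1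
      (heights S j).2 s t K := by
  obtain ⟨s, t, hr⟩ := h.realizes j
  exact ⟨s, t, hr, h.circ j, (CircSeq.heights_pos S j).1, hj.1, hj.2.1, hj.2.2.1⟩

theorem CircSeq.exists_small_floors {S : ℕ → PIET n 𝒜} {b : Fin n → ℝ} (h : CircSeq S b) {K : ℝ}
    (hgood : ∀ N, ∃ j, N ≤ j ∧ GoodTime S K j) {μ : ℝ} (hμ : 0 < μ) (N : ℕ) :
    ∃ j, N ≤ j ∧ GoodTime S K j ∧ ∀ i < (heights S j).2,
      ((h.circ 0).liftIso ^ i) (scale S j) -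
        ((h.circ 0).liftIso ^ i) ((S j).floorLeft (scale S j) (heights S j).1 i) < μ := by
  by_contra hcon
  push Not at hcon
  set G := (h.circ 0).liftIso with hGdef
  have hG : CommutesInt G := (h.circ 0).commutesInt
  have hD := (h.circ 0).boundedVar
  set Ω := ∑ γ, (|(S 0).nonlin γ| + |(S 0).jump γ - (0 : 𝒜 → ℝ) γ|)
  set κ := Real.exp (-(3 * Ω + K)) with hκ
  have hκ0 : 0 < κ := Real.exp_pos _
  obtain ⟨M, hM⟩ := exists_nat_gt (4 / μ)
  have hM0 : 0 < M := by
    have : (0 : ℝ) < M := lt_trans (by positivity) hM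
    exact_mod_cast this
  have hM' : (0 : ℝ) < M := by exact_mod_cast hM0
  have hMμ : 2 / (M : ℝ) ≤ μ / 2 := by
    rw [div_lt_iff₀ hμ] at hM
    rw [div_le_div_iff₀ hM' two_pos]
    linarith
  set Q : ℕ → Fin M → Prop := fun j r => GoodTime S K j ∧ ∃ (i : ℕ) (q m : ℤ),
    (G ^ i) 0 ≤ (r : ℝ) / M + q ∧ ((r : ℝ) + 1) / M + q ≤ (G ^ i) (scale S j) ∧
    (heights S j).1 ≤ m.natAbs ∧
    κ * (1 / M) ≤ (G ^ m) (((r : ℝ) + 1) / M) - (G ^ m) ((r : ℝ) / M) with hQ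
  have key : ∀ j, N ≤ j → GoodTime S K j → ∃ r, Q j r := by
    intro j hj hg
    obtain ⟨i, hi, hiμ⟩ := hcon j hj hg
    obtain ⟨s, t, hT⟩ := hg.exists_tower h
    obtain ⟨X, Y, hX, hXY, hY, hlen, m, hm, hret⟩ := hT.exists_return hD hi hiμ hμ.le
    obtain ⟨r, q, h1, h2⟩ := exists_grid_cell hM0 (x := (G ^ i) X) (y := (G ^ i) Y) (by linarith)
    refine ⟨r, hg, i, q, m, ((G ^ i).monotone hX).trans h1, h2.trans ((G ^ i).monotone hY), hm, ?_⟩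
    have e3 : (r : ℝ) / M < ((r : ℝ) + 1) / M := by
      rw [div_lt_div_iff_of_pos_right hM']; linarith
    have h3 := hret ((G ^ i)⁻¹ ((r : ℝ) / M + q)) ((G ^ i)⁻¹ (((r : ℝ) + 1) / M + q))
      (by
        have := ((G ^ i)⁻¹ : ℝ ≃o ℝ).monotone h1
        rwa [RelIso.inv_apply_self] at this)
      (((G ^ i)⁻¹ : ℝ ≃o ℝ).strictMono (by linarith))
      (by
        have := ((G ^ i)⁻¹ : ℝ ≃o ℝ).monotone h2
        rwa [RelIso.inv_apply_self] at this)
    have e : ∀ z, (G ^ (m + i)) ((G ^ i)⁻¹ z) = (G ^ m) z := fun z => by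
      rw [zpow_add, zpow_natCast, RelIso.mul_apply, RelIso.apply_inv_self]
    rw [e, e, RelIso.apply_inv_self, RelIso.apply_inv_self, hG.zpow, hG.zpow] at h3
    have e4 : ((r : ℝ) + 1) / M + q - ((r : ℝ) / M + q) = 1 / M := by ring
    rw [e4] at h3
    linarith
  obtain ⟨r, hr⟩ : ∃ r : Fin M, ∀ N', ∃ j, N' ≤ j ∧ Q j r := by
    by_contra hc
    push Not at hc
    choose f hf using hc
    obtain ⟨j, hj, hg⟩ := hgood (max N (Finset.univ.sup f))
    obtain ⟨r, hr⟩ := key j ((le_max_left _ _).trans hj) hg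
    exact hf r j ((Finset.le_sup (Finset.mem_univ r)).trans ((le_max_right _ _).trans hj)) hr
  have e3 : (r : ℝ) / M < ((r : ℝ) + 1) / M := by
    rw [div_lt_div_iff_of_pos_right hM']; linarith
  have hsum := summable_images hG e3.le (n := n) (𝒜 := 𝒜) fun H => by
    obtain ⟨N', hN'⟩ := h.exists_lt_heights H
    obtain ⟨j, hj, hg, i, q, m, h1, h2, -, -⟩ := hr N'
    obtain ⟨s, t, hT⟩ := hg.exists_tower h
    exact ⟨S j, scale S j, _, _, s, t, K, i, q, hT, (hN' j hj).1.le, h1, h2⟩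
  have hfin := hsum.tendsto_cofinite_zero.eventually (gt_mem_nhds (show 0 < κ * (1 / M) by positivity))
  rw [Filter.eventually_cofinite] at hfin
  obtain ⟨B, hB⟩ := (hfin.image Int.natAbs).bddAbove
  obtain ⟨N', hN'⟩ := h.exists_lt_heights B
  obtain ⟨j, hj, hg, i, q, m, -, -, h3, h4⟩ := hr N'
  have h5 := hB (Set.mem_image_of_mem _ (show m ∈ _ from not_lt.mpr h4))
  have h6 := (hN' j hj).1
  omega

end PIET

/-! ### Positive and negative parts of the nonlinearity -/

theorem log_sub_log_le {u v : ℝ} (hu : 0 < u) (hv : 0 < v) : Real.log v - Real.log u ≤ (v - u) / u := by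
  rw [← Real.log_div hv.ne' hu.ne', sub_div, div_self hu.ne']
  exact Real.log_le_sub_one_of_pos (div_pos hv hu)

/-- The variations of the logarithm of an affine function on an interval and a subinterval. -/
theorem log_affine_ratio {m e l r x x' y' y : ℝ} (hl : 0 < m * l + e) (hr : 0 < m * r + e)
    (h1 : l ≤ x) (h2 : x ≤ x') (h3 : x' ≤ y') (h4 : y' ≤ y) (h5 : y ≤ r) :
    Real.exp (-|Real.log (m * r + e) - Real.log (m * l + e)|) *
      |Real.log (m * y + e) - Real.log (m * x + e)| * (y' - x') ≤
    |Real.log (m * y' + e) - Real.log (m * x' + e)| * (y - x) := by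
  have hpos : ∀ z, l ≤ z → z ≤ r → 0 < m * z + e := by
    intro z hz hz'
    rcases le_total 0 m with hm | hm
    · nlinarith
    · nlinarith
  have px := hpos x h1 (by linarith)
  have px' := hpos x' (by linarith) (by linarith)
  have py' := hpos y' (by linarith) (by linarith)
  have py := hpos y (by linarith) h5
  have hyx : 0 ≤ y - x := by linarith
  have hyx' : 0 ≤ y' - x' := by linarith
  rcases le_total 0 m with hm | hm
  · have e1 : Real.log (m * l + e) ≤ Real.log (m * r + e) := Real.log_le_log hl (by nlinarith)
    have e2 : Real.log (m * x + e) ≤ Real.log (m * y + e) := Real.log_le_log px (by nlinarith)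
    have e3 : Real.log (m * x' + e) ≤ Real.log (m * y' + e) := Real.log_le_log px' (by nlinarith)
    rw [abs_of_nonneg (by linarith), abs_of_nonneg (by linarith), abs_of_nonneg (by linarith),
      neg_sub, Real.exp_sub, Real.exp_log hl, Real.exp_log hr]
    have e4 : Real.log (m * y + e) - Real.log (m * x + e) ≤ m * (y - x) / (m * l + e) := by
      refine (log_sub_log_le px py).trans ?_
      rw [show m * y + e - (m * x + e) = m * (y - x) by ring]
      exact div_le_div_of_nonneg_left (mul_nonneg hm hyx) hl (by nlinarith)
    have e5 : m * (y' - x') / (m * r + e) ≤ Real.log (m * y' + e) - Real.log (m * x' + e) := by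
      have := log_sub_log_le py' px'
      rw [show m * x' + e - (m * y' + e) = -(m * (y' - x')) by ring, neg_div] at this
      have h6 : m * (y' - x') / (m * r + e) ≤ m * (y' - x') / (m * y' + e) :=
        div_le_div_of_nonneg_left (mul_nonneg hm hyx') py' (by nlinarith)
      linarith
    calc _ ≤ (m * l + e) / (m * r + e) * (m * (y - x) / (m * l + e)) * (y' - x') := by gcongr
      _ = m * (y' - x') / (m * r + e) * (y - x) := by field_simp
      _ ≤ _ := by gcongr
  · have e1 : Real.log (m * r + e) ≤ Real.log (m * l + e) := Real.log_le_log hr (by nlinarith)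
    have e2 : Real.log (m * y + e) ≤ Real.log (m * x + e) := Real.log_le_log py (by nlinarith)
    have e3 : Real.log (m * y' + e) ≤ Real.log (m * x' + e) := Real.log_le_log py' (by nlinarith)
    rw [abs_of_nonpos (by linarith), abs_of_nonpos (by linarith), abs_of_nonpos (by linarith),
      neg_neg, Real.exp_sub, Real.exp_log hl, Real.exp_log hr]
    have e4 : -(Real.log (m * y + e) - Real.log (m * x + e)) ≤ -m * (y - x) / (m * r + e) := by
      have := log_sub_log_le py px
      rw [show m * x + e - (m * y + e) = -m * (y - x) by ring] at this
      have h6 : -m * (y - x) / (m * y + e) ≤ -m * (y - x) / (m * r + e) :=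
        div_le_div_of_nonneg_left (mul_nonneg (by linarith) hyx) hr (by nlinarith)
      linarith
    have e5 : -m * (y' - x') / (m * l + e) ≤ -(Real.log (m * y' + e) - Real.log (m * x' + e)) := by
      have := log_sub_log_le px' py'
      rw [show m * y' + e - (m * x' + e) = -(-m * (y' - x')) by ring, neg_div] at this
      have h6 : -m * (y' - x') / (m * l + e) ≤ -m * (y' - x') / (m * x' + e) :=
        div_le_div_of_nonneg_left (mul_nonneg (by linarith) hyx') px' (by nlinarith)
      linarith
    calc _ ≤ (m * r + e) / (m * l + e) * (-m * (y - x) / (m * r + e)) * (y' - x') := by gcongr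
      _ = -m * (y' - x') / (m * l + e) * (y - x) := by field_simp
      _ ≤ _ := by gcongr

theorem lderiv_ratio {g : Matrix.SpecialLinearGroup (Fin 2) ℝ} {l r x x' y' y : ℝ}
    (h : ∀ z ∈ Set.Icc l r, moebiusDen g z ≠ 0)
    (h1 : l ≤ x) (h2 : x ≤ x') (h3 : x' ≤ y') (h4 : y' ≤ y) (h5 : y ≤ r) :
    Real.exp (-(|lderiv g r - lderiv g l| / 2)) * |lderiv g y - lderiv g x| * (y' - x') ≤
      |lderiv g y' - lderiv g x'| * (y - x) := by
  have hl : l ∈ Set.Icc l r := ⟨le_rfl, by linarith⟩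
  have hr : r ∈ Set.Icc l r := ⟨by linarith, le_rfl⟩
  have hpos := moebiusDen_mul_pos g h hl hr
  have key : ∀ m e : ℝ, 0 < m * l + e → 0 < m * r + e →
      (∀ z, lderiv g z = -2 * Real.log (m * z + e)) →
      Real.exp (-(|lderiv g r - lderiv g l| / 2)) * |lderiv g y - lderiv g x| * (y' - x') ≤
      |lderiv g y' - lderiv g x'| * (y - x) := by
    intro m e p1 p2 hz
    have := log_affine_ratio p1 p2 h1 h2 h3 h4 h5
    have e1 : ∀ u v, |lderiv g u - lderiv g v| =
        2 * |Real.log (m * u + e) - Real.log (m * v + e)| := fun u v => by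
      rw [hz, hz, ← mul_sub, abs_mul]; norm_num
    rw [e1, e1, e1, mul_div_cancel_left₀ _ two_ne_zero]
    linarith
  rcases lt_or_gt_of_ne (h l hl) with h6 | h6
  · refine key (-(g 1 0)) (-(g 1 1)) ?_ ?_ fun z => ?_
    · unfold moebiusDen at h6; linarith
    · have : moebiusDen g r < 0 := by nlinarith
      unfold moebiusDen at this; linarith
    · unfold lderiv moebiusDen
      rw [← Real.log_neg_eq_log]; ring_nf
  · refine key (g 1 0) (g 1 1) h6 ?_ fun z => rfl
    have : 0 < moebiusDen g r := by nlinarith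
    exact this

namespace PIET

variable {n : ℕ} {𝒜 : Type*} [Fintype 𝒜]

/-- The positive (`ε = 1`) or negative (`ε = -1`) part of the nonlinearity in an interval. -/
noncomputable def partVal (T : PIET n 𝒜) (ε : ℝ) (γ : 𝒜) (z : ℝ) : ℝ :=
  max (ε * (lderiv (T.branch γ) z - T.dL γ)) 0

/-- The positive (`ε = 1`) or negative (`ε = -1`) part of the nonlinearity. -/
noncomputable def partVar (T : PIET n 𝒜) (ε : ℝ) : ℝ → ℝ :=
  T.accum (fun γ => max (ε * T.nonlin γ) 0) (T.partVal ε)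

theorem partVal_cases (T : PIET n 𝒜) {ε : ℝ} (hε : ε = 1 ∨ ε = -1) (γ : 𝒜) :
    (∀ z ∈ Set.Icc (T.topLeft γ) (T.topRight γ),
      T.partVal ε γ z = |lderiv (T.branch γ) z - T.dL γ|) ∨
    ∀ z ∈ Set.Icc (T.topLeft γ) (T.topRight γ), T.partVal ε γ z = 0 := by
  unfold partVal
  rcases lderiv_monotone_or_antitone (T.branch γ) (fun z hz => T.den_ne (α := γ) hz) with hm | hm
  · have key : ∀ z ∈ Set.Icc (T.topLeft γ) (T.topRight γ), 0 ≤ lderiv (T.branch γ) z - T.dL γ :=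
      fun z hz => sub_nonneg.mpr (hm (T.left_mem γ) hz hz.1)
    rcases hε with rfl | rfl
    · left
      intro z hz
      rw [one_mul, max_eq_left (key z hz), abs_of_nonneg (key z hz)]
    · right
      intro z hz
      exact max_eq_right (by linarith [key z hz])
  · have key : ∀ z ∈ Set.Icc (T.topLeft γ) (T.topRight γ), lderiv (T.branch γ) z - T.dL γ ≤ 0 :=
      fun z hz => sub_nonpos.mpr (hm (T.left_mem γ) hz hz.1)
    rcases hε with rfl | rfl
    · right
      intro z hz
      exact max_eq_right (by linarith [key z hz])
    · left
      intro z hz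
      rw [max_eq_left (by linarith [key z hz]), abs_of_nonpos (key z hz), neg_one_mul]

theorem partVal_ratio (T : PIET n 𝒜) {ε : ℝ} (hε : ε = 1 ∨ ε = -1) {γ : 𝒜} {x x' y' y : ℝ}
    (h1 : T.topLeft γ ≤ x) (h2 : x ≤ x') (h3 : x' ≤ y') (h4 : y' ≤ y) (h5 : y ≤ T.topRight γ) :
    Real.exp (-(|T.nonlin γ| / 2)) * (T.partVal ε γ y - T.partVal ε γ x) * (y' - x') ≤
      (T.partVal ε γ y' - T.partVal ε γ x') * (y - x) := by
  have mx : x ∈ Set.Icc (T.topLeft γ) (T.topRight γ) := ⟨h1, by linarith⟩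
  have mx' : x' ∈ Set.Icc (T.topLeft γ) (T.topRight γ) := ⟨by linarith, by linarith⟩
  have my' : y' ∈ Set.Icc (T.topLeft γ) (T.topRight γ) := ⟨by linarith, by linarith⟩
  have my : y ∈ Set.Icc (T.topLeft γ) (T.topRight γ) := ⟨by linarith, h5⟩
  rcases T.partVal_cases hε γ with h | h
  · rw [h y my, h x mx, h y' my', h x' mx', ← T.abs_lderiv_sub_le mx my (by linarith),
      ← T.abs_lderiv_sub_le mx' my' h3]
    exact lderiv_ratio (fun z hz => T.den_ne hz) h1 h2 h3 h4 h5
  · rw [h y my, h x mx, h y' my', h x' mx']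
    simp

theorem partVal_monotoneOn (T : PIET n 𝒜) {ε : ℝ} (hε : ε = 1 ∨ ε = -1) (γ : 𝒜) :
    MonotoneOn (T.partVal ε γ) (Set.Icc (T.topLeft γ) (T.topRight γ)) := by
  intro x hx y hy hxy
  rcases T.partVal_cases hε γ with h | h
  · rw [h y hy, h x hx, ← sub_nonneg, ← T.abs_lderiv_sub_le hx hy hxy]
    exact abs_nonneg _
  · rw [h y hy, h x hx]

theorem partVal_left (T : PIET n 𝒜) (ε : ℝ) (γ : 𝒜) : T.partVal ε γ (T.topLeft γ) = 0 := by
  unfold partVal dL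
  rw [sub_self, mul_zero, max_self]

theorem lderiv_continuousOn (T : PIET n 𝒜) (γ : 𝒜) :
    ContinuousOn (lderiv (T.branch γ)) (Set.Icc (T.topLeft γ) (T.topRight γ)) := by
  unfold lderiv moebiusDen
  refine ContinuousOn.mul continuousOn_const (ContinuousOn.log (by fun_prop) fun z hz => T.den_ne hz)

theorem Circ.partVar_quasiPeriodic {T : PIET n 𝒜} (h : T.Circ) {ε : ℝ} (hε : ε = 1 ∨ ε = -1) :
    QuasiPeriodic (T.partVar ε) (∑ γ, max (ε * T.nonlin γ) 0) :=
  ⟨h.accum_monotone (T.partVal_monotoneOn hε) (fun γ => (T.partVal_left ε γ).ge) fun γ => le_rfl,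
    fun x k => accum_add_int x k⟩

theorem Circ.partVar_continuous {T : PIET n 𝒜} (h : T.Circ) (ε : ℝ) : Continuous (T.partVar ε) :=
  h.accum_continuous (fun γ => by
    have := T.lderiv_continuousOn γ
    unfold partVal
    fun_prop) (T.partVal_left ε) fun γ => rfl

theorem _root_.QuasiPeriodic.exists_small {Ψ : ℝ → ℝ} {tot : ℝ} (h : QuasiPeriodic Ψ tot)
    (hc : Continuous Ψ) {η : ℝ} (hη : 0 < η) :
    ∃ μ, 0 < μ ∧ ∀ x y, x ≤ y → y - x < μ → Ψ y - Ψ x ≤ η := by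
  have hu := (isCompact_Icc (a := (0 : ℝ)) (b := 2)).uniformContinuousOn_of_continuous
    hc.continuousOn
  rw [Metric.uniformContinuousOn_iff] at hu
  obtain ⟨δ, hδ, hd⟩ := hu η hη
  refine ⟨min δ 1, lt_min hδ one_pos, fun x y hxy hlt => ?_⟩
  have f0 := Int.fract_nonneg x
  have f1 := Int.fract_lt_one x
  have ex := Int.fract_add_floor x
  have h1 := lt_min_iff.mp hlt
  have h2 := hd (Int.fract x) ⟨f0, by linarith⟩ (y - ⌊x⌋) ⟨by linarith, by linarith⟩ (by
    rw [Real.dist_eq, abs_lt]; constructor <;> linarith)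
  rw [Real.dist_eq, abs_lt] at h2
  have h3 := h.add_int (Int.fract x) ⌊x⌋
  have h4 := h.add_int (y - ⌊x⌋) ⌊x⌋
  rw [ex] at h3
  rw [sub_add_cancel] at h4
  linarith

/-- The number of singularities. -/
noncomputable def countSing (T : PIET n 𝒜) : ℝ → ℝ := T.accum (fun _ => 1) fun _ _ => 0

theorem Circ.countSing_quasiPeriodic {T : PIET n 𝒜} (h : T.Circ) :
    QuasiPeriodic T.countSing (n + 1) := by
  have e : ∑ _γ : 𝒜, (1 : ℝ) = n + 1 := by
    rw [← Equiv.sum_comp T.perm.top]; simp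
  rw [← e]
  exact ⟨h.accum_monotone (fun _ => monotoneOn_const) (fun _ => le_rfl) fun _ => zero_le_one,
    fun x k => accum_add_int x k⟩

theorem Circ.partVar_ratio {T : PIET n 𝒜} (h : T.Circ) {ε κ η : ℝ} (hε : ε = 1 ∨ ε = -1)
    (hκ0 : 0 ≤ κ) (hκ1 : κ ≤ 1) (hη : 0 ≤ η) {x x' y' y : ℝ} (h2 : x ≤ x') (h3 : x' ≤ y') (h4 : y' ≤ y)
    (hsmall : T.partVar ε y - T.partVar ε x ≤ η) (hlen : κ * (y - x) ≤ y' - x') :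
    Real.exp (-(T.totalNonlin / 2)) * κ * (T.partVar ε y - T.partVar ε x) -
      η * (T.countSing y - T.countSing x) ≤ T.partVar ε y' - T.partVar ε x' := by
  have hmono := (h.partVar_quasiPeriodic hε).mono
  have m1 : T.partVar ε x ≤ T.partVar ε y := hmono (by linarith)
  have m2 : T.partVar ε x' ≤ T.partVar ε y' := hmono h3
  have hE : Real.exp (-(T.totalNonlin / 2)) ≤ 1 := by
    rw [Real.exp_le_one_iff]
    have : 0 ≤ T.totalNonlin := Finset.sum_nonneg fun _ _ => abs_nonneg _
    linarith
  have hE0 := Real.exp_pos (-(T.totalNonlin / 2))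
  by_cases hcnt : 1 ≤ T.countSing y - T.countSing x
  · have e1 : Real.exp (-(T.totalNonlin / 2)) * κ ≤ 1 := mul_le_one₀ hE hκ0 hκ1
    have e2 := mul_le_mul_of_nonneg_right e1 (sub_nonneg.mpr m1)
    have e3 := mul_le_mul_of_nonneg_left hcnt hη
    linarith
  · push Not at hcnt
    obtain ⟨α, hα⟩ := h.exists_letter x
    obtain ⟨β, hβ⟩ := h.exists_letter y
    have hcx : T.countSing x = partLeft T.perm.top (fun _ => 1) 0 α + 0 + _ := accum_eq hα
    have hcy : T.countSing y = partLeft T.perm.top (fun _ => 1) 0 β + 0 + _ := accum_eq hβ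
    have hw : ∀ α : 𝒜, (0 : ℝ) ≤ (fun _ => 1) α := fun _ => zero_le_one
    have hS : (1 : ℝ) ≤ ∑ _γ : 𝒜, (1 : ℝ) := by
      have := Finset.single_le_sum (f := fun _ : 𝒜 => (1 : ℝ)) (fun γ _ => hw γ) (Finset.mem_univ α)
      exact this
    have efx := Int.fract_add_floor x
    have efy := Int.fract_add_floor y
    have hfl : ⌊x⌋ = ⌊y⌋ := by
      rcases (Int.floor_le_floor (show x ≤ y by linarith)).lt_or_eq with hlt | heq
      · exfalso
        have e3 : (⌊x⌋ : ℝ) + 1 ≤ ⌊y⌋ := by exact_mod_cast hlt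
        have e4 := partRight_le (p := T.perm.top) (lo := 0) hw α
        have e5 := le_partLeft (p := T.perm.top) (lo := 0) hw β
        nlinarith
      · exact heq
    have hflR : (⌊x⌋ : ℝ) = ⌊y⌋ := by rw [hfl]
    have hαβ : α = β := by
      rcases lt_trichotomy (T.perm.top.symm α : ℕ) (T.perm.top.symm β) with hlt | he | hlt
      · exfalso
        have e1 := partLeft_right_le (p := T.perm.top) (lo := 0) hw hlt
        rw [hcx, hcy, hflR] at hcnt
        linarith
      · exact MarkedPerm.Blocks.eq_of_pos he
      · exfalso
        have := T.topRight_le_topLeft hlt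
        linarith [hα.1, hβ.2]
    subst hαβ
    have key : ∀ z, x ≤ z → z ≤ y → ⌊z⌋ = ⌊x⌋ := fun z hz hz' =>
      le_antisymm ((Int.floor_le_floor hz').trans_eq hfl.symm) (Int.floor_le_floor hz)
    have hval : ∀ z, x ≤ z → z ≤ y → Int.fract z = z - ⌊x⌋ ∧
        T.partVar ε z = partLeft T.perm.top (fun γ => max (ε * T.nonlin γ) 0) 0 α +
          T.partVal ε α (z - ⌊x⌋) + (∑ γ, max (ε * T.nonlin γ) 0) * ⌊x⌋ := by
      intro z hz hz'
      have e1 : Int.fract z = z - ⌊x⌋ := by rw [← Int.self_sub_floor, key z hz hz']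
      refine ⟨e1, ?_⟩
      have hmem : Int.fract z ∈ Set.Ico (T.topLeft α) (T.topRight α) := by
        rw [e1]
        exact ⟨by linarith [hα.1], by linarith [hβ.2]⟩
      have := accum_eq (w := fun γ => max (ε * T.nonlin γ) 0) (u := T.partVal ε) hmem
      rw [e1, key z hz hz'] at this
      exact this
    have ex := hval x le_rfl (by linarith)
    have ex' := hval x' h2 (by linarith)
    have ey' := hval y' (by linarith) h4
    have ey := hval y (by linarith) le_rfl
    rw [ex.1] at hα
    rw [ey.1] at hβ
    have hr := T.partVal_ratio hε (γ := α) (x := x - ⌊x⌋) (x' := x' - ⌊x⌋) (y' := y' - ⌊x⌋)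
      (y := y - ⌊x⌋) hα.1 (by linarith) (by linarith) (by linarith) hβ.2.le
    have hc0 : T.countSing y - T.countSing x = 0 := by rw [hcx, hcy, hflR]; ring
    rw [hc0, mul_zero, sub_zero]
    have d1 : T.partVar ε y - T.partVar ε x =
      T.partVal ε α (y - ⌊x⌋) - T.partVal ε α (x - ⌊x⌋) := by rw [ex.2, ey.2]; ring
    have d2 : T.partVar ε y' - T.partVar ε x' =
      T.partVal ε α (y' - ⌊x⌋) - T.partVal ε α (x' - ⌊x⌋) := by rw [ex'.2, ey'.2]; ring
    rw [← d1, ← d2] at hr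
    have hexp : Real.exp (-(T.totalNonlin / 2)) ≤ Real.exp (-(|T.nonlin α| / 2)) := by
      rw [Real.exp_le_exp]
      have : |T.nonlin α| ≤ T.totalNonlin :=
        Finset.single_le_sum (f := fun γ => |T.nonlin γ|) (fun _ _ => abs_nonneg _)
          (Finset.mem_univ α)
      linarith
    rcases (show x ≤ y by linarith).eq_or_lt with rfl | hlt
    · simp only [sub_self, mul_zero]; linarith
    · refine le_of_mul_le_mul_right ?_ (sub_pos.mpr hlt)
      calc _ = Real.exp (-(T.totalNonlin / 2)) * (T.partVar ε y - T.partVar ε x) *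
            (κ * (y - x)) := by ring
        _ ≤ Real.exp (-(|T.nonlin α| / 2)) * (T.partVar ε y - T.partVar ε x) * (y' - x') := by
            have := sub_nonneg.mpr m1
            have : 0 ≤ κ * (y - x) := mul_nonneg hκ0 (sub_nonneg.mpr hlt.le)
            gcongr
        _ ≤ (T.partVar ε y' - T.partVar ε x') * (y - x) := by
            refine le_trans (le_of_eq ?_) (hr.trans (le_of_eq ?_)) <;> ring

end PIET

/-! ### Decay of the total nonlinearity -/

namespace PIET

variable {n : ℕ} {𝒜 : Type*} [Fintype 𝒜]

/-- The derivative without the contribution of the nonlinearity is a step function. -/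
theorem Circ.eventually_step_eq {T : PIET n 𝒜} (h : T.Circ) (z : ℝ) :
    ∀ᶠ y in nhdsWithin z (Set.Ici z),
      T.logD (Int.fract y) - T.partVar 1 y + T.partVar (-1) y =
        T.logD (Int.fract z) - T.partVar 1 z + T.partVar (-1) z := by
  obtain ⟨α, hα⟩ := h.exists_letter z
  have htR : T.topRight α ≤ 1 := h.hi ▸ T.topRight_le_hi α
  have ez := Int.fract_add_floor z
  have key : ∀ y, z ≤ y → y < z + (T.topRight α - Int.fract z) →
      T.logD (Int.fract y) - T.partVar 1 y + T.partVar (-1) y =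
      T.dL (T.perm.top 0) + partLeft T.perm.top (fun γ => T.nonlin γ + T.jump γ) 0 α -
        partLeft T.perm.top (fun γ => max (1 * T.nonlin γ) 0) 0 α +
        partLeft T.perm.top (fun γ => max (-1 * T.nonlin γ) 0) 0 α +
        ((∑ γ, (T.nonlin γ + T.jump γ)) - (∑ γ, max (1 * T.nonlin γ) 0) +
          ∑ γ, max (-1 * T.nonlin γ) 0) * ⌊z⌋ := by
    intro y h1 h2
    have hfl : ⌊y⌋ = ⌊z⌋ := by
      rw [Int.floor_eq_iff]
      constructor <;> linarith [Int.fract_nonneg z]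
    have hfr : Int.fract y = y - ⌊z⌋ := by rw [← hfl, Int.self_sub_floor]
    have hm : Int.fract y ∈ Set.Ico (T.topLeft α) (T.topRight α) := by
      rw [hfr]; exact ⟨by linarith [hα.1], by linarith⟩
    rw [h.logD_fract, partVar, partVar, accum_eq hm, accum_eq hm, accum_eq hm, hfl]
    have e : T.partVal 1 α (Int.fract y) - T.partVal (-1) α (Int.fract y) =
        lderiv (T.branch α) (Int.fract y) - T.dL α := by
      unfold partVal
      rcases le_total 0 (lderiv (T.branch α) (Int.fract y) - T.dL α) with h0 | h0
      · rw [max_eq_left (by linarith), max_eq_right (by linarith)]; ring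
      · rw [max_eq_right (by linarith), max_eq_left (by linarith)]; ring
    linarith
  have hlt : z < z + (T.topRight α - Int.fract z) := by linarith [hα.2]
  filter_upwards [Ico_mem_nhdsGE hlt] with y hy
  rw [key y hy.1 hy.2, key z le_rfl hlt]

theorem birk_step_eventuallyEq {G : ℝ ≃o ℝ} {Q : ℝ → ℝ}
    (hQ : ∀ z, ∀ᶠ y in nhdsWithin z (Set.Ici z), Q y = Q z) (m : ℕ) (z : ℝ) :
    ∀ᶠ y in nhdsWithin z (Set.Ici z), birk G Q m y = birk G Q m z := by
  have : ∀ i ∈ Finset.range m, ∀ᶠ y in nhdsWithin z (Set.Ici z), Q ((G ^ i) y) = Q ((G ^ i) z) := by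
    intro i _
    have ht : Filter.Tendsto (G ^ i : ℝ ≃o ℝ) (nhdsWithin z (Set.Ici z))
        (nhdsWithin ((G ^ i) z) (Set.Ici ((G ^ i) z))) :=
      ((G ^ i).continuous.continuousWithinAt).tendsto_nhdsWithin fun y hy => (G ^ i).monotone hy
    exact ht.eventually (hQ _)
  filter_upwards [(Finset.eventually_all _).mpr this] with y hy
  exact Finset.sum_congr rfl hy

/-- A logarithmic derivative of a first return map. -/
theorem eq_birk_of_return {G : ℝ ≃o ℝ} {D : ℝ → ℝ} (hD : HasLogDeriv G D) {F E : ℝ → ℝ}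
    (hF : HasLogDeriv F E) {m : ℕ} {ℓ k x y : ℝ} (hℓ : 0 < ℓ)
    (h : ∀ z ∈ Set.Icc x y, (G ^ m) (ℓ * z) = ℓ * F z + k) {z : ℝ} (hz : z ∈ Set.Ico x y) :
    E z = birk G D m (ℓ * z) := by
  have h1 := HasDerivWithinAt.comp (s := Set.Ici z) z ((hD.pow m).deriv (ℓ * z))
    (((hasDerivAt_id z).const_mul ℓ).hasDerivWithinAt)
    fun w hw => mul_le_mul_of_nonneg_left hw hℓ.le
  have h2 := ((hF.deriv z).const_mul ℓ).add_const k
  have h3 : HasDerivWithinAt ((G ^ m : ℝ ≃o ℝ) ∘ fun w => ℓ * id w) (ℓ * Real.exp (E z))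
      (Set.Ici z) z := by
    refine h2.congr_of_eventuallyEq ?_ (h z ⟨hz.1, hz.2.le⟩)
    filter_upwards [Ico_mem_nhdsGE hz.2] with w hw
    exact h w ⟨hz.1.trans hw.1, hw.2.le⟩
  have h4 := (uniqueDiffWithinAt_Ici z).eq_deriv _ h1 h3
  rw [mul_one, mul_comm] at h4
  exact (Real.exp_injective (mul_left_cancel₀ hℓ.ne' h4)).symm

/-- The nonlinearity of a branch of a first return map. -/
theorem nonlin_eq_birk {T₀ T : PIET n 𝒜} (h₀ : T₀.Circ) (h : T.Circ) {m : ℕ} {ℓ k j : ℝ}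
    (hℓ : 0 < ℓ) {γ : 𝒜} (hr : ∀ z ∈ Set.Icc (T.topLeft γ) (T.topRight γ),
      (h₀.liftIso ^ m) (ℓ * z) = ℓ * (T.lift z - j) + k) :
    T.nonlin γ =
      birk h₀.liftIso (T₀.partVar 1) m (ℓ * T.topRight γ) -
        birk h₀.liftIso (T₀.partVar 1) m (ℓ * T.topLeft γ) -
      (birk h₀.liftIso (T₀.partVar (-1)) m (ℓ * T.topRight γ) -
        birk h₀.liftIso (T₀.partVar (-1)) m (ℓ * T.topLeft γ)) := by
  set G := h₀.liftIso
  have e1 : ∀ z ∈ Set.Ico (T.topLeft γ) (T.topRight γ),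
      lderiv (T.branch γ) z = birk G (fun x => T₀.logD (Int.fract x)) m (ℓ * z) := by
    intro z hz
    have h1 := eq_birk_of_return h₀.hasLogDeriv h.hasLogDeriv hℓ (k := k - ℓ * j)
      (fun z hz => by rw [hr z hz]; ring) hz
    have hz' : z ∈ Set.Ico (0 : ℝ) 1 := 
      ⟨h.lo ▸ (T.lo_le_topLeft γ).trans hz.1, hz.2.trans_le (h.hi ▸ T.topRight_le_hi γ)⟩
    rw [Int.fract_eq_self.mpr hz', T.logD_eq hz] at h1
    exact h1
  have hc : ∀ ε, Continuous fun z => birk G (T₀.partVar ε) m (ℓ * z) := by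
    intro ε
    unfold birk
    refine continuous_finsetSum _ fun i _ => ?_
    have := h₀.partVar_continuous ε
    have := (G ^ i).continuous
    fun_prop
  have hconst := constant_of_has_deriv_right_zero
    (f := fun z => lderiv (T.branch γ) z - birk G (T₀.partVar 1) m (ℓ * z) +
      birk G (T₀.partVar (-1)) m (ℓ * z)) (a := T.topLeft γ) (b := T.topRight γ)
    (((T.lderiv_continuousOn γ).sub (hc 1).continuousOn).add (hc (-1)).continuousOn)
    (fun z hz => by
      have hb := birk_step_eventuallyEq (G := G) h₀.eventually_step_eq m (ℓ * z)
      have ht : Filter.Tendsto (fun w => ℓ * w) (nhdsWithin z (Set.Ici z))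
          (nhdsWithin (ℓ * z) (Set.Ici (ℓ * z))) :=
        ((continuous_const_mul ℓ).continuousWithinAt).tendsto_nhdsWithin
          fun y hy => mul_le_mul_of_nonneg_left hy hℓ.le
      have hE : ∀ w, birk G (fun x => T₀.logD (Int.fract x) - T₀.partVar 1 x +
          T₀.partVar (-1) x) m w = birk G (fun x => T₀.logD (Int.fract x)) m w -
          birk G (T₀.partVar 1) m w + birk G (T₀.partVar (-1)) m w := fun w => by
        unfold birk
        rw [Finset.sum_add_distrib, Finset.sum_sub_distrib]
      refine (hasDerivWithinAt_const z _ (lderiv (T.branch γ) z - birk G (T₀.partVar 1) m (ℓ * z) +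
        birk G (T₀.partVar (-1)) m (ℓ * z))).congr_of_eventuallyEq ?_ rfl
      filter_upwards [ht.eventually hb, Ico_mem_nhdsGE hz.2] with w hw hw'
      rw [hE, hE] at hw
      rw [e1 w ⟨hz.1.trans hw'.1, hw'.2⟩, e1 z hz, hw])
    (T.topRight γ) (T.right_mem γ)
  unfold nonlin dR dL
  linarith

/-- Telescoping over the top intervals. -/
theorem Circ.sum_top_sub {T : PIET n 𝒜} (h : T.Circ) (F : ℝ → ℝ) :
    ∑ γ, (F (T.topRight γ) - F (T.topLeft γ)) = F 1 - F 0 := by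
  rw [← Equiv.sum_comp T.perm.top]
  set v : ℕ → ℝ := fun i => if hi : i < n + 1 then F (T.topLeft (T.perm.top ⟨i, hi⟩)) else F 1
  have e : ∀ i : Fin (n + 1), F (T.topRight (T.perm.top i)) - F (T.topLeft (T.perm.top i)) =
      v (i + 1) - v i := by
    intro i
    have hv : v i = F (T.topLeft (T.perm.top i)) := dif_pos i.2
    rw [hv]
    congr 1
    by_cases hi : (i : ℕ) + 1 < n + 1
    · have : v (i + 1) = F (T.topLeft (T.perm.top ⟨i + 1, hi⟩)) := dif_pos hi
      rw [this]
      congr 1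
      symm
      exact partLeft_next (by simp)
    · have : v (i + 1) = F 1 := dif_neg hi
      rw [this, ← h.hi]
      congr 1
      have : i = Fin.last n := by ext; simp; omega
      rw [this]
      exact T.topRight_last
  rw [Finset.sum_congr rfl fun i _ => e i, Fin.sum_univ_eq_sum_range fun i => v (i + 1) - v i,
    Finset.sum_range_sub]
  have h1 : v (n + 1) = F 1 := dif_neg (by omega)
  have h2 : v 0 = F (T.topLeft (T.perm.top 0)) := dif_pos (by omega)
  rw [h1, h2, topLeft_eq, partLeft_first (by simp), h.lo]

end PIET

namespace PIET

variable {n : ℕ} {𝒜 : Type*} [Fintype 𝒜]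

theorem topRight_le_groupTop_or (T : PIET n 𝒜) (γ : 𝒜) :
    T.topRight γ ≤ T.groupTop ∨ T.groupTop ≤ T.topLeft γ := by
  rcases lt_or_ge (T.perm.top.symm γ : ℕ) (T.perm.top.symm (T.perm.bot 0)) with h | h
  · exact Or.inl (T.topRight_le_topLeft h)
  · exact Or.inr (T.topLeft_le_topLeft h)

namespace Tower

variable {G : ℝ ≃o ℝ} {T : PIET n 𝒜} {ℓ K : ℝ} {a c : ℕ} {s t : ℤ} {D Φ : ℝ → ℝ} {Ω : ℝ}

/-- The increments of a function along the tower. -/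
noncomputable def profile (G : ℝ ≃o ℝ) (T : PIET n 𝒜) (ℓ : ℝ) (a c : ℕ) (Ψ : ℝ → ℝ) (y : ℝ) : ℝ :=
  birk G Ψ a (ℓ * min y T.groupTop) + birk G Ψ c (ℓ * max y T.groupTop)

theorem profile_mono (h : Tower G T ℓ a c s t K) {Ψ : ℝ → ℝ} (hΨ : Monotone Ψ) :
    Monotone (profile G T ℓ a c Ψ) := fun x y hxy => by
  have hℓ := h.pos
  unfold profile
  exact add_le_add
    (birk_mono G hΨ a (mul_le_mul_of_nonneg_left (min_le_min_right _ hxy) hℓ.le))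
    (birk_mono G hΨ c (mul_le_mul_of_nonneg_left (max_le_max_right _ hxy) hℓ.le))

theorem profile_one_sub_zero (h : Tower G T ℓ a c s t K) {Ψ : ℝ → ℝ} {tot : ℝ}
    (hΨ : QuasiPeriodic Ψ tot) : profile G T ℓ a c Ψ 1 - profile G T ℓ a c Ψ 0 = tot := by
  have h1 := h.mass Ψ tot hΨ
  unfold profile
  rw [min_eq_right h.circ.groupTop_lt_one.le, max_eq_left h.circ.groupTop_lt_one.le,
    min_eq_left h.circ.groupTop_pos.le, max_eq_right h.circ.groupTop_pos.le, mul_one, mul_zero]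
  linarith

theorem nonlin_eq_profile {T₀ : PIET n 𝒜} {h₀ : T₀.Circ} (h : Tower h₀.liftIso T ℓ a c s t K)
    (γ : 𝒜) : T.nonlin γ =
      profile h₀.liftIso T ℓ a c (T₀.partVar 1) (T.topRight γ) -
        profile h₀.liftIso T ℓ a c (T₀.partVar 1) (T.topLeft γ) -
      (profile h₀.liftIso T ℓ a c (T₀.partVar (-1)) (T.topRight γ) -
        profile h₀.liftIso T ℓ a c (T₀.partVar (-1)) (T.topLeft γ)) := by
  have hlt := T.topLeft_lt_topRight γ
  have h0 := T.lo_le_topLeft γ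
  have h1 := T.topRight_le_hi γ
  rw [h.circ.lo] at h0
  rw [h.circ.hi] at h1
  unfold profile
  rcases T.topRight_le_groupTop_or γ with hγ | hγ
  · rw [nonlin_eq_birk h₀ h.circ h.pos (γ := γ) (m := a) (j := 0) (k := s) fun z hz => by
      rw [sub_zero]; exact h.left z ⟨h0.trans hz.1, hz.2.trans hγ⟩]
    rw [min_eq_left hγ, min_eq_left (hlt.le.trans hγ), max_eq_right hγ,
      max_eq_right (hlt.le.trans hγ)]
    ring
  · rw [nonlin_eq_birk h₀ h.circ h.pos (γ := γ) (m := c) (j := 1) (k := t) fun z hz =>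
      h.right z ⟨hγ.trans hz.1, hz.2.trans h1⟩]
    rw [min_eq_right hγ, min_eq_right (hγ.trans hlt.le), max_eq_left hγ,
      max_eq_left (hγ.trans hlt.le)]
    ring

/-- The second group contains a long interval. -/
theorem exists_long_letter (h : Tower G T ℓ a c s t K) (hw : T.groupTop < T.groupBot) :
    ∃ γ, T.groupTop ≤ T.topLeft γ ∧
      1 / ((1 + Real.exp K) * (n + 1)) ≤ T.topRight γ - T.topLeft γ := by
  have hn : (0 : ℝ) < n + 1 := by positivity
  have hp := h.circ.groupTop_pos
  have hq := h.circ.groupBot_lt_one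
  have hlen : 1 / (1 + Real.exp K) ≤ 1 - T.groupTop := by
    have e1 : Real.exp T.slopeA * T.groupTop = 1 - T.groupBot := by
      rw [slopeA, Real.exp_log (div_pos (by linarith) hp)]
      field_simp
    have e2 : Real.exp (-K) ≤ Real.exp T.slopeA :=
      Real.exp_le_exp.mpr (abs_le.mp h.slopeA_le).1
    have e3 : Real.exp (-K) * T.groupTop ≤ 1 - T.groupTop := by nlinarith
    rw [Real.exp_neg] at e3
    have e4 := Real.exp_pos K
    rw [div_le_iff₀ (by positivity)]
    have e5 : T.groupTop ≤ (1 - T.groupTop) * Real.exp K := by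
      rw [inv_mul_le_iff₀ e4] at e3; linarith
    linarith
  have hsum := h.circ.sum_top_sub fun y => max y T.groupTop
  rw [max_eq_left h.circ.groupTop_lt_one.le, max_eq_right hp.le] at hsum
  have hcard : (Finset.univ : Finset 𝒜).card = n + 1 := by
    rw [Finset.card_univ, ← Fintype.card_congr T.perm.top, Fintype.card_fin]
  obtain ⟨γ, -, hγ⟩ := Finset.exists_le_of_sum_le (s := (Finset.univ : Finset 𝒜))
    ⟨T.perm.top 0, Finset.mem_univ _⟩
    (f := fun _ => 1 / ((1 + Real.exp K) * (n + 1)))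
    (g := fun γ => max (T.topRight γ) T.groupTop - max (T.topLeft γ) T.groupTop) (by
      rw [hsum, Finset.sum_const, hcard, nsmul_eq_mul]
      push_cast
      refine le_trans (le_of_eq ?_) hlen
      have := Real.exp_pos K
      field_simp)
  have hpos : 0 < 1 / ((1 + Real.exp K) * ((n : ℝ) + 1)) := by positivity
  have hlt := T.topLeft_lt_topRight γ
  rcases T.topRight_le_groupTop_or γ with h1 | h1
  · rw [max_eq_right h1, max_eq_right (hlt.le.trans h1), sub_self] at hγ
    linarith
  · rw [max_eq_left h1, max_eq_left (h1.trans hlt.le)] at hγ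
    exact ⟨γ, h1, hγ⟩

theorem le_image_of_long (h : Tower G T ℓ a c s t K) (hD : BoundedVar G D Φ Ω) {γ : 𝒜}
    (hγ : T.groupTop ≤ T.topLeft γ) {lam : ℝ} (hlam0 : 0 ≤ lam)
    (hlam : lam ≤ T.topRight γ - T.topLeft γ)
    {i : ℕ} (hi : i ≤ c) :
    Real.exp (-Ω) * lam * ((G ^ i) ℓ - (G ^ i) (T.floorLeft ℓ a i)) ≤
      (G ^ i) (ℓ * T.topRight γ) - (G ^ i) (ℓ * T.topLeft γ) := by
  have hℓ := h.pos
  have hlt := T.topLeft_lt_topRight γ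
  have h1 := T.topRight_le_hi γ
  rw [h.circ.hi] at h1
  have hfl := h.floorLeft_lt i
  have hfl0 := h.floorLeft_nonneg i
  have m1 : T.floorLeft ℓ a i ≤ ℓ * T.topLeft γ :=
    (h.floorLeft_le i).trans (mul_le_mul_of_nonneg_left hγ hℓ.le)
  have m2 : ℓ * T.topRight γ ≤ ℓ := by nlinarith
  have m3 : ℓ * T.topLeft γ < ℓ * T.topRight γ := mul_lt_mul_of_pos_left hlt hℓ
  have key := hD.mul_le_of_distortion (h.birk_floor_le hD.var hi) le_rfl hfl le_rfl m1 m3 m2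
  have p1 : 0 ≤ (G ^ i) ℓ - (G ^ i) (T.floorLeft ℓ a i) :=
    sub_nonneg.mpr ((G ^ i).monotone hfl.le)
  have p2 : 0 ≤ (G ^ i) (ℓ * T.topRight γ) - (G ^ i) (ℓ * T.topLeft γ) :=
    sub_nonneg.mpr ((G ^ i).monotone m3.le)
  refine le_of_mul_le_mul_right ?_ hℓ
  calc _ = Real.exp (-Ω) * (((G ^ i) ℓ - (G ^ i) (T.floorLeft ℓ a i)) * (ℓ * lam)) := by ring
    _ ≤ Real.exp (-Ω) * (((G ^ i) ℓ - (G ^ i) (T.floorLeft ℓ a i)) *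
        (ℓ * T.topRight γ - ℓ * T.topLeft γ)) := by
      rw [← mul_sub]; gcongr
    _ ≤ _ := key
    _ ≤ _ := mul_le_mul_of_nonneg_left (by linarith) p2

/-- The nonlinearity carried by a long letter. -/
theorem le_profile_of_long {T₀ : PIET n 𝒜} {h₀ : T₀.Circ} (h : Tower h₀.liftIso T ℓ a c s t K)
    (hD : BoundedVar h₀.liftIso D Φ Ω) {ε η μ : ℝ} (hε : ε = 1 ∨ ε = -1) (hη : 0 ≤ η)
    (hμ : ∀ x y, x ≤ y → y - x < μ → T₀.partVar ε y - T₀.partVar ε x ≤ η)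
    (hfl : ∀ i < c, (h₀.liftIso ^ i) ℓ - (h₀.liftIso ^ i) (T.floorLeft ℓ a i) < μ) {γ : 𝒜}
    (hγ : T.groupTop ≤ T.topLeft γ) {lam : ℝ} (hlam0 : 0 ≤ lam)
    (hlam : lam ≤ T.topRight γ - T.topLeft γ) :
    Real.exp (-(T₀.totalNonlin / 2)) * (Real.exp (-Ω) * lam) *
        (∑ γ, max (ε * T₀.nonlin γ) 0) - η * (n + 1) ≤
      profile h₀.liftIso T ℓ a c (T₀.partVar ε) (T.topRight γ) -
        profile h₀.liftIso T ℓ a c (T₀.partVar ε) (T.topLeft γ) := by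
  have hℓ := h.pos
  have hlt := T.topLeft_lt_topRight γ
  have h0 := T.lo_le_topLeft γ
  have h1 := T.topRight_le_hi γ
  rw [h.circ.lo] at h0
  rw [h.circ.hi] at h1
  have m2 : ℓ * T.topRight γ ≤ ℓ := by nlinarith
  have m3 : ℓ * T.topLeft γ < ℓ * T.topRight γ := mul_lt_mul_of_pos_left hlt hℓ
  have hκ1 : Real.exp (-Ω) * lam ≤ 1 :=
    mul_le_one₀ (Real.exp_le_one_iff.mpr (by linarith [hD.nonneg])) hlam0 (by linarith)
  have e : profile h₀.liftIso T ℓ a c (T₀.partVar ε) (T.topRight γ) -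
        profile h₀.liftIso T ℓ a c (T₀.partVar ε) (T.topLeft γ) =
      ∑ i ∈ Finset.range c, (T₀.partVar ε ((h₀.liftIso ^ i) (ℓ * T.topRight γ)) -
        T₀.partVar ε ((h₀.liftIso ^ i) (ℓ * T.topLeft γ))) := by
    unfold profile birk
    rw [min_eq_right hγ, min_eq_right (hγ.trans hlt.le), max_eq_left hγ,
      max_eq_left (hγ.trans hlt.le), Finset.sum_sub_distrib]
    ring
  rw [e, ← h.sum_floors (h₀.partVar_quasiPeriodic hε), ← h.sum_floors h₀.countSing_quasiPeriodic,
    Finset.mul_sum, Finset.mul_sum, ← Finset.sum_sub_distrib]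
  refine Finset.sum_le_sum fun i hi => ?_
  have hi' := Finset.mem_range.mp hi
  have m1 : T.floorLeft ℓ a i ≤ ℓ * T.topLeft γ :=
    (h.floorLeft_le i).trans (mul_le_mul_of_nonneg_left hγ hℓ.le)
  have mono := (h₀.liftIso ^ i).monotone
  exact h₀.partVar_ratio hε (by positivity) hκ1 hη (mono m1) (mono m3.le) (mono m2)
    (hμ _ _ (mono (h.floorLeft_lt i).le) (hfl i hi'))
    (h.le_image_of_long hD hγ hlam0 hlam hi'.le)

/-- A definite part of the positive and negative nonlinearities cancels. -/
theorem totalNonlin_le {T₀ : PIET n 𝒜} {h₀ : T₀.Circ} (h : Tower h₀.liftIso T ℓ a c s t K)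
    (hw : T.groupTop < T.groupBot) (hD : BoundedVar h₀.liftIso D Φ Ω) {η μ : ℝ} (hη : 0 ≤ η)
    (hμ : ∀ ε : ℝ, ε = 1 ∨ ε = -1 →
      ∀ x y, x ≤ y → y - x < μ → T₀.partVar ε y - T₀.partVar ε x ≤ η)
    (hfl : ∀ i < c, (h₀.liftIso ^ i) ℓ - (h₀.liftIso ^ i) (T.floorLeft ℓ a i) < μ) :
    T.totalNonlin ≤ T₀.totalNonlin -
      Real.exp (-(T₀.totalNonlin / 2)) * (Real.exp (-Ω) * (1 / ((1 + Real.exp K) * (n + 1)))) *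
        (T₀.totalNonlin - |∑ γ, T₀.nonlin γ|) + 2 * (η * (n + 1)) := by
  obtain ⟨δ, hδ, hlen⟩ := h.exists_long_letter hw
  have hlam0 : 0 ≤ 1 / ((1 + Real.exp K) * ((n : ℝ) + 1)) := by positivity
  have l1 := h.le_profile_of_long hD (Or.inl rfl) hη (hμ 1 (Or.inl rfl)) hfl hδ hlam0 hlen
  have l2 := h.le_profile_of_long hD (Or.inr rfl) hη (hμ (-1) (Or.inr rfl)) hfl hδ hlam0 hlen
  set κ := Real.exp (-(T₀.totalNonlin / 2)) *
    (Real.exp (-Ω) * (1 / ((1 + Real.exp K) * ((n : ℝ) + 1)))) with hκ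
  have hκ0 : 0 ≤ κ := by positivity
  have q1 := h₀.partVar_quasiPeriodic (ε := 1) (Or.inl rfl)
  have q2 := h₀.partVar_quasiPeriodic (ε := -1) (Or.inr rfl)
  have t1 := h.profile_one_sub_zero q1
  have t2 := h.profile_one_sub_zero q2
  rw [← h.circ.sum_top_sub] at t1 t2
  set A := fun γ => profile h₀.liftIso T ℓ a c (T₀.partVar 1) (T.topRight γ) -
    profile h₀.liftIso T ℓ a c (T₀.partVar 1) (T.topLeft γ)
  set B := fun γ => profile h₀.liftIso T ℓ a c (T₀.partVar (-1)) (T.topRight γ) -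
    profile h₀.liftIso T ℓ a c (T₀.partVar (-1)) (T.topLeft γ)
  have hA : ∀ γ, 0 ≤ A γ := fun γ =>
    sub_nonneg.mpr (h.profile_mono q1.mono (T.topLeft_lt_topRight γ).le)
  have hB : ∀ γ, 0 ≤ B γ := fun γ =>
    sub_nonneg.mpr (h.profile_mono q2.mono (T.topLeft_lt_topRight γ).le)
  have hN : ∀ γ, T.nonlin γ = A γ - B γ := h.nonlin_eq_profile
  have hsum : (∑ γ, max (1 * T₀.nonlin γ) 0) + ∑ γ, max (-1 * T₀.nonlin γ) 0 =
      T₀.totalNonlin := by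
    rw [← Finset.sum_add_distrib]
    refine Finset.sum_congr rfl fun γ _ => ?_
    rcases le_total 0 (T₀.nonlin γ) with h0 | h0
    · rw [max_eq_left (by linarith), max_eq_right (by linarith), abs_of_nonneg h0]; ring
    · rw [max_eq_right (by linarith), max_eq_left (by linarith), abs_of_nonpos h0]; ring
  have hdiff : (∑ γ, max (1 * T₀.nonlin γ) 0) - ∑ γ, max (-1 * T₀.nonlin γ) 0 =
      ∑ γ, T₀.nonlin γ := by
    rw [← Finset.sum_sub_distrib]
    refine Finset.sum_congr rfl fun γ _ => ?_
    rcases le_total 0 (T₀.nonlin γ) with h0 | h0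
    · rw [max_eq_left (by linarith), max_eq_right (by linarith)]; ring
    · rw [max_eq_right (by linarith), max_eq_left (by linarith)]; ring
  classical
  have hterm : ∀ γ, |T.nonlin γ| ≤ A γ + B γ - if γ = δ then 2 * min (A δ) (B δ) else 0 := by
    intro γ
    rw [hN]
    have := hA γ
    have := hB γ
    split_ifs with hγ
    · rw [hγ]
      rcases le_total (A δ) (B δ) with h0 | h0
      · rw [min_eq_left h0, abs_of_nonpos (by linarith)]; linarith
      · rw [min_eq_right h0, abs_of_nonneg (by linarith)]; linarith
    · rw [abs_le]; constructor <;> linarith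
  have htot := Finset.sum_le_sum fun γ (_ : γ ∈ Finset.univ) => hterm γ
  rw [Finset.sum_sub_distrib, Finset.sum_add_distrib, t1, t2, hsum, Finset.sum_ite_eq',
    if_pos (Finset.mem_univ _)] at htot
  have hmin : κ * ((T₀.totalNonlin - |∑ γ, T₀.nonlin γ|) / 2) - η * (n + 1) ≤
      min (A δ) (B δ) := by
    have n1 := neg_abs_le (∑ γ, T₀.nonlin γ)
    have n2 := le_abs_self (∑ γ, T₀.nonlin γ)
    refine le_min ?_ ?_
    · refine le_trans (sub_le_sub_right (mul_le_mul_of_nonneg_left ?_ hκ0) _) l1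
      linarith
    · refine le_trans (sub_le_sub_right (mul_le_mul_of_nonneg_left ?_ hκ0) _) l2
      linarith
  have e : T.totalNonlin = ∑ γ, |T.nonlin γ| := rfl
  rw [e]
  linarith

end Tower

end PIET

namespace PIET

variable {n : ℕ} {𝒜 : Type*} [Fintype 𝒜]

theorem HasBreaks.sum_log {T : PIET n 𝒜} {c : Fin n → ℝ} (h : T.HasBreaks c) :
    ∑ i, Real.log (c i) = -∑ γ, T.nonlin γ := by
  classical
  obtain ⟨e, he⟩ := h
  have d1 : ∀ γ, deriv (moebius (T.branch γ)) (T.topLeft γ) = Real.exp (T.dL γ) := fun γ =>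
    deriv_eq_exp_lderiv _ (T.den_ne (T.left_mem γ))
  have d2 : ∀ γ, deriv (moebius (T.branch γ)) (T.topRight γ) = Real.exp (T.dR γ) := fun γ =>
    deriv_eq_exp_lderiv _ (T.den_ne (T.right_mem γ))
  have key : ∀ i, Real.log (c i) = (∑ γ with e.symm (T.perm.leftPoint γ) = i, T.dL γ) -
      ∑ γ with e.symm (T.perm.rightPoint γ) = i, T.dR γ := by
    intro i
    rw [← he, breakSize]
    simp only [d1, d2]
    rw [← Real.exp_sum, ← Real.exp_sum, ← Real.exp_sub, Real.log_exp]
    congr 1 <;>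
    · refine Finset.sum_congr (Finset.filter_congr fun γ _ => ?_) fun _ _ => rfl
      rw [Equiv.symm_apply_eq]
  rw [Finset.sum_congr rfl fun i _ => key i, Finset.sum_sub_distrib,
    Finset.sum_fiberwise, Finset.sum_fiberwise, ← Finset.sum_sub_distrib, ← Finset.sum_neg_distrib]
  exact Finset.sum_congr rfl fun γ _ => by unfold nonlin; ring

theorem HasBreaks.abs_sum_nonlin_le {T : PIET n 𝒜} {c : Fin n → ℝ} (h : T.HasBreaks c) :
    |∑ γ, T.nonlin γ| ≤ ∑ i, |Real.log (c i)| := by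
  rw [← abs_neg, ← h.sum_log]
  exact Finset.abs_sum_le_sum_abs _ _

theorem totalNonlin_le_groupVar (T : PIET n 𝒜) (c : Fin n → ℝ) : T.totalNonlin ≤ T.groupVar c :=
  le_add_of_nonneg_right (Finset.sum_nonneg fun _ _ => abs_nonneg _)

theorem totalNonlin_nonneg (T : PIET n 𝒜) : 0 ≤ T.totalNonlin :=
  Finset.sum_nonneg fun _ _ => abs_nonneg _

/-- The derivatives are controlled by the mean slopes of the two groups. -/
theorem Circ.abs_logD_le {T : PIET n 𝒜} (h : T.Circ) {c : Fin n → ℝ} (hc : T.HasBreaks c) {K : ℝ}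
    (ha : |T.slopeA| ≤ K) (hb : |T.slopeC| ≤ K) {x : ℝ} (hx : x ∈ Set.Ico (0 : ℝ) 1) :
    |T.logD x| ≤ K + T.groupVar c := by
  have hp := h.groupTop_pos
  have hp1 := h.groupTop_lt_one
  have key : ∀ u v, u < v → 0 ≤ u → v ≤ 1 →
      (∀ z ∈ Set.Ico u v, (z < T.groupTop ↔ x < T.groupTop)) →
      |logSlope T.lift u v| ≤ K → |T.logD x| ≤ K + T.groupVar c := by
    intro u v huv hu hv hs hK
    have hz : ∀ z ∈ Set.Ico u v, |T.logD x - T.logD (Int.fract z)| ≤ T.groupVar c := by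
      intro z hz
      have hz' : z ∈ Set.Ico (0 : ℝ) 1 := ⟨hu.trans hz.1, hz.2.trans_le hv⟩
      rw [Int.fract_eq_self.mpr hz']
      exact h.abs_logD_sub_le hc hz' hx (hs z hz)
    have h1 := h.hasLogDeriv.logSlope_le huv (M := T.logD x + T.groupVar c)
      fun z hz' => by linarith [(abs_le.mp (hz z hz')).1]
    have h2 := h.hasLogDeriv.le_logSlope huv (M := T.logD x - T.groupVar c)
      fun z hz' => by linarith [(abs_le.mp (hz z hz')).2]
    rw [abs_le] at hK ⊢
    constructor <;> linarith [hK.1, hK.2]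
  rw [h.slopeA_eq] at ha
  rw [h.slopeC_eq] at hb
  by_cases hxp : x < T.groupTop
  · exact key 0 T.groupTop hp le_rfl hp1.le (fun z hz => iff_of_true hz.2 hxp) ha
  · exact key T.groupTop 1 hp1 hp.le le_rfl
      (fun z hz => iff_of_false (not_lt.mpr hz.1) hxp) hb

theorem Circ.abs_dL_le {T : PIET n 𝒜} (h : T.Circ) {c : Fin n → ℝ} (hc : T.HasBreaks c) {K : ℝ}
    (ha : |T.slopeA| ≤ K) (hb : |T.slopeC| ≤ K) (γ : 𝒜) : |T.dL γ| ≤ K + T.groupVar c := by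
  have hm : T.topLeft γ ∈ Set.Ico (T.topLeft γ) (T.topRight γ) := ⟨le_rfl, T.topLeft_lt_topRight γ⟩
  have h1 := h.abs_logD_le hc ha hb (x := T.topLeft γ)
    ⟨h.lo ▸ T.lo_le_topLeft γ, hm.2.trans_le (h.hi ▸ T.topRight_le_hi γ)⟩
  rwa [T.logD_eq hm] at h1

theorem card_eq (T : PIET n 𝒜) : Fintype.card 𝒜 = n + 1 := by
  rw [← Fintype.card_congr T.perm.top, Fintype.card_fin]

theorem Circ.sum_variation_le {T : PIET n 𝒜} (h : T.Circ) {c : Fin n → ℝ} (hc : T.HasBreaks c)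
    {K V : ℝ} (ha : |T.slopeA| ≤ K) (hb : |T.slopeC| ≤ K) (hV : T.groupVar c ≤ V) :
    ∑ γ, (|T.nonlin γ| + |T.jump γ - (0 : 𝒜 → ℝ) γ|) ≤ V + (n + 1) * (2 * K + 3 * V) := by
  have hW := T.totalNonlin_le_groupVar c
  rw [Finset.sum_add_distrib]
  refine add_le_add (hW.trans hV) ?_
  have : ∀ γ ∈ (Finset.univ : Finset 𝒜), |T.jump γ - (0 : 𝒜 → ℝ) γ| ≤ 2 * K + 3 * V := by
    intro γ _
    rw [Pi.zero_apply, sub_zero]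
    have h1 := abs_le.mp (h.abs_dL_le hc ha hb γ)
    have h2 := abs_le.mp (h.abs_dL_le hc ha hb (T.perm.top (T.perm.top.symm γ + 1)))
    have h3 : |T.nonlin γ| ≤ T.totalNonlin :=
      Finset.single_le_sum (f := fun γ => |T.nonlin γ|) (fun _ _ => abs_nonneg _)
        (Finset.mem_univ γ)
    have h4 := abs_le.mp h3
    unfold nonlin at h4
    unfold jump
    rw [abs_le]
    constructor <;> linarith
  refine (Finset.sum_le_card_nsmul _ _ _ this).trans_eq ?_
  rw [Finset.card_univ, T.card_eq, nsmul_eq_mul]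
  push_cast
  ring

variable [DecidableEq 𝒜]

namespace CircSeq

variable {S : ℕ → PIET n 𝒜} {c : Fin n → ℝ}

theorem totalNonlin_antitone (h : CircSeq S c) : Antitone fun j => (S j).totalNonlin :=
  antitone_nat_of_succ_le fun j => RauzyChain.totalNonlin_le (h.step j)

theorem sum_nonlin (h : CircSeq S c) (j : ℕ) : ∑ γ, (S j).nonlin γ = ∑ γ, (S 0).nonlin γ := by
  induction j with
  | zero => rfl
  | succ j ih => rw [RauzyChain.sum_nonlin (h.step j), ih]

/-- The total nonlinearity decreases by a definite proportion of its excess. -/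
theorem exists_totalNonlin_le (h : CircSeq S c) {K V : ℝ} (ha : |(S 0).slopeA| ≤ K)
    (hb : |(S 0).slopeC| ≤ K) (hV : (S 0).groupVar c ≤ V)
    (hgood : ∀ N, ∃ j, N ≤ j ∧ GoodTime S K j) {η : ℝ} (hη : 0 < η) :
    ∃ j, GoodTime S K j ∧ (S j).totalNonlin ≤ (S 0).totalNonlin -
      Real.exp (-(V / 2)) * (Real.exp (-(V + (n + 1) * (2 * K + 3 * V))) *
        (1 / ((1 + Real.exp K) * (n + 1)))) *
        ((S 0).totalNonlin - |∑ γ, (S 0).nonlin γ|) + 2 * (η * (n + 1)) := by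
  obtain ⟨μ₁, hμ₁, h₁⟩ := ((h.circ 0).partVar_quasiPeriodic (ε := 1) (Or.inl rfl)).exists_small
    ((h.circ 0).partVar_continuous 1) hη
  obtain ⟨μ₂, hμ₂, h₂⟩ := ((h.circ 0).partVar_quasiPeriodic (ε := -1) (Or.inr rfl)).exists_small
    ((h.circ 0).partVar_continuous (-1)) hη
  obtain ⟨j, -, hj, hfl⟩ := h.exists_small_floors hgood (lt_min hμ₁ hμ₂) 0
  obtain ⟨s, t, hT⟩ := hj.exists_tower h
  refine ⟨j, hj, (hT.totalNonlin_le hj.2.2.2 (h.circ 0).boundedVar hη.le (μ := min μ₁ μ₂) ?_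
    hfl).trans ?_⟩
  · rintro ε (rfl | rfl) x y hxy hlt
    · exact h₁ x y hxy (hlt.trans_le (min_le_left _ _))
    · exact h₂ x y hxy (hlt.trans_le (min_le_right _ _))
  · have hΩ := (h.circ 0).sum_variation_le (h.breaks 0) ha hb hV
    have hW := ((S 0).totalNonlin_le_groupVar c).trans hV
    have hE : 0 ≤ (S 0).totalNonlin - |∑ γ, (S 0).nonlin γ| :=
      sub_nonneg.mpr (Finset.abs_sum_le_sum_abs _ _)
    have hK := Real.exp_pos K
    gcongr

theorem goodTime_of_switch (h : CircSeq S c) {K : ℝ} {j : ℕ}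
    (h1 : ¬ (S j).groupTop < (S j).groupBot) (h2 : (S (j + 1)).groupTop < (S (j + 1)).groupBot)
    (ha : |(S (j + 1)).slopeA| ≤ K) (hb : |(S (j + 1)).slopeC| ≤ K) : GoodTime S K (j + 1) :=
  ⟨heights_le_of_bot (h.bot_of_not h1), ha, hb, h2⟩

/-- The total nonlinearity is eventually controlled by the breaks. -/
theorem exists_totalNonlin_lt (h : CircSeq S c) :
    ∃ J, ∀ j, J ≤ j → (S j).totalNonlin ≤ ∑ i, |Real.log (c i)| + 1 := by
  set V := (S 0).groupVar c with hVdef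
  have hs := h.slopeSeq le_rfl
  have hV0 : 0 ≤ V := hs.V_nonneg
  set K := 3 * V + 1 with hK
  obtain ⟨J, hJ⟩ := hs.exists_abs_le
  have hgood : ∀ k N, ∃ j, N ≤ j ∧ GoodTime (fun i => S (k + i)) K j := by
    intro k N
    obtain ⟨j, hj, h1, h2⟩ := hs.dual.exists_bot_start (N + k + J)
    rw [not_not] at h2
    obtain ⟨i, rfl⟩ := Nat.exists_eq_add_of_le (show k ≤ j by omega)
    have h3 := hJ (k + i) (by omega) (iff_of_false h1 (not_not.mpr h2))
    exact ⟨i + 1, by omega, (h.shift k).goodTime_of_switch (j := i) h1 h2 h3.1 h3.2⟩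
  set κ := Real.exp (-(V / 2)) * (Real.exp (-(V + (n + 1) * (2 * K + 3 * V))) *
    (1 / ((1 + Real.exp K) * ((n : ℝ) + 1)))) with hκ
  have hκ0 : 0 < κ := by positivity
  suffices hsuff : ∃ k, (S k).totalNonlin ≤ |∑ γ, (S 0).nonlin γ| + 1 by
    obtain ⟨k, hk⟩ := hsuff
    refine ⟨k, fun j hj => (h.totalNonlin_antitone hj).trans (hk.trans ?_)⟩
    linarith [(h.breaks 0).abs_sum_nonlin_le]
  by_contra hcon
  push Not at hcon
  have key : ∀ m : ℕ, ∃ k, |(S k).slopeA| ≤ K ∧ |(S k).slopeC| ≤ K ∧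
      (S k).totalNonlin ≤ V - m * (κ / 2) := by
    intro m
    induction m with
    | zero =>
      obtain ⟨j, -, hj⟩ := hgood 0 0
      refine ⟨0 + j, hj.2.1, hj.2.2.1, ?_⟩
      have := h.totalNonlin_antitone (Nat.zero_le (0 + j))
      have := (S 0).totalNonlin_le_groupVar c
      push_cast
      linarith
    | succ m ih =>
      obtain ⟨k, ha, hb, hk⟩ := ih
      have hVk : (S (k + 0)).groupVar c ≤ V := h.groupVar_antitone (Nat.zero_le _)
      have hn : (0 : ℝ) < n + 1 := by positivity
      obtain ⟨j, hj, hW⟩ := (h.shift k).exists_totalNonlin_le (V := V) ha hb hVk (hgood k)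
        (η := κ / (4 * (n + 1))) (by positivity)
      refine ⟨k + j, hj.2.1, hj.2.2.1, hW.trans ?_⟩
      have e1 : κ / (4 * ((n : ℝ) + 1)) * (n + 1) = κ / 4 := by field_simp
      have e2 := h.sum_nonlin k
      have e3 := hcon k
      simp only [add_zero]
      rw [e1, e2, ← hκ]
      push_cast
      nlinarith
  obtain ⟨m, hm⟩ := exists_nat_gt (V / (κ / 2))
  obtain ⟨k, -, -, hk⟩ := key m
  have := (S k).totalNonlin_nonneg
  rw [div_lt_iff₀ (by positivity)] at hm
  linarith

theorem exists_groupVar_le (h : CircSeq S c) :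
    ∃ J, ∀ j, J ≤ j → (S j).groupVar c ≤ 2 * ∑ i, |Real.log (c i)| + 1 := by
  obtain ⟨J, hJ⟩ := h.exists_totalNonlin_lt
  refine ⟨J, fun j hj => ?_⟩
  have := hJ j hj
  unfold groupVar
  linarith

end CircSeq

end PIET

/-! ### The accelerated renormalisation -/

/-- Times of the accelerated steps: the value of `w` is constant from `k i` on, changes at
`k (i + 1) - 1`. -/
def SwitchTimes (w : ℕ → Prop) (k : ℕ → ℕ) : Prop :=
  ∀ i, ∃ j, k i < j ∧ k (i + 1) = j + 1 ∧ ¬(w j ↔ w (k i)) ∧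
    ∀ l, k i ≤ l → l < j → (w l ↔ w (k i))

theorem exists_switchTimes {w : ℕ → Prop} (h : ∀ k, ∃ j, k < j ∧ ¬(w j ↔ w k)) :
    ∃ k : ℕ → ℕ, k 0 = 0 ∧ SwitchTimes w k := by
  classical
  have key : ∀ k, ∃ j, k < j ∧ ¬(w j ↔ w k) ∧ ∀ l, k ≤ l → l < j → (w l ↔ w k) := by
    intro k
    refine ⟨Nat.find (h k), (Nat.find_spec (h k)).1, (Nat.find_spec (h k)).2, fun l h1 h2 => ?_⟩
    rcases h1.eq_or_lt with rfl | h1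
    · exact Iff.rfl
    · have := Nat.find_min (h k) h2
      tauto
  choose f h1 h2 h3 using key
  refine ⟨fun i => (fun m => f m + 1)^[i] 0, rfl, fun i => ⟨_, h1 _, ?_, h2 _, h3 _⟩⟩
  exact Function.iterate_succ_apply' (fun m => f m + 1) i 0

theorem SwitchTimes.strictMono {w : ℕ → Prop} {k : ℕ → ℕ} (h : SwitchTimes w k) : StrictMono k :=
  strictMono_nat_of_lt_succ fun i => by
    obtain ⟨j, h1, h2, -⟩ := h i
    omega

theorem SwitchTimes.shift {w : ℕ → Prop} {k : ℕ → ℕ} (h : SwitchTimes w k) :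
    SwitchTimes (fun l => w (l + 1)) fun i => k (i + 1) - 1 := by
  intro i
  have h0 : ∀ i, 1 ≤ k (i + 1) := fun i => by
    obtain ⟨j, h1, h2, -⟩ := h i
    omega
  obtain ⟨j, h1, h2, h3, h4⟩ := h (i + 1)
  have e := h0 i
  beta_reduce
  refine ⟨j - 1, by omega, by omega, ?_, fun l h5 h6 => ?_⟩
  · rw [Nat.sub_add_cancel (by omega), Nat.sub_add_cancel e]
    exact h3
  · have := h4 (l + 1) (by omega) (by omega)
    rwa [Nat.sub_add_cancel e]

theorem SwitchTimes.exists_switch {w : ℕ → Prop} {k : ℕ → ℕ} (h : SwitchTimes w k) (i : ℕ) :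
    ∃ j, i ≤ j ∧ k (i + 1) = j + 2 ∧ (w j ↔ ¬ w (j + 1)) := by
  obtain ⟨j, h1, h2, h3, h4⟩ := h i
  have h5 := h4 (j - 1) (by omega) (by omega)
  have h6 := h.strictMono.le_apply (x := i)
  refine ⟨j - 1, by omega, by omega, ?_⟩
  rw [Nat.sub_add_cancel (by omega)]
  tauto

namespace PIET

variable {n : ℕ} {𝒜 : Type*} [Fintype 𝒜] [DecidableEq 𝒜]

theorem groupRun_of_steps {S : ℕ → PIET n 𝒜} (h : ∀ j, GroupStep (S j) (S (j + 1))) {s : Bool}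
    {k j : ℕ} (hkj : k ≤ j) (hs : ∀ l, k ≤ l → l < j → (S l).GroupWins s)
    (hj : (S j).GroupWins (!s)) : GroupRun s (S k) (S (j + 1)) := by
  induction hkj using Nat.decreasingInduction with
  | self => exact GroupRun.last hj (h j)
  | of_succ m hm ih =>
    exact GroupRun.more (hs m le_rfl hm) (h m) (ih fun l h1 h2 => hs l (by omega) h2)

namespace GroupSeq

variable {S : ℕ → PIET n 𝒜}

theorem bot_of_not (h : GroupSeq S) {j : ℕ} (hj : ¬ (S j).groupTop < (S j).groupBot) :
    (S j).groupBot < (S j).groupTop := lt_of_le_of_ne (not_lt.mp hj) (h.ne j).symm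

theorem exists_switchTimes (h : GroupSeq S) :
    ∃ k : ℕ → ℕ, k 0 = 0 ∧ SwitchTimes (fun j => (S j).groupTop < (S j).groupBot) k := by
  refine _root_.exists_switchTimes fun k => ?_
  obtain ⟨i, hi, hi'⟩ := h.top_wins (k + 1)
  obtain ⟨j, hj, hj'⟩ := h.bot_wins (k + 1)
  by_cases hk : (S k).groupTop < (S k).groupBot
  · exact ⟨j, by omega, fun hc => hj'.not_gt (hc.mpr hk)⟩
  · exact ⟨i, by omega, fun hc => hk (hc.mp hi')⟩

theorem renormalises (h : GroupSeq S) {k : ℕ → ℕ}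
    (hk : SwitchTimes (fun j => (S j).groupTop < (S j).groupBot) k) (i : ℕ) :
    Renormalises (S (k i)) (S (k (i + 1))) := by
  obtain ⟨j, h1, h2, h3, h4⟩ := hk i
  rw [h2]
  by_cases hw : (S (k i)).groupTop < (S (k i)).groupBot
  · exact ⟨true, hw, groupRun_of_steps h.step h1.le (fun l a b => (h4 l a b).mpr hw)
      (h.bot_of_not fun hc => h3 (iff_of_true hc hw))⟩
  · exact ⟨false, h.bot_of_not hw, groupRun_of_steps h.step h1.le
      (fun l a b => h.bot_of_not fun hc => hw ((h4 l a b).mp hc))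
      (not_not.mp fun hc => h3 (iff_of_false hc hw))⟩

theorem circSeq (h : GroupSeq S) {c : Fin n → ℝ} (hc : (S 0).HasBreaks c) :
    CircSeq (fun j => S (j + 1)) c where
  circ j := ⟨(RauzyChain.lo_hi (h.step j)).1, (RauzyChain.lo_hi (h.step j)).2, h.circular j⟩
  step j := h.step (j + 1)
  ne j := h.ne (j + 1)
  top_wins N := by
    obtain ⟨j, hj, hj'⟩ := h.top_wins (N + 1)
    exact ⟨j - 1, by omega, by rwa [Nat.sub_add_cancel (by omega)]⟩
  bot_wins N := by
    obtain ⟨j, hj, hj'⟩ := h.bot_wins (N + 1)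
    exact ⟨j - 1, by omega, by rwa [Nat.sub_add_cancel (by omega)]⟩
  breaks j := by
    have key : ∀ j, (S j).HasBreaks c := fun j => by
      induction j with
      | zero => exact hc
      | succ j ih =>
        exact RauzyChain.induct (P := fun T => T.HasBreaks c) (fun T T' h hg hT => hT.rauzyStep h hg)
          (h.step j) (h.genusOne j) ih
    exact key (j + 1)

end GroupSeq

/-- Half the opposite of the nonlinearity of the distinguished loop at the left end. -/
def loopNonlin (T : PIET n 𝒜) : ℝ := T.loopMatrix 1 0 * T.loopMatrix 0 0

theorem RauzyStep.loopNonlin {T T' : PIET n 𝒜} (h : RauzyStep T T') (hg : T.perm.GenusOne)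
    (hlo : T.lo = 0) : T'.loopNonlin = (T.cut - T.lo) * T.loopNonlin := by
  have e1 := rescale_apply_one_zero T.lo (T.cut - T.lo) (cut_sub_lo_pos h.cut_ne) T.loopMatrix
  have e2 := rescale_zero_apply_zero_zero (T.cut - T.lo) (cut_sub_lo_pos h.cut_ne) T.loopMatrix
  unfold PIET.loopNonlin
  rcases h.loopMatrix hg with h | h <;> rw [h]
  · rw [e1]
    simp only [hlo] at e2 ⊢
    rw [e2, mul_assoc]
  · simp only [Matrix.SpecialLinearGroup.coe_neg, Matrix.neg_apply, neg_mul_neg]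
    rw [e1]
    simp only [hlo] at e2 ⊢
    rw [e2, mul_assoc]

theorem RauzyChain.loopNonlin {T T' : PIET n 𝒜} {ℓ : ℝ} (h : RauzyChain T ℓ T')
    (hg : T.perm.GenusOne) (hlo : T.lo = 0) : T'.loopNonlin = ℓ * T.loopNonlin := by
  induction h with
  | single h => exact h.loopNonlin hg hlo
  | cons h h' ih => rw [ih (h.genusOne hg) h.lo_eq, h.loopNonlin hg hlo]; ring

theorem Circ.genusOne {T : PIET n 𝒜} (h : T.Circ) : T.perm.GenusOne := by
  obtain ⟨t, ht⟩ := h.blocks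
  exact ht.genusOne

/-- Bound for the smallest group of intervals in terms of the mean slopes. -/
theorem Circ.min_group_le {T : PIET n 𝒜} (h : T.Circ) {K : ℝ} (ha : |T.slopeA| ≤ K)
    (hb : |T.slopeC| ≤ K) : min T.groupTop T.groupBot ≤ 1 / (1 + Real.exp (-K)) := by
  have hE := Real.exp_pos (-K)
  have key : ∀ {T : PIET n 𝒜}, T.Circ → |T.slopeA| ≤ K → T.groupTop ≤ T.groupBot →
      T.groupTop ≤ 1 / (1 + Real.exp (-K)) := by
    intro T h ha hpq
    have hp := h.groupTop_pos
    have hq := h.groupBot_lt_one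
    have e1 : Real.exp T.slopeA * T.groupTop = 1 - T.groupBot := by
      rw [slopeA, Real.exp_log (div_pos (by linarith) hp)]
      field_simp
    have e2 : Real.exp (-K) ≤ Real.exp T.slopeA := Real.exp_le_exp.mpr (abs_le.mp ha).1
    rw [le_div_iff₀ (by positivity)]
    nlinarith
  rcases le_total T.groupTop T.groupBot with hpq | hpq
  · rw [min_eq_left hpq]
    exact key h ha hpq
  · rw [min_eq_right hpq]
    have := key h.inv (by rw [inv_slopeA, abs_neg]; exact hb) (by simpa [inv_groupTop, inv_groupBot])
    simpa [inv_groupTop] using this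

namespace CircSeq

variable {S : ℕ → PIET n 𝒜} {c : Fin n → ℝ}

theorem scale_pos (h : CircSeq S c) (j : ℕ) : 0 < scale S j := by
  induction j with
  | zero => exact one_pos
  | succ j ih => exact mul_pos ih (lt_max_of_lt_left (h.circ j).groupTop_pos)

theorem loopNonlin (h : CircSeq S c) (j : ℕ) : (S j).loopNonlin = scale S j * (S 0).loopNonlin := by
  induction j with
  | zero => exact (one_mul _).symm
  | succ j ih =>
    rw [RauzyChain.loopNonlin (h.step j) (h.circ j).genusOne (h.circ j).lo, ih, (h.circ j).lo, sub_zero,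
      scale]
    ring

theorem scale_mul_of_top (h : CircSeq S c) {k j : ℕ} (hkj : k ≤ j)
    (hw : ∀ l, k ≤ l → l < j → (S l).groupTop < (S l).groupBot) :
    scale S j * (S j).groupTop = scale S k * (S k).groupTop := by
  induction j, hkj using Nat.le_induction with
  | base => rfl
  | succ j hj ih =>
    have h1 := hw j hj (by omega)
    rw [scale, max_eq_right h1.le, mul_assoc,
      ((h.circ j).lift_step_top (h.circ (j + 1)) (h.step j) h1).1]
    exact ih fun l a b => hw l a (by omega)

theorem scale_mul_of_bot (h : CircSeq S c) {k j : ℕ} (hkj : k ≤ j)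
    (hw : ∀ l, k ≤ l → l < j → (S l).groupBot < (S l).groupTop) :
    scale S j * (S j).groupBot = scale S k * (S k).groupBot := by
  induction j, hkj using Nat.le_induction with
  | base => rfl
  | succ j hj ih =>
    have h1 := hw j hj (by omega)
    rw [scale, max_eq_left h1.le, mul_assoc,
      ((h.circ j).lift_step_bot (h.circ (j + 1)) (h.step j) h1).2.1]
    exact ih fun l a b => hw l a (by omega)

/-- The ratio of lengths in an accelerated step. -/
theorem scale_switch (h : CircSeq S c) {k : ℕ → ℕ}
    (hk : SwitchTimes (fun j => (S j).groupTop < (S j).groupBot) k) (i : ℕ) :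
    scale S (k (i + 1)) = scale S (k i) * min (S (k i)).groupTop (S (k i)).groupBot := by
  obtain ⟨j, h1, h2, h3, h4⟩ := hk i
  simp only at h3 h4
  rw [h2, scale]
  by_cases hw : (S (k i)).groupTop < (S (k i)).groupBot
  · have hj := h.bot_of_not fun hc => h3 (iff_of_true hc hw)
    rw [max_eq_left hj.le, min_eq_left hw.le]
    exact h.scale_mul_of_top h1.le fun l a b => (h4 l a b).mpr hw
  · have hj : (S j).groupTop < (S j).groupBot := not_not.mp fun hc => h3 (iff_of_false hc hw)
    rw [max_eq_right hj.le, min_eq_right (h.bot_of_not hw).le]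
    exact h.scale_mul_of_bot h1.le fun l a b => h.bot_of_not fun hc => hw ((h4 l a b).mp hc)

/-- Uniform bounds along the accelerated sequence, after a finite time. -/
theorem exists_uniform (h : CircSeq S c) {k : ℕ → ℕ}
    (hk : SwitchTimes (fun j => (S j).groupTop < (S j).groupBot) k) {V : ℝ}
    (hV : V = 2 * ∑ i, |Real.log (c i)| + 1) :
    ∃ I, ∀ i, I ≤ i → (S (k i)).groupVar c ≤ V ∧ |(S (k i)).slopeA| ≤ 8 * V + 2 ∧
      |(S (k i)).slopeC| ≤ 8 * V + 2 := by
  obtain ⟨J, hJ⟩ := h.exists_groupVar_le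
  rw [← hV] at hJ
  obtain ⟨J', hJ'⟩ := ((h.shift J).slopeSeq (hJ (J + 0) (by omega))).exists_abs_le_step
  refine ⟨J + J' + 1, fun i hi => ?_⟩
  have hmono := hk.strictMono.le_apply (x := i)
  refine ⟨hJ _ (by omega), ?_⟩
  obtain ⟨i, rfl⟩ := Nat.exists_eq_add_of_le' (show 1 ≤ i by omega)
  obtain ⟨j, h1, h2, h3⟩ := hk.exists_switch i
  obtain ⟨l, rfl⟩ := Nat.exists_eq_add_of_le (show J ≤ j by omega)
  rw [h2]
  exact hJ' l (by omega) h3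

theorem exists_scale_le (h : CircSeq S c) {k : ℕ → ℕ}
    (hk : SwitchTimes (fun j => (S j).groupTop < (S j).groupBot) k) {K : ℝ} {I : ℕ}
    (hI : ∀ i, I ≤ i → |(S (k i)).slopeA| ≤ K ∧ |(S (k i)).slopeC| ≤ K) :
    ∃ C, 0 ≤ C ∧ ∀ i, I ≤ i → scale S (k i) ≤ C * (1 / (1 + Real.exp (-K))) ^ i := by
  have hE := Real.exp_pos (-K)
  set r := 1 / (1 + Real.exp (-K)) with hr
  have hr0 : 0 < r := by positivity
  refine ⟨scale S (k I) / r ^ I, div_nonneg (h.scale_pos _).le (by positivity), fun i hi => ?_⟩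
  induction i, hi using Nat.le_induction with
  | base => rw [div_mul_cancel₀ _ (by positivity)]
  | succ i hi ih =>
    rw [h.scale_switch hk, pow_succ, ← mul_assoc]
    have h1 := (h.circ (k i)).min_group_le (hI i hi).1 (hI i hi).2
    have h2 := (h.scale_pos (k i)).le
    exact mul_le_mul ih h1 (le_min (h.circ _).groupTop_pos.le (h.circ _).groupBot_pos.le)
      (h2.trans ih)

end CircSeq

end PIET

/-! ### Perturbation of a branch with given end points -/

theorem abs_sub_le_of_ratio {X Y ρ θ : ℝ} (hX : 0 < X) (hY : 0 < Y) (hρ : 0 < ρ) (hθ : 0 ≤ θ)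
    (hθ1 : θ ≤ 1) (h1 : X ≤ (1 + θ) * Y) (h2 : Y ≤ (1 + θ) * X) (h3 : ρ ≤ 1 + θ)
    (h4 : 1 ≤ (1 + θ) * ρ) : |ρ * X ^ 2 / Y ^ 2 - 1| ≤ 7 * θ := by
  have c1 : (1 + θ) ^ 3 ≤ 1 + 7 * θ := by nlinarith [mul_nonneg hθ hθ, mul_nonneg (mul_nonneg hθ hθ) hθ]
  have a1 : ρ * X ^ 2 ≤ (1 + θ) ^ 3 * Y ^ 2 := by
    calc ρ * X ^ 2 ≤ (1 + θ) * ((1 + θ) * Y) ^ 2 := by gcongr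
      _ = _ := by ring
  have a2 : Y ^ 2 ≤ (1 + θ) ^ 3 * (ρ * X ^ 2) := by
    calc Y ^ 2 ≤ ((1 + θ) * X) ^ 2 := by gcongr
      _ = 1 * ((1 + θ) ^ 2 * X ^ 2) := by ring
      _ ≤ (1 + θ) * ρ * ((1 + θ) ^ 2 * X ^ 2) := by gcongr
      _ = _ := by ring
  have hY2 : 0 < Y ^ 2 := by positivity
  have b1 : ρ * X ^ 2 / Y ^ 2 ≤ 1 + 7 * θ := by
    rw [div_le_iff₀ hY2]
    exact a1.trans (mul_le_mul_of_nonneg_right c1 hY2.le)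
  have b2 : 1 ≤ (1 + 7 * θ) * (ρ * X ^ 2 / Y ^ 2) := by
    rw [← mul_div_assoc, le_div_iff₀ hY2, one_mul]
    exact a2.trans (mul_le_mul_of_nonneg_right c1 (by positivity))
  have b3 : 0 ≤ ρ * X ^ 2 / Y ^ 2 := by positivity
  rw [abs_le]
  refine ⟨?_, by linarith⟩
  by_contra hc
  push Not at hc
  nlinarith

/-- Two Möbius maps with the same values at the ends of an interval. -/
theorem moebius_close {f g : Matrix.SpecialLinearGroup (Fin 2) ℝ} {l r ρ θ : ℝ} (hlr : l < r)
    (hf : ∀ x ∈ Set.Icc l r, moebiusDen f x ≠ 0) (hg : ∀ x ∈ Set.Icc l r, moebiusDen g x ≠ 0)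
    (hl : moebius g l = moebius f l) (hr : moebius g r = moebius f r)
    (hρ : moebiusDen g l ^ 2 = ρ * moebiusDen f l ^ 2) (hθ : 0 ≤ θ) (hθ1 : θ ≤ 1)
    (h3 : ρ ≤ 1 + θ) (h4 : 1 ≤ (1 + θ) * ρ) {x : ℝ} (hx : x ∈ Set.Icc l r) :
    |moebius g x - moebius f x| ≤ θ * (moebius f r - moebius f l) ∧
      |deriv (moebius g) x - deriv (moebius f) x| ≤ 7 * θ * deriv (moebius f) x := by
  have ml : l ∈ Set.Icc l r := ⟨le_rfl, hlr.le⟩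
  have mr : r ∈ Set.Icc l r := ⟨hlr.le, le_rfl⟩
  have pf := moebiusDen_mul_pos f hf ml mr
  have pg := moebiusDen_mul_pos g hg ml mr
  have pX := moebiusDen_mul_pos f hf ml hx
  have pY := moebiusDen_mul_pos g hg ml hx
  have sf := moebius_sub f (hf l ml) (hf r mr)
  have sg := moebius_sub g (hg l ml) (hg r mr)
  have sx := moebius_sub f (hf l ml) (hf x hx)
  have sy := moebius_sub g (hg l ml) (hg x hx)
  have nf := hf l ml
  have ng := hg l ml
  have nfx := hf x hx
  have ngx := hg x hx
  have hP : moebiusDen g l * moebiusDen g r = moebiusDen f l * moebiusDen f r := by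
    have h5 : (r - l) / (moebiusDen g l * moebiusDen g r) =
        (r - l) / (moebiusDen f l * moebiusDen f r) := by rw [← sg, ← sf, hl, hr]
    rw [div_eq_div_iff pg.ne' pf.ne'] at h5
    exact (mul_left_cancel₀ (sub_pos.mpr hlr).ne' h5).symm
  have hρ0 : 0 < ρ := by
    have h5 : 0 < moebiusDen g l ^ 2 := by positivity
    rw [hρ] at h5
    exact pos_of_mul_pos_left h5 (by positivity)
  have eX : ∀ k : Matrix.SpecialLinearGroup (Fin 2) ℝ,
      (r - l) * (moebiusDen k l * moebiusDen k x) =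
      (r - x) * moebiusDen k l ^ 2 + (x - l) * (moebiusDen k l * moebiusDen k r) := by
    intro k
    unfold moebiusDen
    ring
  have eXf := eX f
  have eXg := eX g
  rw [hP, hρ] at eXg
  have hrl := sub_pos.mpr hlr
  have hrx := sub_nonneg.mpr hx.2
  have hxl := sub_nonneg.mpr hx.1
  have sq : 0 ≤ moebiusDen f l ^ 2 := sq_nonneg _
  generalize hXe : moebiusDen f l * moebiusDen f x = X at *
  generalize hYe : moebiusDen g l * moebiusDen g x = Y at *
  generalize hPe : moebiusDen f l * moebiusDen f r = P at *
  have h1 : X ≤ (1 + θ) * Y := by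
    refine le_of_mul_le_mul_left ?_ hrl
    have t1 := mul_le_mul_of_nonneg_right h4 (mul_nonneg hrx sq)
    have t2 := mul_nonneg hθ (mul_nonneg hxl pf.le)
    rw [show (r - l) * ((1 + θ) * Y) = (1 + θ) * ((r - l) * Y) by ring, eXg, eXf]
    linarith
  have h2 : Y ≤ (1 + θ) * X := by
    refine le_of_mul_le_mul_left ?_ hrl
    have t1 := mul_le_mul_of_nonneg_right h3 (mul_nonneg hrx sq)
    have t2 := mul_nonneg hθ (mul_nonneg hxl pf.le)
    rw [show (r - l) * ((1 + θ) * X) = (1 + θ) * ((r - l) * X) by ring, eXg, eXf]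
    linarith
  constructor
  · have uX : (x - l) / X ≤ (r - l) / P := by
      rw [div_le_div_iff₀ pX pf]
      have := mul_nonneg hrx sq
      linarith
    have uY : (x - l) / Y ≤ (r - l) / P := by
      rw [div_le_div_iff₀ pY pf]
      have := mul_nonneg hrx (mul_nonneg hρ0.le sq)
      linarith
    have e : moebius g x - moebius f x = (x - l) / Y - (x - l) / X := by
      rw [← sx, ← sy, hl]; ring
    rw [e, sf, abs_le]
    have vX : 0 ≤ (x - l) / X := div_nonneg hxl pX.le
    have vY : 0 ≤ (x - l) / Y := div_nonneg hxl pY.le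
    have w1 : (x - l) / Y ≤ (1 + θ) * ((x - l) / X) := by
      rw [← mul_div_assoc, div_le_div_iff₀ pY pX]
      linarith [mul_le_mul_of_nonneg_left h1 hxl]
    have w2 : (x - l) / X ≤ (1 + θ) * ((x - l) / Y) := by
      rw [← mul_div_assoc, div_le_div_iff₀ pX pY]
      linarith [mul_le_mul_of_nonneg_left h2 hxl]
    have w3 := mul_le_mul_of_nonneg_left uX hθ
    have w4 := mul_le_mul_of_nonneg_left uY hθ
    constructor <;> linarith
  · rw [deriv_moebius _ nfx, deriv_moebius _ ngx]
    have e : 1 / moebiusDen g x ^ 2 - 1 / moebiusDen f x ^ 2 =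
        (ρ * X ^ 2 / Y ^ 2 - 1) * (1 / moebiusDen f x ^ 2) := by
      rw [← hXe, ← hYe, mul_pow, mul_pow, hρ]
      field_simp
    rw [e, abs_mul, abs_of_nonneg (show 0 ≤ 1 / moebiusDen f x ^ 2 by positivity)]
    exact mul_le_mul_of_nonneg_right (abs_sub_le_of_ratio pX pY hρ0 hθ hθ1 h1 h2 h3 h4)
      (by positivity)

/-- The matrix of a Möbius map which fixes `0` and `τ`. -/
noncomputable def scaleFix (τ d : ℝ) (hd : d ≠ 0) : Matrix.SpecialLinearGroup (Fin 2) ℝ :=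
  ⟨!![d, 0; (d - 1 / d) / τ, 1 / d], by
    rw [Matrix.det_fin_two_of]; field_simp; ring⟩

section scaleFix

variable {τ d : ℝ}

theorem moebiusDen_scaleFix (hd : d ≠ 0) (x : ℝ) :
    moebiusDen (scaleFix τ d hd) x = (d - 1 / d) / τ * x + 1 / d := by
  simp [moebiusDen, scaleFix]

theorem moebius_scaleFix_zero (hd : d ≠ 0) : moebius (scaleFix τ d hd) 0 = 0 := by
  simp [moebius, scaleFix]

theorem moebius_scaleFix_end (hd : d ≠ 0) (hτ : τ ≠ 0) : moebius (scaleFix τ d hd) τ = τ := by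
  simp [moebius, scaleFix]
  field_simp
  simp

theorem moebiusDen_scaleFix_pos (hd : 0 < d) (hτ : 0 < τ) {x : ℝ} (hx : x ∈ Set.Icc 0 τ) :
    0 < moebiusDen (scaleFix τ d hd.ne') x := by
  rw [moebiusDen_scaleFix]
  have e : (d - 1 / d) / τ * x + 1 / d = (d * x + 1 / d * (τ - x)) / τ := by
    field_simp
    ring
  rw [e]
  have h1 : 0 < 1 / d := by positivity
  refine div_pos ?_ hτ
  rcases hx.1.eq_or_lt with h0 | h0
  · rw [← h0]; simp only [mul_zero, sub_zero, zero_add]; positivity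
  · have := mul_pos hd h0
    have := mul_nonneg h1.le (sub_nonneg.mpr hx.2)
    linarith

theorem moebius_scaleFix_mem (hd : 0 < d) (hτ : 0 < τ) {x : ℝ} (hx : x ∈ Set.Icc 0 τ) :
    moebius (scaleFix τ d hd.ne') x ∈ Set.Icc 0 τ := by
  have p0 := moebiusDen_scaleFix_pos hd hτ (x := 0) ⟨le_rfl, hτ.le⟩
  have p1 := moebiusDen_scaleFix_pos hd hτ (x := τ) ⟨hτ.le, le_rfl⟩
  have px := moebiusDen_scaleFix_pos hd hτ hx
  have e0 := moebius_sub _ p0.ne' px.ne'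
  have e1 := moebius_sub _ px.ne' p1.ne'
  rw [moebius_scaleFix_zero, sub_zero] at e0
  rw [moebius_scaleFix_end _ hτ.ne'] at e1
  have q0 : 0 ≤ (x - 0) / (moebiusDen (scaleFix τ d hd.ne') 0 * moebiusDen (scaleFix τ d hd.ne') x) :=
    div_nonneg (by linarith [hx.1]) (by positivity)
  have q1 : 0 ≤ (τ - x) / (moebiusDen (scaleFix τ d hd.ne') x * moebiusDen (scaleFix τ d hd.ne') τ) :=
    div_nonneg (by linarith [hx.2]) (by positivity)
  constructor <;> linarith

end scaleFix

namespace PIET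

variable {n : ℕ} {𝒜 : Type*} [Fintype 𝒜]

/-! ### The distinguished loop of a circular map -/

theorem Circ.loopMatrix_eq {T : PIET n 𝒜} (h : T.Circ) : T.loopMatrix =
    T.branch (T.perm.bot 0) * (T.branch (T.perm.bot (Fin.last n)))⁻¹ *
      (T.branch (T.perm.top (Fin.last n)))⁻¹ * T.branch (T.perm.top 0) := by
  obtain ⟨t, hb⟩ := h.blocks
  unfold loopMatrix
  rw [hb.loop_circular]
  simp

theorem topLeft_top_first (T : PIET n 𝒜) : T.topLeft (T.perm.top 0) = T.lo := by
  rw [topLeft_eq, partLeft_first (by simp)]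

/-- The right end of the top interval of the last bottom letter. -/
theorem Circ.topRight_bot_last {T : PIET n 𝒜} (h : T.Circ) :
    T.topRight (T.perm.bot (Fin.last n)) = T.groupTop := by
  obtain ⟨t, hb⟩ := h.blocks
  unfold groupTop
  rw [topLeft_eq, partLeft_next (α := T.perm.bot (Fin.last n))]
  · rfl
  · have := hb.pos
    rw [hb.top_bot_first, hb.top_bot_last]; omega

theorem Circ.botRight_top_last {T : PIET n 𝒜} (h : T.Circ) :
    T.botRight (T.perm.top (Fin.last n)) = T.groupBot := h.inv.topRight_bot_last

theorem Circ.loop_at_zero {T : PIET n 𝒜} (h : T.Circ) :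
    T.loopMatrix 0 1 = 0 ∧ T.loopMatrix 1 1 =
      moebiusDen (T.branch (T.perm.bot 0)) T.groupTop *
      (1 / moebiusDen (T.branch (T.perm.bot (Fin.last n))) T.groupTop *
      (1 / moebiusDen (T.branch (T.perm.top (Fin.last n))) 1 *
        moebiusDen (T.branch (T.perm.top 0)) 0)) := by
  have l0 : T.topLeft (T.perm.top 0) = 0 := T.topLeft_top_first.trans h.lo
  have r1 : T.topRight (T.perm.top (Fin.last n)) = 1 := T.topRight_last.trans h.hi
  have r2 : T.botRight (T.perm.bot (Fin.last n)) = 1 := T.inv.topRight_last.trans h.hi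
  have l2 : T.botLeft (T.perm.bot 0) = 0 := T.inv.topLeft_top_first.trans h.lo
  have d1 := T.den_ne (T.left_mem (T.perm.top 0))
  have d2 := T.den_ne (T.right_mem (T.perm.top (Fin.last n)))
  have d3 := T.den_ne (T.right_mem (T.perm.bot (Fin.last n)))
  have d4 := T.den_ne (T.left_mem (T.perm.bot 0))
  have m1 := T.branch_left (T.perm.top 0)
  have m2 := T.branch_right (T.perm.top (Fin.last n))
  have m3 := T.branch_right (T.perm.bot (Fin.last n))
  have m4 := T.branch_left (T.perm.bot 0)
  rw [l0] at d1 m1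
  rw [r1] at d2 m2
  rw [r2] at m3
  rw [h.topRight_bot_last] at d3 m3
  rw [l2] at m4
  rw [h.botRight_top_last] at m2
  change moebius _ _ = T.groupBot at m1
  change moebius _ T.groupTop = _ at m4
  change moebiusDen _ T.groupTop ≠ 0 at d4
  have i2 := moebius_inv_apply _ d2
  have j2 := moebiusDen_inv_apply _ d2
  have i3 := moebius_inv_apply _ d3
  have j3 := moebiusDen_inv_apply _ d3
  rw [m2] at i2 j2
  rw [m3] at i3 j3
  rw [h.loopMatrix_eq, mul_assoc, mul_assoc]
  have a1 := moebiusDen_mul (T.branch (T.perm.top (Fin.last n)))⁻¹ _ d1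
  have b1 := moebius_mul (T.branch (T.perm.top (Fin.last n)))⁻¹ _ d1
  rw [m1, j2] at a1
  rw [m1, i2] at b1
  have n1 : moebiusDen ((T.branch (T.perm.top (Fin.last n)))⁻¹ * T.branch (T.perm.top 0)) 0 ≠ 0 := by
    rw [a1]; exact mul_ne_zero (one_div_ne_zero d2) d1
  have a2 := moebiusDen_mul (T.branch (T.perm.bot (Fin.last n)))⁻¹ _ n1
  have b2 := moebius_mul (T.branch (T.perm.bot (Fin.last n)))⁻¹ _ n1
  rw [b1, j3] at a2
  rw [b1, i3] at b2
  have n2 : moebiusDen ((T.branch (T.perm.bot (Fin.last n)))⁻¹ *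
      ((T.branch (T.perm.top (Fin.last n)))⁻¹ * T.branch (T.perm.top 0))) 0 ≠ 0 := by
    rw [a2]; exact mul_ne_zero (one_div_ne_zero d3) n1
  have a3 := moebiusDen_mul (T.branch (T.perm.bot 0)) _ n2
  have b3 := moebius_mul (T.branch (T.perm.bot 0)) _ n2
  rw [b2] at a3 b3
  rw [m4] at b3
  have n3 : moebiusDen (T.branch (T.perm.bot 0) * ((T.branch (T.perm.bot (Fin.last n)))⁻¹ *
      ((T.branch (T.perm.top (Fin.last n)))⁻¹ * T.branch (T.perm.top 0)))) 0 ≠ 0 := by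
    rw [a3]; exact mul_ne_zero d4 n2
  generalize T.branch (T.perm.bot 0) * ((T.branch (T.perm.bot (Fin.last n)))⁻¹ *
      ((T.branch (T.perm.top (Fin.last n)))⁻¹ * T.branch (T.perm.top 0))) = M at *
  constructor
  · unfold moebius at b3
    unfold moebiusDen at n3
    rw [div_eq_zero_iff] at b3
    simpa using b3.resolve_right n3
  · rw [a2, a1] at a3
    rw [← a3, moebiusDen]
    ring

theorem Circ.loop_zero_zero_mul {T : PIET n 𝒜} (h : T.Circ) :
    T.loopMatrix 0 0 * T.loopMatrix 1 1 = 1 := by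
  have := sl2_det T.loopMatrix
  rw [h.loop_at_zero.1] at this
  linarith

theorem exp_neg_lderiv (g : Matrix.SpecialLinearGroup (Fin 2) ℝ) {x : ℝ} (h : moebiusDen g x ≠ 0) :
    Real.exp (-lderiv g x) = moebiusDen g x ^ 2 := by
  have := deriv_eq_exp_lderiv g h
  rw [deriv_moebius g h] at this
  rw [Real.exp_neg, ← this, one_div, _root_.inv_inv]

theorem Circ.loop_one_one_sq_le {T : PIET n 𝒜} (h : T.Circ) {M : ℝ} (hL : ∀ γ, |T.dL γ| ≤ M)
    (hR : ∀ γ, |T.dR γ| ≤ M) : T.loopMatrix 1 1 ^ 2 ≤ Real.exp (4 * M) := by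
  have l0 : T.topLeft (T.perm.top 0) = 0 := T.topLeft_top_first.trans h.lo
  have r1 : T.topRight (T.perm.top (Fin.last n)) = 1 := T.topRight_last.trans h.hi
  have e1 := exp_neg_lderiv _ (T.den_ne (T.left_mem (T.perm.top 0)))
  have e2 := exp_neg_lderiv _ (T.den_ne (T.right_mem (T.perm.top (Fin.last n))))
  have e3 := exp_neg_lderiv _ (T.den_ne (T.right_mem (T.perm.bot (Fin.last n))))
  have e4 := exp_neg_lderiv _ (T.den_ne (T.left_mem (T.perm.bot 0)))
  change Real.exp (-T.dL _) = _ at e1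
  change Real.exp (-T.dR _) = _ at e2
  change Real.exp (-T.dR _) = _ at e3
  change Real.exp (-T.dL _) = moebiusDen _ T.groupTop ^ 2 at e4
  rw [l0] at e1
  rw [r1] at e2
  rw [h.topRight_bot_last] at e3
  rw [h.loop_at_zero.2]
  simp only [mul_pow, div_pow, one_pow]
  rw [← e1, ← e2, ← e3, ← e4, one_div, one_div, ← Real.exp_neg, ← Real.exp_neg, ← Real.exp_add,
    ← Real.exp_add, ← Real.exp_add, Real.exp_le_exp]
  have f1 := abs_le.mp (hL (T.perm.top 0))
  have f2 := abs_le.mp (hR (T.perm.top (Fin.last n)))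
  have f3 := abs_le.mp (hR (T.perm.bot (Fin.last n)))
  have f4 := abs_le.mp (hL (T.perm.bot 0))
  linarith [f1.1, f1.2, f2.1, f2.2, f3.1, f3.2, f4.1, f4.2]

end PIET

/-! ### Approximation by the attracting family -/

namespace PIET

variable {n : ℕ} {𝒜 : Type*} [Fintype 𝒜]

theorem deriv_le_exp (T : PIET n 𝒜) {M : ℝ} {γ : 𝒜} (hL : |T.dL γ| ≤ M) (hR : |T.dR γ| ≤ M) {x : ℝ}
    (hx : x ∈ Set.Icc (T.topLeft γ) (T.topRight γ)) :
    deriv (moebius (T.branch γ)) x ≤ Real.exp M := by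
  rw [deriv_eq_exp_lderiv _ (T.den_ne hx), Real.exp_le_exp]
  have h1 : T.dL γ ≤ M := (abs_le.mp hL).2
  have h2 : T.dR γ ≤ M := (abs_le.mp hR).2
  rcases lderiv_monotone_or_antitone (T.branch γ) (fun z hz => T.den_ne (α := γ) hz) with hm | hm
  · exact (hm hx (T.right_mem γ) hx.2).trans h2
  · exact (hm (T.left_mem γ) hx hx.1).trans h1

theorem deriv_branch_nonneg (T : PIET n 𝒜) {γ : 𝒜} {x : ℝ}
    (hx : x ∈ Set.Icc (T.topLeft γ) (T.topRight γ)) : 0 ≤ deriv (moebius (T.branch γ)) x := by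
  rw [deriv_eq_exp_lderiv _ (T.den_ne hx)]
  exact (Real.exp_pos _).le

theorem segment_mem (T : PIET n 𝒜) (γ : 𝒜) {t : ℝ} (ht : t ∈ Set.Icc (0 : ℝ) 1) :
    T.topLeft γ + t * T.topLen γ ∈ Set.Icc (T.topLeft γ) (T.topRight γ) := by
  have := T.topLen_pos γ
  unfold topRight
  constructor <;> nlinarith [ht.1, ht.2]

theorem C1DistLE.mono {T S : PIET n 𝒜} {ε ε' : ℝ} (h : C1DistLE T S ε) (hε : ε ≤ ε') :
    C1DistLE T S ε' :=
  ⟨h.1, fun α t ht => (h.2 α t ht).imp (·.trans hε) (·.imp (·.trans hε) (·.trans hε))⟩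

theorem C1DistLE.refl (T : PIET n 𝒜) {ε : ℝ} (hε : 0 ≤ ε) : C1DistLE T T ε :=
  ⟨rfl, fun α t _ => by simpa using hε⟩

variable [DecidableEq 𝒜]

/-- Change of the branch of one letter. -/
def updateBranch (T : PIET n 𝒜) (δ : 𝒜) (g : Matrix.SpecialLinearGroup (Fin 2) ℝ)
    (hden : ∀ x ∈ Set.Icc (T.topLeft δ) (T.topRight δ), moebiusDen g x ≠ 0)
    (hl : moebius g (T.topLeft δ) = T.botLeft δ) (hr : moebius g (T.topRight δ) = T.botRight δ) :
    PIET n 𝒜 where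
  perm := T.perm
  lo := T.lo
  hi := T.hi
  topLen := T.topLen
  botLen := T.botLen
  topLen_pos := T.topLen_pos
  botLen_pos := T.botLen_pos
  sum_topLen := T.sum_topLen
  sum_botLen := T.sum_botLen
  branch := Function.update T.branch δ g
  no_pole α := by
    by_cases h : α = δ
    · subst h; rw [Function.update_self]; exact hden
    · rw [Function.update_of_ne h]; exact T.no_pole α
  map_left α := by
    by_cases h : α = δ
    · subst h; rw [Function.update_self]; exact hl
    · rw [Function.update_of_ne h]; exact T.map_left α
  map_right α := by
    by_cases h : α = δ
    · subst h; rw [Function.update_self]; exact hr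
    · rw [Function.update_of_ne h]; exact T.map_right α

section updateBranch

variable {T : PIET n 𝒜} {δ : 𝒜} {g : Matrix.SpecialLinearGroup (Fin 2) ℝ}
  {hden : ∀ x ∈ Set.Icc (T.topLeft δ) (T.topRight δ), moebiusDen g x ≠ 0}
  {hl : moebius g (T.topLeft δ) = T.botLeft δ} {hr : moebius g (T.topRight δ) = T.botRight δ}

theorem updateBranch_branch (α : 𝒜) :
    (T.updateBranch δ g hden hl hr).branch α = if α = δ then g else T.branch α :=
  Function.update_apply _ _ _ _

theorem Circ.updateBranch (h : T.Circ) : (T.updateBranch δ g hden hl hr).Circ :=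
  ⟨h.lo, h.hi, h.blocks⟩

theorem Circ.c1DistLE_updateBranch (h : T.Circ) {M ρ θ : ℝ} (hL : |T.dL δ| ≤ M) (hR : |T.dR δ| ≤ M)
    (hρ : moebiusDen g (T.topLeft δ) ^ 2 = ρ * moebiusDen (T.branch δ) (T.topLeft δ) ^ 2)
    (hθ : 0 ≤ θ) (hθ1 : θ ≤ 1) (h3 : ρ ≤ 1 + θ) (h4 : 1 ≤ (1 + θ) * ρ) :
    C1DistLE T (T.updateBranch δ g hden hl hr) (7 * θ * Real.exp M) := by
  have hM : 0 ≤ M := (abs_nonneg _).trans hL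
  have hE : 1 ≤ Real.exp M := Real.one_le_exp hM
  have hε : 0 ≤ 7 * θ * Real.exp M := by positivity
  refine ⟨rfl, fun α t ht => ⟨?_, ?_⟩⟩
  · change |T.topLeft α + t * T.topLen α - (T.topLeft α + t * T.topLen α)| ≤ _
    rwa [sub_self, abs_zero]
  · change |moebius _ (T.topLeft α + t * T.topLen α) - moebius _ (T.topLeft α + t * T.topLen α)| ≤ _ ∧
      |deriv (moebius _) (T.topLeft α + t * T.topLen α) -
        deriv (moebius _) (T.topLeft α + t * T.topLen α)| ≤ _
    rw [updateBranch_branch]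
    split_ifs with hα
    · subst hα
      have hx := T.segment_mem α ht
      have key := moebius_close (T.topLeft_lt_topRight α) (fun x hx => T.den_ne hx) hden
        (hl.trans (T.branch_left α).symm) (hr.trans (T.branch_right α).symm) hρ hθ hθ1 h3 h4 hx
      rw [abs_sub_comm, abs_sub_comm (deriv _ _)]
      refine ⟨key.1.trans ?_, key.2.trans (mul_le_mul_of_nonneg_left
        (T.deriv_le_exp hL hR hx) (by positivity))⟩
      rw [T.branch_left, T.branch_right]
      have h5 := T.lo_le_botLeft α
      have h6 := T.botRight_le_hi α
      rw [h.lo] at h5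
      rw [h.hi] at h6
      have h7 : T.botRight α - T.botLeft α ≤ 7 * Real.exp M := by linarith
      calc _ ≤ θ * (7 * Real.exp M) := mul_le_mul_of_nonneg_left h7 hθ
        _ = _ := by ring
    · simp only [sub_self, abs_zero]
      exact ⟨hε, hε⟩

end updateBranch

theorem Circ.first_ne {T : PIET n 𝒜} (h : T.Circ) : T.perm.top 0 ≠ T.perm.bot 0 := by
  obtain ⟨t, hb⟩ := h.blocks
  intro hc
  have h1 := hb.top_bot_first
  rw [← hc, Equiv.symm_apply_apply, Fin.val_zero] at h1
  have := hb.pos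
  omega

theorem Circ.top_ne {T : PIET n 𝒜} (h : T.Circ) : T.perm.top 0 ≠ T.perm.top (Fin.last n) := by
  obtain ⟨t, hb⟩ := h.blocks
  have := hb.pos
  have := hb.le_n
  intro hc
  have := T.perm.top.injective hc
  rw [Fin.ext_iff, Fin.val_zero, Fin.val_last] at this
  omega

/-- The square of the perturbation parameter. -/
theorem ratio_bounds {y θ : ℝ} (hy : 2 * |y| ≤ θ) (hθ : θ ≤ 1) :
    0 < 1 + y ∧ 1 + y ≤ 1 + θ ∧ 1 ≤ (1 + θ) * (1 + y) := by
  have h1 := abs_le.mp (le_refl |y|)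
  have h0 := abs_nonneg y
  refine ⟨by linarith [h1.1], by linarith [h1.2], ?_⟩
  nlinarith [h1.1, mul_nonneg h0 h0]

/-- Approximation when the first top letter is not the last bottom letter. -/
theorem Circ.exists_approx_of_ne {T : PIET n 𝒜} (h : T.Circ) {M θ : ℝ} (hL : ∀ γ, |T.dL γ| ≤ M)
    (hR : ∀ γ, |T.dR γ| ≤ M) (hne : T.perm.top 0 ≠ T.perm.bot (Fin.last n))
    (hθ : θ = 2 * |T.loopNonlin|) (hθ1 : θ ≤ 1) :
    ∃ T' ∈ attractingFamily n 𝒜, C1DistLE T T' (7 * θ * Real.exp M) := by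
  set δ := T.perm.top 0
  set τ := T.topLen δ
  have l0 : T.topLeft δ = 0 := T.topLeft_top_first.trans h.lo
  have hτ0 : 0 < τ := T.topLen_pos δ
  have r0 : T.topRight δ = τ := by unfold topRight; rw [l0, zero_add]
  have hτ1 : τ ≤ 1 := by
    have := T.topRight_le_hi δ
    rwa [r0, h.hi] at this
  set y := T.loopNonlin * τ
  have hy : 2 * |y| ≤ θ := by
    rw [abs_mul, abs_of_pos hτ0, hθ]
    nlinarith [abs_nonneg T.loopNonlin]
  obtain ⟨hρ0, h3, h4⟩ := ratio_bounds hy hθ1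
  set e := Real.sqrt (1 + y)
  have he : 0 < e := Real.sqrt_pos.mpr hρ0
  have he2 : e ^ 2 = 1 + y := Real.sq_sqrt hρ0.le
  have hd : 0 < 1 / e := one_div_pos.mpr he
  set D := scaleFix τ (1 / e) hd.ne' with hD
  have hden : ∀ x ∈ Set.Icc (T.topLeft δ) (T.topRight δ), moebiusDen (T.branch δ * D) x ≠ 0 := by
    rw [l0, r0]
    intro x hx
    have h1 := moebiusDen_scaleFix_pos hd hτ0 hx
    rw [moebiusDen_mul _ _ h1.ne']
    refine mul_ne_zero (T.den_ne ?_) h1.ne'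
    rw [l0, r0]
    exact moebius_scaleFix_mem hd hτ0 hx
  have p0 := moebiusDen_scaleFix_pos hd hτ0 (x := 0) ⟨le_rfl, hτ0.le⟩
  have p1 := moebiusDen_scaleFix_pos hd hτ0 (x := τ) ⟨hτ0.le, le_rfl⟩
  have hl : moebius (T.branch δ * D) (T.topLeft δ) = T.botLeft δ := by
    rw [l0, moebius_mul _ _ p0.ne', moebius_scaleFix_zero, ← l0, T.branch_left]
  have hr : moebius (T.branch δ * D) (T.topRight δ) = T.botRight δ := by
    rw [r0, moebius_mul _ _ p1.ne', moebius_scaleFix_end _ hτ0.ne', ← r0, T.branch_right]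
  refine ⟨T.updateBranch δ (T.branch δ * D) hden hl hr, ?_, h.c1DistLE_updateBranch (hL δ) (hR δ)
    (ρ := 1 + y) ?_ (by rw [hθ]; positivity) hθ1 h3 h4⟩
  · rw [mem_attractingFamily]
    have hC : (T.updateBranch δ (T.branch δ * D) hden hl hr).Circ := h.updateBranch
    refine ⟨hC.genusOne, h.lo, h.hi, ?_⟩
    rw [hC.loopMatrix_eq, updateBranch_branch, updateBranch_branch, updateBranch_branch,
      updateBranch_branch]
    have e1 : (T.updateBranch δ (T.branch δ * D) hden hl hr).perm = T.perm := rfl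
    rw [e1, if_neg h.first_ne.symm, if_neg hne.symm, if_neg h.top_ne.symm, if_pos rfl, ← mul_assoc,
      ← h.loopMatrix_eq, sl2_mul_apply]
    have c0 := h.loop_zero_zero_mul
    have e2 : D 0 0 = 1 / e := rfl
    have e3 : D 1 0 = (1 / e - 1 / (1 / e)) / τ := rfl
    have e4 : y = T.loopMatrix 1 0 * T.loopMatrix 0 0 * τ := rfl
    rw [e2, e3]
    have : T.loopMatrix 1 0 * (1 / e) + T.loopMatrix 1 1 * ((1 / e - 1 / (1 / e)) / τ) =
        (T.loopMatrix 1 0 * τ + T.loopMatrix 1 1 * (1 - e ^ 2)) / (e * τ) := by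
      field_simp
    rw [this, he2, div_eq_zero_iff]
    left
    rw [e4]
    linear_combination (-T.loopMatrix 1 0 * τ) * c0
  · rw [l0, moebiusDen_mul _ _ p0.ne', moebius_scaleFix_zero, moebiusDen_scaleFix, mul_zero,
      zero_add, one_div_one_div, mul_pow, he2]
    ring

/-- Approximation when the first top letter is the last bottom letter. -/
theorem Circ.exists_approx_of_eq {T : PIET n 𝒜} (h : T.Circ) {M θ : ℝ} (hL : ∀ γ, |T.dL γ| ≤ M)
    (hR : ∀ γ, |T.dR γ| ≤ M) (heq : T.perm.top 0 = T.perm.bot (Fin.last n))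
    (hne : T.perm.bot 0 ≠ T.perm.top (Fin.last n))
    (hθ : θ = 4 * (Real.exp (4 * M) * |T.loopNonlin|)) (hθ1 : θ ≤ 1) :
    ∃ T' ∈ attractingFamily n 𝒜, C1DistLE T T' (7 * θ * Real.exp M) := by
  set δ := T.perm.bot 0
  set κ := T.botLen δ
  have l0 : T.botLeft δ = 0 := T.inv.topLeft_top_first.trans h.lo
  have hκ0 : 0 < κ := T.botLen_pos δ
  have r0 : T.botRight δ = κ := by unfold botRight; rw [l0, zero_add]
  have hκ1 : κ ≤ 1 := by
    have := T.botRight_le_hi δ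
    rwa [r0, h.hi] at this
  set y := -(κ * T.loopNonlin * T.loopMatrix 1 1 ^ 2)
  have h11 := h.loop_one_one_sq_le hL hR
  have hyE : |y| ≤ Real.exp (4 * M) * |T.loopNonlin| := by
    rw [abs_neg, abs_mul, abs_mul, abs_of_pos hκ0, abs_of_nonneg (sq_nonneg (T.loopMatrix 1 1))]
    have h5 := abs_nonneg T.loopNonlin
    calc _ ≤ 1 * |T.loopNonlin| * Real.exp (4 * M) := by gcongr
      _ = _ := by ring
  have hθ0 : 0 ≤ θ := by rw [hθ]; positivity
  have hylt : |y| ≤ 1 / 4 := by linarith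
  have hy1 := abs_le.mp hylt
  have hpos : 0 < 1 + y := by linarith [hy1.1]
  have hz : 2 * |1 / (1 + y) - 1| ≤ θ := by
    have e1 : 1 / (1 + y) - 1 = -y / (1 + y) := by field_simp; ring
    rw [e1, abs_div, abs_neg, abs_of_pos hpos, ← mul_div_assoc, div_le_iff₀ hpos]
    nlinarith [hy1.1, abs_nonneg y]
  obtain ⟨hρ0, h3, h4⟩ := ratio_bounds hz hθ1
  rw [add_sub_cancel] at hρ0 h3 h4
  set d := Real.sqrt (1 + y)
  have hd : 0 < d := Real.sqrt_pos.mpr hpos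
  have hd2 : d ^ 2 = 1 + y := Real.sq_sqrt hpos.le
  set D := scaleFix κ d hd.ne' with hD
  have hbr : ∀ x ∈ Set.Icc (T.topLeft δ) (T.topRight δ), moebius (T.branch δ) x ∈ Set.Icc 0 κ := by
    intro x hx
    have hm := (T.branch_strictMonoOn δ).monotoneOn
    have h1 := hm (T.left_mem δ) hx hx.1
    have h2 := hm hx (T.right_mem δ) hx.2
    rw [T.branch_left, l0] at h1
    rw [T.branch_right, r0] at h2
    exact ⟨h1, h2⟩
  have hden : ∀ x ∈ Set.Icc (T.topLeft δ) (T.topRight δ), moebiusDen (D * T.branch δ) x ≠ 0 := by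
    intro x hx
    rw [moebiusDen_mul _ _ (T.den_ne hx)]
    exact mul_ne_zero (moebiusDen_scaleFix_pos hd hκ0 (hbr x hx)).ne' (T.den_ne hx)
  have hl : moebius (D * T.branch δ) (T.topLeft δ) = T.botLeft δ := by
    rw [moebius_mul _ _ (T.den_ne (T.left_mem δ)), T.branch_left, l0, moebius_scaleFix_zero]
  have hr : moebius (D * T.branch δ) (T.topRight δ) = T.botRight δ := by
    rw [moebius_mul _ _ (T.den_ne (T.right_mem δ)), T.branch_right, r0,
      moebius_scaleFix_end _ hκ0.ne']
  refine ⟨T.updateBranch δ (D * T.branch δ) hden hl hr, ?_, h.c1DistLE_updateBranch (hL δ) (hR δ)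
    (ρ := 1 / (1 + y)) ?_ hθ0 hθ1 h3 h4⟩
  · rw [mem_attractingFamily]
    have hC : (T.updateBranch δ (D * T.branch δ) hden hl hr).Circ := h.updateBranch
    refine ⟨hC.genusOne, h.lo, h.hi, ?_⟩
    rw [hC.loopMatrix_eq, updateBranch_branch, updateBranch_branch, updateBranch_branch,
      updateBranch_branch]
    have e1 : (T.updateBranch δ (D * T.branch δ) hden hl hr).perm = T.perm := rfl
    rw [e1, if_pos rfl, if_neg (show T.perm.bot (Fin.last n) ≠ δ from heq ▸ h.first_ne),
      if_neg hne.symm, if_neg h.first_ne, mul_assoc, mul_assoc, mul_assoc, ← mul_assoc (T.branch δ),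
      ← mul_assoc (T.branch δ * _), ← h.loopMatrix_eq, sl2_mul_apply]
    have c0 := h.loop_zero_zero_mul
    have e2 : D 1 1 = 1 / d := rfl
    have e3 : D 1 0 = (d - 1 / d) / κ := rfl
    have e4 : y = -(κ * (T.loopMatrix 1 0 * T.loopMatrix 0 0) * T.loopMatrix 1 1 ^ 2) := rfl
    rw [e2, e3]
    have : (d - 1 / d) / κ * T.loopMatrix 0 0 + 1 / d * T.loopMatrix 1 0 =
        ((d ^ 2 - 1) * T.loopMatrix 0 0 + κ * T.loopMatrix 1 0) / (d * κ) := by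
      field_simp
    rw [this, hd2, div_eq_zero_iff]
    left
    rw [e4]
    linear_combination (-T.loopMatrix 1 0 * κ * (T.loopMatrix 0 0 * T.loopMatrix 1 1 + 1)) * c0
  · rw [moebiusDen_mul _ _ (T.den_ne (T.left_mem δ)), T.branch_left, l0, moebiusDen_scaleFix, mul_zero,
      zero_add, mul_pow, div_pow, hd2, one_pow]

end PIET

namespace PIET

variable {n : ℕ} {𝒜 : Type*} [Fintype 𝒜]

/-- Postcomposition with affine maps which change the lengths of the bottom intervals. -/
noncomputable def withBot (T : PIET n 𝒜) (len : 𝒜 → ℝ) (hpos : ∀ α, 0 < len α)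
    (hsum : ∑ α, len α = T.hi - T.lo) : PIET n 𝒜 :=
  have hk : ∀ α, 0 < len α / T.botLen α := fun α => div_pos (hpos α) (T.botLen_pos α)
  have hden : ∀ α, ∀ x ∈ Set.Icc (T.topLeft α) (T.topRight α), moebius (affineSL
      (partLeft T.perm.bot len T.lo α - len α / T.botLen α * T.botLeft α) (len α / T.botLen α)
      (hk α) * T.branch α) x = partLeft T.perm.bot len T.lo α - len α / T.botLen α * T.botLeft α +
      len α / T.botLen α * moebius (T.branch α) x := fun α x hx => by
    rw [moebius_mul _ _ (T.den_ne hx), moebius_affineSL]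
  { perm := T.perm
    lo := T.lo
    hi := T.hi
    topLen := T.topLen
    botLen := len
    topLen_pos := T.topLen_pos
    botLen_pos := hpos
    sum_topLen := T.sum_topLen
    sum_botLen := hsum
    branch := fun α => affineSL
      (partLeft T.perm.bot len T.lo α - len α / T.botLen α * T.botLeft α) (len α / T.botLen α)
      (hk α) * T.branch α
    no_pole := fun α x hx => by
      change moebiusDen _ x ≠ 0
      rw [moebiusDen_mul _ _ (T.den_ne hx), moebiusDen_affineSL]
      exact mul_ne_zero (one_div_ne_zero (Real.sqrt_pos.mpr (hk α)).ne') (T.den_ne hx)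
    map_left := fun α => by
      refine (hden α _ (T.left_mem α)).trans ?_
      rw [T.branch_left, sub_add_cancel]
      rfl
    map_right := fun α => by
      refine (hden α _ (T.right_mem α)).trans ?_
      rw [T.branch_right, botRight, mul_add, ← add_assoc, sub_add_cancel,
        div_mul_cancel₀ _ (T.botLen_pos α).ne']
      rfl }

section withBot

variable {T : PIET n 𝒜} {len : 𝒜 → ℝ} {hpos : ∀ α, 0 < len α}
  {hsum : ∑ α, len α = T.hi - T.lo} {α : 𝒜} {x : ℝ}

theorem withBot_moebius (hx : x ∈ Set.Icc (T.topLeft α) (T.topRight α)) :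
    moebius ((T.withBot len hpos hsum).branch α) x = partLeft T.perm.bot len T.lo α +
      len α / T.botLen α * (moebius (T.branch α) x - T.botLeft α) := by
  change moebius (affineSL _ _ (div_pos (hpos α) (T.botLen_pos α)) * T.branch α) x = _
  rw [moebius_mul _ _ (T.den_ne hx), moebius_affineSL]
  ring

theorem withBot_den (hx : x ∈ Set.Icc (T.topLeft α) (T.topRight α)) :
    moebiusDen ((T.withBot len hpos hsum).branch α) x =
      1 / Real.sqrt (len α / T.botLen α) * moebiusDen (T.branch α) x := by
  change moebiusDen (affineSL _ _ (div_pos (hpos α) (T.botLen_pos α)) * T.branch α) x = _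
  rw [moebiusDen_mul _ _ (T.den_ne hx), moebiusDen_affineSL]

theorem withBot_deriv (hx : x ∈ Set.Icc (T.topLeft α) (T.topRight α)) :
    deriv (moebius ((T.withBot len hpos hsum).branch α)) x =
      len α / T.botLen α * deriv (moebius (T.branch α)) x := by
  have h1 := T.den_ne hx
  have h2 : moebiusDen ((T.withBot len hpos hsum).branch α) x ≠ 0 :=
    (T.withBot len hpos hsum).den_ne hx
  have hk := div_pos (hpos α) (T.botLen_pos α)
  rw [deriv_moebius _ h1, deriv_moebius _ h2, withBot_den hx, mul_pow, div_pow, one_pow,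
    Real.sq_sqrt hk.le]
  field_simp

theorem Circ.withBot (h : T.Circ) : (T.withBot len hpos hsum).Circ := ⟨h.lo, h.hi, h.blocks⟩

theorem c1DistLE_withBot {M θ : ℝ} (hL : ∀ γ, |T.dL γ| ≤ M) (hR : ∀ γ, |T.dR γ| ≤ M) (hθ : 0 ≤ θ)
    (hk : ∀ γ, |len γ / T.botLen γ - 1| ≤ θ)
    (him : ∀ γ, ∀ y ∈ Set.Icc (T.botLeft γ) (T.botRight γ),
      |y - (partLeft T.perm.bot len T.lo γ + len γ / T.botLen γ * (y - T.botLeft γ))| ≤ θ) :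
    C1DistLE T (T.withBot len hpos hsum) (θ * Real.exp M) := by
  have hM : 0 ≤ M := (abs_nonneg _).trans (hL (T.perm.top 0))
  have hE : 1 ≤ Real.exp M := Real.one_le_exp hM
  refine ⟨rfl, fun α t ht => ?_⟩
  have hx := T.segment_mem α ht
  refine ⟨?_, ?_, ?_⟩
  · change |T.topLeft α + t * T.topLen α - (T.topLeft α + t * T.topLen α)| ≤ _
    rw [sub_self, abs_zero]
    positivity
  · change |_ - moebius _ (T.topLeft α + t * T.topLen α)| ≤ _
    rw [withBot_moebius hx]
    have hm := (T.branch_strictMonoOn α).monotoneOn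
    have h1 := hm (T.left_mem α) hx hx.1
    have h2 := hm hx (T.right_mem α) hx.2
    rw [T.branch_left] at h1
    rw [T.branch_right] at h2
    exact (him α _ ⟨h1, h2⟩).trans (le_mul_of_one_le_right hθ hE)
  · change |_ - deriv (moebius _) (T.topLeft α + t * T.topLen α)| ≤ _
    rw [withBot_deriv hx]
    have e : ∀ D k : ℝ, D - k * D = -((k - 1) * D) := fun D k => by ring
    rw [e, abs_neg, abs_mul, abs_of_nonneg (T.deriv_branch_nonneg hx)]
    exact mul_le_mul (hk α) (T.deriv_le_exp (hL α) (hR α) hx) (T.deriv_branch_nonneg hx) hθ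

end withBot

/-- The commutator of two Möbius maps exchanging two intervals. -/
theorem commutator_identity {A C : Matrix.SpecialLinearGroup (Fin 2) ℝ} {p q s u : ℝ} (hp : p ≠ 0)
    (hp1 : 1 - p ≠ 0) (hA0 : moebiusDen A 0 ≠ 0) (hAp : moebiusDen A p ≠ 0)
    (hCp : moebiusDen C p ≠ 0) (hC1 : moebiusDen C 1 ≠ 0) (a0 : moebius A 0 = q)
    (a1 : moebius A p = 1) (c0 : moebius C p = 0) (c1 : moebius C 1 = q)
    (hs : s = moebiusDen A p / moebiusDen A 0) (hu : u = moebiusDen C 1 / moebiusDen C p) :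
    (C * A⁻¹ * C⁻¹ * A) 1 0 * (p * q) =
      (C * A⁻¹ * C⁻¹ * A) 1 1 * ((s * u - 1) * (q - s + s * p * u)) := by
  unfold moebius at a0 a1 c0 c1
  unfold moebiusDen at *
  rw [div_eq_iff hA0] at a0
  rw [div_eq_iff hAp] at a1
  rw [div_eq_iff hCp] at c0
  rw [div_eq_iff hC1] at c1
  have hs' : s * A 1 1 = A 1 0 * p + A 1 1 := by
    rw [hs]
    simp only [mul_zero, zero_add] at *
    field_simp
  have hu' : u * (C 1 0 * p + C 1 1) = C 1 0 + C 1 1 := by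
    rw [hu]
    simp only [mul_one] at *
    field_simp
  set f := C 1 0 * p + C 1 1 with hf
  have eA10 : A 1 0 = (s - 1) * A 1 1 / p := by
    rw [eq_div_iff hp]; linarith
  have eA01 : A 0 1 = q * A 1 1 := by simpa using a0
  have eA00 : A 0 0 = (s - q) * A 1 1 / p := by
    rw [eq_div_iff hp]; linarith
  have eC10 : C 1 0 = (u - 1) * f / (1 - p) := by
    rw [eq_div_iff hp1]; linear_combination hf - hu'
  have eC11 : C 1 1 = (1 - u * p) * f / (1 - p) := by
    rw [eq_div_iff hp1]; linear_combination p * hu' - hf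
  have eC00 : C 0 0 = q * u * f / (1 - p) := by
    rw [eq_div_iff hp1]; linear_combination c1 - c0 - q * hu'
  have eC01 : C 0 1 = -(q * u * p) * f / (1 - p) := by
    rw [eq_div_iff hp1]; linear_combination c0 - p * c1 + q * p * hu'
  have i00 : ∀ g : Matrix.SpecialLinearGroup (Fin 2) ℝ, g⁻¹ 0 0 = g 1 1 := fun g => by
    rw [Matrix.SpecialLinearGroup.SL2_inv_expl]; rfl
  have i01 : ∀ g : Matrix.SpecialLinearGroup (Fin 2) ℝ, g⁻¹ 0 1 = -g 0 1 := fun g => by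
    rw [Matrix.SpecialLinearGroup.SL2_inv_expl]; rfl
  have i10 : ∀ g : Matrix.SpecialLinearGroup (Fin 2) ℝ, g⁻¹ 1 0 = -g 1 0 := fun g => by
    rw [Matrix.SpecialLinearGroup.SL2_inv_expl]; rfl
  have i11 : ∀ g : Matrix.SpecialLinearGroup (Fin 2) ℝ, g⁻¹ 1 1 = g 0 0 := fun g => by
    rw [Matrix.SpecialLinearGroup.SL2_inv_expl]; rfl
  simp only [sl2_mul_apply, i00, i01, i10, i11]
  rw [eA10, eA01, eA00, eC10, eC11, eC00, eC01]
  field_simp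
  ring

end PIET

namespace PIET

variable {n : ℕ} {𝒜 : Type*} [Fintype 𝒜]

/-- A circular map of two intervals. -/
structure TwoCirc (T : PIET n 𝒜) : Prop extends T.Circ where
  first_eq : T.perm.top 0 = T.perm.bot (Fin.last n)
  last_eq : T.perm.bot 0 = T.perm.top (Fin.last n)

namespace TwoCirc

variable {T : PIET n 𝒜}

theorem eq_or (h : T.TwoCirc) (γ : 𝒜) : γ = T.perm.top 0 ∨ γ = T.perm.bot 0 := by
  obtain ⟨t, hb⟩ := h.blocks
  have h1 := hb.top_bot_first
  have h2 := hb.top_bot_last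
  rw [h.last_eq, Equiv.symm_apply_apply, Fin.val_last] at h1
  rw [← h.first_eq, Equiv.symm_apply_apply, Fin.val_zero] at h2
  have h3 := hb.pos
  have h4 : n = 1 := by omega
  rcases Nat.lt_or_ge (T.perm.top.symm γ : ℕ) 1 with h5 | h5
  · left
    rw [← Equiv.symm_apply_eq]
    ext
    rw [Fin.val_zero]
    omega
  · right
    rw [h.last_eq, ← Equiv.symm_apply_eq]
    ext
    rw [Fin.val_last]
    have := (T.perm.top.symm γ).isLt
    omega

theorem sum_eq (h : T.TwoCirc) (f : 𝒜 → ℝ) :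
    ∑ γ, f γ = f (T.perm.top 0) + f (T.perm.bot 0) := by
  classical
  have : (Finset.univ : Finset 𝒜) = {T.perm.top 0, T.perm.bot 0} := by
    ext γ
    simpa using h.eq_or γ
  rw [this, Finset.sum_pair h.first_ne]

theorem botLeft_second (h : T.TwoCirc) (len : 𝒜 → ℝ) :
    partLeft T.perm.bot len T.lo (T.perm.top 0) = len (T.perm.bot 0) := by
  rw [partLeft_next (α := T.perm.bot 0), partLeft_first (by simp), h.lo, zero_add]
  obtain ⟨t, hb⟩ := h.blocks
  have h1 := hb.bot_top_first
  have h2 := hb.top_bot_first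
  have h3 := hb.top_bot_last
  rw [h.last_eq, Equiv.symm_apply_apply, Fin.val_last] at h2
  rw [h1, Equiv.symm_apply_apply, Fin.val_zero]
  omega

theorem groupBot_eq (h : T.TwoCirc) : T.groupBot = T.botLen (T.perm.bot 0) := h.botLeft_second _

theorem top_first (h : T.TwoCirc) :
    T.topLeft (T.perm.top 0) = 0 ∧ T.topRight (T.perm.top 0) = T.groupTop :=
  ⟨T.topLeft_top_first.trans h.lo, by rw [h.first_eq, h.topRight_bot_last]⟩

theorem top_second (h : T.TwoCirc) :
    T.topLeft (T.perm.bot 0) = T.groupTop ∧ T.topRight (T.perm.bot 0) = 1 :=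
  ⟨rfl, by rw [h.last_eq, T.topRight_last, h.hi]⟩

theorem bot_first (h : T.TwoCirc) :
    T.botLeft (T.perm.bot 0) = 0 ∧ T.botRight (T.perm.bot 0) = T.groupBot :=
  ⟨T.inv.topLeft_top_first.trans h.lo, by rw [h.last_eq, h.botRight_top_last]⟩

theorem bot_second (h : T.TwoCirc) :
    T.botLeft (T.perm.top 0) = T.groupBot ∧ T.botRight (T.perm.top 0) = 1 :=
  ⟨rfl, by rw [h.first_eq]; exact T.inv.topRight_last.trans h.hi⟩

theorem botLen_eq (h : T.TwoCirc) : T.botLen (T.perm.top 0) = 1 - T.groupBot := by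
  have h1 := h.bot_second
  unfold botRight at h1
  linarith [h1.1, h1.2]

/-- The ratio of the ends of the denominator of a branch. -/
noncomputable def _root_.PIET.denRatio (T : PIET n 𝒜) (γ : 𝒜) : ℝ :=
  moebiusDen (T.branch γ) (T.topRight γ) / moebiusDen (T.branch γ) (T.topLeft γ)

theorem _root_.PIET.denRatio_eq (T : PIET n 𝒜) (γ : 𝒜) :
    T.denRatio γ = Real.exp (-(T.nonlin γ / 2)) := by
  have h1 := T.den_ne (T.left_mem γ)
  have h2 := T.den_ne (T.right_mem γ)
  have h3 := T.den_mul_pos (T.left_mem γ) (T.right_mem γ)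
  have hpos : 0 < T.denRatio γ := by
    unfold denRatio
    have := div_pos h3 (show 0 < moebiusDen (T.branch γ) (T.topLeft γ) ^ 2 by positivity)
    have e : moebiusDen (T.branch γ) (T.topRight γ) / moebiusDen (T.branch γ) (T.topLeft γ) =
      moebiusDen (T.branch γ) (T.topLeft γ) * moebiusDen (T.branch γ) (T.topRight γ) /
        moebiusDen (T.branch γ) (T.topLeft γ) ^ 2 := by field_simp
    rwa [e]
  rw [← Real.exp_log hpos]
  congr 1
  unfold denRatio nonlin dR dL lderiv
  rw [Real.log_div h2 h1]
  ring

theorem loop_identity (h : T.TwoCirc) :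
    T.loopMatrix 1 0 * (T.groupTop * T.groupBot) = T.loopMatrix 1 1 *
      ((T.denRatio (T.perm.top 0) * T.denRatio (T.perm.bot 0) - 1) *
        (T.groupBot - T.denRatio (T.perm.top 0) +
          T.denRatio (T.perm.top 0) * T.groupTop * T.denRatio (T.perm.bot 0))) := by
  have hp := h.groupTop_pos
  have hp1 := h.groupTop_lt_one
  have d1 := T.den_ne (T.left_mem (T.perm.top 0))
  have d2 := T.den_ne (T.right_mem (T.perm.top 0))
  have d3 := T.den_ne (T.left_mem (T.perm.bot 0))
  have d4 := T.den_ne (T.right_mem (T.perm.bot 0))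
  have m1 := T.branch_left (T.perm.top 0)
  have m2 := T.branch_right (T.perm.top 0)
  have m3 := T.branch_left (T.perm.bot 0)
  have m4 := T.branch_right (T.perm.bot 0)
  unfold denRatio
  rw [h.top_first.1] at *
  rw [h.top_first.2] at *
  rw [h.top_second.1] at *
  rw [h.top_second.2] at *
  rw [h.bot_second.1] at m1
  rw [h.bot_second.2] at m2
  rw [h.bot_first.1] at m3
  rw [h.bot_first.2] at m4
  rw [h.loopMatrix_eq, ← h.first_eq, ← h.last_eq]
  exact commutator_identity hp.ne' (by linarith) d1 d2 d3 d4 m1 m2 m3 m4 rfl rfl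

theorem denRatio_mul (h : T.TwoCirc) : T.denRatio (T.perm.top 0) * T.denRatio (T.perm.bot 0) =
    Real.exp (-(∑ γ, T.nonlin γ) / 2) := by
  rw [denRatio_eq, denRatio_eq, ← Real.exp_add, h.sum_eq]
  congr 1
  ring

variable [DecidableEq 𝒜]

theorem exists_approx (h : T.TwoCirc) {M K θ : ℝ} (hL : ∀ γ, |T.dL γ| ≤ M) (hR : ∀ γ, |T.dR γ| ≤ M)
    (hK0 : 0 ≤ K) (hK : |T.slopeA| ≤ K) (hσ : Real.exp (-(∑ γ, T.nonlin γ) / 2) ≠ 1)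
    (hθ : θ = Real.exp K * |T.loopNonlin| / |Real.exp (-(∑ γ, T.nonlin γ) / 2) - 1|)
    (hθ1 : θ < 1) :
    ∃ T' ∈ attractingFamily n 𝒜, C1DistLE T T' (θ * Real.exp M) := by
  have hp := h.groupTop_pos
  have hp1 := h.groupTop_lt_one
  have hq := h.groupBot_pos
  have hq1 := h.groupBot_lt_one
  have hid := h.loop_identity
  have hsu := h.denRatio_mul
  set σ := Real.exp (-(∑ γ, T.nonlin γ) / 2)
  set s := T.denRatio (T.perm.top 0)
  set u := T.denRatio (T.perm.bot 0)
  rw [hsu] at hid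
  have hσ' : σ - 1 ≠ 0 := sub_ne_zero.mpr hσ
  set ν := T.loopNonlin with hν
  set p := T.groupTop
  set q := T.groupBot
  have hid' : ν * (p * q) = (σ - 1) * (q - s + s * p * u) := by
    have c0 := h.loop_zero_zero_mul
    rw [hν, PIET.loopNonlin]
    linear_combination T.loopMatrix 0 0 * hid + ((σ - 1) * (q - s + s * p * u)) * c0
  set q' := q - ν * p * q / (σ - 1) with hq'
  have hzero : q' - s + s * p * u = 0 := by
    have : ν * p * q / (σ - 1) = q - s + s * p * u := by
      rw [div_eq_iff hσ']; linarith
    rw [hq', this]; ring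
  have hθ0 : 0 ≤ θ := by rw [hθ]; positivity
  have hEK : 1 ≤ Real.exp K := Real.one_le_exp hK0
  have hσa : 0 < |σ - 1| := abs_pos.mpr hσ'
  have hdiff : |q' - q| = |ν| * p * q / |σ - 1| := by
    rw [hq', show q - ν * p * q / (σ - 1) - q = -(ν * p * q / (σ - 1)) by ring, abs_neg, abs_div,
      abs_mul, abs_mul, abs_of_pos hp, abs_of_pos hq]
  have hν0 := abs_nonneg ν
  have r1 : |q' - q| ≤ θ * q := by
    rw [hdiff, hθ, div_mul_eq_mul_div]
    gcongr ?_ / _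
    have : |ν| * p ≤ Real.exp K * |ν| := by nlinarith
    exact mul_le_mul_of_nonneg_right this hq.le
  have r2 : |q' - q| ≤ θ * (1 - q) := by
    rw [hdiff, hθ, div_mul_eq_mul_div]
    gcongr ?_ / _
    have e1 : Real.exp T.slopeA * p = 1 - q := by
      rw [slopeA, Real.exp_log (div_pos (by linarith) hp)]
      exact div_mul_cancel₀ _ hp.ne'
    have e2 : Real.exp (-K) ≤ Real.exp T.slopeA := Real.exp_le_exp.mpr (abs_le.mp hK).1
    have e3 : p ≤ Real.exp K * (1 - q) := by
      have h5 : Real.exp (-K) * p ≤ 1 - q := by rw [← e1]; gcongr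
      rwa [Real.exp_neg, inv_mul_le_iff₀ (Real.exp_pos K)] at h5
    calc |ν| * p * q ≤ |ν| * (Real.exp K * (1 - q)) * 1 := by gcongr
      _ = _ := by ring
  have hq'0 : 0 < q' := by
    linarith [(abs_le.mp r1).1, mul_lt_mul_of_pos_right hθ1 hq]
  have hq'1 : q' < 1 := by
    linarith [(abs_le.mp r2).2, mul_lt_mul_of_pos_right hθ1 (sub_pos.mpr hq1)]
  let len : 𝒜 → ℝ := fun γ => if γ = T.perm.bot 0 then q' else 1 - q'
  have len0 : len (T.perm.bot 0) = q' := if_pos rfl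
  have len1 : len (T.perm.top 0) = 1 - q' := if_neg h.first_ne
  have hpos : ∀ α, 0 < len α := fun α => by
    rcases h.eq_or α with rfl | rfl
    · rw [len1]; linarith
    · rwa [len0]
  have hsum : ∑ α, len α = T.hi - T.lo := by
    rw [h.sum_eq, len0, len1, h.hi, h.lo]; ring
  have b0 : T.botLen (T.perm.bot 0) = q := h.groupBot_eq.symm
  have b1 : T.botLen (T.perm.top 0) = 1 - q := h.botLen_eq
  have k0 : |q' / q - 1| ≤ θ := by
    rw [div_sub_one hq.ne', abs_div, abs_of_pos hq, div_le_iff₀ hq]; exact r1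
  have k1 : |(1 - q') / (1 - q) - 1| ≤ θ := by
    have h5 : 0 < 1 - q := by linarith
    rw [div_sub_one h5.ne', abs_div, abs_of_pos h5, div_le_iff₀ h5,
      show 1 - q' - (1 - q) = -(q' - q) by ring, abs_neg]
    exact r2
  refine ⟨T.withBot len hpos hsum, ?_, c1DistLE_withBot hL hR hθ0 ?_ ?_⟩
  · rw [mem_attractingFamily]
    have h' : (T.withBot len hpos hsum).TwoCirc := ⟨h.toCirc.withBot, h.first_eq, h.last_eq⟩
    refine ⟨h'.genusOne, h.lo, h.hi, ?_⟩
    have hr : ∀ γ, (T.withBot len hpos hsum).denRatio γ = T.denRatio γ := fun γ => by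
      unfold denRatio
      have e1 : (T.withBot len hpos hsum).topRight γ = T.topRight γ := rfl
      have e2 : (T.withBot len hpos hsum).topLeft γ = T.topLeft γ := rfl
      rw [e1, e2, withBot_den (T.right_mem γ), withBot_den (T.left_mem γ), mul_div_mul_left]
      exact one_div_ne_zero (Real.sqrt_pos.mpr (div_pos (hpos γ) (T.botLen_pos γ))).ne'
    have hid2 := h'.loop_identity
    have hB : (T.withBot len hpos hsum).groupBot = q' := h'.groupBot_eq.trans len0
    have hT : (T.withBot len hpos hsum).groupTop = p := rfl
    have hP : (T.withBot len hpos hsum).perm = T.perm := rfl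
    rw [hB, hT, hr, hr, hP] at hid2
    change _ = _ * (_ * (q' - s + s * p * u)) at hid2
    rw [hzero, mul_zero, mul_zero] at hid2
    exact (mul_eq_zero.mp hid2).resolve_right (mul_pos hp hq'0).ne'
  · intro γ
    rcases h.eq_or γ with rfl | rfl
    · rw [len1, b1]; exact k1
    · rw [len0, b0]; exact k0
  · intro γ y hy
    rcases h.eq_or γ with rfl | rfl
    · rw [h.bot_second.1, h.bot_second.2] at hy
      rw [h.botLeft_second, len0, len1, b1, h.bot_second.1]
      have h5 : 0 < 1 - q := by linarith
      have e : y - (q' + (1 - q') / (1 - q) * (y - q)) =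
          ((1 - q') / (1 - q) - 1) * (1 - y) := by
        field_simp; ring
      rw [e, abs_mul, abs_of_nonneg (show 0 ≤ 1 - y by linarith [hy.2])]
      exact (mul_le_of_le_one_right (abs_nonneg _) (by linarith [hy.1])).trans k1
    · rw [h.bot_first.1, h.bot_first.2] at hy
      rw [partLeft_first (by simp), h.lo, len0, b0, h.bot_first.1]
      have e : y - (0 + q' / q * (y - 0)) = -((q' / q - 1) * y) := by ring
      rw [e, abs_neg, abs_mul, abs_of_nonneg hy.1]
      exact (mul_le_of_le_one_right (abs_nonneg _) (by linarith [hy.2])).trans k0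

end TwoCirc

variable [DecidableEq 𝒜]

theorem Circ.abs_dR_le {T : PIET n 𝒜} (h : T.Circ) {c : Fin n → ℝ} (hc : T.HasBreaks c) {K : ℝ}
    (ha : |T.slopeA| ≤ K) (hb : |T.slopeC| ≤ K) (γ : 𝒜) : |T.dR γ| ≤ K + 2 * T.groupVar c := by
  have h1 := h.abs_dL_le hc ha hb γ
  have h2 : |T.nonlin γ| ≤ T.totalNonlin :=
    Finset.single_le_sum (f := fun γ => |T.nonlin γ|) (fun _ _ => abs_nonneg _) (Finset.mem_univ γ)
  have h3 := T.totalNonlin_le_groupVar c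
  have h4 : T.dR γ = T.dL γ + T.nonlin γ := by unfold nonlin; ring
  rw [h4]
  exact (abs_add_le _ _).trans (by linarith)

/-- A circular map whose distinguished loop is nearly affine is near the attracting family. -/
theorem exists_approx (c : Fin n → ℝ) (K V : ℝ) (hK0 : 0 ≤ K) :
    ∃ ε B : ℝ, 0 < ε ∧ 0 ≤ B ∧ ∀ T : PIET n 𝒜, T.Circ → T.HasBreaks c → T.groupVar c ≤ V →
      |T.slopeA| ≤ K → |T.slopeC| ≤ K → |T.loopNonlin| ≤ ε →
      ∃ T' ∈ attractingFamily n 𝒜, C1DistLE T T' (B * |T.loopNonlin|) := by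
  set M := K + 2 * V with hM
  set σ := Real.exp ((∑ i, Real.log (c i)) / 2) with hσ
  set Θ := max (4 * Real.exp (4 * |M|)) (Real.exp K / |σ - 1|) with hΘ
  have hΘ4 : 4 ≤ Θ := le_max_of_le_left (by linarith [Real.one_le_exp (x := 4 * |M|) (by positivity)])
  have hΘ0 : 0 < Θ := by linarith
  refine ⟨1 / (2 * Θ), 7 * Θ * Real.exp M, by positivity, by positivity, ?_⟩
  intro T h hc hV ha hb hε
  have hgv : 0 ≤ T.groupVar c := T.totalNonlin_nonneg.trans (T.totalNonlin_le_groupVar c)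
  have hM0 : 0 ≤ M := by linarith
  have hL : ∀ γ, |T.dL γ| ≤ M := fun γ => (h.abs_dL_le hc ha hb γ).trans (by linarith)
  have hR : ∀ γ, |T.dR γ| ≤ M := fun γ => (h.abs_dR_le hc ha hb γ).trans (by linarith)
  have hν := abs_nonneg T.loopNonlin
  have hsmall : Θ * |T.loopNonlin| ≤ 1 / 2 := by
    rw [le_div_iff₀ (by positivity)] at hε
    linarith
  have hE := Real.exp_pos M
  have fin : ∀ {θ k : ℝ}, 0 ≤ θ → θ ≤ Θ * |T.loopNonlin| → 0 ≤ k → k ≤ 7 →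
      k * θ * Real.exp M ≤ 7 * Θ * Real.exp M * |T.loopNonlin| := by
    intro θ k h0 h1 h2 h3
    calc k * θ * Real.exp M ≤ 7 * (Θ * |T.loopNonlin|) * Real.exp M := by gcongr
      _ = _ := by ring
  by_cases h1 : T.perm.top 0 = T.perm.bot (Fin.last n)
  · by_cases h2 : T.perm.bot 0 = T.perm.top (Fin.last n)
    · have h' : T.TwoCirc := ⟨h, h1, h2⟩
      have hs : Real.exp (-(∑ γ, T.nonlin γ) / 2) = σ := by rw [hσ, hc.sum_log]
      by_cases hσ1 : σ = 1
      · refine ⟨T, mem_attractingFamily.mpr ⟨h.genusOne, h.lo, h.hi, ?_⟩,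
          C1DistLE.refl T (by positivity)⟩
        have hid := h'.loop_identity
        rw [h'.denRatio_mul, hs, hσ1, sub_self, zero_mul, mul_zero] at hid
        exact (mul_eq_zero.mp hid).resolve_right (mul_pos h.groupTop_pos h.groupBot_pos).ne'
      · have hσa : 0 < |σ - 1| := abs_pos.mpr (sub_ne_zero.mpr hσ1)
        have hle : Real.exp K * |T.loopNonlin| / |σ - 1| ≤ Θ * |T.loopNonlin| := by
          rw [mul_div_right_comm]
          exact mul_le_mul_of_nonneg_right (le_max_right _ _) hν
        obtain ⟨T', hT', hd⟩ := h'.exists_approx hL hR hK0 ha (by rwa [hs]) (by rw [hs])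
          (hle.trans_lt (by linarith))
        refine ⟨T', hT', hd.mono ?_⟩
        have := fin (θ := Real.exp K * |T.loopNonlin| / |σ - 1|) (k := 1) (by positivity) hle
          zero_le_one (by norm_num)
        rwa [one_mul] at this
    · have hle : 4 * (Real.exp (4 * M) * |T.loopNonlin|) ≤ Θ * |T.loopNonlin| := by
        rw [← mul_assoc]
        refine mul_le_mul_of_nonneg_right ?_ hν
        rw [hΘ, abs_of_nonneg hM0]
        exact le_max_left _ _
      obtain ⟨T', hT', hd⟩ := h.exists_approx_of_eq hL hR h1 h2 rfl (hle.trans (by linarith))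
      exact ⟨T', hT', hd.mono (fin (by positivity) hle (by norm_num) le_rfl)⟩
  · have hle : 2 * |T.loopNonlin| ≤ Θ * |T.loopNonlin| :=
      mul_le_mul_of_nonneg_right (by linarith) hν
    obtain ⟨T', hT', hd⟩ := h.exists_approx_of_ne hL hR h1 rfl (hle.trans (by linarith))
    exact ⟨T', hT', hd.mono (fin (by positivity) hle (by norm_num) le_rfl)⟩

end PIET

namespace PIET

variable {n : ℕ} {𝒜 : Type*} [Fintype 𝒜]

/-- An exchange of intervals of equal lengths. -/
noncomputable def equalLengths (σ : MarkedPerm n 𝒜) : PIET n 𝒜 :=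
  have hsum : ∑ _α : 𝒜, (1 / ((n : ℝ) + 1)) = 1 - 0 := by
    rw [← Equiv.sum_comp σ.top, Finset.sum_const, Finset.card_univ, Fintype.card_fin, nsmul_eq_mul]
    push_cast
    have : (n : ℝ) + 1 ≠ 0 := by positivity
    field_simp
    ring
  { perm := σ
    lo := 0
    hi := 1
    topLen := fun _ => 1 / ((n : ℝ) + 1)
    botLen := fun _ => 1 / ((n : ℝ) + 1)
    topLen_pos := fun _ => by positivity
    botLen_pos := fun _ => by positivity
    sum_topLen := hsum
    sum_botLen := hsum
    branch := fun α => affineSL (partLeft σ.bot (fun _ => 1 / ((n : ℝ) + 1)) 0 α -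
      partLeft σ.top (fun _ => 1 / ((n : ℝ) + 1)) 0 α) 1 one_pos
    no_pole := fun α x _ => by
      change moebiusDen _ x ≠ 0
      rw [moebiusDen_affineSL, Real.sqrt_one, div_one]
      exact one_ne_zero
    map_left := fun α => by
      rw [moebius_affineSL, one_mul]
      exact sub_add_cancel _ _
    map_right := fun α => by
      rw [moebius_affineSL, one_mul, ← add_assoc]
      congr 1
      exact sub_add_cancel _ _ }

theorem equalLengths_mem {σ : MarkedPerm n 𝒜} (hσ : σ.GenusOne) :
    equalLengths σ ∈ attractingFamily n 𝒜 := by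
  rw [mem_attractingFamily]
  refine ⟨hσ, rfl, rfl, ?_⟩
  have key : ∀ w : FreeGroup 𝒜, FreeGroup.lift (equalLengths σ).branch w ∈ upperTriangular := by
    intro w
    induction w using FreeGroup.induction_on with
    | C1 => rw [map_one]; exact upperTriangular.one_mem
    | of α =>
      rw [FreeGroup.lift_apply_of]
      rfl
    | inv_of α ih => rw [map_inv]; exact upperTriangular.inv_mem ih
    | mul x y hx hy => rw [map_mul]; exact upperTriangular.mul_mem hx hy
  exact key _

theorem exists_c1DistLE {T S : PIET n 𝒜} (h : T.perm = S.perm) : ∃ D, 0 ≤ D ∧ C1DistLE T S D := by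
  have hE : ∀ T : PIET n 𝒜, ∀ α, 0 ≤ Real.exp (|T.dL α| + |T.dR α|) := fun T α => (Real.exp_pos _).le
  refine ⟨|T.lo| + |T.hi| + |S.lo| + |S.hi| + ∑ α, (Real.exp (|T.dL α| + |T.dR α|) +
    Real.exp (|S.dL α| + |S.dR α|)), ?_, h, fun α t ht => ?_⟩
  · have : 0 ≤ ∑ α, (Real.exp (|T.dL α| + |T.dR α|) + Real.exp (|S.dL α| + |S.dR α|)) :=
      Finset.sum_nonneg fun α _ => add_nonneg (hE T α) (hE S α)
    positivity
  · have hsum : Real.exp (|T.dL α| + |T.dR α|) + Real.exp (|S.dL α| + |S.dR α|) ≤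
        ∑ α, (Real.exp (|T.dL α| + |T.dR α|) + Real.exp (|S.dL α| + |S.dR α|)) :=
      Finset.single_le_sum (f := fun α => Real.exp (|T.dL α| + |T.dR α|) +
        Real.exp (|S.dL α| + |S.dR α|)) (fun α _ => add_nonneg (hE T α) (hE S α)) (Finset.mem_univ α)
    have facts : ∀ T : PIET n 𝒜,
        |T.topLeft α + t * T.topLen α| ≤ |T.lo| + |T.hi| ∧
        |moebius (T.branch α) (T.topLeft α + t * T.topLen α)| ≤ |T.lo| + |T.hi| ∧
        |deriv (moebius (T.branch α)) (T.topLeft α + t * T.topLen α)| ≤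
          Real.exp (|T.dL α| + |T.dR α|) := by
      intro T
      have hx := T.segment_mem α ht
      have h1 := T.lo_le_topLeft α
      have h2 := T.topRight_le_hi α
      have h3 := T.lo_le_botLeft α
      have h4 := T.botRight_le_hi α
      have hm := (T.branch_strictMonoOn α).monotoneOn
      have m1 := hm (T.left_mem α) hx hx.1
      have m2 := hm hx (T.right_mem α) hx.2
      rw [T.branch_left] at m1
      rw [T.branch_right] at m2
      have a1 := neg_abs_le T.lo
      have a2 := le_abs_self T.hi
      have a3 := abs_nonneg T.lo
      have a4 := abs_nonneg T.hi
      refine ⟨abs_le.mpr ⟨by linarith [hx.1], by linarith [hx.2]⟩,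
        abs_le.mpr ⟨by linarith, by linarith⟩, ?_⟩
      rw [abs_of_nonneg (T.deriv_branch_nonneg hx)]
      exact T.deriv_le_exp (le_add_of_nonneg_right (abs_nonneg _))
        (le_add_of_nonneg_left (abs_nonneg _)) hx
    have hS := facts S
    have hT := facts T
    have p1 := hE T α
    have p2 := hE S α
    have q1 := abs_nonneg T.lo
    have q2 := abs_nonneg T.hi
    have q3 := abs_nonneg S.lo
    have q4 := abs_nonneg S.hi
    refine ⟨(abs_sub _ _).trans ?_, (abs_sub _ _).trans ?_, (abs_sub _ _).trans ?_⟩ <;>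
    linarith [hS.1, hT.1, hS.2.1, hT.2.1, hS.2.2, hT.2.2]

variable [DecidableEq 𝒜]

/-- Exponential convergence along one sequence of renormalisations. -/
theorem exists_exponential {c : Fin n → ℝ} {K V ε B ρ : ℝ}
    (hV : V = 2 * ∑ i, |Real.log (c i)| + 1) (hK : K = 8 * V + 2) (hε : 0 < ε) (hB : 0 ≤ B)
    (hρ : ρ = 1 / (1 + Real.exp (-K)))
    (happrox : ∀ T : PIET n 𝒜, T.Circ → T.HasBreaks c → T.groupVar c ≤ V →
      |T.slopeA| ≤ K → |T.slopeC| ≤ K → |T.loopNonlin| ≤ ε →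
      ∃ T' ∈ attractingFamily n 𝒜, C1DistLE T T' (B * |T.loopNonlin|))
    {S : ℕ → PIET n 𝒜} (hS : GroupSeq S) (hc : (S 0).HasBreaks c) {k : ℕ → ℕ}
    (hk : SwitchTimes (fun j => (S j).groupTop < (S j).groupBot) k) :
    ∃ C : ℝ, ∀ i, ∃ T' ∈ attractingFamily n 𝒜, C1DistLE (S (k i)) T' (C * ρ ^ i) := by
  have hE := Real.exp_pos (-K)
  have hρ0 : 0 < ρ := by rw [hρ]; positivity
  have hρ1 : ρ < 1 := by
    rw [hρ, div_lt_one (by positivity)]; linarith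
  have hU := hS.circSeq hc
  have hτ := hk.shift
  obtain ⟨I, hI⟩ := hU.exists_uniform hτ hV
  rw [← hK] at hI
  obtain ⟨C₀, hC₀, hsc⟩ := hU.exists_scale_le hτ fun i hi => (hI i hi).2
  rw [← hρ] at hsc
  set C₁ := C₀ * |(S (0 + 1)).loopNonlin|
  have hC₁ : 0 ≤ C₁ := by positivity
  have hpos : ∀ i, 1 ≤ k (i + 1) := fun i => by
    obtain ⟨j, h1, h2, -⟩ := hk i
    omega
  have hnl : ∀ i, I ≤ i → |(S (k (i + 1))).loopNonlin| ≤ C₁ * ρ ^ i := by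
    intro i hi
    have h1 := hU.loopNonlin (k (i + 1) - 1)
    beta_reduce at h1
    rw [Nat.sub_add_cancel (hpos i)] at h1
    rw [h1, abs_mul, abs_of_pos (hU.scale_pos _)]
    calc _ ≤ C₀ * ρ ^ i * |(S (0 + 1)).loopNonlin| :=
          mul_le_mul_of_nonneg_right (hsc i hi) (abs_nonneg _)
      _ = _ := by ring
  obtain ⟨I', hI'⟩ : ∃ I', ∀ i, I' ≤ i → C₁ * ρ ^ i ≤ ε := by
    have ht := (tendsto_pow_atTop_nhds_zero_of_lt_one hρ0.le hρ1).const_mul C₁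
    rw [mul_zero] at ht
    exact Filter.eventually_atTop.mp (ht.eventually_le_const hε)
  have hfin : ∀ i, ∃ D, 0 ≤ D ∧ ∃ T' ∈ attractingFamily n 𝒜, C1DistLE (S (k i)) T' D := fun i => by
    obtain ⟨D, hD, hd⟩ := exists_c1DistLE (T := S (k i)) (S := equalLengths (S (k i)).perm) rfl
    exact ⟨D, hD, _, equalLengths_mem (hS.genusOne _), hd⟩
  choose D hD hDd using hfin
  set N := I + I' + 1
  have hsum0 : 0 ≤ ∑ i ∈ Finset.range N, D i / ρ ^ i :=
    Finset.sum_nonneg fun i _ => div_nonneg (hD i) (pow_pos hρ0 i).le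
  refine ⟨B * C₁ / ρ + ∑ i ∈ Finset.range N, D i / ρ ^ i, fun i => ?_⟩
  have hρi := pow_pos hρ0 i
  by_cases hi : i < N
  · obtain ⟨T', hT', hd⟩ := hDd i
    refine ⟨T', hT', hd.mono ?_⟩
    have h1 : D i / ρ ^ i ≤ ∑ i ∈ Finset.range N, D i / ρ ^ i :=
      Finset.single_le_sum (f := fun i => D i / ρ ^ i)
        (fun i _ => div_nonneg (hD i) (pow_pos hρ0 i).le) (Finset.mem_range.mpr hi)
    have h2 : 0 ≤ B * C₁ / ρ := by positivity
    rw [← div_le_iff₀ hρi]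
    linarith
  · obtain ⟨j, rfl⟩ := Nat.exists_eq_add_of_le' (show 1 ≤ i by omega)
    have hj := hI j (by omega)
    have hb := hU.breaks (k (j + 1) - 1)
    have hcirc := hU.circ (k (j + 1) - 1)
    beta_reduce at hj hb hcirc
    rw [Nat.sub_add_cancel (hpos j)] at hj hb hcirc
    have h1 := hnl j (by omega)
    obtain ⟨T', hT', hd⟩ := happrox _ hcirc hb hj.1 hj.2.1 hj.2.2 (h1.trans (hI' j (by omega)))
    refine ⟨T', hT', hd.mono ?_⟩
    have h2 : B * C₁ / ρ * ρ ^ (j + 1) = B * (C₁ * ρ ^ j) := by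
      rw [pow_succ]
      field_simp
    rw [add_mul, h2]
    have h3 := mul_le_mul_of_nonneg_left h1 hB
    have h4 := mul_nonneg hsum0 hρi.le
    linarith

end PIET

theorem mainTheorem4 (n : ℕ) (𝒜 : Type*) [Fintype 𝒜] [DecidableEq 𝒜] :
    (∀ T ∈ PIET.attractingFamily n 𝒜, T.cutTop ≠ T.cutBot →
      (∃ T' : PIET n 𝒜, PIET.RauzyStep T T') ∧
      ∀ T' : PIET n 𝒜, PIET.RauzyStep T T' → T' ∈ PIET.attractingFamily n 𝒜) ∧
    (∀ c : Fin n → ℝ, ∃ ρ : ℝ, 0 < ρ ∧ ρ < 1 ∧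
      ∀ σ : MarkedPerm n 𝒜, σ.GenusOne → ∀ T ∈ PIET.familyP σ,
        T.HasBreaks c → T.InfinitelyComplete →
        (∃ S : ℕ → PIET n 𝒜, S 0 = T ∧ ∀ k, PIET.Renormalises (S k) (S (k + 1))) ∧
        ∃ C : ℝ, ∀ S : ℕ → PIET n 𝒜, S 0 = T → (∀ k, PIET.Renormalises (S k) (S (k + 1))) →
          ∀ k, ∃ T' ∈ PIET.attractingFamily n 𝒜, PIET.C1DistLE (S k) T' (C * ρ ^ k)) := by
  refine ⟨fun T hT h => PIET.attractingFamily_invariant T hT h, fun c => ?_⟩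
  have hV : 0 ≤ ∑ i, |Real.log (c i)| := Finset.sum_nonneg fun _ _ => abs_nonneg _
  obtain ⟨ε, B, hε, hB, happrox⟩ := PIET.exists_approx (𝒜 := 𝒜) c
    (8 * (2 * ∑ i, |Real.log (c i)| + 1) + 2) (2 * ∑ i, |Real.log (c i)| + 1) (by linarith)
  refine ⟨1 / (1 + Real.exp (-(8 * (2 * ∑ i, |Real.log (c i)| + 1) + 2))), by positivity, ?_, ?_⟩
  · rw [div_lt_one (by positivity)]
    linarith [Real.exp_pos (-(8 * (2 * ∑ i, |Real.log (c i)| + 1) + 2))]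
  rintro σ hσ T rfl hc hT
  obtain ⟨S, hS0, hS⟩ := PIET.exists_groupSeq hσ hT
  obtain ⟨k, hk0, hk⟩ := hS.exists_switchTimes
  have h0 : S (k 0) = T := by rw [hk0, hS0]
  refine ⟨⟨fun i => S (k i), h0, hS.renormalises hk⟩, ?_⟩
  obtain ⟨C, hC⟩ := PIET.exists_exponential rfl rfl hε hB rfl happrox hS (hS0.symm ▸ hc) hk
  refine ⟨C, fun S' hS'0 hS' i => ?_⟩
  obtain ⟨T', hT', hd⟩ := hC i
  have hsame : PIET.Same (S (k i)) (S' i) :=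
    PIET.renormalises_same (S := fun i => S (k i)) (by rw [hS'0, h0]; exact PIET.Same.refl T)
      (hS.renormalises hk) hS' i
  exact ⟨T', hT', hsame.c1DistLE hd⟩
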